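/- Let $\kappa\in\mathbb C$, $\omega,\zeta,\xi\in\mathbb C^\times$ and $\hbar:=-\kappa\omega^2/2$, and assume $\hbar\notin i\pi\mathbb Z$. Put $q=e^\hbar$ and $[3]_q=(q^3-q^{-3})/(q-q^{-1})$. **The topological algebras.** For finite sets $H,X$ let $\mathcal E_0(H;X)$ be the complex algebra generated by variables $h\in H$ that commute with each other and by free variables $x\in X$ (with no relation between the two kinds), with the norms $\|\sum_w c_w w\|_r=\sum_w|c_w|r^{|w|}$ ($w$ words, $|w|$ the total length, $r>0$). Let $\mathcal E^{(n)}$ be the completion, for all these norms, of the span of the words with exactly $n$ letters from $X$, and $\mathcal E(H;X)=\bigoplus_n\mathcal E^{(n)}$ with the locally convex direct sum topology. Quotients are by closed two-sided ideals, with the quotient topology. For a quotient $A$ of $\mathcal E(H;X)$ by the closed ideal of some relations, $A\bar\otimes A$ is the quotient of $\mathcal E(H\sqcup H;X\sqcup X)$ by the closed two-sided ideal generated by the relations in each copy and by the commutators of generators of the first copy with generators of the second. A representation of $A$ on a vector space $V$ is an algebra map $A\to\mathrm{End}(V)$ such that $a\mapsto\varphi(a.v)$ is continuous for all $v\in V$,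 $\varphi\in V^*$. * $A_F$ is $\mathcal E(h;f^\pm,\bar f^\pm)$ modulo $[h,f^\pm]=\pm\omega f^\pm$, $[h,\bar f^\pm]=\pm\omega\bar f^\pm$, with $\Delta h=h\otimes1+1\otimes h$, $\Delta f^\pm=f^\pm\otimes1+e^{\pm\kappa\omega h}\otimes f^\pm$, $\Delta\bar f^\pm=\bar f^\pm\otimes1+e^{\mp\kappa\omega h}\otimes\bar f^\pm$, and counit zero on the generators. * $\tilde U_\hbar=\tilde U_\hbar(L\mathfrak{sl}_2)$ is $\mathcal E(h_0,h_1;e_0^\pm,e_1^\pm)$ modulo (for $i,j\in\{0,1\}$) $h_0=-h_1$, $[h_i,e_i^\pm]=\pm2e_i^\pm$, $[e_i^+,e_j^-]=\delta_{ij}\frac{e^{\hbar h_i}-e^{-\hbar h_i}}{e^\hbar-e^{-\hbar}}$, $(e_i^\pm)^3e_j^\pm-[3]_q(e_i^\pm)^2e_j^\pm e_i^\pm+[3]_qe_i^\pm e_j^\pm(e_i^\pm)^2-e_j^\pm(e_i^\pm)^3=0$, with $\Delta h_i=h_i\otimes1+1\otimes h_i$, $\Delta e_i^+=e_i^+\otimes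 e^{\hbar h_i}+1\otimes e_i^+$, $\Delta e_i^-=e_i^-\otimes1+e^{-\hbar h_i}\otimes e_i^-$, and counit zero on the generators. **The braided category.** $\mathcal C$ is the monoidal category of complex vector spaces with a diagonalisable endomorphism $h$ (acting on $V\otimes W$ by $h\otimes1+1\otimes h$), with braiding $\tau\circ e^{\kappa\,h\otimes h}$, where $\tau$ is the flip. Let $F^+=F^-=\mathbb C_\omega\oplus\mathbb C_{-\omega}\in\mathcal C$ ($h$ acts by $\omega$ and $-\omega$), let $b\colon F^+\otimes F^-\to\mathbf 1$, $b((a,a')\otimes(c,c'))=\zeta ac'+\xi a'c$, and let $T(F^\pm)$ be the tensor algebras, as bialgebras in $\mathcal C$ for which $F^\pm$ is primitive. A Hopf pairing of $T(F^+)$ and $T(F^-)$ is a morphism $T(F^+)\otimes T(F^-)\to\mathbf 1$ for which the algebra and coalgebra structures are dual to each other. For a Hopf pairing $\rho$, ${}_{T(F^+)}\mathcal{YD}^{\rho}_{T(F^-)}$ is the category of objects $X\in\mathcal C$ with a left $T(F^+)$-action and a right $T(F^-)$-action satisfying the Yetter–Drinfeld condition $p_{(1)}.(x.q_{(1)})\,\rho(p_{(2)},q_{(2)})=\rho(p_{(1)},q_{(1)})\,(p_{(2)}.x).q_{(2)}$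 (in braided Sweedler notation), with the tensor product given by the coproducts and the unit object by the counits. **Theorem.** The bialgebras $T(F^\pm)$ exist, and there is a unique Hopf pairing $\rho\colon T(F^+)\otimes T(F^-)\to\mathbf 1$ that restricts to $b$ on $F^+\otimes F^-$. The coproducts and counits above are well-defined continuous algebra homomorphisms, and so is $$\psi\colon A_F\to\tilde U_\hbar,\quad h\mapsto\tfrac\omega2h_0,\quad f^+\mapsto e_0^+e^{-\hbar h_0},\quad f^-\mapsto\xi\tfrac{e^\hbar-e^{-\hbar}}{e^{2\hbar}}e_1^+e^{-\hbar h_1},\quad\bar f^+\mapsto e_1^-,\quad\bar f^-\mapsto\zeta\tfrac{e^\hbar-e^{-\hbar}}{e^{2\hbar}}e_0^-,$$ which satisfies $(\psi\bar\otimes\psi)\Delta=\Delta\psi$ and $\varepsilon\psi=\varepsilon$. The representations of $\tilde U_\hbar$ on which $h_0$ acts diagonalisably form a monoidal category (the tensor product $V\otimes W$ with action through $\Delta$, the unit $\mathbb C$ with action through $\varepsilon$). So does ${}_{T(F^+)}\mathcal{YD}^{\rho}_{T(F^-)}$. There is a functor $F_{\zeta,\xi}$ from the first category to the second, which on underlying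 vector spaces and linear maps is the identity, such that in $F_{\zeta,\xi}(V)$ the operator $h$ acts as $\psi(h)$, an element $(a,a')\in F^+\subset T(F^+)$ acts as $\psi(af^++a'f^-)$, and, when $F^-$ is moved from the left to the right of $V$ by the inverse of the braiding $V\otimes F^-\to F^-\otimes V$, an element $(a,a')\in F^-\subset T(F^-)$ acts as $\psi(a\bar f^++a'\bar f^-)$. The functor $F_{\zeta,\xi}$ is fully faithful, injective on objects, and monoidal with identity structure maps on underlying spaces, and its essential image contains the unit object and is closed under tensor products. Thus $F_{\zeta,\xi}$ identifies the monoidal category of $\tilde U_\hbar(L\mathfrak{sl}_2)$-modules with semisimple $h$-action with a full monoidal subcategory of ${}_{T(F^+)}\mathcal{YD}^{\rho}_{T(F^-)}$. -/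

import Mathlib

open CategoryTheory MonoidalCategory
open scoped TensorProduct

noncomputable section

namespace SinhGordon

/-! ### Diagonalisable endomorphisms -/

/-- A linear endomorphism of a complex vector space is diagonalisable if its eigenspaces span. -/
def IsDiag {V : Type} [AddCommGroup V] [Module ℂ V] (T : Module.End ℂ V) : Prop :=
  ⨆ a : ℂ, T.eigenspace a = ⊤

section Diag
variable {V W Z : Type} [AddCommGroup V] [Module ℂ V] [AddCommGroup W] [Module ℂ W]
  [AddCommGroup Z] [Module ℂ Z]

theorem IsDiag.eq_top {T : Module.End ℂ V} (hT : IsDiag T) {P : Submodule ℂ V}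
    (h : ∀ (a : ℂ) (v : V), T v = a • v → v ∈ P) : P = ⊤ :=
  top_le_iff.1 (hT ▸ iSup_le fun a v hv => h a v (Module.End.mem_eigenspace_iff.1 hv))

theorem isDiag_of_forall {T : Module.End ℂ V}
    (h : ∀ P : Submodule ℂ V, (∀ (a : ℂ) (v : V), T v = a • v → v ∈ P) → P = ⊤) : IsDiag T :=
  h _ fun a _ hv => Submodule.mem_iSup_of_mem a (Module.End.mem_eigenspace_iff.2 hv)

theorem IsDiag.tensor_eq_top {S : Module.End ℂ V} {T : Module.End ℂ W} (hS : IsDiag S)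
    (hT : IsDiag T) {P : Submodule ℂ (V ⊗[ℂ] W)}
    (h : ∀ (a b : ℂ) (v : V) (w : W), S v = a • v → T w = b • w → v ⊗ₜ[ℂ] w ∈ P) : P = ⊤ := by
  refine top_le_iff.1 ?_
  rw [← TensorProduct.span_tmul_eq_top, Submodule.span_le]
  rintro _ ⟨v, w, rfl⟩
  have h1 : P.comap (TensorProduct.mk ℂ V W v) = ⊤ := hT.eq_top fun b w hw => by
    have h2 : P.comap ((TensorProduct.mk ℂ V W).flip w) = ⊤ := hS.eq_top fun a v hv =>
      h a b v w hv hw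
    exact (h2 ▸ Submodule.mem_top : v ∈ P.comap ((TensorProduct.mk ℂ V W).flip w))
  exact (h1 ▸ Submodule.mem_top : w ∈ P.comap (TensorProduct.mk ℂ V W v))

theorem IsDiag.tensor_eq_top_left {S : Module.End ℂ V} (hS : IsDiag S)
    {P : Submodule ℂ (V ⊗[ℂ] W)}
    (h : ∀ (a : ℂ) (v : V) (w : W), S v = a • v → v ⊗ₜ[ℂ] w ∈ P) : P = ⊤ := by
  refine top_le_iff.1 ?_
  rw [← TensorProduct.span_tmul_eq_top, Submodule.span_le]
  rintro _ ⟨v, w, rfl⟩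
  have h2 : P.comap ((TensorProduct.mk ℂ V W).flip w) = ⊤ := hS.eq_top fun a v hv => h a v w hv
  exact (h2 ▸ Submodule.mem_top : v ∈ P.comap ((TensorProduct.mk ℂ V W).flip w))

theorem IsDiag.tensor_eq_top_right {T : Module.End ℂ W} (hT : IsDiag T)
    {P : Submodule ℂ (V ⊗[ℂ] W)}
    (h : ∀ (b : ℂ) (v : V) (w : W), T w = b • w → v ⊗ₜ[ℂ] w ∈ P) : P = ⊤ := by
  refine top_le_iff.1 ?_
  rw [← TensorProduct.span_tmul_eq_top, Submodule.span_le]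
  rintro _ ⟨v, w, rfl⟩
  have h1 : P.comap (TensorProduct.mk ℂ V W v) = ⊤ := hT.eq_top fun b w hw => h b v w hw
  exact (h1 ▸ Submodule.mem_top : w ∈ P.comap (TensorProduct.mk ℂ V W v))

/-- `h ↦ h ⊗ 1 + 1 ⊗ h`. -/
def addEnd (S : Module.End ℂ V) (T : Module.End ℂ W) : Module.End ℂ (V ⊗[ℂ] W) :=
  TensorProduct.map S LinearMap.id + TensorProduct.map LinearMap.id T

theorem addEnd_tmul (S : Module.End ℂ V) (T : Module.End ℂ W) (v : V) (w : W) :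
    addEnd S T (v ⊗ₜ w) = S v ⊗ₜ w + v ⊗ₜ T w := by
  simp [addEnd]

theorem addEnd_eigen {S : Module.End ℂ V} {T : Module.End ℂ W} {a b : ℂ} {v : V} {w : W}
    (hv : S v = a • v) (hw : T w = b • w) :
    addEnd S T (v ⊗ₜ w) = (a + b) • (v ⊗ₜ w) := by
  rw [addEnd_tmul, hv, hw, ← TensorProduct.smul_tmul', TensorProduct.tmul_smul, add_smul]

theorem addEnd_comm {S : Module.End ℂ V} {T : Module.End ℂ W} {R : Module.End ℂ Z}
    {f : V ⊗[ℂ] W →ₗ[ℂ] Z}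
    (h : ∀ v w, f (S v ⊗ₜ[ℂ] w) + f (v ⊗ₜ[ℂ] T w) = R (f (v ⊗ₜ[ℂ] w))) (t : V ⊗[ℂ] W) :
    f (addEnd S T t) = R (f t) := by
  have h1 : f ∘ₗ addEnd S T = R ∘ₗ f := TensorProduct.ext' fun v w => by
    simp [addEnd_tmul, h]
  exact LinearMap.congr_fun h1 t

theorem IsDiag.addEnd {S : Module.End ℂ V} {T : Module.End ℂ W} (hS : IsDiag S)
    (hT : IsDiag T) : IsDiag (SinhGordon.addEnd S T) :=
  isDiag_of_forall fun _ hP => hS.tensor_eq_top hT fun _ _ _ _ hv hw =>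
    hP _ _ (addEnd_eigen hv hw)

theorem map_eigen {S : Module.End ℂ V} {T : Module.End ℂ W} {a b : ℂ} {v : V} {w : W}
    (hv : S v = a • v) (hw : T w = b • w) :
    TensorProduct.map S T (v ⊗ₜ w) = (a * b) • (v ⊗ₜ w) := by
  rw [TensorProduct.map_tmul, hv, hw, ← TensorProduct.smul_tmul', TensorProduct.tmul_smul, smul_smul]

theorem IsDiag.map {S : Module.End ℂ V} {T : Module.End ℂ W} (hS : IsDiag S)
    (hT : IsDiag T) : IsDiag (TensorProduct.map S T) :=
  isDiag_of_forall fun _ hP => hS.tensor_eq_top hT fun _ _ _ _ hv hw =>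
    hP _ _ (map_eigen hv hw)

theorem IsDiag.smul {T : Module.End ℂ V} (hT : IsDiag T) (c : ℂ) : IsDiag (c • T) :=
  isDiag_of_forall fun _ hP => hT.eq_top fun a v hv => hP (c * a) v (by simp [hv, smul_smul])

open scoped Classical in
/-- `g(T)` for a diagonalisable `T`: multiplication by `g a` on the `a`-eigenspace of `T`. -/
def IsDiag.fc {T : Module.End ℂ V} (hT : IsDiag T) (g : ℂ → ℂ) : Module.End ℂ V :=
  DirectSum.toModule ℂ ℂ V (fun a => g a • (T.eigenspace a).subtype) ∘ₗ
    (LinearEquiv.ofBijective (DirectSum.coeLinearMap fun a => T.eigenspace a)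
      (DirectSum.isInternal_submodule_of_iSupIndep_of_iSup_eq_top
        T.eigenspaces_iSupIndep hT)).symm.toLinearMap

theorem IsDiag.fc_apply {T : Module.End ℂ V} (hT : IsDiag T) (g : ℂ → ℂ) {a : ℂ} {v : V}
    (hv : T v = a • v) : hT.fc g v = g a • v := by
  classical
  have hv' : v ∈ T.eigenspace a := Module.End.mem_eigenspace_iff.2 hv
  set e := LinearEquiv.ofBijective (DirectSum.coeLinearMap fun a => T.eigenspace a)
      (DirectSum.isInternal_submodule_of_iSupIndep_of_iSup_eq_top
        T.eigenspaces_iSupIndep hT) with he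
  have h1 : e (DirectSum.lof ℂ ℂ (fun a => T.eigenspace a) a ⟨v, hv'⟩) = v := by
    exact DirectSum.coeLinearMap_lof (fun a => T.eigenspace a) a ⟨v, hv'⟩
  have h2 : e.symm v = DirectSum.lof ℂ ℂ (fun a => T.eigenspace a) a ⟨v, hv'⟩ := by
    rw [LinearEquiv.symm_apply_eq, h1]
  have h3 : hT.fc g v = DirectSum.toModule ℂ ℂ V (fun a => g a • (T.eigenspace a).subtype)
      (e.symm v) := rfl
  rw [h3, h2, DirectSum.toModule_lof]
  simp

end Diag

/-! ### The braided category of diagonalisable modules -/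

/-- Objects of `𝒞`: a complex vector space with a diagonalisable endomorphism `h`.
The parameter `κ` only enters the braiding. -/
structure DiagRep (κ : ℂ) where
  V : Type
  [acg : AddCommGroup V]
  [mod : Module ℂ V]
  h : Module.End ℂ V
  diag : IsDiag h

namespace DiagRep
variable {κ : ℂ}

attribute [instance] DiagRep.acg DiagRep.mod

/-- Linear maps that commute with `h`. -/
@[ext] structure Hom (X Y : DiagRep κ) where
  lin : X.V →ₗ[ℂ] Y.V
  comm : ∀ v, lin (X.h v) = Y.h (lin v)

instance : Category (DiagRep κ) where
  Hom := Hom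
  id X := ⟨LinearMap.id, fun _ => rfl⟩
  comp f g := ⟨g.lin ∘ₗ f.lin, fun v => by simp [f.comm, g.comm]⟩

/-- The underlying linear map of a morphism of `𝒞`. -/
def lin {X Y : DiagRep κ} (f : X ⟶ Y) : X.V →ₗ[ℂ] Y.V := Hom.lin f

theorem comm {X Y : DiagRep κ} (f : X ⟶ Y) (v : X.V) : lin f (X.h v) = Y.h (lin f v) :=
  Hom.comm f v

theorem hom_ext {X Y : DiagRep κ} {f g : X ⟶ Y} (h : lin f = lin g) : f = g := Hom.ext h

/-- Morphisms of `𝒞` from linear maps. -/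
def mk' {X Y : DiagRep κ} (f : X.V →ₗ[ℂ] Y.V) (hf : ∀ v, f (X.h v) = Y.h (f v)) : X ⟶ Y :=
  Hom.mk f hf

@[simp] theorem lin_mk' {X Y : DiagRep κ} (f : X.V →ₗ[ℂ] Y.V)
    (hf : ∀ v, f (X.h v) = Y.h (f v)) : lin (mk' f hf : X ⟶ Y) = f := rfl
@[simp] theorem lin_id (X : DiagRep κ) : lin (𝟙 X) = LinearMap.id := rfl
@[simp] theorem lin_comp {X Y Z : DiagRep κ} (f : X ⟶ Y) (g : Y ⟶ Z) :
    lin (f ≫ g) = lin g ∘ₗ lin f := rfl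

/-- Isomorphisms of `𝒞` from linear equivalences. -/
def mkIso {X Y : DiagRep κ} (e : X.V ≃ₗ[ℂ] Y.V) (he : ∀ v, e (X.h v) = Y.h (e v)) : X ≅ Y where
  hom := mk' e.toLinearMap he
  inv := mk' e.symm.toLinearMap fun v => by
    apply e.injective
    simp [he]
  hom_inv_id := hom_ext (by ext; simp)
  inv_hom_id := hom_ext (by ext; simp)

@[simp] theorem lin_mkIso_hom {X Y : DiagRep κ} (e : X.V ≃ₗ[ℂ] Y.V)
    (he : ∀ v, e (X.h v) = Y.h (e v)) : lin (mkIso e he : X ≅ Y).hom = e.toLinearMap := rfl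
@[simp] theorem lin_mkIso_inv {X Y : DiagRep κ} (e : X.V ≃ₗ[ℂ] Y.V)
    (he : ∀ v, e (X.h v) = Y.h (e v)) : lin (mkIso e he : X ≅ Y).inv = e.symm.toLinearMap := rfl

instance (X Y : DiagRep κ) : Zero (X ⟶ Y) := ⟨mk' 0 fun v => by simp⟩
instance (X Y : DiagRep κ) : Add (X ⟶ Y) :=
  ⟨fun f g => mk' (lin f + lin g) fun v => by simp [comm]⟩
instance (X Y : DiagRep κ) : Neg (X ⟶ Y) := ⟨fun f => mk' (-lin f) fun v => by simp [comm]⟩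
instance (X Y : DiagRep κ) : Sub (X ⟶ Y) :=
  ⟨fun f g => mk' (lin f - lin g) fun v => by simp [comm]⟩
instance (X Y : DiagRep κ) : SMul ℕ (X ⟶ Y) :=
  ⟨fun n f => mk' (n • lin f) fun v => by simp [comm]⟩
instance (X Y : DiagRep κ) : SMul ℤ (X ⟶ Y) :=
  ⟨fun n f => mk' (n • lin f) fun v => by simp [comm]⟩

instance (X Y : DiagRep κ) : AddCommGroup (X ⟶ Y) :=
  Function.Injective.addCommGroup (fun f : X ⟶ Y => lin f) (fun _ _ h => hom_ext h) rfl
    (fun _ _ => rfl) (fun _ => rfl) (fun _ _ => rfl) (fun _ _ => rfl) (fun _ _ => rfl)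

@[simp] theorem lin_add {X Y : DiagRep κ} (f g : X ⟶ Y) : lin (f + g) = lin f + lin g := rfl

instance : Preadditive (DiagRep κ) where
  add_comp _ _ _ _ _ _ := hom_ext (by ext; simp)
  comp_add _ _ _ _ _ _ := hom_ext (by ext; simp)

instance : MonoidalCategoryStruct (DiagRep κ) where
  tensorObj X Y := ⟨X.V ⊗[ℂ] Y.V, addEnd X.h Y.h, X.diag.addEnd Y.diag⟩
  tensorUnit := ⟨ℂ, 0, isDiag_of_forall fun _ hP => top_le_iff.1 fun v _ => hP 0 v (by simp)⟩
  tensorHom f g := mk' (TensorProduct.map (lin f) (lin g)) <| addEnd_comm fun v w => by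
    simp [addEnd_tmul, comm]
  whiskerLeft X _ _ g := mk' (TensorProduct.map LinearMap.id (lin g)) <|
    addEnd_comm fun v w => by simp [addEnd_tmul, comm]
  whiskerRight f Y := mk' (TensorProduct.map (lin f) LinearMap.id) <|
    addEnd_comm fun v w => by simp [addEnd_tmul, comm]
  associator X Y Z := mkIso (TensorProduct.assoc ℂ X.V Y.V Z.V) <|
    addEnd_comm (f := (TensorProduct.assoc ℂ X.V Y.V Z.V).toLinearMap) fun t w => by
      induction t with
      | zero => simp
      | add x y hx hy => simp only [map_add, TensorProduct.add_tmul, ← hx, ← hy]; abel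
      | tmul u v =>
        simp [addEnd_tmul, TensorProduct.add_tmul, TensorProduct.tmul_add, add_assoc]
  leftUnitor X := mkIso (TensorProduct.lid ℂ X.V) <|
    addEnd_comm (f := (TensorProduct.lid ℂ X.V).toLinearMap) fun v w => by simp
  rightUnitor X := mkIso (TensorProduct.rid ℂ X.V) <|
    addEnd_comm (f := (TensorProduct.rid ℂ X.V).toLinearMap) fun v w => by simp

section simp
variable (X Y Z X' Y' : DiagRep κ)
theorem tensor_V : (X ⊗ Y).V = (X.V ⊗[ℂ] Y.V) := rfl
theorem tensor_h : (X ⊗ Y).h = addEnd X.h Y.h := rfl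
theorem unit_h : (𝟙_ (DiagRep κ)).h = 0 := rfl
@[simp] theorem lin_tensorHom {X Y X' Y' : DiagRep κ} (f : X ⟶ X') (g : Y ⟶ Y') :
    lin (f ⊗ₘ g) = TensorProduct.map (lin f) (lin g) := rfl
@[simp] theorem lin_whiskerLeft {Y Y' : DiagRep κ} (g : Y ⟶ Y') :
    lin (X ◁ g) = TensorProduct.map LinearMap.id (lin g) := rfl
@[simp] theorem lin_whiskerRight {X X' : DiagRep κ} (f : X ⟶ X') :
    lin (f ▷ Y) = TensorProduct.map (lin f) LinearMap.id := rfl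
@[simp] theorem lin_assoc_hom :
    lin (α_ X Y Z).hom = (TensorProduct.assoc ℂ X.V Y.V Z.V).toLinearMap := rfl
@[simp] theorem lin_assoc_inv :
    lin (α_ X Y Z).inv = (TensorProduct.assoc ℂ X.V Y.V Z.V).symm.toLinearMap := rfl
@[simp] theorem lin_lid_hom : lin (λ_ X).hom = (TensorProduct.lid ℂ X.V).toLinearMap := rfl
@[simp] theorem lin_rid_hom : lin (ρ_ X).hom = (TensorProduct.rid ℂ X.V).toLinearMap := rfl
end simp

instance : MonoidalCategory (DiagRep κ) where
  tensorHom_def _ _ := hom_ext (TensorProduct.ext' fun _ _ => rfl)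
  id_tensorHom_id _ _ := hom_ext (TensorProduct.ext' fun _ _ => rfl)
  tensorHom_comp_tensorHom _ _ _ _ := hom_ext (TensorProduct.ext' fun _ _ => rfl)
  whiskerLeft_id _ _ := hom_ext (TensorProduct.ext' fun _ _ => rfl)
  id_whiskerRight _ _ := hom_ext (TensorProduct.ext' fun _ _ => rfl)
  associator_naturality _ _ _ := hom_ext (TensorProduct.ext_threefold fun _ _ _ => rfl)
  leftUnitor_naturality f := hom_ext (TensorProduct.ext' fun (a : ℂ) v => (map_smul (lin f) a v).symm)
  rightUnitor_naturality f := hom_ext (TensorProduct.ext' fun v (a : ℂ) => (map_smul (lin f) a v).symm)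
  pentagon _ _ _ _ := hom_ext (TensorProduct.ext_fourfold fun _ _ _ _ => rfl)
  triangle _ _ := hom_ext (TensorProduct.ext_threefold fun _ _ _ => TensorProduct.tmul_smul _ _ _)

/-- The operator `e^{κ h ⊗ h}` on `X ⊗ Y`. -/
def rmat (κ : ℂ) {κ' : ℂ} (X Y : DiagRep κ') : Module.End ℂ (X.V ⊗[ℂ] Y.V) :=
  (X.diag.map Y.diag).fc fun z => Complex.exp (κ * z)

theorem rmat_tmul (k : ℂ) {X Y : DiagRep κ} {a b : ℂ} {v : X.V} {w : Y.V} (hv : X.h v = a • v)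
    (hw : Y.h w = b • w) : rmat k X Y (v ⊗ₜ w) = Complex.exp (k * (a * b)) • (v ⊗ₜ[ℂ] w) :=
  IsDiag.fc_apply _ _ (map_eigen hv hw)

theorem tensor_ext {X Y : DiagRep κ} {T : Type} [AddCommGroup T] [Module ℂ T]
    {f g : X.V ⊗[ℂ] Y.V →ₗ[ℂ] T}
    (h : ∀ (a b : ℂ) (v : X.V) (w : Y.V), X.h v = a • v → Y.h w = b • w →
      f (v ⊗ₜ[ℂ] w) = g (v ⊗ₜ[ℂ] w)) : f = g :=
  LinearMap.eqLocus_eq_top.1 (X.diag.tensor_eq_top Y.diag h)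

theorem tensor_ext₃ {X Y Z : DiagRep κ} {T : Type} [AddCommGroup T] [Module ℂ T]
    {f g : X.V ⊗[ℂ] (Y.V ⊗[ℂ] Z.V) →ₗ[ℂ] T}
    (h : ∀ (a b c : ℂ) (u : X.V) (v : Y.V) (w : Z.V), X.h u = a • u → Y.h v = b • v →
      Z.h w = c • w → f (u ⊗ₜ[ℂ] (v ⊗ₜ[ℂ] w)) = g (u ⊗ₜ[ℂ] (v ⊗ₜ[ℂ] w))) : f = g := by
  refine LinearMap.eqLocus_eq_top.1 (X.diag.tensor_eq_top_left fun a u t hu => ?_)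
  have h1 : (LinearMap.eqLocus f g).comap (TensorProduct.mk ℂ X.V (Y.V ⊗[ℂ] Z.V) u) = ⊤ :=
    Y.diag.tensor_eq_top Z.diag fun b c v w hv hw => h a b c u v w hu hv hw
  exact (h1 ▸ Submodule.mem_top :
    t ∈ (LinearMap.eqLocus f g).comap (TensorProduct.mk ℂ X.V (Y.V ⊗[ℂ] Z.V) u))

theorem tensor_ext₃' {X Y Z : DiagRep κ} {T : Type} [AddCommGroup T] [Module ℂ T]
    {f g : (X.V ⊗[ℂ] Y.V) ⊗[ℂ] Z.V →ₗ[ℂ] T}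
    (h : ∀ (a b c : ℂ) (u : X.V) (v : Y.V) (w : Z.V), X.h u = a • u → Y.h v = b • v →
      Z.h w = c • w → f ((u ⊗ₜ[ℂ] v) ⊗ₜ[ℂ] w) = g ((u ⊗ₜ[ℂ] v) ⊗ₜ[ℂ] w)) : f = g := by
  have h1 : f ∘ₗ (TensorProduct.assoc ℂ X.V Y.V Z.V).symm.toLinearMap =
      g ∘ₗ (TensorProduct.assoc ℂ X.V Y.V Z.V).symm.toLinearMap :=
    tensor_ext₃ fun a b c u v w hu hv hw => by simpa using h a b c u v w hu hv hw
  refine LinearMap.ext fun t => ?_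
  simpa using LinearMap.congr_fun h1 (TensorProduct.assoc ℂ X.V Y.V Z.V t)

theorem braid_comm (k : ℂ) (X Y : DiagRep κ) (t : X.V ⊗[ℂ] Y.V) :
    TensorProduct.comm ℂ X.V Y.V (rmat k X Y (addEnd X.h Y.h t)) =
      addEnd Y.h X.h (TensorProduct.comm ℂ X.V Y.V (rmat k X Y t)) := by
  have h1 : (TensorProduct.comm ℂ X.V Y.V).toLinearMap ∘ₗ rmat k X Y ∘ₗ addEnd X.h Y.h =
      addEnd Y.h X.h ∘ₗ (TensorProduct.comm ℂ X.V Y.V).toLinearMap ∘ₗ rmat k X Y :=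
    tensor_ext fun a b v w hv hw => by
      simp [addEnd_eigen hv hw, rmat_tmul k hv hw, addEnd_eigen hw hv, smul_smul, add_comm a b,
        mul_comm]
  exact LinearMap.congr_fun h1 t

theorem rmat_neg (k : ℂ) (X Y : DiagRep κ) (t : X.V ⊗[ℂ] Y.V) :
    rmat (-k) X Y (rmat k X Y t) = t := by
  have h1 : rmat (-k) X Y ∘ₗ rmat k X Y = LinearMap.id := tensor_ext fun a b v w hv hw => by
    simp [rmat_tmul _ hv hw, smul_smul, ← Complex.exp_add]
  exact LinearMap.congr_fun h1 t

/-- The linear equivalence `τ ∘ e^{κ h ⊗ h}`. -/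
def braidEquiv (X Y : DiagRep κ) : X.V ⊗[ℂ] Y.V ≃ₗ[ℂ] Y.V ⊗[ℂ] X.V :=
  ({ rmat κ X Y with
      invFun := rmat (-κ) X Y
      left_inv := rmat_neg κ X Y
      right_inv := fun t => by simpa using rmat_neg (-κ) X Y t } :
    X.V ⊗[ℂ] Y.V ≃ₗ[ℂ] X.V ⊗[ℂ] Y.V).trans (TensorProduct.comm ℂ X.V Y.V)

/-- The braiding `τ ∘ e^{κ h ⊗ h}`. -/
def braid (X Y : DiagRep κ) : X ⊗ Y ≅ Y ⊗ X :=
  mkIso (X := X ⊗ Y) (Y := Y ⊗ X) (braidEquiv X Y) (braid_comm κ X Y)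

theorem braidEquiv_tmul {X Y : DiagRep κ} {a b : ℂ} {v : X.V} {w : Y.V} (hv : X.h v = a • v)
    (hw : Y.h w = b • w) :
    braidEquiv X Y (v ⊗ₜ[ℂ] w) = Complex.exp (κ * (a * b)) • (w ⊗ₜ[ℂ] v) := by
  change TensorProduct.comm ℂ X.V Y.V (rmat κ X Y (v ⊗ₜ[ℂ] w)) = _
  rw [rmat_tmul κ hv hw, map_smul, TensorProduct.comm_tmul]

theorem eigen_lin {X Y : DiagRep κ} (f : X ⟶ Y) {a : ℂ} {v : X.V} (hv : X.h v = a • v) :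
    Y.h (lin f v) = a • lin f v := by
  rw [← comm, hv, map_smul]

theorem braid_naturality_right (X : DiagRep κ) {Y Z : DiagRep κ} (f : Y ⟶ Z) :
    (braidEquiv X Z).toLinearMap ∘ₗ TensorProduct.map LinearMap.id (lin f) =
      TensorProduct.map (lin f) LinearMap.id ∘ₗ (braidEquiv X Y).toLinearMap :=
  tensor_ext fun a b v w hv hw => by
    simp [braidEquiv_tmul hv hw, braidEquiv_tmul hv (eigen_lin f hw)]

theorem braid_naturality_left {X Y : DiagRep κ} (f : X ⟶ Y) (Z : DiagRep κ) :
    (braidEquiv Y Z).toLinearMap ∘ₗ TensorProduct.map (lin f) LinearMap.id =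
      TensorProduct.map LinearMap.id (lin f) ∘ₗ (braidEquiv X Z).toLinearMap :=
  tensor_ext fun a b v w hv hw => by
    simp [braidEquiv_tmul hv hw, braidEquiv_tmul (eigen_lin f hv) hw]

theorem braidEquiv_tmul_right (X Y Z : DiagRep κ) {a b c : ℂ} {u : X.V} {v : Y.V} {w : Z.V}
    (hu : X.h u = a • u) (hv : Y.h v = b • v) (hw : Z.h w = c • w) :
    (braidEquiv X (Y ⊗ Z) : X.V ⊗[ℂ] (Y.V ⊗[ℂ] Z.V) ≃ₗ[ℂ] (Y.V ⊗[ℂ] Z.V) ⊗[ℂ] X.V)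
      (u ⊗ₜ[ℂ] (v ⊗ₜ[ℂ] w)) =
      Complex.exp (κ * (a * (b + c))) • ((v ⊗ₜ[ℂ] w) ⊗ₜ[ℂ] u) :=
  braidEquiv_tmul (Y := Y ⊗ Z) hu (addEnd_eigen hv hw)

theorem braidEquiv_tmul_left (X Y Z : DiagRep κ) {a b c : ℂ} {u : X.V} {v : Y.V} {w : Z.V}
    (hu : X.h u = a • u) (hv : Y.h v = b • v) (hw : Z.h w = c • w) :
    (braidEquiv (X ⊗ Y) Z : (X.V ⊗[ℂ] Y.V) ⊗[ℂ] Z.V ≃ₗ[ℂ] Z.V ⊗[ℂ] (X.V ⊗[ℂ] Y.V))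
      ((u ⊗ₜ[ℂ] v) ⊗ₜ[ℂ] w) =
      Complex.exp (κ * ((a + b) * c)) • (w ⊗ₜ[ℂ] (u ⊗ₜ[ℂ] v)) :=
  braidEquiv_tmul (X := X ⊗ Y) (addEnd_eigen hu hv) hw

theorem hexagon_forward (X Y Z : DiagRep κ) :
    (TensorProduct.assoc ℂ Y.V Z.V X.V).toLinearMap ∘ₗ
      (braidEquiv X (Y ⊗ Z) : X.V ⊗[ℂ] (Y.V ⊗[ℂ] Z.V) ≃ₗ[ℂ] (Y.V ⊗[ℂ] Z.V) ⊗[ℂ] X.V).toLinearMap ∘ₗ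
        (TensorProduct.assoc ℂ X.V Y.V Z.V).toLinearMap =
    TensorProduct.map LinearMap.id (braidEquiv X Z).toLinearMap ∘ₗ
      (TensorProduct.assoc ℂ Y.V X.V Z.V).toLinearMap ∘ₗ
        TensorProduct.map (braidEquiv X Y).toLinearMap LinearMap.id :=
  tensor_ext₃' fun a b c u v w hu hv hw => by
    simp only [LinearMap.comp_apply, LinearEquiv.coe_coe, TensorProduct.assoc_tmul,
      braidEquiv_tmul_right X Y Z hu hv hw, map_smul, TensorProduct.map_tmul,
      braidEquiv_tmul hu hv, braidEquiv_tmul hu hw, TensorProduct.smul_tmul', LinearMap.id_apply]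
    simp only [← TensorProduct.smul_tmul', TensorProduct.tmul_smul, smul_smul, ← Complex.exp_add]
    ring_nf

theorem hexagon_reverse (X Y Z : DiagRep κ) :
    (TensorProduct.assoc ℂ Z.V X.V Y.V).symm.toLinearMap ∘ₗ
      (braidEquiv (X ⊗ Y) Z : (X.V ⊗[ℂ] Y.V) ⊗[ℂ] Z.V ≃ₗ[ℂ] Z.V ⊗[ℂ] (X.V ⊗[ℂ] Y.V)).toLinearMap ∘ₗ
        (TensorProduct.assoc ℂ X.V Y.V Z.V).symm.toLinearMap =
    TensorProduct.map (braidEquiv X Z).toLinearMap LinearMap.id ∘ₗ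
      (TensorProduct.assoc ℂ X.V Z.V Y.V).symm.toLinearMap ∘ₗ
        TensorProduct.map LinearMap.id (braidEquiv Y Z).toLinearMap :=
  tensor_ext₃ fun a b c u v w hu hv hw => by
    simp only [LinearMap.comp_apply, LinearEquiv.coe_coe, TensorProduct.assoc_symm_tmul,
      braidEquiv_tmul_left X Y Z hu hv hw, map_smul, TensorProduct.map_tmul,
      braidEquiv_tmul hv hw, LinearMap.id_apply, TensorProduct.tmul_smul, braidEquiv_tmul hu hw,
      ← TensorProduct.smul_tmul', smul_smul, ← Complex.exp_add]
    ring_nf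

instance : BraidedCategory (DiagRep κ) where
  braiding := braid
  braiding_naturality_right X _ _ f := hom_ext (braid_naturality_right X f)
  braiding_naturality_left f Z := hom_ext (braid_naturality_left f Z)
  hexagon_forward X Y Z := hom_ext (hexagon_forward X Y Z)
  hexagon_reverse X Y Z := hom_ext (hexagon_reverse X Y Z)

end DiagRep
/-! ### The topological algebras `𝓔(H; X)` -/

/-- Words in commuting letters `H` and free letters `X` (no relation between the two kinds):
the free product of the free commutative monoid on `H` and the free monoid on `X`. -/
abbrev Word (H X : Type) : Type := Monoid.Coprod (Multiplicative (H →₀ ℕ)) (FreeMonoid X)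

namespace Word
variable (H X : Type)

/-- Total length of a word. -/
def deg : Word H X →* Multiplicative ℕ :=
  Monoid.Coprod.lift (AddMonoidHom.toMultiplicative
    (Finsupp.liftAddHom (fun _ : H => AddMonoidHom.id ℕ)))
    (FreeMonoid.lift fun _ => Multiplicative.ofAdd 1)

/-- Number of letters from `X` in a word. -/
def xdeg : Word H X →* Multiplicative ℕ :=
  Monoid.Coprod.lift 1 (FreeMonoid.lift fun _ => Multiplicative.ofAdd 1)

end Word

/-- The weight `r ^ |w|` of a word. -/
def wt {H X : Type} (r : NNReal) (w : Word H X) : ℝ := (r : ℝ) ^ (Word.deg H X w).toAdd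

/-- The norm `‖∑ c_w w‖_r = ∑ |c_w| r ^ |w|`. -/
def nrm {H X : Type} (r : NNReal) (f : MonoidAlgebra ℂ (Word H X)) : ℝ :=
  f.coeff.sum fun w c => ‖c‖ * wt r w

section nrm
variable {H X : Type} (r : NNReal)

theorem wt_nonneg (w : Word H X) : 0 ≤ wt r w := by
  unfold wt; positivity

theorem wt_mul (w w' : Word H X) : wt r (w * w') = wt r w * wt r w' := by
  simp [wt, pow_add]

theorem nrm_single (w : Word H X) (c : ℂ) :
    nrm r (MonoidAlgebra.single w c) = ‖c‖ * wt r w :=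
  Finsupp.sum_single_index (by simp)

theorem nrm_add_le (f g : MonoidAlgebra ℂ (Word H X)) :
    nrm r (f + g) ≤ nrm r f + nrm r g := by
  classical
  have key : ∀ (u : Word H X →₀ ℂ) (s : Finset (Word H X)), u.support ⊆ s →
      (u.sum fun w c => ‖c‖ * wt r w) = ∑ w ∈ s, ‖u w‖ * wt r w := fun u s hs =>
    Finsupp.sum_of_support_subset _ hs _ (by simp)
  have h1 : nrm r (f + g) = (f.coeff + g.coeff).sum fun w c => ‖c‖ * wt r w := rfl
  rw [h1, nrm, nrm, key _ _ Finsupp.support_add, key _ _ Finset.subset_union_left,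
    key g.coeff _ (Finset.subset_union_right (s₁ := f.coeff.support)), ← Finset.sum_add_distrib]
  refine Finset.sum_le_sum fun w _ => ?_
  rw [← add_mul]
  exact mul_le_mul_of_nonneg_right (norm_add_le _ _) (wt_nonneg r w)

theorem nrm_zero : nrm r (0 : MonoidAlgebra ℂ (Word H X)) = 0 := Finsupp.sum_zero_index

theorem nrm_nonneg (f : MonoidAlgebra ℂ (Word H X)) : 0 ≤ nrm r f :=
  Finset.sum_nonneg fun _ _ => mul_nonneg (norm_nonneg _) (wt_nonneg r _)

theorem nrm_neg (f : MonoidAlgebra ℂ (Word H X)) : nrm r (-f) = nrm r f := by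
  have h1 : nrm r (-f) = (-f.coeff).sum fun w c => ‖c‖ * wt r w := rfl
  rw [h1, Finsupp.sum_neg_index (by simp)]
  simp [nrm]

theorem nrm_single_mul_le (w : Word H X) (c : ℂ) (g : MonoidAlgebra ℂ (Word H X)) :
    nrm r (MonoidAlgebra.single w c * g) ≤ nrm r (MonoidAlgebra.single w c) * nrm r g := by
  induction g using MonoidAlgebra.induction with
  | zero => simp [nrm_zero]
  | single_add w' c' g hw hc hg =>
    have h1 : nrm r (MonoidAlgebra.single w' c' + g) =
        nrm r (MonoidAlgebra.single w' c') + nrm r g := by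
      have h2 : nrm r (MonoidAlgebra.single w' c' + g) =
        (Finsupp.single w' c' + g.coeff).sum fun w c => ‖c‖ * wt r w := rfl
      classical
      rw [h2, Finsupp.sum_add_index_of_disjoint]
      · rfl
      · refine Finset.disjoint_left.2 fun a ha hb => hw ?_
        have := Finset.mem_singleton.1 (Finsupp.support_single_subset ha)
        exact this ▸ hb
    rw [mul_add, h1, mul_add]
    refine (nrm_add_le r _ _).trans (add_le_add (le_of_eq ?_) hg)
    rw [MonoidAlgebra.single_mul_single, nrm_single, nrm_single, nrm_single, wt_mul, norm_mul]
    ring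

theorem nrm_mul_le (f g : MonoidAlgebra ℂ (Word H X)) : nrm r (f * g) ≤ nrm r f * nrm r g := by
  induction f using MonoidAlgebra.induction with
  | zero => simp [nrm_zero]
  | single_add w' c' f hw hc hf =>
    have h1 : nrm r (MonoidAlgebra.single w' c' + f) =
        nrm r (MonoidAlgebra.single w' c') + nrm r f := by
      have h2 : nrm r (MonoidAlgebra.single w' c' + f) =
        (Finsupp.single w' c' + f.coeff).sum fun w c => ‖c‖ * wt r w := rfl
      classical
      rw [h2, Finsupp.sum_add_index_of_disjoint]
      · rfl
      · refine Finset.disjoint_left.2 fun a ha hb => hw ?_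
        have := Finset.mem_singleton.1 (Finsupp.support_single_subset ha)
        exact this ▸ hb
    rw [add_mul, h1, add_mul]
    exact (nrm_add_le r _ _).trans (add_le_add (nrm_single_mul_le r _ _ _) hf)

end nrm

/-- The algebra `𝓔₀(H; X)` generated by commuting variables `H` and free variables `X`. -/
def E0 (H X : Type) : Type := MonoidAlgebra ℂ (Word H X)

namespace E0
variable (H X : Type)

instance : Ring (E0 H X) := inferInstanceAs (Ring (MonoidAlgebra ℂ (Word H X)))
instance : Algebra ℂ (E0 H X) := inferInstanceAs (Algebra ℂ (MonoidAlgebra ℂ (Word H X)))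

/-- The element of `𝓔₀` given by a word. -/
def word : Word H X →* E0 H X := MonoidAlgebra.of ℂ (Word H X)

/-- The norm `‖·‖_r` on `𝓔₀`. -/
def ringSeminorm (r : NNReal) : RingSeminorm (E0 H X) where
  toFun := nrm r
  map_zero' := nrm_zero r
  add_le' := nrm_add_le r
  neg' := nrm_neg r
  mul_le' := nrm_mul_le r

/-- `𝓔₀` as a seminormed ring. -/
abbrev seminormedRing (r : NNReal) : SeminormedRing (E0 H X) := (ringSeminorm H X r).toSeminormedRing

/-- The uniform structure on `𝓔₀` given by all the norms `‖·‖_r`. -/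
instance : UniformSpace (E0 H X) :=
  ⨅ r : NNReal, (seminormedRing H X r).toPseudoMetricSpace.toUniformSpace

instance : IsUniformAddGroup (E0 H X) :=
  isUniformAddGroup_iInf fun r =>
    let _ := seminormedRing H X r
    inferInstance

instance : IsTopologicalRing (E0 H X) := by
  have h2 : (inferInstance : TopologicalSpace (E0 H X)) =
      ⨅ r : NNReal, (seminormedRing H X r).toPseudoMetricSpace.toUniformSpace.toTopologicalSpace :=
    UniformSpace.toTopologicalSpace_iInf
  have h3 : ContinuousMul (E0 H X) := by
    have h4 := continuousMul_iInf (M := E0 H X)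
      (ts := fun r => (seminormedRing H X r).toPseudoMetricSpace.toUniformSpace.toTopologicalSpace)
      fun r => by
        let _ := seminormedRing H X r
        infer_instance
    rw [← h2] at h4
    exact h4
  exact { }

instance : UniformContinuousConstSMul ℂ (E0 H X) where
  uniformContinuous_const_smul c := by
    have h1 : (fun x : E0 H X => c • x) =
        AddMonoidHom.mulLeft (algebraMap ℂ (E0 H X) c) := funext fun x => Algebra.smul_def c x
    rw [h1]
    exact uniformContinuous_addMonoidHom_of_continuous (continuous_const_mul _)

end E0

/-- The completion of `𝓔₀` with respect to the norms `‖·‖_r`. -/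
abbrev EHat (H X : Type) : Type := UniformSpace.Completion (E0 H X)

/-- `𝓔₀⁽ⁿ⁾`, spanned by the words with `n` letters from `X`. -/
def E0n (H X : Type) (n : ℕ) : Submodule ℂ (E0 H X) :=
  Submodule.span ℂ {f | ∃ w, Word.xdeg H X w = Multiplicative.ofAdd n ∧ f = E0.word H X w}

/-- `𝓔⁽ⁿ⁾`, the completion of `𝓔₀⁽ⁿ⁾`. -/
def En (H X : Type) (n : ℕ) : Submodule ℂ (EHat H X) where
  carrier := closure ((fun f : E0 H X => (f : EHat H X)) '' E0n H X n)
  add_mem' := by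
    intro a b ha hb
    refine map_mem_closure₂ continuous_add ha hb ?_
    rintro _ ⟨f, hf, rfl⟩ _ ⟨g, hg, rfl⟩
    exact ⟨f + g, add_mem hf hg, UniformSpace.Completion.coe_add _ _⟩
  zero_mem' := subset_closure ⟨0, zero_mem _, UniformSpace.Completion.coe_zero⟩
  smul_mem' := by
    intro c a ha
    refine map_mem_closure (continuous_const_smul c) ha ?_
    rintro _ ⟨f, hf, rfl⟩
    exact ⟨c • f, Submodule.smul_mem _ c hf, UniformSpace.Completion.coe_smul c f⟩

theorem E0n_mul {H X : Type} {m n : ℕ} {f g : E0 H X} (hf : f ∈ E0n H X m) (hg : g ∈ E0n H X n) :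
    f * g ∈ E0n H X (m + n) := by
  have h := Submodule.mul_mem_mul hf hg
  rw [E0n, E0n, Submodule.span_mul_span] at h
  refine Submodule.span_mono ?_ h
  rintro _ ⟨_, ⟨w, hw, rfl⟩, _, ⟨w', hw', rfl⟩, rfl⟩
  exact ⟨w * w', by rw [map_mul, hw, hw', ofAdd_add], (map_mul _ _ _).symm⟩

instance (H X : Type) : SetLike.GradedMonoid (En H X) where
  one_mem := subset_closure ⟨1, Submodule.subset_span ⟨1, map_one _, (map_one _).symm⟩,
    UniformSpace.Completion.coe_one _⟩
  mul_mem := by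
    intro m n a b ha hb
    refine map_mem_closure₂ continuous_mul ha hb ?_
    rintro _ ⟨f, hf, rfl⟩ _ ⟨g, hg, rfl⟩
    exact ⟨f * g, E0n_mul hf hg, UniformSpace.Completion.coe_mul _ _⟩

/-- `𝓔(H; X) = ⨁ₙ 𝓔⁽ⁿ⁾`. -/
def E (H X : Type) : Type := DirectSum ℕ fun n => En H X n

namespace E
variable (H X : Type)

instance : Ring (E H X) := inferInstanceAs (Ring (DirectSum ℕ fun n => En H X n))
instance : Algebra ℂ (E H X) := inferInstanceAs (Algebra ℂ (DirectSum ℕ fun n => En H X n))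

/-- The inclusion of the `n`-th summand. -/
def incl (n : ℕ) : En H X n →ₗ[ℂ] E H X := DirectSum.lof ℂ ℕ (fun n => En H X n) n

/-- The seminorms on `𝓔` that are continuous on each `𝓔⁽ⁿ⁾`. -/
def seminorms : SeminormFamily ℂ (E H X)
    {p : Seminorm ℂ (E H X) // ∀ n, Continuous fun a : En H X n => p (incl H X n a)} :=
  Subtype.val

instance : Nonempty
    {p : Seminorm ℂ (E H X) // ∀ n, Continuous fun a : En H X n => p (incl H X n a)} :=
  ⟨⟨0, fun _ => continuous_const⟩⟩

/-- The locally convex direct sum topology: it is given by all seminorms that are continuous on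
each summand. -/
instance : TopologicalSpace (E H X) := (seminorms H X).moduleFilterBasis.topology

variable {H X}

theorem word_mem (w : Word H X) :
    ((E0.word H X w : E0 H X) : EHat H X) ∈ En H X (Word.xdeg H X w).toAdd :=
  subset_closure ⟨_, Submodule.subset_span ⟨w, rfl, rfl⟩, rfl⟩

/-- A word as an element of `𝓔`. -/
def word (w : Word H X) : E H X := incl H X _ ⟨_, word_mem w⟩

/-- The commuting generators. -/
def h (i : H) : E H X := word (Monoid.Coprod.inl (Multiplicative.ofAdd (Finsupp.single i 1)))

/-- The free generators. -/
def x (j : X) : E H X := word (Monoid.Coprod.inr (FreeMonoid.of j))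

end E

/-- The exponential series. -/
def texp {B : Type} [Ring B] [Algebra ℂ B] [TopologicalSpace B] (a : B) : B :=
  ∑' n : ℕ, ((n.factorial : ℂ)⁻¹) • a ^ n

/-! ### Closed ideals and presentations -/

/-- The smallest closed two-sided ideal containing `R`. -/
def closedIdeal {B : Type} [Ring B] [TopologicalSpace B] (R : Set B) : TwoSidedIdeal B :=
  sInf {I | R ⊆ (I : Set B) ∧ IsClosed (I : Set B)}

/-- The topological quotient of `B` by the smallest closed two-sided ideal containing `R`. -/
def ClosedQuot {B : Type} [Ring B] [TopologicalSpace B] (R : Set B) : Type :=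
  (closedIdeal R).ringCon.Quotient

namespace ClosedQuot
variable {B : Type} [Ring B] [Algebra ℂ B] [TopologicalSpace B] (R : Set B)

instance : Ring (ClosedQuot R) := inferInstanceAs (Ring (closedIdeal R).ringCon.Quotient)
instance : Algebra ℂ (ClosedQuot R) := inferInstanceAs (Algebra ℂ (closedIdeal R).ringCon.Quotient)

/-- The projection. -/
def mk : B →ₐ[ℂ] ClosedQuot R where
  toRingHom := (closedIdeal R).ringCon.mk'
  commutes' _ := rfl

instance : TopologicalSpace (ClosedQuot R) := TopologicalSpace.coinduced (mk R) inferInstance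

end ClosedQuot


/-- A family of relations between commuting generators `h` and free generators `x`, given in any
topological algebra that contains such elements: the listed elements are to vanish. -/
def Rels (H X : Type) : Type 1 :=
  ∀ (B : Type) [Ring B] [Algebra ℂ B] [TopologicalSpace B], (H → B) → (X → B) → Set B

/-- `𝓔(H; X)` modulo the closure of the two-sided ideal generated by the relations. -/
abbrev Alg {H X : Type} (S : Rels H X) : Type := ClosedQuot (S (E H X) E.h E.x)

/-- The generators of `Alg S`. -/
def Alg.h {H X : Type} (S : Rels H X) (i : H) : Alg S := ClosedQuot.mk _ (E.h i)

/-- The generators of `Alg S`. -/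
def Alg.x {H X : Type} (S : Rels H X) (j : X) : Alg S := ClosedQuot.mk _ (E.x j)

/-- Two copies of the generators and relations, and the relations that the generators of the first
copy commute with those of the second. -/
def Rels.double {H X : Type} (S : Rels H X) : Rels (H ⊕ H) (X ⊕ X) := fun B _ _ _ h x =>
  S B (fun i => h (Sum.inl i)) (fun j => x (Sum.inl j)) ∪
  S B (fun i => h (Sum.inr i)) (fun j => x (Sum.inr j)) ∪
  {c | ∃ a b, ((∃ i, a = h (Sum.inl i)) ∨ ∃ j, a = x (Sum.inl j)) ∧
    ((∃ i, b = h (Sum.inr i)) ∨ ∃ j, b = x (Sum.inr j)) ∧ c = a * b - b * a}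

/-- The completed tensor product of `Alg S` with itself:
`𝓔(H ⊕ H; X ⊕ X)` modulo the closed ideal generated by the relations of both factors and
by the commutators of generators of the first factor with generators of the second factor. -/
abbrev Alg₂ {H X : Type} (S : Rels H X) : Type := Alg S.double

/-- `φ` is the continuous algebra homomorphism with the values `a` and `y` on the generators. -/
structure IsGenHom {H X : Type} {S : Rels H X} {B : Type} [Ring B] [Algebra ℂ B]
    [TopologicalSpace B] (φ : Alg S →ₐ[ℂ] B) (a : H → B) (y : X → B) : Prop where
  cont : Continuous φ
  map_h : ∀ i, φ (Alg.h S i) = a i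
  map_x : ∀ j, φ (Alg.x S j) = y j

/-- The continuous algebra homomorphism `φ ⊗̄ φ`. -/
def IsDoubleOf {H X H' X' : Type} {S : Rels H X} {S' : Rels H' X'} (φ₂ : Alg₂ S →ₐ[ℂ] Alg₂ S')
    (φ : Alg S →ₐ[ℂ] Alg S') : Prop :=
  ∃ i₁ i₂ : Alg S →ₐ[ℂ] Alg₂ S, ∃ j₁ j₂ : Alg S' →ₐ[ℂ] Alg₂ S',
    IsGenHom i₁ (fun i => Alg.h S.double (Sum.inl i)) (fun i => Alg.x S.double (Sum.inl i)) ∧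
    IsGenHom i₂ (fun i => Alg.h S.double (Sum.inr i)) (fun i => Alg.x S.double (Sum.inr i)) ∧
    IsGenHom j₁ (fun i => Alg.h S'.double (Sum.inl i)) (fun i => Alg.x S'.double (Sum.inl i)) ∧
    IsGenHom j₂ (fun i => Alg.h S'.double (Sum.inr i)) (fun i => Alg.x S'.double (Sum.inr i)) ∧
    Continuous φ₂ ∧ (∀ a, φ₂ (i₁ a) = j₁ (φ a)) ∧ (∀ a, φ₂ (i₂ a) = j₂ (φ a))

/-- Signs. -/
inductive Pm
  | pos
  | neg

/-- The value of a sign. -/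
def Pm.val : Pm → ℂ
  | .pos => 1
  | .neg => -1

/-! ### The bialgebra `A_F` -/

namespace AF

/-- `[h, f^±] = ± ω f^±` and `[h, f̄^±] = ± ω f̄^±`. The generators `f^±` and `f̄^±` are indexed by
the left and the right copy of the signs. -/
def rels (ω : ℂ) : Rels Unit (Pm ⊕ Pm) := fun _ _ _ _ h x =>
  {r | ∃ s : Pm, r = h () * x (Sum.inl s) - x (Sum.inl s) * h () - (s.val * ω) • x (Sum.inl s)} ∪
  {r | ∃ s : Pm, r = h () * x (Sum.inr s) - x (Sum.inr s) * h () - (s.val * ω) • x (Sum.inr s)}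

variable (ω : ℂ)

/-- The generator `h`. -/
def h : Alg (rels ω) := Alg.h (rels ω) ()
/-- The generators `f^±`. -/
def f (s : Pm) : Alg (rels ω) := Alg.x (rels ω) (Sum.inl s)
/-- The generators `f̄^±`. -/
def fbar (s : Pm) : Alg (rels ω) := Alg.x (rels ω) (Sum.inr s)

/-- `h ⊗ 1`. -/
def h₁ : Alg₂ (rels ω) := Alg.h (rels ω).double (Sum.inl ())
/-- `1 ⊗ h`. -/
def h₂ : Alg₂ (rels ω) := Alg.h (rels ω).double (Sum.inr ())

/-- The coproduct: `Δ h = h ⊗ 1 + 1 ⊗ h`, `Δ f^± = f^± ⊗ 1 + e^{± κ ω h} ⊗ f^±`,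
`Δ f̄^± = f̄^± ⊗ 1 + e^{∓ κ ω h} ⊗ f̄^±`. -/
def IsComul (κ : ℂ) (Δ : Alg (rels ω) →ₐ[ℂ] Alg₂ (rels ω)) : Prop :=
  IsGenHom Δ (fun _ => h₁ ω + h₂ ω)
    (Sum.elim
      (fun s => Alg.x (rels ω).double (Sum.inl (Sum.inl s)) +
        texp ((s.val * κ * ω) • h₁ ω) * Alg.x (rels ω).double (Sum.inr (Sum.inl s)))
      (fun s => Alg.x (rels ω).double (Sum.inl (Sum.inr s)) +
        texp ((-s.val * κ * ω) • h₁ ω) * Alg.x (rels ω).double (Sum.inr (Sum.inr s))))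

/-- The counit vanishes on the generators. -/
def IsCounit (ε : Alg (rels ω) →ₐ[ℂ] ℂ) : Prop := IsGenHom ε 0 0

end AF

/-! ### The bialgebra `Ũ_ħ(Lsl₂)` -/

namespace Uq

/-- `[3]_q` for `q = e^ħ`. -/
def three (ħ : ℂ) : ℂ :=
  (Complex.exp (3 * ħ) - Complex.exp (-(3 * ħ))) / (Complex.exp ħ - Complex.exp (-ħ))

/-- The defining relations of `Ũ_ħ(Lsl₂)`; the generator `e_i^±` is `x (±, i)`. -/
def rels (ħ : ℂ) : Rels (Fin 2) (Pm × Fin 2) := fun _ _ _ _ h x =>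
  {h 0 + h 1} ∪
  {r | ∃ (s : Pm) (i : Fin 2), r = h i * x (s, i) - x (s, i) * h i - (2 * s.val) • x (s, i)} ∪
  {r | ∃ i : Fin 2, r = x (.pos, i) * x (.neg, i) - x (.neg, i) * x (.pos, i) -
    (Complex.exp ħ - Complex.exp (-ħ))⁻¹ • (texp (ħ • h i) - texp (-ħ • h i))} ∪
  {r | ∃ i j : Fin 2, i ≠ j ∧ r = x (.pos, i) * x (.neg, j) - x (.neg, j) * x (.pos, i)} ∪
  {r | ∃ (s : Pm) (i j : Fin 2), r = x (s, i) ^ 3 * x (s, j) -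
    three ħ • (x (s, i) ^ 2 * x (s, j) * x (s, i)) +
    three ħ • (x (s, i) * x (s, j) * x (s, i) ^ 2) - x (s, j) * x (s, i) ^ 3}

variable (ħ : ℂ)

/-- The generators `h_i`. -/
def h (i : Fin 2) : Alg (rels ħ) := Alg.h (rels ħ) i
/-- The generators `e_i^±`. -/
def e (s : Pm) (i : Fin 2) : Alg (rels ħ) := Alg.x (rels ħ) (s, i)

/-- `h_i ⊗ 1`. -/
def h₁ (i : Fin 2) : Alg₂ (rels ħ) := Alg.h (rels ħ).double (Sum.inl i)
/-- `1 ⊗ h_i`. -/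
def h₂ (i : Fin 2) : Alg₂ (rels ħ) := Alg.h (rels ħ).double (Sum.inr i)
/-- `e_i^± ⊗ 1`. -/
def e₁ (s : Pm) (i : Fin 2) : Alg₂ (rels ħ) := Alg.x (rels ħ).double (Sum.inl (s, i))
/-- `1 ⊗ e_i^±`. -/
def e₂ (s : Pm) (i : Fin 2) : Alg₂ (rels ħ) := Alg.x (rels ħ).double (Sum.inr (s, i))

/-- The values of the coproduct: `Δ e_i⁺ = e_i⁺ ⊗ e^{ħ h_i} + 1 ⊗ e_i⁺`,
`Δ e_i⁻ = e_i⁻ ⊗ 1 + e^{-ħ h_i} ⊗ e_i⁻`. -/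
def comulE : Pm × Fin 2 → Alg₂ (rels ħ)
  | (.pos, i) => e₁ ħ .pos i * texp (ħ • h₂ ħ i) + e₂ ħ .pos i
  | (.neg, i) => e₁ ħ .neg i + texp (-ħ • h₁ ħ i) * e₂ ħ .neg i

/-- The coproduct. -/
def IsComul (Δ : Alg (rels ħ) →ₐ[ℂ] Alg₂ (rels ħ)) : Prop :=
  IsGenHom Δ (fun i => h₁ ħ i + h₂ ħ i) (comulE ħ)

/-- The counit vanishes on the generators. -/
def IsCounit (ε : Alg (rels ħ) →ₐ[ℂ] ℂ) : Prop := IsGenHom ε 0 0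

/-- The number `(e^ħ - e^{-ħ}) / e^{2ħ}`. -/
def c : ℂ := (Complex.exp ħ - Complex.exp (-ħ)) / Complex.exp (2 * ħ)

/-- The values of `ψ` on `f^±` and `f̄^±`. -/
def psiX (ζ ξ : ℂ) : Pm ⊕ Pm → Alg (rels ħ)
  | .inl .pos => e ħ .pos 0 * texp (-ħ • h ħ 0)
  | .inl .neg => (ξ * c ħ) • (e ħ .pos 1 * texp (-ħ • h ħ 1))
  | .inr .pos => e ħ .neg 1
  | .inr .neg => (ζ * c ħ) • e ħ .neg 0

/-- The homomorphism `ψ : A_F → Ũ_ħ(Lsl₂)`. -/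
def IsPsi (ω ζ ξ : ℂ) (ψ : Alg (AF.rels ω) →ₐ[ℂ] Alg (rels ħ)) : Prop :=
  IsGenHom ψ (fun _ => (ω / 2) • h ħ 0) (psiX ħ ζ ξ)

end Uq

/-! ### Representations on which `h` acts semisimply -/

/-- For all `v ∈ V` and `φ ∈ V*` the function `b ↦ φ (ρ b v)` is continuous. -/
def WeaklyContinuous {B V : Type} [Ring B] [Algebra ℂ B] [TopologicalSpace B] [AddCommGroup V]
    [Module ℂ V] (ρ : B →ₐ[ℂ] Module.End ℂ V) : Prop :=
  ∀ (v : V) (φ : V →ₗ[ℂ] ℂ), Continuous fun b => φ (ρ b v)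

/-- Weakly continuous representations of `B` on which `t` acts diagonalisably. -/
structure RepSS (B : Type) [Ring B] [Algebra ℂ B] [TopologicalSpace B] (t : B) where
  V : Type
  [acg : AddCommGroup V]
  [mod : Module ℂ V]
  act : B →ₐ[ℂ] Module.End ℂ V
  cont : WeaklyContinuous act
  diag : IsDiag (act t)

namespace RepSS
attribute [instance] RepSS.acg RepSS.mod

variable {B B' : Type} [Ring B] [Algebra ℂ B] [TopologicalSpace B] [Ring B'] [Algebra ℂ B']
  [TopologicalSpace B'] {t : B} {t' : B'}

/-- Intertwiners. -/
@[ext] structure Hom (X Y : RepSS B t) where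
  lin : X.V →ₗ[ℂ] Y.V
  comm : ∀ b v, lin (X.act b v) = Y.act b (lin v)

instance : Category (RepSS B t) where
  Hom := Hom
  id X := ⟨LinearMap.id, fun _ _ => rfl⟩
  comp f g := ⟨g.lin ∘ₗ f.lin, fun b v => by simp [f.comm, g.comm]⟩

/-- Pullback of representations along a continuous homomorphism `φ` with `φ t = c t'`. -/
def pullback (φ : B →ₐ[ℂ] B') (hφ : Continuous φ) (c : ℂ) (hc : φ t = c • t') :
    RepSS B' t' ⥤ RepSS B t where
  obj X := ⟨X.V, X.act.comp φ, fun v f => (X.cont v f).comp hφ, by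
    have h1 : (X.act.comp φ) t = c • X.act t' := by simp [hc]
    rw [h1]
    exact X.diag.smul c⟩
  map {X Y} f := ⟨(f : Hom X Y).lin, fun b v => (f : Hom X Y).comm (φ b) v⟩

/-- The underlying object of `𝒞`: the vector space with the action of `t`. -/
def toDiag (κ : ℂ) : RepSS B t ⥤ DiagRep κ where
  obj X := ⟨X.V, X.act t, X.diag⟩
  map {X Y} f := ⟨(f : Hom X Y).lin, fun v => (f : Hom X Y).comm t v⟩

end RepSS

/-- `ρ₂` is the representation of the completed tensor product on `V ⊗ W`. -/
structure IsTensorRep {H X : Type} {S : Rels H X} {V W : Type} [AddCommGroup V] [Module ℂ V]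
    [AddCommGroup W] [Module ℂ W] (ρV : Alg S →ₐ[ℂ] Module.End ℂ V)
    (ρW : Alg S →ₐ[ℂ] Module.End ℂ W) (ρ₂ : Alg₂ S →ₐ[ℂ] Module.End ℂ (V ⊗[ℂ] W)) : Prop where
  cont : WeaklyContinuous ρ₂
  h_left : ∀ i, ρ₂ (Alg.h S.double (Sum.inl i)) = TensorProduct.map (ρV (Alg.h S i)) LinearMap.id
  h_right : ∀ i, ρ₂ (Alg.h S.double (Sum.inr i)) = TensorProduct.map LinearMap.id (ρW (Alg.h S i))
  x_left : ∀ i, ρ₂ (Alg.x S.double (Sum.inl i)) = TensorProduct.map (ρV (Alg.x S i)) LinearMap.id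
  x_right : ∀ i, ρ₂ (Alg.x S.double (Sum.inr i)) = TensorProduct.map LinearMap.id (ρW (Alg.x S i))

/-! ### Tensor algebras, Hopf pairings and Yetter-Drinfeld modules -/

section Braided
universe u v
variable {D : Type u} [Category.{v} D] [MonoidalCategory D] [BraidedCategory D]

open MonObj ComonObj

/-- The tensor algebra of `F` as a bialgebra: the free algebra on `F`, with the bialgebra
structure for which `F` is primitive. -/
structure TensorBialgebra [Preadditive D] (F : D) where
  T : D
  [bimon : BimonObj T]
  incl : F ⟶ T
  lift : ∀ (A : D) [MonObj A] (f : F ⟶ A), ∃! g : T ⟶ A, IsMonHom g ∧ incl ≫ g = f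
  comul_incl : incl ≫ Δ[T] = (ρ_ F).inv ≫ (incl ⊗ₘ η[T]) + (λ_ F).inv ≫ (η[T] ⊗ₘ incl)
  counit_incl : incl ≫ ε[T] = 0

attribute [instance] TensorBialgebra.bimon

variable {P Q : D} [BimonObj P] [BimonObj Q]

/-- `(p ⊗ p') ⊗ (q ⊗ q') ↦ ρ(p', q) ρ(p, q')`. -/
def nested (r : P ⊗ Q ⟶ 𝟙_ D) : (P ⊗ P) ⊗ (Q ⊗ Q) ⟶ 𝟙_ D :=
  (α_ P P (Q ⊗ Q)).hom ≫ P ◁ ((α_ P Q Q).inv ≫ r ▷ Q ≫ (λ_ Q).hom) ≫ r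

/-- Hopf pairings: the algebra and coalgebra structures of `P` and `Q` are dual to each other. -/
structure IsHopfPairing (r : P ⊗ Q ⟶ 𝟙_ D) : Prop where
  mul_left : μ[P] ▷ Q ≫ r = (P ⊗ P) ◁ Δ[Q] ≫ nested r
  mul_right : P ◁ μ[Q] ≫ r = Δ[P] ▷ (Q ⊗ Q) ≫ nested r
  one_left : η[P] ▷ Q ≫ r = (λ_ Q).hom ≫ ε[Q]
  one_right : P ◁ η[Q] ≫ r = (ρ_ P).hom ≫ ε[P]

/-- A left action `l` of `P` and a right action `m` of `Q` on `X` that satisfy the Yetter-Drinfeld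
condition `p₍₁₎.(x.q₍₁₎) r(p₍₂₎, q₍₂₎) = r(p₍₁₎, q₍₁₎) (p₍₂₎.x).q₍₂₎`. -/
structure YDStructure (r : P ⊗ Q ⟶ 𝟙_ D) (X : D) where
  l : P ⊗ X ⟶ X
  m : X ⊗ Q ⟶ X
  one_l : η[P] ▷ X ≫ l = (λ_ X).hom
  mul_l : μ[P] ▷ X ≫ l = (α_ P P X).hom ≫ P ◁ l ≫ l
  one_m : X ◁ η[Q] ≫ m = (ρ_ X).hom
  mul_m : X ◁ μ[Q] ≫ m = (α_ X Q Q).inv ≫ m ▷ Q ≫ m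
  yd : (Δ[P] ⊗ₘ (X ◁ Δ[Q] ≫ (α_ X Q Q).inv ≫ m ▷ Q)) ≫ tensorμ P P X Q ≫ (l ⊗ₘ r) ≫ (ρ_ X).hom =
    (α_ P X Q).inv ≫ ((Δ[P] ▷ X ≫ (α_ P P X).hom ≫ P ◁ l) ⊗ₘ Δ[Q]) ≫ tensorμ P X Q Q ≫
      (r ⊗ₘ m) ≫ (λ_ X).hom

/-- Yetter-Drinfeld modules for `P`, `Q` and the pairing `r`. -/
structure YDMod (r : P ⊗ Q ⟶ 𝟙_ D) where
  X : D
  str : YDStructure r X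

namespace YDMod
variable {r : P ⊗ Q ⟶ 𝟙_ D}

/-- Morphisms that commute with both actions. -/
@[ext] structure Hom (M N : YDMod r) where
  hom : M.X ⟶ N.X
  l_comm : M.str.l ≫ hom = P ◁ hom ≫ N.str.l
  m_comm : M.str.m ≫ hom = hom ▷ Q ≫ N.str.m

instance : Category (YDMod r) where
  Hom := Hom
  id M := ⟨𝟙 _, by simp, by simp⟩
  comp f g := ⟨f.hom ≫ g.hom,
    by rw [← Category.assoc, f.l_comm, Category.assoc, g.l_comm, MonoidalCategory.whiskerLeft_comp, Category.assoc],
    by rw [← Category.assoc, f.m_comm, Category.assoc, g.m_comm, comp_whiskerRight, Category.assoc]⟩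

variable (r) in
/-- The forgetful functor. -/
def forget : YDMod r ⥤ D where
  obj M := M.X
  map f := Hom.hom f

variable (r) in
/-- Compatible Yetter-Drinfeld structures on the values of a functor `G` to `D`. -/
structure Lift {𝒜 : Type*} [Category 𝒜] (G : 𝒜 ⥤ D) where
  str : ∀ A, YDStructure r (G.obj A)
  l_map : ∀ {A B : 𝒜} (f : A ⟶ B), (str A).l ≫ G.map f = P ◁ G.map f ≫ (str B).l
  m_map : ∀ {A B : 𝒜} (f : A ⟶ B), (str A).m ≫ G.map f = G.map f ▷ Q ≫ (str B).m

/-- The functor to Yetter-Drinfeld modules given by a functor to `D` and compatible structures. -/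
def Lift.functor {𝒜 : Type*} [Category 𝒜] {G : 𝒜 ⥤ D} (F : Lift r G) : 𝒜 ⥤ YDMod r where
  obj A := ⟨G.obj A, F.str A⟩
  map f := ⟨G.map f, F.l_map f, F.m_map f⟩
  map_id A := Hom.ext (G.map_id A)
  map_comp f g := Hom.ext (G.map_comp f g)

/-- The diagonal left action on `M ⊗ N`. -/
def tensorL (M N : YDMod r) : P ⊗ (M.X ⊗ N.X) ⟶ M.X ⊗ N.X :=
  Δ[P] ▷ (M.X ⊗ N.X) ≫ tensorμ P P M.X N.X ≫ (M.str.l ⊗ₘ N.str.l)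

/-- The diagonal right action on `M ⊗ N`. -/
def tensorM (M N : YDMod r) : (M.X ⊗ N.X) ⊗ Q ⟶ M.X ⊗ N.X :=
  (M.X ⊗ N.X) ◁ Δ[Q] ≫ tensorμ M.X N.X Q Q ≫ (M.str.m ⊗ₘ N.str.m)

/-- The monoidal structure on Yetter-Drinfeld modules: the forgetful functor is monoidal, and
`P` and `Q` act on tensor products by the coproducts and on the unit by the counits. -/
structure IsTensor [MonoidalCategory (YDMod r)] [(forget r).Monoidal] : Prop where
  l_tensor : ∀ M N : YDMod r, P ◁ Functor.LaxMonoidal.μ (forget r) M N ≫ (M ⊗ N).str.l =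
    tensorL M N ≫ Functor.LaxMonoidal.μ (forget r) M N
  m_tensor : ∀ M N : YDMod r, Functor.LaxMonoidal.μ (forget r) M N ▷ Q ≫ (M ⊗ N).str.m =
    tensorM M N ≫ Functor.LaxMonoidal.μ (forget r) M N
  l_unit : P ◁ Functor.LaxMonoidal.ε (forget r) ≫ (𝟙_ (YDMod r)).str.l =
    (ρ_ P).hom ≫ ε[P] ≫ Functor.LaxMonoidal.ε (forget r)
  m_unit : Functor.LaxMonoidal.ε (forget r) ▷ Q ≫ (𝟙_ (YDMod r)).str.m =
    (λ_ Q).hom ≫ ε[Q] ≫ Functor.LaxMonoidal.ε (forget r)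

end YDMod
end Braided

/-! ### The objects `F^±` and the morphism `b` -/

/-- `F^+ = F^- = ℂ_ω ⊕ ℂ_{-ω}`. -/
def Fω (κ ω : ℂ) : DiagRep κ where
  V := ℂ × ℂ
  h := LinearMap.prodMap (ω • LinearMap.id) (-ω • LinearMap.id)
  diag := isDiag_of_forall fun P hP => top_le_iff.1 fun v _ => by
    have h1 : (v.1, (0 : ℂ)) ∈ P := hP ω _ (by simp)
    have h2 : ((0 : ℂ), v.2) ∈ P := hP (-ω) _ (by simp)
    have h3 := P.add_mem h1 h2
    simpa using h3

/-- `(a, b) ⊗ (c, d) ↦ ζ a d + ξ b c`. -/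
def bLin (ζ ξ : ℂ) : (ℂ × ℂ) ⊗[ℂ] (ℂ × ℂ) →ₗ[ℂ] ℂ :=
  TensorProduct.lift (LinearMap.mk₂ ℂ (fun p q : ℂ × ℂ => ζ * p.1 * q.2 + ξ * p.2 * q.1)
    (fun p p' q => by simp; ring) (fun a p q => by simp; ring) (fun p q q' => by simp; ring)
    (fun a p q => by simp; ring))

/-- The morphism `b_{ζ,ξ} : F^+ ⊗ F^- ⟶ 𝟙`. -/
def bMor (κ ω ζ ξ : ℂ) : Fω κ ω ⊗ Fω κ ω ⟶ 𝟙_ (DiagRep κ) :=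
  DiagRep.mk' (X := Fω κ ω ⊗ Fω κ ω) (Y := 𝟙_ (DiagRep κ)) (bLin ζ ξ) <|
    addEnd_comm (f := bLin ζ ξ) fun p q => by
      change _ = (0 : ℂ)
      simp [bLin, Fω]
      ring

/-! ### The functor -/

section Functor
variable {κ ω ħ ζ ξ : ℂ}

/-- The category of weakly continuous `Ũ_ħ(Lsl₂)`-modules on which `h` acts semisimply. -/
abbrev RepU (ħ : ℂ) : Type 1 := RepSS (Alg (Uq.rels ħ)) (Uq.h ħ 0)

/-- The category of weakly continuous `A_F`-modules on which `h` acts semisimply. -/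
abbrev RepA (ω : ℂ) : Type 1 := RepSS (Alg (AF.rels ω)) (AF.h ω)

/-- Pullback of modules along `ψ`. -/
def pullPsi {ψ : Alg (AF.rels ω) →ₐ[ℂ] Alg (Uq.rels ħ)} (hψ : Uq.IsPsi ħ ω ζ ξ ψ) :
    RepU ħ ⥤ RepA ω :=
  RepSS.pullback ψ hψ.cont (ω / 2) (hψ.map_h ())

variable (κ) in
/-- The object of `𝒞` underlying the pullback along `ψ`. -/
def under {ψ : Alg (AF.rels ω) →ₐ[ℂ] Alg (Uq.rels ħ)} (hψ : Uq.IsPsi ħ ω ζ ξ ψ) :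
    RepU ħ ⥤ DiagRep κ :=
  pullPsi hψ ⋙ RepSS.toDiag κ

/-- The monoidal structure on `Ũ_ħ(Lsl₂)`-modules: the functor to `𝒞` is monoidal, and the action
on tensor products is by the coproduct, on the unit by the counit. -/
structure IsRepTensor {ψ : Alg (AF.rels ω) →ₐ[ℂ] Alg (Uq.rels ħ)} (hψ : Uq.IsPsi ħ ω ζ ξ ψ)
    (Δ : Alg (Uq.rels ħ) →ₐ[ℂ] Alg₂ (Uq.rels ħ)) (ε : Alg (Uq.rels ħ) →ₐ[ℂ] ℂ)
    [MonoidalCategory (RepU ħ)] [(under κ hψ).Monoidal] : Prop where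
  act_tensor : ∀ V W : RepU ħ, ∃ ρ₂ : Alg₂ (Uq.rels ħ) →ₐ[ℂ] Module.End ℂ (V.V ⊗[ℂ] W.V),
    IsTensorRep V.act W.act ρ₂ ∧ ∀ (u : Alg (Uq.rels ħ)) (z : V.V ⊗[ℂ] W.V),
      (V ⊗ W).act u (DiagRep.lin (Functor.LaxMonoidal.μ (under κ hψ) V W) z) =
        DiagRep.lin (Functor.LaxMonoidal.μ (under κ hψ) V W) (ρ₂ (Δ u) z)
  act_unit : ∀ (u : Alg (Uq.rels ħ)) (z : ℂ),
    (𝟙_ (RepU ħ)).act u (DiagRep.lin (Functor.LaxMonoidal.ε (under κ hψ)) z) =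
      DiagRep.lin (Functor.LaxMonoidal.ε (under κ hψ)) (ε u * z)

/-- The Yetter-Drinfeld structure on (the pullback along `ψ` of) `V`: an element `(a, b)` of `F^+`
acts from the left as `a f⁺ + b f⁻`, and, after moving `F^-` to the left by the inverse braiding,
an element `(a, b)` of `F^-` acts as `a f̄⁺ + b f̄⁻`. -/
structure IsActionOf {Tp Tm : TensorBialgebra (Fω κ ω)} {r : Tp.T ⊗ Tm.T ⟶ 𝟙_ (DiagRep κ)}
    {ψ : Alg (AF.rels ω) →ₐ[ℂ] Alg (Uq.rels ħ)} (hψ : Uq.IsPsi ħ ω ζ ξ ψ) (V : RepU ħ)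
    (s : YDStructure r ((under κ hψ).obj V)) : Prop where
  left : ∀ (p : ℂ × ℂ) (v : V.V),
    DiagRep.lin (Tp.incl ▷ (under κ hψ).obj V ≫ s.l) (p ⊗ₜ[ℂ] v : (ℂ × ℂ) ⊗[ℂ] V.V) =
      ((pullPsi hψ).obj V).act (p.1 • AF.f ω .pos + p.2 • AF.f ω .neg) v
  right : ∀ (p : ℂ × ℂ) (v : V.V),
    DiagRep.lin ((β_ ((under κ hψ).obj V) (Fω κ ω)).inv ≫ (under κ hψ).obj V ◁ Tm.incl ≫ s.m)
        (p ⊗ₜ[ℂ] v : (ℂ × ℂ) ⊗[ℂ] V.V) =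
      ((pullPsi hψ).obj V).act (p.1 • AF.fbar ω .pos + p.2 • AF.fbar ω .neg) v

/-- The lift `F` of `G` to Yetter-Drinfeld modules is monoidal over `D`: the structure morphisms of
`F` are the identity on underlying objects. -/
structure IsMonoidalOver {𝒜 : Type*} [Category 𝒜] [MonoidalCategory 𝒜] {D : Type*} [Category D]
    [MonoidalCategory D] [BraidedCategory D] {P Q : D} [BimonObj P] [BimonObj Q]
    {r : P ⊗ Q ⟶ 𝟙_ D} [MonoidalCategory (YDMod r)] [(YDMod.forget r).Monoidal]
    (G : 𝒜 ⥤ D) [G.Monoidal] (F : YDMod.Lift r G) [F.functor.Monoidal] : Prop where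
  mu : ∀ V W : 𝒜, Functor.LaxMonoidal.μ (YDMod.forget r) (F.functor.obj V) (F.functor.obj W) ≫
      (YDMod.forget r).map (Functor.LaxMonoidal.μ F.functor V W) = Functor.LaxMonoidal.μ G V W
  eps : Functor.LaxMonoidal.ε (YDMod.forget r) ≫
      (YDMod.forget r).map (Functor.LaxMonoidal.ε F.functor) = Functor.LaxMonoidal.ε G

end Functor

end SinhGordon

/-!
The theorem combines an analytic part, which makes the topological algebras behave like algebras
given by generators and relations, with an algebraic part, which reduces all statements about
Yetter-Drinfeld modules to generators.

*Topological algebras.* Degree by degree, `𝓔(H; X)` is complete and the words span a dense subspace.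
A choice of images of the generators `h` in degree `0` and `x` in degree `1` therefore extends to a
continuous homomorphism, and on a presented algebra only the relations remain to be checked
(`Alg.exists_genHom`). Representations are different, as the vector space carries no topology: here
one uses that on a weight vector all words with `n` free letters take values in the
finite-dimensional span of the products of `n` free generators, and that their coefficients are at
most exponential in the length of the word, because the weights stay bounded
(`IsWeightData.exists_word`, `IsWeightData.exists_rep`). Such representations are determined by the
generators, so that tensor products, associativity and intertwiners can be compared on generators.
The coproduct of `Ũ_ħ` and `ψ` are then computations with `K_i = e^{ħ h_i}`, which commutes with the
`e_j^±` up to scalars (`Uq.Holds.comul`, `Uq.KHolds.psi`, `Uq.comul_psi`); for the `q`-Serre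
relation they rest on its additivity for `q`-commuting elements.

*The Hopf pairing.* Words in two letters form a basis of `T(F^±)`, so linear maps out of it can be
defined by recursion on left multiplication by generators. Duality of product and coproduct forces
left multiplication by a generator of `T(F⁺)` to be dual to a braided skew derivation `d` of
`T(F⁻)`. This recursion determines the pairing, and conversely the pairing defined by it is a Hopf
pairing (`TensorBialgebra.existsUnique_pairing`). The mirror image `d'` of `d` satisfies `(d ⊗ id) Δ
= (id ⊗ d') Δ`.

*Yetter-Drinfeld modules.* As `T(F^±)` are free, actions on `X` are the same as operators `A_s` and
`B_t` of the weights of the generators. Using `d` and `d'`, induction on words shows that the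
Yetter-Drinfeld condition holds if and only if it holds on generators, where it reads `A_s B_t - B_t
A_s = b(s, t) (K_s⁻¹ - K_s)` with `K_s = e^{± κ ω h}` (`TensorBialgebra.GenData`,
`TensorBialgebra.GenData.exists_str`, `TensorBialgebra.genData`).

*The functor.* With `h = ω h₀ / 2` and `ħ = -κ ω² / 2`, the operator `K_s` acts by `e^{-ħ h_i}`, and
the last relation is the relation for `[e_i^+, e_j^-]`, multiplied by `e^{-ħ h_j}` and by the
constants in the definition of `ψ` (`Uq.comm_psi`). This yields the functor, and its compatibility
with tensor products is again a comparison on generators. As `ζ`, `ξ`, `ω` and `e^ħ - e^{-ħ}` do not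
vanish and `K_s` is invertible, the operators `h₀` and `e_i^±` can be recovered from the
Yetter-Drinfeld module (`RepU.ydE_obj`). Hence the functor is full and injective on objects.
-/


namespace SinhGordon

/-! ### The norms on `𝓔₀` and on its completion -/

section Norms
variable {H X : Type}

theorem nrm_smul (r : NNReal) (c : ℂ) (f : E0 H X) :
    nrm r (c • f : E0 H X) ≤ ‖c‖ * nrm r f := by
  let g : MonoidAlgebra ℂ (Word H X) := f
  have h1 : nrm r (c • g) ≤ ‖c‖ * nrm r g := by
    rw [Algebra.smul_def, MonoidAlgebra.coe_algebraMap]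
    refine (nrm_mul_le r _ _).trans (le_of_eq ?_)
    rw [Function.comp_apply, nrm_single]
    simp [wt]
  exact h1

theorem nrm_mono {r s : NNReal} (hrs : r ≤ s) (f : MonoidAlgebra ℂ (Word H X)) :
    nrm r f ≤ nrm s f := by
  refine Finset.sum_le_sum fun w _ => mul_le_mul_of_nonneg_left ?_ (norm_nonneg _)
  exact pow_le_pow_left₀ r.2 hrs _

theorem nrm_word (r : NNReal) (w : Word H X) : nrm r (E0.word H X w) = wt r w := by
  change nrm r (MonoidAlgebra.single w 1) = _
  rw [nrm_single]
  simp

/-- The norm `‖·‖_r` as a complex seminorm. -/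
def E0.snorm (H X : Type) (r : NNReal) : Seminorm ℂ (E0 H X) :=
  Seminorm.ofSMulLE (fun f => nrm r f) (nrm_zero r) (nrm_add_le r) (nrm_smul r)

theorem E0.withSeminorms : WithSeminorms (E0.snorm H X) := by
  rw [SeminormFamily.withSeminorms_iff_uniformSpace_eq_iInf]
  rfl

theorem E0.uniformContinuous_nrm (r : NNReal) :
    UniformContinuous fun f : E0 H X => nrm r f :=
  Seminorm.uniformContinuous_of_continuousAt_zero (p := E0.snorm H X r)
    (E0.withSeminorms.continuous_seminorm r).continuousAt

/-- A neighbourhood of zero contains a ball of one of the norms. -/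
theorem E0.exists_ball {U : Set (E0 H X)} (hU : U ∈ nhds 0) :
    ∃ (r : NNReal) (ε : ℝ), 0 < ε ∧ ∀ f : E0 H X, nrm r f < ε → f ∈ U := by
  obtain ⟨s, ε, hε, h⟩ := (E0.withSeminorms.mem_nhds_iff 0 U).1 hU
  refine ⟨s.sup id, ε, hε, fun f hf => h ?_⟩
  rw [Seminorm.mem_ball_zero]
  refine lt_of_le_of_lt ?_ hf
  refine Seminorm.finset_sup_apply_le (nrm_nonneg _ _) fun r hr => ?_
  exact nrm_mono (Finset.le_sup (f := id) hr) f

/-- The linear map on `𝓔₀` with prescribed values on words. -/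
def E0.linLift {M : Type*} [AddCommGroup M] [Module ℂ M] (F : Word H X → M) : E0 H X →ₗ[ℂ] M where
  toFun f := MonoidAlgebra.coeff f |>.sum fun w c => c • F w
  map_add' f g := Finsupp.sum_add_index' (fun _ => zero_smul _ _) fun _ _ _ => add_smul _ _ _
  map_smul' c f := by
    let g : MonoidAlgebra ℂ (Word H X) := f
    have h1 : (c • g.coeff).sum (fun w c => c • F w) = c • g.coeff.sum fun w c => c • F w := by
      rw [Finsupp.sum_smul_index (by simp), Finsupp.smul_sum]
      simp only [mul_smul]
    exact h1

theorem E0.linLift_word {M : Type*} [AddCommGroup M] [Module ℂ M] (F : Word H X → M)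
    (w : Word H X) : E0.linLift F (E0.word H X w) = F w := by
  change (Finsupp.single w (1 : ℂ)).sum (fun w c => c • F w) = F w
  rw [Finsupp.sum_single_index (by simp), one_smul]

theorem E0.span_word : Submodule.span ℂ (Set.range (E0.word H X)) = ⊤ := by
  refine top_le_iff.1 fun f _ => ?_
  induction f using MonoidAlgebra.induction with
  | zero => exact zero_mem _
  | single_add w c f hw hc hf =>
    refine add_mem ?_ (hf trivial)
    have h1 : (MonoidAlgebra.single w c : MonoidAlgebra ℂ (Word H X)) = c • MonoidAlgebra.single w 1 := by
      simp
    rw [h1]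
    exact Submodule.smul_mem _ c (Submodule.subset_span ⟨w, rfl⟩)

theorem E0.lin_ext {M : Type*} [AddCommGroup M] [Module ℂ M] {u v : E0 H X →ₗ[ℂ] M}
    (h : ∀ w, u (E0.word H X w) = v (E0.word H X w)) : u = v :=
  LinearMap.ext_on_range E0.span_word h

/-- A seminorm bound on words extends to `𝓔₀`, because `‖·‖_r` is a weighted `ℓ¹`-norm. -/
theorem E0.linLift_bound {M : Type*} [AddCommGroup M] [Module ℂ M] (u : E0 H X →ₗ[ℂ] M)
    (p : Seminorm ℂ M) (r : NNReal) (C : ℝ)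
    (hF : ∀ w, p (u (E0.word H X w)) ≤ C * wt r w) (f : E0 H X) : p (u f) ≤ C * nrm r f := by
  have h1 : u = E0.linLift fun w => u (E0.word H X w) := E0.lin_ext fun w => by
    rw [E0.linLift_word]
  have h2 : u f = ∑ w ∈ (MonoidAlgebra.coeff f).support,
    MonoidAlgebra.coeff f w • u (E0.word H X w) := congrArg (fun L => L f) h1
  have h3 : nrm r f = ∑ w ∈ (MonoidAlgebra.coeff f).support, ‖MonoidAlgebra.coeff f w‖ * wt r w := rfl
  rw [h2, h3, Finset.mul_sum]
  refine (Finset.le_sum_of_subadditive p (map_zero p).le (map_add_le_add p) _ _).trans (Finset.sum_le_sum fun w _ => ?_)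
  rw [map_smul_eq_mul]
  calc _ ≤ ‖MonoidAlgebra.coeff f w‖ * (C * wt r w) :=
        mul_le_mul_of_nonneg_left (hF w) (norm_nonneg _)
    _ = _ := by ring

/-- The extension of `‖·‖_r` to the completion. -/
def hatNrm (r : NNReal) : EHat H X → ℝ := UniformSpace.Completion.extension fun f : E0 H X => nrm r f

theorem continuous_hatNrm (r : NNReal) : Continuous (hatNrm (H := H) (X := X) r) :=
  UniformSpace.Completion.continuous_extension

theorem hatNrm_coe (r : NNReal) (f : E0 H X) : hatNrm r (f : EHat H X) = nrm r f :=
  UniformSpace.Completion.extension_coe (E0.uniformContinuous_nrm r) f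

theorem hatNrm_add_le (r : NNReal) (a b : EHat H X) :
    hatNrm r (a + b) ≤ hatNrm r a + hatNrm r b := by
  have := continuous_hatNrm (H := H) (X := X) r
  induction a, b using UniformSpace.Completion.induction_on₂ with
  | hp => exact isClosed_le (by fun_prop) (by fun_prop)
  | ih a b =>
    rw [← UniformSpace.Completion.coe_add, hatNrm_coe, hatNrm_coe, hatNrm_coe]
    exact nrm_add_le r a b

theorem hatNrm_mul_le (r : NNReal) (a b : EHat H X) :
    hatNrm r (a * b) ≤ hatNrm r a * hatNrm r b := by
  have := continuous_hatNrm (H := H) (X := X) r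
  induction a, b using UniformSpace.Completion.induction_on₂ with
  | hp => exact isClosed_le (by fun_prop) (by fun_prop)
  | ih a b =>
    rw [← UniformSpace.Completion.coe_mul, hatNrm_coe, hatNrm_coe, hatNrm_coe]
    exact nrm_mul_le r a b

theorem hatNrm_nonneg (r : NNReal) (a : EHat H X) : 0 ≤ hatNrm r a := by
  have := continuous_hatNrm (H := H) (X := X) r
  induction a using UniformSpace.Completion.induction_on with
  | hp => exact isClosed_le (by fun_prop) (by fun_prop)
  | ih a =>
    rw [hatNrm_coe]
    exact nrm_nonneg r a

theorem EHat.coe_smul (c : ℂ) (f : E0 H X) : ((c • f : E0 H X) : EHat H X) = c • (f : EHat H X) :=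
  UniformSpace.Completion.coe_smul c f

theorem EHat.coe_zero : ((0 : E0 H X) : EHat H X) = 0 := UniformSpace.Completion.coe_zero

theorem hatNrm_zero (r : NNReal) : hatNrm r (0 : EHat H X) = 0 := by
  rw [← EHat.coe_zero, hatNrm_coe]
  exact nrm_zero r

theorem hatNrm_smul_le (r : NNReal) (c : ℂ) (a : EHat H X) :
    hatNrm r (c • a) ≤ ‖c‖ * hatNrm r a := by
  have h1 := continuous_hatNrm (H := H) (X := X) r
  induction a using UniformSpace.Completion.induction_on with
  | hp => exact isClosed_le (h1.comp (continuous_const_smul c)) (continuous_const.mul h1)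
  | ih a =>
    rw [← EHat.coe_smul, hatNrm_coe, hatNrm_coe]
    exact nrm_smul r c a

/-- `hatNrm r` as a complex seminorm. -/
def hatSeminorm (H X : Type) (r : NNReal) : Seminorm ℂ (EHat H X) :=
  Seminorm.ofSMulLE (hatNrm r) (hatNrm_zero r) (hatNrm_add_le r) (hatNrm_smul_le r)

theorem hatNrm_one (r : NNReal) : hatNrm r (1 : EHat H X) = 1 := by
  rw [← UniformSpace.Completion.coe_one, hatNrm_coe, ← map_one (E0.word H X), nrm_word]
  simp [wt]

/-- A neighbourhood of zero in the completion contains a ball of one of the norms. -/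
theorem EHat.exists_ball {U : Set (EHat H X)} (hU : U ∈ nhds 0) :
    ∃ (r : NNReal) (ε : ℝ), 0 < ε ∧ ∀ a : EHat H X, hatNrm r a < ε → a ∈ U := by
  obtain ⟨C, hC, hCc, hCU⟩ := exists_mem_nhds_isClosed_subset hU
  have h1 : (fun f : E0 H X => (f : EHat H X)) ⁻¹' C ∈ nhds 0 :=
    (UniformSpace.Completion.continuous_coe _).continuousAt.preimage_mem_nhds
      (by rw [EHat.coe_zero]; exact hC)
  obtain ⟨r, ε, hε, h⟩ := E0.exists_ball h1
  refine ⟨r, ε, hε, fun a ha => hCU ?_⟩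
  rw [← hCc.closure_eq]
  have hopen : IsOpen {b : EHat H X | hatNrm r b < ε} :=
    isOpen_lt (continuous_hatNrm r) continuous_const
  refine closure_mono ?_ (UniformSpace.Completion.denseRange_coe.open_subset_closure_inter hopen ha)
  rintro _ ⟨hb, f, rfl⟩
  exact h f (by simpa [hatNrm_coe] using hb)

/-- A linear map out of `𝓔₀` is continuous if each norm of the images of words is bounded by a
weight of the words, since `‖·‖_r` is the largest seminorm with given values on words. -/
theorem E0.continuous_toHat {H' X' : Type} (u : E0 H X →ₗ[ℂ] EHat H' X')
    (h : ∀ s, ∃ r, ∀ w, hatNrm s (u (E0.word H X w)) ≤ wt r w) : Continuous u := by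
  refine continuous_of_continuousAt_zero u ?_
  rw [ContinuousAt, map_zero]
  refine Filter.tendsto_def.2 fun U hU => ?_
  obtain ⟨s, ε, hε, hs⟩ := EHat.exists_ball hU
  obtain ⟨r, hr⟩ := h s
  have h1 : ∀ f, hatNrm s (u f) ≤ nrm r f := fun f => by
    have h2 := E0.linLift_bound u (hatSeminorm H' X' s) r 1 (fun w => by
      rw [one_mul]
      exact hr w) f
    rwa [one_mul] at h2
  have h2 : {f : E0 H X | nrm r f < ε} ∈ nhds 0 := by
    refine (isOpen_lt (E0.uniformContinuous_nrm r).continuous continuous_const).mem_nhds ?_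
    change nrm r 0 < ε
    exact (nrm_zero r).trans_lt hε
  exact Filter.mem_of_superset h2 fun f hf => hs _ ((h1 f).trans_lt hf)

end Norms

/-! ### Words and the topology of `𝓔(H; X)` -/

section Words
variable {H X : Type}

/-- The word consisting of one commuting letter. -/
def Word.h (i : H) : Word H X := Monoid.Coprod.inl (Multiplicative.ofAdd (Finsupp.single i 1))

/-- The word consisting of one free letter. -/
def Word.x (j : X) : Word H X := Monoid.Coprod.inr (FreeMonoid.of j)

/-- Induction on words, with the generators and products as steps. -/
@[elab_as_elim]
theorem Word.ind {p : Word H X → Prop} (w : Word H X) (one : p 1) (h : ∀ i, p (Word.h i))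
    (x : ∀ j, p (Word.x j)) (mul : ∀ u v, p u → p v → p (u * v)) : p w := by
  induction w using Monoid.Coprod.induction_on with
  | inl m =>
    have h1 : ∀ m : H →₀ ℕ, p (Monoid.Coprod.inl (Multiplicative.ofAdd m)) := fun m => by
      induction m using Finsupp.induction_linear with
      | zero => simpa using one
      | add f g hf hg => simpa [ofAdd_add] using mul _ _ hf hg
      | single i k =>
        induction k with
        | zero => simpa using one
        | succ k ih => simpa [Finsupp.single_add, ofAdd_add, Word.h] using mul _ _ ih (h i)
    exact h1 m.toAdd
  | inr m =>
    induction m using FreeMonoid.inductionOn' with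
    | one => simpa using one
    | of_mul j m ih => simpa [Word.x] using mul _ _ (x j) ih
  | mul u v hu hv => exact mul u v hu hv

theorem Word.deg_h (i : H) : Word.deg H X (Word.h i) = Multiplicative.ofAdd 1 := by
  simp [Word.deg, Word.h]
theorem Word.deg_x (i : X) : Word.deg H X (Word.x i) = Multiplicative.ofAdd 1 := by
  simp [Word.deg, Word.x]
theorem Word.xdeg_h (i : H) : Word.xdeg H X (Word.h i) = 1 := by
  simp [Word.xdeg, Word.h]
theorem Word.xdeg_x (i : X) : Word.xdeg H X (Word.x i) = Multiplicative.ofAdd 1 := by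
  simp [Word.xdeg, Word.x]

theorem wt_one (r : NNReal) : wt r (1 : Word H X) = 1 := by simp [wt]
theorem wt_h (r : NNReal) (i : H) : wt r (Word.h i : Word H X) = r := by
  simp [wt, Word.deg_h]
theorem wt_x (r : NNReal) (i : X) : wt r (Word.x i : Word H X) = r := by
  simp [wt, Word.deg_x]

/-- The homomorphism from the free commutative monoid given by commuting elements. -/
def commHom {M : Type*} [Monoid M] (a : H → M) (ha : ∀ i j, a i * a j = a j * a i) :
    Multiplicative (H →₀ ℕ) →* M :=
  haveI : IsMulCommutative (Submonoid.closure (Set.range a)) :=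
    Submonoid.isMulCommutative_closure M (by rintro _ ⟨i, rfl⟩ _ ⟨j, rfl⟩; exact ha i j)
  letI : CommMonoid (Submonoid.closure (Set.range a)) := { mul_comm := mul_comm' }
  (Submonoid.closure (Set.range a)).subtype.comp
    { toFun := fun m => m.toAdd.prod fun i k =>
        (⟨a i, Submonoid.subset_closure ⟨i, rfl⟩⟩ : Submonoid.closure (Set.range a)) ^ k
      map_one' := by simp
      map_mul' := fun m n => by
        rw [toAdd_mul, Finsupp.prod_add_index' (by simp) (by simp [pow_add])] }

theorem commHom_single {M : Type*} [Monoid M] (a : H → M) (ha : ∀ i j, a i * a j = a j * a i)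
    (i : H) : commHom a ha (Multiplicative.ofAdd (Finsupp.single i 1)) = a i := by
  simp [commHom]

/-- The homomorphism from words given by commuting elements and further elements. -/
def wordHom {M : Type*} [Monoid M] (a : H → M) (ha : ∀ i j, a i * a j = a j * a i) (y : X → M) :
    Word H X →* M :=
  Monoid.Coprod.lift (commHom a ha) (FreeMonoid.lift y)

variable {M : Type*} [Monoid M] (a : H → M) (ha : ∀ i j, a i * a j = a j * a i) (y : X → M)

theorem wordHom_h (i : H) : wordHom a ha y (Word.h i) = a i := by
  simp [wordHom, Word.h, commHom_single]

theorem wordHom_x (j : X) : wordHom a ha y (Word.x j) = y j := by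
  simp [wordHom, Word.x]

end Words

section E
variable {H X : Type}

theorem En.mul_mem {m n : ℕ} {a b : EHat H X} (ha : a ∈ En H X m) (hb : b ∈ En H X n) :
    a * b ∈ En H X (m + n) := SetLike.GradedMul.mul_mem ha hb

theorem En.isClosed (n : ℕ) : IsClosed (En H X n : Set (EHat H X)) := isClosed_closure

theorem En.word_mem {n : ℕ} {w : Word H X} (hw : Word.xdeg H X w = Multiplicative.ofAdd n) :
    ((E0.word H X w : E0 H X) : EHat H X) ∈ En H X n := by
  have := E.word_mem w
  rwa [hw] at this

/-- The span of the words with `n` free letters is dense in `𝓔⁽ⁿ⁾`. -/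
theorem En.eq_top_of_isClosed {n : ℕ} (N : Submodule ℂ (En H X n))
    (hc : IsClosed (N : Set (En H X n)))
    (hw : ∀ (w : Word H X) (hw : Word.xdeg H X w = Multiplicative.ofAdd n),
      (⟨(E0.word H X w : E0 H X), En.word_mem hw⟩ : En H X n) ∈ N) : N = ⊤ := by
  have h1 : (En H X n : Set (EHat H X)) ⊆ N.map (En H X n).subtype := by
    refine closure_minimal ?_ ?_
    · rintro _ ⟨f, hf, rfl⟩
      beta_reduce
      induction hf using Submodule.span_induction with
      | mem f hf =>
        obtain ⟨w, hw', rfl⟩ := hf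
        exact ⟨_, hw w hw', rfl⟩
      | zero => rw [EHat.coe_zero]; exact zero_mem _
      | add f g _ _ hf hg =>
        rw [UniformSpace.Completion.coe_add]
        exact add_mem hf hg
      | smul c f _ hf =>
        rw [EHat.coe_smul]
        exact Submodule.smul_mem _ c hf
    · rw [Submodule.map_coe]
      exact (En.isClosed n).isClosedEmbedding_subtypeVal.isClosedMap _ hc
  refine top_le_iff.1 fun a _ => ?_
  obtain ⟨b, hb, hba⟩ := h1 a.2
  rwa [show b = a from Subtype.ext hba] at hb

/-- Continuous linear maps on `𝓔⁽ⁿ⁾` are determined by their values on words. -/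
theorem En.lin_ext {n : ℕ} {M : Type*} [AddCommGroup M] [Module ℂ M] [TopologicalSpace M]
    [T2Space M] {u v : En H X n →ₗ[ℂ] M} (hu : Continuous u) (hv : Continuous v)
    (hw : ∀ (w : Word H X) (hw : Word.xdeg H X w = Multiplicative.ofAdd n),
      u ⟨(E0.word H X w : E0 H X), En.word_mem hw⟩ = v ⟨(E0.word H X w : E0 H X), En.word_mem hw⟩) :
    u = v :=
  LinearMap.eqLocus_eq_top.1 (En.eq_top_of_isClosed (LinearMap.eqLocus u v)
    (isClosed_eq hu hv) hw)

theorem E.word_one : E.word (1 : Word H X) = 1 := by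
  refine DirectSum.of_eq_of_gradedMonoid_eq (A := fun n => En H X n) ?_
  refine Sigma.subtype_ext (by simp; rfl) ?_
  change ((E0.word H X 1 : E0 H X) : EHat H X) = 1
  rw [map_one, UniformSpace.Completion.coe_one]

theorem E.word_mul (w w' : Word H X) : E.word (w * w') = E.word w * E.word w' := by
  refine Eq.trans ?_ (DirectSum.of_mul_of (A := fun n => En H X n) _ _).symm
  refine DirectSum.of_eq_of_gradedMonoid_eq (A := fun n => En H X n) ?_
  refine Sigma.subtype_ext (congrArg Multiplicative.toAdd (map_mul (Word.xdeg H X) w w')) ?_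
  change ((E0.word H X (w * w') : E0 H X) : EHat H X) =
    ((E0.word H X w : E0 H X) : EHat H X) * ((E0.word H X w' : E0 H X) : EHat H X)
  rw [map_mul, UniformSpace.Completion.coe_mul]

theorem E.incl_mul {m n : ℕ} (a : En H X m) (b : En H X n) :
    E.incl H X m a * E.incl H X n b = E.incl H X (m + n) ⟨a * b, En.mul_mem a.2 b.2⟩ :=
  DirectSum.of_mul_of (A := fun n => En H X n) _ _

theorem E.incl_one : E.incl H X 0 ⟨1, SetLike.GradedOne.one_mem⟩ = 1 := rfl

theorem E.word_eq_incl {n : ℕ} {w : Word H X} (hw : Word.xdeg H X w = Multiplicative.ofAdd n) :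
    E.word w = E.incl H X n ⟨(E0.word H X w : E0 H X), En.word_mem hw⟩ := by
  obtain rfl : (Word.xdeg H X w).toAdd = n := by rw [hw]; rfl
  rfl

theorem E.withSeminorms : WithSeminorms (E.seminorms H X) := ⟨rfl⟩

instance : IsTopologicalAddGroup (E H X) := E.withSeminorms.topologicalAddGroup
instance : ContinuousSMul ℂ (E H X) := E.withSeminorms.continuousSMul

/-- A linear map out of `𝓔` to a space with a topology given by seminorms is continuous if its
restrictions to the summands are. -/
theorem E.continuous_of_seminorms {M ι : Type*} [AddCommGroup M] [Module ℂ M] [TopologicalSpace M]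
    {q : SeminormFamily ℂ M ι} (hq : WithSeminorms q) (u : E H X →ₗ[ℂ] M)
    (hu : ∀ n i, Continuous fun a : En H X n => q i (u (E.incl H X n a))) : Continuous u := by
  refine hq.continuous_of_continuous_comp u fun i => ?_
  exact E.withSeminorms.continuous_seminorm ⟨(q i).comp u, fun n => hu n i⟩

theorem E.continuous_incl (n : ℕ) : Continuous (E.incl H X n) :=
  E.withSeminorms.continuous_of_continuous_comp _ fun p => p.2 n

theorem E.continuous_to_E {H' X' : Type} (u : E H X →ₗ[ℂ] E H' X')
    (hu : ∀ n, Continuous fun a : En H X n => u (E.incl H X n a)) : Continuous u :=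
  E.continuous_of_seminorms E.withSeminorms u fun n i =>
    (E.withSeminorms.continuous_seminorm i).comp (hu n)

theorem E.continuous_functional (u : E H X →ₗ[ℂ] ℂ)
    (hu : ∀ n, Continuous fun a : En H X n => u (E.incl H X n a)) : Continuous u :=
  E.continuous_of_seminorms (norm_withSeminorms ℂ ℂ) u fun n _ => (hu n).norm

/-- Additive induction on `𝓔`. -/
theorem E.ind {p : E H X → Prop} (a : E H X) (zero : p 0) (incl : ∀ n a, p (E.incl H X n a))
    (add : ∀ a b, p a → p b → p (a + b)) : p a :=
  DirectSum.induction_on (motive := p) a zero incl add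

/-- Multiplication by a fixed element is continuous. The multiplication of `𝓔` is not claimed to
be jointly continuous. -/
theorem E.continuous_mul_left (b : E H X) : Continuous fun a => a * b := by
  refine E.continuous_to_E (LinearMap.mulRight ℂ b) fun n => ?_
  induction b using E.ind with
  | zero => simpa using continuous_const
  | add b c hb hc => simpa [mul_add] using! hb.add hc
  | incl m b =>
    simp only [LinearMap.mulRight_apply, E.incl_mul]
    refine (E.continuous_incl _).comp (Continuous.subtype_mk ?_ _)
    exact continuous_subtype_val.mul continuous_const

theorem E.continuous_mul_right (b : E H X) : Continuous fun a => b * a := by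
  refine E.continuous_to_E (LinearMap.mulLeft ℂ b) fun n => ?_
  induction b using E.ind with
  | zero => simpa using continuous_const
  | add b c hb hc => simpa [add_mul] using! hb.add hc
  | incl m b =>
    simp only [LinearMap.mulLeft_apply, E.incl_mul]
    refine (E.continuous_incl _).comp (Continuous.subtype_mk ?_ _)
    exact continuous_const.mul continuous_subtype_val

/-- The generators generate `𝓔` topologically. -/
theorem E.subalgebra_eq_top (A : Subalgebra ℂ (E H X)) (hA : IsClosed (A : Set (E H X)))
    (hh : ∀ i, E.h i ∈ A) (hx : ∀ j, E.x j ∈ A) : A = ⊤ := by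
  have hw : ∀ w : Word H X, E.word w ∈ A := fun w => by
    induction w using Word.ind with
    | one => rw [E.word_one]; exact one_mem A
    | h i => exact hh i
    | x j => exact hx j
    | mul u v hu hv => rw [E.word_mul]; exact mul_mem hu hv
  refine top_le_iff.1 fun a _ => ?_
  induction a using E.ind with
  | zero => exact zero_mem A
  | add a b ha hb => exact add_mem (ha trivial) (hb trivial)
  | incl n a =>
    have h1 : (Subalgebra.toSubmodule A).comap (E.incl H X n) = ⊤ :=
      En.eq_top_of_isClosed _ (hA.preimage (E.continuous_incl n)) fun w hw' => by
        rw [Submodule.mem_comap, ← E.word_eq_incl hw']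
        exact hw w
    exact (h1 ▸ Submodule.mem_top : a ∈ (Subalgebra.toSubmodule A).comap (E.incl H X n))

end E

/-! ### Exponentials in `𝓔(H; X)` -/

section Exp
variable {H X : Type}

/-- Series that converge absolutely in all norms converge in the completion. -/
theorem EHat.summable {ι : Type*} (g : ι → EHat H X)
    (h : ∀ r, Summable fun i => hatNrm r (g i)) : Summable g := by
  rw [summable_iff_vanishing]
  intro U hU
  obtain ⟨r, ε, hε, hr⟩ := EHat.exists_ball hU
  obtain ⟨s, hs⟩ := summable_iff_vanishing_norm.1 (h r) ε hε
  refine ⟨s, fun t ht => hr _ ?_⟩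
  refine lt_of_le_of_lt ?_ (hs t ht)
  refine le_trans ?_ (le_abs_self _)
  exact Finset.le_sum_of_subadditive (hatNrm r) (hatNrm_zero r).le (hatNrm_add_le r) _ _

theorem hatNrm_pow_le (r : NNReal) (a : EHat H X) (n : ℕ) : hatNrm r (a ^ n) ≤ hatNrm r a ^ n := by
  induction n with
  | zero => simp [hatNrm_one]
  | succ n ih =>
    rw [pow_succ, pow_succ]
    exact (hatNrm_mul_le r _ _).trans (mul_le_mul_of_nonneg_right ih (hatNrm_nonneg r a))

theorem hatNrm_exp_term_le (r : NNReal) (a : EHat H X) (n : ℕ) :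
    hatNrm r (((n.factorial : ℂ)⁻¹) • a ^ n) ≤ hatNrm r a ^ n / n.factorial := by
  refine (hatNrm_smul_le r _ _).trans ?_
  rw [norm_inv, Complex.norm_natCast, inv_mul_eq_div]
  exact div_le_div_of_nonneg_right (hatNrm_pow_le r a n) (Nat.cast_nonneg _)

theorem EHat.summable_exp (a : EHat H X) :
    Summable fun n : ℕ => ((n.factorial : ℂ)⁻¹) • a ^ n :=
  EHat.summable _ fun r => Summable.of_nonneg_of_le (fun _ => hatNrm_nonneg r _)
    (hatNrm_exp_term_le r a) (Real.summable_pow_div_factorial _)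

/-- The functional equation of the exponential, from the Cauchy product of two absolutely convergent
series. -/
theorem EHat.texp_add {a b : EHat H X} (hab : Commute a b) : texp (a + b) = texp a * texp b := by
  have h1 : Summable fun z : ℕ × ℕ =>
      (((z.1.factorial : ℂ)⁻¹) • a ^ z.1) * (((z.2.factorial : ℂ)⁻¹) • b ^ z.2) := by
    refine EHat.summable _ fun r => ?_
    refine Summable.of_nonneg_of_le (fun _ => hatNrm_nonneg r _) (fun z => ?_)
      ((Real.summable_pow_div_factorial (hatNrm r a)).mul_of_nonneg
        (Real.summable_pow_div_factorial (hatNrm r b))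
        (fun n => div_nonneg (pow_nonneg (hatNrm_nonneg r a) n) (Nat.cast_nonneg _))
        (fun n => div_nonneg (pow_nonneg (hatNrm_nonneg r b) n) (Nat.cast_nonneg _)))
    refine (hatNrm_mul_le r _ _).trans ?_
    exact mul_le_mul (hatNrm_exp_term_le r a _) (hatNrm_exp_term_le r b _) (hatNrm_nonneg r _)
      (div_nonneg (pow_nonneg (hatNrm_nonneg r a) _) (Nat.cast_nonneg _))
  rw [texp, texp, texp, (EHat.summable_exp a).tsum_mul_tsum_eq_tsum_sum_antidiagonal
    (EHat.summable_exp b) h1]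
  refine tsum_congr fun n => ?_
  rw [hab.add_pow', Finset.smul_sum]
  refine Finset.sum_congr rfl fun z hz => ?_
  obtain rfl := Finset.HasAntidiagonal.mem_antidiagonal.1 hz
  rw [← Nat.cast_smul_eq_nsmul ℂ, smul_smul, smul_mul_smul_comm]
  congr 1
  have h2 : (((z.1 + z.2).choose z.1 : ℕ) : ℂ) * z.1.factorial * z.2.factorial =
      (z.1 + z.2).factorial := by
    rw [Nat.choose_symm_add]
    exact_mod_cast Nat.add_choose_mul_factorial_mul_factorial z.1 z.2
  have h3 : ((z.1.factorial : ℕ) : ℂ) ≠ 0 := by exact_mod_cast z.1.factorial_ne_zero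
  have h4 : ((z.2.factorial : ℕ) : ℂ) ≠ 0 := by exact_mod_cast z.2.factorial_ne_zero
  have h5 : (((z.1 + z.2).factorial : ℕ) : ℂ) ≠ 0 := by exact_mod_cast (Nat.factorial_ne_zero _)
  field_simp
  linear_combination h2

theorem hatNrm_eq_zero {a : EHat H X} (h : ∀ r, hatNrm r a = 0) : a = 0 := by
  by_contra ha
  have h1 : ({a}ᶜ : Set (EHat H X)) ∈ nhds 0 := isOpen_compl_singleton.mem_nhds (Ne.symm ha)
  obtain ⟨r, ε, hε, hr⟩ := EHat.exists_ball h1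
  exact hr a (by rw [h r]; exact hε) rfl

/-- The projection to a summand. -/
def E.comp (H X : Type) (n : ℕ) : E H X →ₗ[ℂ] En H X n :=
  DirectSum.component ℂ ℕ (fun n => En H X n) n

theorem E.comp_incl_self (n : ℕ) (a : En H X n) : E.comp H X n (E.incl H X n a) = a :=
  DirectSum.component.lof_self ℂ (M := fun n => En H X n) n a

theorem E.comp_incl_ne {m n : ℕ} (h : m ≠ n) (a : En H X m) : E.comp H X n (E.incl H X m a) = 0 :=
  (DirectSum.component.of ℂ (M := fun n => En H X n) n m a).trans (dif_neg h)

theorem E.incl_injective (n : ℕ) : Function.Injective (E.incl H X n) :=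
  Function.LeftInverse.injective (E.comp_incl_self n)

instance : T2Space (E H X) := by
  have h1 : T1Space (E H X) := E.withSeminorms.T1_of_separating fun a ha => by
    by_contra! hp
    refine ha (DirectSum.ext_component ℂ fun n => Subtype.ext (hatNrm_eq_zero fun r => ?_))
    refine hp ⟨((hatSeminorm H X r).comp (En H X n).subtype).comp (E.comp H X n), fun m => ?_⟩
    by_cases hmn : m = n
    · subst hmn
      refine ((continuous_hatNrm r).comp continuous_subtype_val).congr fun b => ?_
      change _ = hatNrm r (E.comp H X m (E.incl H X m b) : EHat H X)
      rw [E.comp_incl_self]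
      rfl
    · refine (continuous_const (y := (0 : ℝ))).congr fun b => ?_
      change _ = hatNrm r (E.comp H X n (E.incl H X m b) : EHat H X)
      rw [E.comp_incl_ne hmn]
      exact (hatNrm_zero r).symm
  infer_instance

theorem En.pow_mem {a : EHat H X} (ha : a ∈ En H X 0) (n : ℕ) : a ^ n ∈ En H X 0 := by
  have h1 := SetLike.pow_mem_graded n ha
  rwa [smul_zero] at h1

theorem E.incl_pow (a : En H X 0) (n : ℕ) :
    E.incl H X 0 a ^ n = E.incl H X 0 ⟨(a : EHat H X) ^ n, En.pow_mem a.2 n⟩ := by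
  induction n with
  | zero => simp only [pow_zero]; rfl
  | succ n ih => simp only [pow_succ]; rw [ih, E.incl_mul]

theorem En.hasSum_mem {ι : Type*} {n : ℕ} {f : ι → EHat H X} {a : EHat H X} (hf : ∀ i, f i ∈ En H X n)
    (h : HasSum f a) : a ∈ En H X n :=
  (En.isClosed n).mem_of_tendsto h (Filter.Eventually.of_forall fun _ => sum_mem fun i _ => hf i)

theorem En.texp_mem {a : EHat H X} (ha : a ∈ En H X 0) : texp a ∈ En H X 0 :=
  En.hasSum_mem (fun n => Submodule.smul_mem _ _ (En.pow_mem ha n)) (EHat.summable_exp a).hasSum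

theorem E.hasSum_exp_incl (a : En H X 0) :
    HasSum (fun n : ℕ => ((n.factorial : ℂ)⁻¹) • E.incl H X 0 a ^ n)
      (E.incl H X 0 ⟨texp (a : EHat H X), En.texp_mem a.2⟩) := by
  have h1 : HasSum (fun n : ℕ => (⟨((n.factorial : ℂ)⁻¹) • (a : EHat H X) ^ n,
      Submodule.smul_mem _ _ (En.pow_mem a.2 n)⟩ : En H X 0))
      ⟨texp (a : EHat H X), En.texp_mem a.2⟩ :=
    Topology.IsInducing.subtypeVal.hasSum_iff (g := (En H X 0).subtype) _ _ |>.1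
      (EHat.summable_exp (a : EHat H X)).hasSum
  have h2 := h1.map (E.incl H X 0) (E.continuous_incl 0)
  refine (congrArg (HasSum · _) (funext fun n => ?_)).mp h2
  rw [E.incl_pow, ← map_smul]
  rfl

theorem E.texp_incl (a : En H X 0) :
    texp (E.incl H X 0 a) = E.incl H X 0 ⟨texp (a : EHat H X), En.texp_mem a.2⟩ :=
  (E.hasSum_exp_incl a).tsum_eq

/-- The span of `1` and the commuting generators of `𝓔`. -/
def E.hspan (H X : Type) : Submodule ℂ (E H X) := Submodule.span ℂ (insert 1 (Set.range E.h))

/-- Elements of `hspan` have degree zero, so that their exponentials can be computed in the Fréchet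
algebra `𝓔⁽⁰⁾`. -/
theorem E.hspan_le : E.hspan H X ≤ LinearMap.range (E.incl H X 0) := by
  refine Submodule.span_le.2 ?_
  rintro _ (rfl | ⟨i, rfl⟩)
  · exact ⟨_, E.incl_one⟩
  exact ⟨_, (E.word_eq_incl (w := Word.h i) (n := 0) (Word.xdeg_h i)).symm⟩

theorem E.h_comm (i j : H) : (E.h i : E H X) * E.h j = E.h j * E.h i := by
  have h1 : ∀ i : H, (E.h i : E H X) = E.word (Word.h i) := fun _ => rfl
  rw [h1, h1, ← E.word_mul, ← E.word_mul]
  simp only [Word.h, ← map_mul, mul_comm]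

theorem E.hspan_commute {a b : E H X} (ha : a ∈ E.hspan H X) (hb : b ∈ E.hspan H X) :
    Commute a b := by
  induction ha, hb using Submodule.span_induction₂ with
  | mem_mem a b ha hb =>
    obtain rfl | ⟨i, rfl⟩ := ha
    · exact Commute.one_left b
    obtain rfl | ⟨j, rfl⟩ := hb
    · exact Commute.one_right _
    exact E.h_comm i j
  | zero_left => exact Commute.zero_left _
  | zero_right => exact Commute.zero_right _
  | add_left _ _ _ _ _ _ h h' => exact h.add_left h'
  | add_right _ _ _ _ _ _ h h' => exact h.add_right h'
  | smul_left c _ _ _ _ h => exact h.smul_left c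
  | smul_right c _ _ _ _ h => exact h.smul_right c

theorem E.hasSum_texp {a : E H X} (ha : a ∈ E.hspan H X) :
    HasSum (fun n : ℕ => ((n.factorial : ℂ)⁻¹) • a ^ n) (texp a) := by
  obtain ⟨b, rfl⟩ := E.hspan_le ha
  rw [E.texp_incl]
  exact E.hasSum_exp_incl b

theorem E.texp_mem {a : E H X} (ha : a ∈ E.hspan H X) :
    texp a ∈ LinearMap.range (E.incl H X 0) := by
  obtain ⟨b, rfl⟩ := E.hspan_le ha
  rw [E.texp_incl]
  exact ⟨_, rfl⟩

theorem E.texp_add {a b : E H X} (ha : a ∈ E.hspan H X) (hb : b ∈ E.hspan H X) :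
    texp (a + b) = texp a * texp b := by
  have hab := E.hspan_commute ha hb
  obtain ⟨a, rfl⟩ := E.hspan_le ha
  obtain ⟨b, rfl⟩ := E.hspan_le hb
  have h1 : Commute (a : EHat H X) b := by
    have h2 := hab.eq
    rw [E.incl_mul, E.incl_mul] at h2
    exact congrArg Subtype.val (E.incl_injective _ h2)
  rw [← map_add, E.texp_incl, E.texp_incl, E.texp_incl, E.incl_mul]
  refine congrArg _ (Subtype.ext ?_)
  exact EHat.texp_add h1

end Exp

theorem texp_zero {B : Type} [Ring B] [Algebra ℂ B] [TopologicalSpace B] : texp (0 : B) = 1 := by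
  rw [texp, tsum_eq_single 0 (fun n hn => by simp [hn])]
  simp

theorem texp_smul_one {B : Type} [Ring B] [Algebra ℂ B] [TopologicalSpace B] [T2Space B]
    [ContinuousSMul ℂ B] (c : ℂ) : texp (c • (1 : B)) = Complex.exp c • 1 := by
  have h1 : HasSum (fun n : ℕ => c ^ n / n.factorial) (Complex.exp c) := by
    rw [Complex.exp_eq_exp_ℂ]
    exact NormedSpace.expSeries_div_hasSum_exp c
  have h2 := h1.map (LinearMap.toSpanSingleton ℂ B 1) (continuous_id.smul continuous_const)
  refine Eq.trans (tsum_congr fun n => ?_) h2.tsum_eq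
  simp [smul_pow, smul_smul, div_eq_inv_mul]

/-- A continuous homomorphism commutes with convergent exponential series. -/
theorem hasSum_texp_map {B C : Type} [Ring B] [Algebra ℂ B] [TopologicalSpace B] [Ring C]
    [Algebra ℂ C] [TopologicalSpace C] (φ : B →ₐ[ℂ] C) (hφ : Continuous φ) {a : B}
    (ha : HasSum (fun n : ℕ => ((n.factorial : ℂ)⁻¹) • a ^ n) (texp a)) :
    HasSum (fun n : ℕ => ((n.factorial : ℂ)⁻¹) • φ a ^ n) (φ (texp a)) := by
  have h1 := ha.map φ hφ
  refine (congrArg (HasSum · _) (funext fun n => ?_)).mp h1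
  simp


/-! ### Homomorphisms between the algebras `𝓔(H; X)` -/

section Hom
variable {H X H' X' : Type}

/-- A homomorphism on words is bounded by the weight `r^{|w|}`, where `r` dominates the norms of the
finitely many images of generators. -/
theorem wordHom_hatNrm_le [Finite H] [Finite X] (a : H → EHat H' X')
    (ha : ∀ i j, a i * a j = a j * a i) (y : X → EHat H' X') (s : NNReal) :
    ∃ r : NNReal, ∀ w, hatNrm s (wordHom a ha y w) ≤ wt r w := by
  cases nonempty_fintype H
  cases nonempty_fintype X
  obtain ⟨r, hr⟩ : ∃ r : NNReal, (r : ℝ) = ∑ i, hatNrm s (a i) + ∑ j, hatNrm s (y j) :=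
    ⟨⟨_, add_nonneg (Finset.sum_nonneg fun i _ => hatNrm_nonneg s _)
      (Finset.sum_nonneg fun i _ => hatNrm_nonneg s _)⟩, rfl⟩
  refine ⟨r, fun w => ?_⟩
  induction w using Word.ind with
  | one => rw [map_one, wt_one, hatNrm_one]
  | h i =>
    rw [wordHom_h, wt_h, hr]
    exact le_add_of_le_of_nonneg
      (Finset.single_le_sum (f := fun i => hatNrm s (a i)) (fun i _ => hatNrm_nonneg s _)
        (Finset.mem_univ i)) (Finset.sum_nonneg fun i _ => hatNrm_nonneg s _)
  | x i =>
    rw [wordHom_x, wt_x, hr]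
    exact le_add_of_nonneg_of_le (Finset.sum_nonneg fun i _ => hatNrm_nonneg s _)
      (Finset.single_le_sum (f := fun i => hatNrm s (y i)) (fun i _ => hatNrm_nonneg s _)
        (Finset.mem_univ i))
  | mul u v hu hv =>
    rw [map_mul, wt_mul]
    exact (hatNrm_mul_le s _ _).trans (mul_le_mul hu hv (hatNrm_nonneg s _) (wt_nonneg _ _))

theorem wordHom_mem_En (a : H → EHat H' X') (ha : ∀ i j, a i * a j = a j * a i)
    (y : X → EHat H' X') (ha0 : ∀ i, a i ∈ En H' X' 0) (hy : ∀ j, y j ∈ En H' X' 1)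
    (w : Word H X) : wordHom a ha y w ∈ En H' X' (Word.xdeg H X w).toAdd := by
  induction w using Word.ind with
  | one => simpa using (En.pow_mem (zero_mem (En H' X' 0)) 0)
  | h i => rw [wordHom_h, Word.xdeg_h]; exact ha0 i
  | x j => rw [wordHom_x, Word.xdeg_x]; exact hy j
  | mul u v hu hv => rw [map_mul, MonoidHom.map_mul, toAdd_mul]; exact En.mul_mem hu hv

/-- The homomorphism of completions with given values on the generators. -/
theorem EHat.exists_hom [Finite H] [Finite X] (a : H → EHat H' X')
    (ha : ∀ i j, a i * a j = a j * a i) (y : X → EHat H' X') :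
    ∃ Φ : EHat H X →ₐ[ℂ] EHat H' X', Continuous Φ ∧
      ∀ w, Φ (E0.word H X w : E0 H X) = wordHom a ha y w := by
  let φ : E0 H X →ₐ[ℂ] EHat H' X' := MonoidAlgebra.lift ℂ (EHat H' X') (Word H X) (wordHom a ha y)
  have h1 : ∀ w, φ (E0.word H X w) = wordHom a ha y w := fun w => MonoidAlgebra.lift_of _ _
  have h2 : Continuous φ := E0.continuous_toHat φ.toLinearMap fun s => by
    obtain ⟨r, hr⟩ := wordHom_hatNrm_le a ha y s
    exact ⟨r, fun w => by rw [AlgHom.toLinearMap_apply, h1]; exact hr w⟩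
  let Φ := UniformSpace.Completion.extensionHom (φ : E0 H X →+* EHat H' X') h2
  have h3 : ∀ f : E0 H X, Φ f = φ f := UniformSpace.Completion.extensionHom_coe _ h2
  have h4 : Continuous Φ := UniformSpace.Completion.continuous_extension
  refine ⟨⟨Φ, fun c => ?_⟩, h4, fun w => (h3 _).trans (h1 w)⟩
  exact (h3 _).trans (φ.commutes c)

/-- The algebra homomorphism on `𝓔` given by linear maps on the summands. -/
theorem E.exists_algHom {B : Type*} [Ring B] [Algebra ℂ B] (f : ∀ n, En H X n →ₗ[ℂ] B)
    (h1 : f 0 ⟨1, SetLike.GradedOne.one_mem⟩ = 1)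
    (hmul : ∀ {m n} (a : En H X m) (b : En H X n),
      f (m + n) ⟨a * b, En.mul_mem a.2 b.2⟩ = f m a * f n b) :
    ∃ Φ : E H X →ₐ[ℂ] B, ∀ n a, Φ (E.incl H X n a) = f n a :=
  ⟨DirectSum.toAlgebra ℂ (fun n => En H X n) f h1 hmul, fun n a =>
    DirectSum.toModule_lof ℂ (M := fun n => En H X n) (φ := f) n a⟩

/-- A continuous homomorphism `𝓔(H; X) → 𝓔(H'; X')` is given by commuting elements of degree zero
and elements of degree one. -/
theorem E.exists_hom [Finite H] [Finite X] (a : H → E H' X')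
    (ha : ∀ i j, a i * a j = a j * a i) (y : X → E H' X')
    (ha0 : ∀ i, a i ∈ LinearMap.range (E.incl H' X' 0))
    (hy : ∀ j, y j ∈ LinearMap.range (E.incl H' X' 1)) :
    ∃ Φ : E H X →ₐ[ℂ] E H' X', Continuous Φ ∧ (∀ i, Φ (E.h i) = a i) ∧ ∀ j, Φ (E.x j) = y j := by
  choose a' ha' using ha0
  choose y' hy' using hy
  have hcomm : ∀ i j, (a' i : EHat H' X') * a' j = a' j * a' i := fun i j => by
    have h2 := ha i j
    rw [← ha', ← ha', E.incl_mul, E.incl_mul] at h2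
    exact congrArg Subtype.val (E.incl_injective _ h2)
  obtain ⟨Φ, hΦ, hw⟩ := EHat.exists_hom (fun i => (a' i : EHat H' X')) hcomm
    (fun j => (y' j : EHat H' X'))
  have hmem : ∀ n (b : En H X n), Φ b ∈ En H' X' n := fun n b => by
    have h1 : (En H' X' n).comap (Φ.toLinearMap ∘ₗ (En H X n).subtype) = ⊤ := by
      refine En.eq_top_of_isClosed _ ?_ fun w hw' => ?_
      · exact (En.isClosed n).preimage (hΦ.comp continuous_subtype_val)
      · have h3 := wordHom_mem_En (fun i => (a' i : EHat H' X')) hcomm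
          (fun j => (y' j : EHat H' X')) (fun i => (a' i).2) (fun j => (y' j).2) w
        rw [hw'] at h3
        change Φ (E0.word H X w : E0 H X) ∈ En H' X' n
        rw [hw]
        exact h3
    exact (h1 ▸ Submodule.mem_top : b ∈ (En H' X' n).comap (Φ.toLinearMap ∘ₗ (En H X n).subtype))
  obtain ⟨Ψ, hΨ⟩ := E.exists_algHom (B := E H' X') (fun n => E.incl H' X' n ∘ₗ
      LinearMap.codRestrict (En H' X' n) (Φ.toLinearMap ∘ₗ (En H X n).subtype) (hmem n))
    (congrArg (E.incl H' X' 0) (Subtype.ext (map_one Φ)))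
    (fun a b => by
      refine Eq.trans ?_ (E.incl_mul _ _).symm
      exact congrArg (E.incl H' X' _) (Subtype.ext (map_mul Φ _ _)))
  refine ⟨Ψ, ?_, fun i => ?_, fun j => ?_⟩
  · refine E.continuous_to_E Ψ.toLinearMap fun n => ?_
    have h1 : Continuous fun b : En H X n => E.incl H' X' n ⟨Φ b, hmem n b⟩ :=
      (E.continuous_incl n).comp ((hΦ.comp continuous_subtype_val).subtype_mk _)
    exact h1.congr fun b => (hΨ n b).symm
  · have h1 : (E.h i : E H X) = _ := E.word_eq_incl (w := Word.h i) (n := 0) (Word.xdeg_h i)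
    rw [h1, hΨ, ← ha' i]
    refine congrArg (E.incl H' X' 0) (Subtype.ext ?_)
    exact (hw _).trans (wordHom_h _ _ _ i)
  · have h1 : (E.x j : E H X) = _ := E.word_eq_incl (w := Word.x j) (n := 1) (Word.xdeg_x j)
    rw [h1, hΨ, ← hy' j]
    refine congrArg (E.incl H' X' 1) (Subtype.ext ?_)
    exact (hw _).trans (wordHom_x _ _ _ j)

end Hom

/-! ### Quotients by closed ideals -/

section ClosedQuot

/-- An algebra with a topology in which the multiplication is separately continuous. -/
class SepContAlg (B : Type) [Ring B] [Algebra ℂ B] [TopologicalSpace B] : Prop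
    extends IsTopologicalAddGroup B, ContinuousConstSMul ℂ B where
  mul_left : ∀ b : B, Continuous fun a => a * b
  mul_right : ∀ b : B, Continuous fun a => b * a

instance {H X : Type} : SepContAlg (E H X) where
  mul_left := E.continuous_mul_left
  mul_right := E.continuous_mul_right

theorem closedIdeal_isClosed {B : Type} [Ring B] [TopologicalSpace B] (R : Set B) : IsClosed (closedIdeal R : Set B) := by
  have h1 : (closedIdeal R : Set B) =
      ⋂ I ∈ {I : TwoSidedIdeal B | R ⊆ (I : Set B) ∧ IsClosed (I : Set B)}, (I : Set B) := by
    ext x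
    simp [closedIdeal, TwoSidedIdeal.mem_sInf]
  rw [h1]
  exact isClosed_biInter fun I hI => hI.2

theorem subset_closedIdeal {B : Type} [Ring B] [TopologicalSpace B] (R : Set B) :
    R ⊆ closedIdeal R := fun _ hx =>
  (TwoSidedIdeal.mem_sInf _).2 fun _ hI => hI.1 hx

variable {B : Type} [Ring B] [Algebra ℂ B] [TopologicalSpace B] (R : Set B)

namespace ClosedQuot

theorem mk_surjective : Function.Surjective (mk R) := RingCon.mk'_surjective _

variable {R} in
theorem mk_eq_iff {a b : B} : mk R a = mk R b ↔ a - b ∈ closedIdeal R :=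
  (RingCon.eq _).trans (TwoSidedIdeal.rel_iff _ _ _)

theorem mk_eq_zero {a : B} (ha : a ∈ R) : mk R a = 0 := by
  rw [← map_zero (mk R), mk_eq_iff, sub_zero]
  exact subset_closedIdeal R ha

theorem continuous_mk : Continuous (mk R) := continuous_coinduced_rng

/-- The quotient map is open because it is the quotient by an additive subgroup. -/
theorem isOpenQuotientMap_mk [SepContAlg B] : IsOpenQuotientMap (mk R) where
  surjective := mk_surjective R
  continuous := continuous_mk R
  isOpenMap := fun U hU => by
    refine isOpen_coinduced.2 ?_
    have h1 : mk R ⁻¹' (mk R '' U) = ⋃ k ∈ (closedIdeal R : Set B), (fun b => b - k) ⁻¹' U := by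
      ext b
      simp only [Set.mem_preimage, Set.mem_image, Set.mem_iUnion, exists_prop]
      constructor
      · rintro ⟨u, hu, hub⟩
        exact ⟨b - u, mk_eq_iff.1 hub.symm, by simpa using hu⟩
      · rintro ⟨k, hk, hb⟩
        exact ⟨b - k, hb, mk_eq_iff.2 (by simpa using (closedIdeal R).neg_mem hk)⟩
    rw [h1]
    exact isOpen_biUnion fun k _ => hU.preimage (continuous_sub_right k)

instance [SepContAlg B] : SepContAlg (ClosedQuot R) where
  continuous_add := by
    have h1 := (isOpenQuotientMap_mk R).prodMap (isOpenQuotientMap_mk R)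
    refine h1.continuous_comp_iff.1 ?_
    refine ((continuous_mk R).comp (continuous_fst.add continuous_snd)).congr fun z => ?_
    exact map_add (mk R) z.1 z.2
  continuous_neg := by
    refine (isOpenQuotientMap_mk R).continuous_comp_iff.1 ?_
    exact ((continuous_mk R).comp continuous_neg).congr fun z => map_neg (mk R) z
  continuous_const_smul c := by
    refine (isOpenQuotientMap_mk R).continuous_comp_iff.1 ?_
    exact ((continuous_mk R).comp (continuous_const_smul c)).congr fun z => map_smul (mk R) c z
  mul_left b := by
    obtain ⟨b, rfl⟩ := mk_surjective R b
    refine (isOpenQuotientMap_mk R).continuous_comp_iff.1 ?_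
    exact ((continuous_mk R).comp (SepContAlg.mul_left b)).congr fun z => map_mul (mk R) z b
  mul_right b := by
    obtain ⟨b, rfl⟩ := mk_surjective R b
    refine (isOpenQuotientMap_mk R).continuous_comp_iff.1 ?_
    exact ((continuous_mk R).comp (SepContAlg.mul_right b)).congr fun z => map_mul (mk R) b z

instance [SepContAlg B] : T2Space (ClosedQuot R) := by
  have h1 : T1Space (ClosedQuot R) := by
    refine ⟨fun a => ?_⟩
    obtain ⟨a, rfl⟩ := mk_surjective R a
    rw [← (isOpenQuotientMap_mk R).isQuotientMap.isClosed_preimage]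
    have h2 : mk R ⁻¹' {mk R a} = (fun b => b - a) ⁻¹' (closedIdeal R : Set B) := by
      ext b
      exact mk_eq_iff
    rw [h2]
    exact (closedIdeal_isClosed R).preimage (continuous_sub_right a)
  infer_instance

variable {R}

/-- Homomorphisms with closed kernel that vanish on `R` factor through the quotient. -/
theorem exists_lift {C : Type*} [Ring C] [Algebra ℂ C] (θ : B →ₐ[ℂ] C)
    (hc : IsClosed {b | θ b = 0}) (hR : ∀ r ∈ R, θ r = 0) :
    ∃ φ : ClosedQuot R →ₐ[ℂ] C, ∀ b, φ (mk R b) = θ b := by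
  have h1 : closedIdeal R ≤ TwoSidedIdeal.ker (θ : B →+* C) := by
    refine sInf_le ⟨fun r hr => ?_, ?_⟩
    · exact (TwoSidedIdeal.mem_ker _).2 (hR r hr)
    · convert hc using 1
      ext b
      exact TwoSidedIdeal.mem_ker _
  refine ⟨RingCon.liftₐ (closedIdeal R).ringCon θ fun x y hxy => ?_, fun b => RingCon.liftₐ_mk _ _ _ b⟩
  have h2 := h1 ((TwoSidedIdeal.rel_iff _ _ _).1 hxy)
  rw [TwoSidedIdeal.mem_ker] at h2
  exact sub_eq_zero.1 ((map_sub θ x y).symm.trans h2)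

theorem continuous_iff {C : Type*} [TopologicalSpace C] (f : ClosedQuot R → C) :
    Continuous f ↔ Continuous fun b => f (mk R b) := continuous_coinduced_dom

end ClosedQuot
end ClosedQuot

/-! ### Presented algebras -/

namespace Alg
variable {H X : Type} (S : Rels H X)

theorem rel_eq_zero {r : E H X} (hr : r ∈ S (E H X) E.h E.x) :
    ClosedQuot.mk (S (E H X) E.h E.x) r = 0 := ClosedQuot.mk_eq_zero _ hr

variable {S}

/-- The generators generate `Alg S` topologically. -/
theorem subalgebra_eq_top (A : Subalgebra ℂ (Alg S)) (hA : IsClosed (A : Set (Alg S)))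
    (hh : ∀ i, Alg.h S i ∈ A) (hx : ∀ j, Alg.x S j ∈ A) : A = ⊤ := by
  have h1 : A.comap (ClosedQuot.mk _) = ⊤ :=
    E.subalgebra_eq_top _ (hA.preimage (ClosedQuot.continuous_mk _)) hh hx
  refine top_le_iff.1 fun a _ => ?_
  obtain ⟨a, rfl⟩ := ClosedQuot.mk_surjective _ a
  exact (h1 ▸ Algebra.mem_top : a ∈ A.comap (ClosedQuot.mk _))

/-- Continuous homomorphisms are determined by their values on generators. -/
theorem hom_ext {B : Type*} [Ring B] [Algebra ℂ B] [TopologicalSpace B] [T2Space B]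
    {φ χ : Alg S →ₐ[ℂ] B} (hφ : Continuous φ) (hχ : Continuous χ)
    (hh : ∀ i, φ (Alg.h S i) = χ (Alg.h S i)) (hx : ∀ j, φ (Alg.x S j) = χ (Alg.x S j)) :
    φ = χ := by
  have h1 := subalgebra_eq_top (AlgHom.equalizer φ χ) (isClosed_eq hφ hχ) hh hx
  exact AlgHom.ext fun a => (h1 ▸ Algebra.mem_top : a ∈ AlgHom.equalizer φ χ)

variable (S) in
/-- The span of `1` and the commuting generators. -/
def hspan : Submodule ℂ (Alg S) := Submodule.span ℂ (insert 1 (Set.range (Alg.h S)))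

theorem one_mem_hspan : 1 ∈ hspan S := Submodule.subset_span (Set.mem_insert _ _)

theorem h_mem_hspan (i : H) : Alg.h S i ∈ hspan S :=
  Submodule.subset_span (Set.mem_insert_of_mem _ ⟨i, rfl⟩)

theorem hspan_eq : hspan S = (E.hspan H X).map (ClosedQuot.mk _).toLinearMap := by
  rw [hspan, E.hspan, Submodule.map_span, Set.image_insert_eq, ← Set.range_comp]
  exact congrArg (fun t => Submodule.span ℂ (insert t _)) (map_one (ClosedQuot.mk (S (E H X) E.h E.x))).symm

theorem hasSum_texp {a : Alg S} (ha : a ∈ hspan S) :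
    HasSum (fun n : ℕ => ((n.factorial : ℂ)⁻¹) • a ^ n) (texp a) := by
  rw [hspan_eq] at ha
  obtain ⟨a, ha, rfl⟩ := ha
  have h1 := hasSum_texp_map (ClosedQuot.mk (S (E H X) E.h E.x)) (ClosedQuot.continuous_mk _)
    (E.hasSum_texp ha)
  have h2 := h1.tsum_eq
  exact (show texp _ = _ from h2) ▸ h1

theorem mk_texp {a : E H X} (ha : a ∈ E.hspan H X) :
    ClosedQuot.mk (S (E H X) E.h E.x) (texp a) = texp (ClosedQuot.mk (S (E H X) E.h E.x) a) :=
  (hasSum_texp_map _ (ClosedQuot.continuous_mk _) (E.hasSum_texp ha)).tsum_eq.symm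

theorem map_texp {B : Type} [Ring B] [Algebra ℂ B] [TopologicalSpace B] [T2Space B]
    {φ : Alg S →ₐ[ℂ] B} (hφ : Continuous φ) {a : Alg S} (ha : a ∈ hspan S) :
    φ (texp a) = texp (φ a) :=
  (hasSum_texp_map _ hφ (hasSum_texp ha)).tsum_eq.symm

theorem texp_add {a b : Alg S} (ha : a ∈ hspan S) (hb : b ∈ hspan S) :
    texp (a + b) = texp a * texp b := by
  rw [hspan_eq] at ha hb
  obtain ⟨a, ha, rfl⟩ := ha
  obtain ⟨b, hb, rfl⟩ := hb
  have h1 := congrArg (ClosedQuot.mk (S (E H X) E.h E.x)) (E.texp_add ha hb)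
  rw [map_mul, mk_texp ha, mk_texp hb, mk_texp (add_mem ha hb), map_add] at h1
  exact h1

theorem texp_add_one {a : Alg S} (ha : a ∈ hspan S) (c : ℂ) :
    texp (a + c • 1) = Complex.exp c • texp a := by
  rw [texp_add ha (Submodule.smul_mem _ c one_mem_hspan)]
  have h1 : (c • (1 : Alg S)) = ClosedQuot.mk (S (E H X) E.h E.x) (c • 1) := by
    rw [map_smul, map_one]
  have h2 : c • 1 ∈ E.hspan H X :=
    Submodule.smul_mem _ c (Submodule.subset_span (Set.mem_insert _ _))
  rw [h1, ← mk_texp h2, texp_smul_one, map_smul, map_one, mul_smul_comm, mul_one]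

/-- If `x` is an eigenvector of `[a, ·]`, then it commutes with `e^a` up to a factor. -/
theorem texp_mul {a x : Alg S} (ha : a ∈ hspan S) {c : ℂ} (hx : a * x - x * a = c • x) :
    texp a * x = Complex.exp c • (x * texp a) := by
  have h1 := (hasSum_texp ha).map (AddMonoidHom.mulRight x) (SepContAlg.mul_left x)
  have h2 := (hasSum_texp (add_mem ha (Submodule.smul_mem _ c one_mem_hspan))).map
    (AddMonoidHom.mulLeft x) (SepContAlg.mul_right x)
  have h3 : ∀ n : ℕ, a ^ n * x = x * (a + c • 1) ^ n := fun n => by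
    induction n with
    | zero => simp
    | succ n ih =>
      rw [pow_succ, mul_assoc, sub_eq_iff_eq_add.1 hx, mul_add, ← mul_assoc, mul_smul_comm, ih,
        pow_succ, mul_add, mul_add, mul_smul_comm, mul_one, mul_smul_comm, ← mul_assoc, add_comm]
  have h4 := h1.unique ((congrArg (HasSum · _) (funext fun n => ?_)).mp h2)
  · rw [texp_add_one ha] at h4
    refine h4.trans ?_
    exact mul_smul_comm _ _ _
  · simp [h3]

theorem texp_mul_smul {a x : Alg S} (ha : a ∈ hspan S) {c : ℂ} (hx : a * x - x * a = c • x) (t : ℂ) :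
    texp (t • a) * x = Complex.exp (t * c) • (x * texp (t • a)) :=
  texp_mul (Submodule.smul_mem _ t ha) (by
    rw [smul_mul_assoc, mul_smul_comm, ← smul_sub, hx, smul_smul])

theorem texp_commute {a x : Alg S} (ha : a ∈ hspan S) (hx : Commute a x) : Commute (texp a) x := by
  have := texp_mul ha (x := x) (c := 0) (by rw [hx.eq, sub_self, zero_smul])
  rw [Complex.exp_zero, one_smul] at this
  exact this

theorem hspan_commute {a b : Alg S} (ha : a ∈ hspan S) (hb : b ∈ hspan S) : Commute a b := by
  rw [hspan_eq] at ha hb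
  obtain ⟨a, ha, rfl⟩ := ha
  obtain ⟨b, hb, rfl⟩ := hb
  exact (E.hspan_commute ha hb).map (ClosedQuot.mk (S (E H X) E.h E.x))

/-- A continuous homomorphism between presented algebras is given by representatives of degrees zero
and one of the images of the generators, if the relations hold between the images. -/
theorem exists_hom [Finite H] [Finite X] {H' X' : Type} {S' : Rels H' X'} (a : H → E H' X')
    (ha : ∀ i j, a i * a j = a j * a i) (y : X → E H' X')
    (ha0 : ∀ i, a i ∈ LinearMap.range (E.incl H' X' 0))
    (hy : ∀ j, y j ∈ LinearMap.range (E.incl H' X' 1))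
    (hS : ∀ θ : E H X →ₐ[ℂ] Alg S', Continuous θ →
      (∀ i, θ (E.h i) = ClosedQuot.mk (S' (E H' X') E.h E.x) (a i)) →
      (∀ j, θ (E.x j) = ClosedQuot.mk (S' (E H' X') E.h E.x) (y j)) →
      ∀ r ∈ S (E H X) E.h E.x, θ r = 0) :
    ∃ φ : Alg S →ₐ[ℂ] Alg S', IsGenHom φ (fun i => ClosedQuot.mk (S' (E H' X') E.h E.x) (a i))
      (fun j => ClosedQuot.mk (S' (E H' X') E.h E.x) (y j)) := by
  obtain ⟨Φ, hΦ, hh, hx⟩ := E.exists_hom a ha y ha0 hy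
  have h1 : Continuous ((ClosedQuot.mk (S' (E H' X') E.h E.x)).comp Φ) :=
    (ClosedQuot.continuous_mk _).comp hΦ
  obtain ⟨φ, hφ⟩ := ClosedQuot.exists_lift ((ClosedQuot.mk (S' (E H' X') E.h E.x)).comp Φ)
    (isClosed_eq h1 continuous_const)
    (hS _ h1 (fun i => congrArg (ClosedQuot.mk _) (hh i)) fun j => congrArg (ClosedQuot.mk _) (hx j))
  exact ⟨φ, (ClosedQuot.continuous_iff _).2 (h1.congr fun b => (hφ b).symm),
    fun i => (hφ _).trans (congrArg (ClosedQuot.mk _) (hh i)),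
    fun j => (hφ _).trans (congrArg (ClosedQuot.mk _) (hx j))⟩

end Alg

theorem E.h_mem_hspan {H X : Type} (i : H) : (E.h i : E H X) ∈ E.hspan H X :=
  Submodule.subset_span (Set.mem_insert_of_mem _ ⟨i, rfl⟩)

theorem E.map_texp {H X B : Type} [Ring B] [Algebra ℂ B] [TopologicalSpace B] [T2Space B]
    {θ : E H X →ₐ[ℂ] B} (hθ : Continuous θ) {a : E H X} (ha : a ∈ E.hspan H X) :
    θ (texp a) = texp (θ a) :=
  (hasSum_texp_map _ hθ (E.hasSum_texp ha)).tsum_eq.symm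

/-! ### Weakly continuous representations -/

section WeakRep
variable {V : Type} [AddCommGroup V] [Module ℂ V]

theorem eq_of_forall_dual {v w : V} (h : ∀ φ : V →ₗ[ℂ] ℂ, φ v = φ w) : v = w := by
  rw [← sub_eq_zero, ← Module.forall_dual_apply_eq_zero_iff ℂ]
  intro φ
  rw [map_sub, h φ, sub_self]

section Intertwine
variable {B : Type} [Ring B] [Algebra ℂ B] [TopologicalSpace B] {W : Type} [AddCommGroup W]
  [Module ℂ W]

/-- The elements whose actions are intertwined by `f`. -/
def intertwined (ρ : B →ₐ[ℂ] Module.End ℂ V) (σ : B →ₐ[ℂ] Module.End ℂ W) (f : V →ₗ[ℂ] W) :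
    Subalgebra ℂ B where
  carrier := {b | ∀ v, f (ρ b v) = σ b (f v)}
  mul_mem' := fun {a b} ha hb v => by
    rw [map_mul, map_mul, Module.End.mul_apply, Module.End.mul_apply, ha, hb]
  add_mem' := fun {a b} ha hb v => by
    rw [map_add, map_add, LinearMap.add_apply, LinearMap.add_apply, map_add, ha, hb]
  algebraMap_mem' := fun c v => by simp [Module.algebraMap_end_apply]

/-- The condition can be tested on linear functionals, for which it is a closed condition. -/
theorem isClosed_intertwined {ρ : B →ₐ[ℂ] Module.End ℂ V} {σ : B →ₐ[ℂ] Module.End ℂ W}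
    (hρ : WeaklyContinuous ρ) (hσ : WeaklyContinuous σ) (f : V →ₗ[ℂ] W) :
    IsClosed (intertwined ρ σ f : Set B) := by
  have h1 : (intertwined ρ σ f : Set B) =
      ⋂ (v : V) (φ : W →ₗ[ℂ] ℂ), {b | (φ ∘ₗ f) (ρ b v) = φ (σ b (f v))} := by
    ext b
    simp only [Set.mem_iInter]
    exact ⟨fun h v φ => congrArg φ (h v), fun h v => eq_of_forall_dual (h v)⟩
  rw [h1]
  exact isClosed_iInter fun v => isClosed_iInter fun φ => isClosed_eq (hρ v _) (hσ _ φ)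

theorem isClosed_ker {ρ : B →ₐ[ℂ] Module.End ℂ V} (hρ : WeaklyContinuous ρ) :
    IsClosed {b | ρ b = 0} := by
  have h1 : {b | ρ b = 0} = ⋂ (v : V) (φ : V →ₗ[ℂ] ℂ), {b | φ (ρ b v) = 0} := by
    ext b
    simp only [Set.mem_iInter]
    refine ⟨fun h v φ => ?_, fun h => LinearMap.ext fun v => eq_of_forall_dual fun φ => ?_⟩
    · change φ (ρ b v) = 0
      rw [show ρ b = 0 from h]
      simp
    · rw [show φ (ρ b v) = 0 from h v φ]
      simp
  rw [h1]
  exact isClosed_iInter fun v => isClosed_iInter fun φ => isClosed_eq (hρ v _) continuous_const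

/-- A weakly continuous representation takes exponentials to exponentials on eigenvectors. -/
theorem texp_eigen {ρ : B →ₐ[ℂ] Module.End ℂ V} (hρ : WeaklyContinuous ρ) {a : B}
    (ha : HasSum (fun n : ℕ => ((n.factorial : ℂ)⁻¹) • a ^ n) (texp a)) {c : ℂ} {v : V}
    (hv : ρ a v = c • v) : ρ (texp a) v = Complex.exp c • v := by
  refine eq_of_forall_dual fun φ => ?_
  let u : B →ₗ[ℂ] ℂ := φ ∘ₗ (LinearMap.applyₗ v) ∘ₗ ρ.toLinearMap
  have h1 := ha.map u (hρ v φ)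
  have h2 : HasSum (fun n : ℕ => c ^ n / n.factorial) (Complex.exp c) := by
    rw [Complex.exp_eq_exp_ℂ]
    exact NormedSpace.expSeries_div_hasSum_exp c
  have h3 := h2.mul_right (φ v)
  have h4 : ∀ n : ℕ, (ρ a ^ n) v = c ^ n • v := fun n => by
    induction n with
    | zero => simp
    | succ n ih => rw [pow_succ', Module.End.mul_apply, ih, map_smul, hv, smul_smul, pow_succ]
  rw [map_smul, smul_eq_mul]
  refine h1.unique ((congrArg (HasSum · _) (funext fun n => ?_)).mp h3)
  simp [u, h4, div_eq_inv_mul, mul_assoc]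

end Intertwine

end WeakRep

/-! ### Construction of weakly continuous representations -/

section WeightRep
variable {H X V : Type} [AddCommGroup V] [Module ℂ V]

/-- The action of a list of free generators. -/
def listAct (y : X → Module.End ℂ V) (l : List X) : Module.End ℂ V := (l.map y).prod

/-- Operators `a i` and `y j` of which the `a i` commute and are simultaneously diagonalisable,
and the `y j` shift the weights. -/
structure IsWeightData (a : H → Module.End ℂ V) (y : X → Module.End ℂ V) (lam : H → X → ℂ) :
    Prop where
  comm : ∀ i j, a i * a j = a j * a i
  shift : ∀ i j v, a i (y j v) = y j (a i v) + lam i j • y j v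
  diag : Submodule.span ℂ {v : V | ∀ i, ∃ c : ℂ, a i v = c • v} = ⊤

variable {a : H → Module.End ℂ V} {y : X → Module.End ℂ V} {lam : H → X → ℂ}

/-- After `l` steps from a weight vector the eigenvalues have grown at most linearly in the length
of `l`. -/
theorem IsWeightData.exists_eigenvalue (h : IsWeightData a y lam) {v : V} {μ : H → ℂ}
    (hv : ∀ i, a i v = μ i • v) {M : ℝ} (hμ : ∀ i, ‖μ i‖ ≤ M) (hM : ∀ i j, ‖lam i j‖ ≤ M)
    (l : List X) (i : H) :
    ∃ c : ℂ, a i (listAct y l v) = c • listAct y l v ∧ ‖c‖ ≤ M + l.length * M := by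
  induction l with
  | nil => exact ⟨μ i, by simpa [listAct] using hv i, by simpa using hμ i⟩
  | cons j l ih =>
    obtain ⟨c, hc, hc'⟩ := ih
    refine ⟨c + lam i j, ?_, ?_⟩
    · simp only [listAct, List.map_cons, List.prod_cons, Module.End.mul_apply] at hc ⊢
      rw [h.shift, hc, map_smul, add_smul]
    · have h1 := norm_add_le c (lam i j)
      have h2 := hM i j
      push_cast [List.length_cons]
      linarith

/-- Every word acts on a vector obtained from a weight vector by applying free generators as
a multiple of the action of a list of free generators. -/
theorem IsWeightData.exists_word [Finite H] [Finite X] (h : IsWeightData a y lam) {v : V}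
    (hv : ∀ i, ∃ c : ℂ, a i v = c • v) (n : ℕ) :
    ∃ r : NNReal, ∀ (w : Word H X) (l : List X), l.length + (Word.xdeg H X w).toAdd ≤ n →
      ∃ (c : ℂ) (l' : List X), l'.length = l.length + (Word.xdeg H X w).toAdd ∧ ‖c‖ ≤ wt r w ∧
        wordHom a h.comm y w (listAct y l v) = c • listAct y l' v := by
  cases nonempty_fintype H
  cases nonempty_fintype X
  choose μ hμ using hv
  obtain ⟨M, hM⟩ : ∃ M : ℝ, M = ∑ i, ‖μ i‖ + ∑ i, ∑ j, ‖lam i j‖ := ⟨_, rfl⟩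
  have hnn : ∀ i, 0 ≤ ∑ j, ‖lam i j‖ := fun i => Finset.sum_nonneg fun j _ => norm_nonneg _
  have hM1 : ∀ i, ‖μ i‖ ≤ M := fun i => by
    rw [hM]
    exact le_add_of_le_of_nonneg
      (Finset.single_le_sum (f := fun i => ‖μ i‖) (fun i _ => norm_nonneg _) (Finset.mem_univ i))
      (Finset.sum_nonneg fun i _ => hnn i)
  have hM2 : ∀ i j, ‖lam i j‖ ≤ M := fun i j => by
    rw [hM]
    refine le_add_of_nonneg_of_le (Finset.sum_nonneg fun i _ => norm_nonneg _) ?_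
    exact (Finset.single_le_sum (f := fun j => ‖lam i j‖) (fun j _ => norm_nonneg _)
      (Finset.mem_univ j)).trans
      (Finset.single_le_sum (f := fun i => ∑ j, ‖lam i j‖) (fun i _ => hnn i) (Finset.mem_univ i))
  have hM0 : 0 ≤ M := by
    rw [hM]
    exact add_nonneg (Finset.sum_nonneg fun i _ => norm_nonneg _)
      (Finset.sum_nonneg fun i _ => hnn i)
  -- on products of at most `n` free generators with `v` the eigenvalues are at most `M + n * M`
  obtain ⟨r, hr⟩ : ∃ r : NNReal, (r : ℝ) = 1 + (M + n * M) := ⟨⟨_, by positivity⟩, rfl⟩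
  refine ⟨r, fun w => ?_⟩
  induction w using Word.ind with
  | one => exact fun l _ => ⟨1, l, by simp, by simp [wt_one], by simp⟩
  | h i =>
    intro l hl
    obtain ⟨c, hc, hc'⟩ := h.exists_eigenvalue hμ hM1 hM2 l i
    refine ⟨c, l, by simp [Word.xdeg_h], ?_, by rw [wordHom_h, hc]⟩
    rw [wt_h, hr]
    have h1 : (l.length : ℝ) ≤ n := by exact_mod_cast le_of_add_le_left hl
    have h2 := mul_le_mul_of_nonneg_right h1 hM0
    linarith
  | x j =>
    intro l hl
    refine ⟨1, j :: l, by simp [Word.xdeg_x], ?_, by simp [wordHom_x, listAct]⟩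
    rw [wt_x, hr, norm_one]
    have : 0 ≤ M + n * M := by positivity
    linarith
  | mul u w hu hw =>
    intro l hl
    rw [map_mul, toAdd_mul] at hl
    obtain ⟨c, l', h1, h2, h3⟩ := hw l (by omega)
    obtain ⟨c', l'', h1', h2', h3'⟩ := hu l' (by omega)
    refine ⟨c * c', l'', ?_, ?_, ?_⟩
    · rw [map_mul, toAdd_mul]
      omega
    · rw [norm_mul, wt_mul, mul_comm]
      exact mul_le_mul h2' h2 (norm_nonneg _) (wt_nonneg _ _)
    · rw [map_mul, Module.End.mul_apply, h3, map_smul, h3', smul_smul]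

/-- A bounded linear map from `𝓔₀` to a finite-dimensional space extends to the completion. -/
theorem E0.exists_extend {K : Type} [Finite K] (G : Word H X → K → ℂ) (r : NNReal)
    (hG : ∀ w k, ‖G w k‖ ≤ wt r w) :
    ∃ u : EHat H X →ₗ[ℂ] (K → ℂ), Continuous u ∧ ∀ w, u (E0.word H X w : E0 H X) = G w := by
  cases nonempty_fintype K
  let u := E0.linLift G
  have h1 : ∀ f, ‖u f‖ ≤ nrm r f := fun f => by
    have := E0.linLift_bound u (normSeminorm ℂ (K → ℂ)) r 1 (fun w => by
      rw [one_mul, E0.linLift_word]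
      exact (pi_norm_le_iff_of_nonneg (wt_nonneg r w)).2 (hG w)) f
    rwa [one_mul] at this
  have h2 : Continuous u := by
    refine continuous_of_continuousAt_zero u ?_
    rw [ContinuousAt, map_zero]
    refine squeeze_zero_norm h1 ?_
    have h3 := (E0.uniformContinuous_nrm (H := H) (X := X) r).continuous.tendsto 0
    rwa [show nrm r (0 : E0 H X) = 0 from nrm_zero r] at h3
  let U := AddMonoidHom.extension u.toAddMonoidHom h2
  have hU : Continuous U := UniformSpace.Completion.continuous_extension
  have hU' : ∀ f : E0 H X, U f = u f := AddMonoidHom.extension_coe u.toAddMonoidHom h2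
  refine ⟨⟨⟨U, map_add U⟩, fun c b => ?_⟩, hU, fun w => (hU' _).trans (E0.linLift_word _ _)⟩
  change U (c • b) = c • U b
  induction b using UniformSpace.Completion.induction_on with
  | hp => exact isClosed_eq (hU.comp (continuous_const_smul c)) (hU.const_smul c)
  | ih f => rw [← EHat.coe_smul, hU', hU', map_smul]

/-- Weakly continuous linear maps on `𝓔⁽ⁿ⁾` are determined by their values on words. -/
theorem En.weak_ext {n : ℕ} {u v : En H X n →ₗ[ℂ] V} (hu : ∀ φ : V →ₗ[ℂ] ℂ, Continuous fun b => φ (u b))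
    (hv : ∀ φ : V →ₗ[ℂ] ℂ, Continuous fun b => φ (v b))
    (hw : ∀ (w : Word H X) (hw : Word.xdeg H X w = Multiplicative.ofAdd n),
      u ⟨(E0.word H X w : E0 H X), En.word_mem hw⟩ = v ⟨(E0.word H X w : E0 H X), En.word_mem hw⟩) :
    u = v := by
  refine LinearMap.ext fun b => eq_of_forall_dual fun φ => ?_
  exact LinearMap.congr_fun (En.lin_ext (u := φ ∘ₗ u) (v := φ ∘ₗ v) (hu φ) (hv φ)
    fun w hw' => congrArg φ (hw w hw')) b

/-- The orbit map of a vector extends to `𝓔⁽ⁿ⁾`: on a weight vector, the words with `n` free letters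
act with values in a finite-dimensional space, by `IsWeightData.exists_word`. -/
theorem IsWeightData.exists_action [Finite H] [Finite X] (h : IsWeightData a y lam) (n : ℕ) (v : V) :
    ∃ T : En H X n →ₗ[ℂ] V, (∀ φ : V →ₗ[ℂ] ℂ, Continuous fun b => φ (T b)) ∧
      ∀ (w : Word H X) (hw : Word.xdeg H X w = Multiplicative.ofAdd n),
        T ⟨(E0.word H X w : E0 H X), En.word_mem hw⟩ = wordHom a h.comm y w v := by
  have hv : v ∈ Submodule.span ℂ {v : V | ∀ i, ∃ c : ℂ, a i v = c • v} := h.diag ▸ trivial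
  induction hv using Submodule.span_induction with
  | zero => exact ⟨0, fun φ => by simpa using continuous_const, fun w hw => by simp⟩
  | add v v' _ _ h1 h2 =>
    obtain ⟨T, hT, hT'⟩ := h1
    obtain ⟨U, hU, hU'⟩ := h2
    exact ⟨T + U, fun φ => by simpa using! (hT φ).add (hU φ), fun w hw => by
      rw [LinearMap.add_apply, hT' w hw, hU' w hw, map_add]⟩
  | smul c v _ h1 =>
    obtain ⟨T, hT, hT'⟩ := h1
    exact ⟨c • T, fun φ => by simpa using! (hT φ).const_smul c, fun w hw => by
      rw [LinearMap.smul_apply, hT' w hw, map_smul]⟩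
  | mem v hv =>
    obtain ⟨r, hr⟩ := h.exists_word hv n
    let K := {l : List X // l.length = n}
    have hK : Finite K := List.finite_length_eq X n
    cases nonempty_fintype K
    -- the value `none` marks the words of the other degrees, which are sent to zero
    have h1 : ∀ w : Word H X, ∃ (c : ℂ) (k : Option K), ‖c‖ ≤ wt r w ∧
        (Word.xdeg H X w = Multiplicative.ofAdd n → ∃ k', k = some k' ∧
          wordHom a h.comm y w v = c • listAct y k'.1 v) := fun w => by
      by_cases hw : Word.xdeg H X w = Multiplicative.ofAdd n
      · obtain ⟨c, l', h1, h2, h3⟩ := hr w [] (by simp [hw])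
        exact ⟨c, some ⟨l', by simpa [hw] using h1⟩, h2, fun _ => ⟨_, rfl, by simpa [listAct] using h3⟩⟩
      · exact ⟨0, none, by simpa using wt_nonneg r w, fun h => absurd h hw⟩
    choose c k hc hk using h1
    classical
    obtain ⟨u, hu, hu'⟩ := E0.exists_extend (H := H) (X := X)
      (fun w k' => if k w = some k' then c w else 0) r (fun w k' => by
        split_ifs
        · exact hc w
        · simpa using wt_nonneg r w)
    refine ⟨(Fintype.linearCombination ℂ fun k' : K => listAct y k'.1 v) ∘ₗ u ∘ₗ (En H X n).subtype,
      fun φ => ?_, fun w hw => ?_⟩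
    · have h2 : ∀ b : En H X n, φ (((Fintype.linearCombination ℂ fun k' : K => listAct y k'.1 v) ∘ₗ u ∘ₗ
          (En H X n).subtype) b) = ∑ k' : K, u b k' * φ (listAct y k'.1 v) := fun b => by
        simp [Fintype.linearCombination_apply]
      simp only [h2]
      have h3 : Continuous fun b : En H X n => u b := hu.comp continuous_subtype_val
      refine continuous_finsetSum _ fun k' _ => ?_
      exact ((continuous_apply k').comp h3).mul continuous_const
    · obtain ⟨k', hk1, hk2⟩ := hk w hw
      rw [hk2]
      change Fintype.linearCombination ℂ (fun k' : K => listAct y k'.1 v)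
        (u (E0.word H X w : E0 H X)) = _
      rw [hu', Fintype.linearCombination_apply]
      rw [Finset.sum_eq_single k' (fun k'' _ hk => by
        rw [if_neg fun h => hk (by simpa using hk1.symm.trans h |>.symm), zero_smul]) (by simp),
        if_pos hk1]

/-- Weight data extend to a weakly continuous representation. -/
theorem IsWeightData.exists_rep [Finite H] [Finite X] (h : IsWeightData a y lam) :
    ∃ ρ : E H X →ₐ[ℂ] Module.End ℂ V, WeaklyContinuous ρ ∧ (∀ i, ρ (E.h i) = a i) ∧
      ∀ j, ρ (E.x j) = y j := by
  choose T hT hTw using h.exists_action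
  have hadd : ∀ n v v', T n (v + v') = T n v + T n v' := fun n v v' => by
    refine En.weak_ext (hT _ _) (fun φ => by simpa using! (hT n v φ).add (hT n v' φ)) fun w hw => ?_
    rw [LinearMap.add_apply, hTw n _ w hw, hTw n v w hw, hTw n v' w hw, map_add]
  have hsmul : ∀ n (c : ℂ) v, T n (c • v) = c • T n v := fun n c v => by
    refine En.weak_ext (hT _ _) (fun φ => by simpa using! (hT n v φ).const_smul c) fun w hw => ?_
    rw [LinearMap.smul_apply, hTw n _ w hw, hTw n v w hw, map_smul]
  let f : ∀ n, En H X n →ₗ[ℂ] Module.End ℂ V := fun n => LinearMap.flip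
    { toFun := T n, map_add' := hadd n, map_smul' := hsmul n }
  have hf : ∀ n b v, f n b v = T n v b := fun _ _ _ => rfl
  -- multiplicativity holds on words, and extends by density in the left and in the right factor
  have hmul : ∀ {m n} (b : En H X m) (b' : En H X n),
      f (m + n) ⟨b * b', En.mul_mem b.2 b'.2⟩ = f m b * f n b' := by
    intro m n b b'
    refine LinearMap.ext fun v => ?_
    rw [Module.End.mul_apply, hf, hf, hf]
    have hL : ∀ b' : En H X n, ∃ L : En H X m →ₗ[ℂ] En H X (m + n), Continuous L ∧
        ∀ b, L b = ⟨b * b', En.mul_mem b.2 b'.2⟩ := fun b' =>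
      ⟨LinearMap.codRestrict _ (LinearMap.mulRight ℂ (b' : EHat H X) ∘ₗ (En H X m).subtype)
        fun b => En.mul_mem b.2 b'.2,
        (continuous_subtype_val.mul continuous_const).subtype_mk _, fun b => rfl⟩
    have hR : ∀ b : En H X m, ∃ L : En H X n →ₗ[ℂ] En H X (m + n), Continuous L ∧
        ∀ b', L b' = ⟨b * b', En.mul_mem b.2 b'.2⟩ := fun b =>
      ⟨LinearMap.codRestrict _ (LinearMap.mulLeft ℂ (b : EHat H X) ∘ₗ (En H X n).subtype)
        fun b' => En.mul_mem b.2 b'.2,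
        (continuous_const.mul continuous_subtype_val).subtype_mk _, fun b => rfl⟩
    obtain ⟨L, hLc, hL⟩ := hL b'
    rw [← hL b]
    refine LinearMap.congr_fun (En.weak_ext (u := T (m + n) v ∘ₗ L) (v := T m (T n v b'))
      (fun φ => (hT _ v φ).comp hLc) (hT _ _) fun w hw => ?_) b
    rw [hTw m _ w hw, LinearMap.comp_apply, hL]
    obtain ⟨R, hRc, hR⟩ := hR ⟨(E0.word H X w : E0 H X), En.word_mem hw⟩
    rw [← hR b']
    refine LinearMap.congr_fun (En.weak_ext (u := T (m + n) v ∘ₗ R)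
      (v := wordHom a h.comm y w ∘ₗ T n v)
      (fun φ => (hT _ v φ).comp hRc) (fun φ => hT n v (φ ∘ₗ _)) fun w' hw' => ?_) b'
    rw [LinearMap.comp_apply, LinearMap.comp_apply, hR, hTw n v w' hw', ← Module.End.mul_apply,
      ← map_mul]
    have hww : Word.xdeg H X (w * w') = Multiplicative.ofAdd (m + n) := by
      rw [map_mul, hw, hw', ofAdd_add]
    rw [← hTw (m + n) v (w * w') hww]
    refine congrArg _ (Subtype.ext ?_)
    change ((E0.word H X w : E0 H X) : EHat H X) * (E0.word H X w' : E0 H X) =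
      (E0.word H X (w * w') : E0 H X)
    rw [map_mul, UniformSpace.Completion.coe_mul]
  have hword : ∀ n w (hw : Word.xdeg H X w = Multiplicative.ofAdd n),
      f n ⟨(E0.word H X w : E0 H X), En.word_mem hw⟩ = wordHom a h.comm y w := fun n w hw =>
    LinearMap.ext fun v => hTw n v w hw
  have hone : f 0 ⟨1, SetLike.GradedOne.one_mem⟩ = 1 := by
    rw [← map_one (wordHom a h.comm y), ← hword 0 1 (map_one _)]
    refine congrArg _ (Subtype.ext ?_)
    change 1 = ((E0.word H X 1 : E0 H X) : EHat H X)
    rw [map_one, UniformSpace.Completion.coe_one]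
  obtain ⟨ρ, hρ⟩ := E.exists_algHom f hone hmul
  refine ⟨ρ, fun v φ => ?_, fun i => ?_, fun j => ?_⟩
  · refine E.continuous_functional (φ ∘ₗ LinearMap.applyₗ v ∘ₗ ρ.toLinearMap) fun n => ?_
    refine (hT n v φ).congr fun b => ?_
    change φ (T n v b) = φ (ρ (E.incl H X n b) v)
    rw [hρ, hf]
  · have h1 : (E.h i : E H X) = _ := E.word_eq_incl (w := Word.h i) (n := 0) (Word.xdeg_h i)
    rw [h1, hρ, hword 0 _ (Word.xdeg_h i), wordHom_h]
  · have h1 : (E.x j : E H X) = _ := E.word_eq_incl (w := Word.x j) (n := 1) (Word.xdeg_x j)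
    rw [h1, hρ, hword 1 _ (Word.xdeg_x j), wordHom_x]

/-- A weakly continuous representation of `𝓔` that respects the relations is a weakly continuous
representation of the presented algebra. -/
theorem Alg.exists_rep {S : Rels H X} (θ : E H X →ₐ[ℂ] Module.End ℂ V) (hθ : WeaklyContinuous θ)
    (hS : ∀ r ∈ S (E H X) E.h E.x, θ r = 0) :
    ∃ ρ : Alg S →ₐ[ℂ] Module.End ℂ V, WeaklyContinuous ρ ∧ (∀ i, ρ (Alg.h S i) = θ (E.h i)) ∧
      ∀ j, ρ (Alg.x S j) = θ (E.x j) := by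
  obtain ⟨ρ, hρ⟩ := ClosedQuot.exists_lift θ (isClosed_ker hθ) hS
  refine ⟨ρ, fun v φ => (ClosedQuot.continuous_iff _).2 ?_, fun i => hρ _, fun j => hρ _⟩
  exact (hθ v φ).congr fun b => by rw [hρ]

end WeightRep

/-! ### The `q`-Serre expression -/

section Serre
variable {B : Type*} [Ring B] [Algebra ℂ B]

/-- The `q`-Serre expression with middle coefficient `c = [3]_q`. -/
def serre (c : ℂ) (x y : B) : B :=
  x ^ 3 * y - c • (x ^ 2 * y * x) + c • (x * y * x ^ 2) - y * x ^ 3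

/-- Factors that commute with the arguments can be extracted from the `q`-Serre expression. -/
theorem serre_mul {c : ℂ} {a b k l : B} (h1 : k * a = a * k) (h2 : k * b = b * k)
    (h3 : l * a = a * l) (h5 : k * l = l * k) :
    serre c (a * k) (b * l) = serre c a b * (k ^ 3 * l) := by
  have e1 : ∀ z, k * (a * z) = a * (k * z) := fun z => by rw [← mul_assoc, h1, mul_assoc]
  have e2 : ∀ z, k * (b * z) = b * (k * z) := fun z => by rw [← mul_assoc, h2, mul_assoc]
  have e3 : ∀ z, l * (a * z) = a * (l * z) := fun z => by rw [← mul_assoc, h3, mul_assoc]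
  have e5 : ∀ z, k * (l * z) = l * (k * z) := fun z => by rw [← mul_assoc, h5, mul_assoc]
  simp only [serre, pow_succ, pow_zero, one_mul, mul_assoc, sub_mul, add_mul, smul_mul_assoc,
    e1, e2, e3, e5, h5]

/-- The `q`-Serre relation is additive for elements that commute up to the appropriate powers of
`q`, where `u = q²`. -/
theorem serre_add {u : ℂ} (hu : u ≠ 0) {a a' b b' : B} (h1 : a * b = u • (b * a))
    (h2 : a * b' = u⁻¹ • (b' * a)) (h3 : a' * b = u⁻¹ • (b * a'))
    (ha : serre (u + 1 + u⁻¹) a a' = 0) (hb : serre (u + 1 + u⁻¹) b b' = 0) :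
    serre (u + 1 + u⁻¹) (a + b) (a' + b') = 0 := by
  have e1 : ∀ z, a * (b * z) = u • (b * (a * z)) := fun z => by
    rw [← mul_assoc, h1, smul_mul_assoc, mul_assoc]
  have e2 : ∀ z, a * (b' * z) = u⁻¹ • (b' * (a * z)) := fun z => by
    rw [← mul_assoc, h2, smul_mul_assoc, mul_assoc]
  have e3 : ∀ z, a' * (b * z) = u⁻¹ • (b * (a' * z)) := fun z => by
    rw [← mul_assoc, h3, smul_mul_assoc, mul_assoc]
  have key : serre (u + 1 + u⁻¹) (a + b) (a' + b') - serre (u + 1 + u⁻¹) a a' -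
      serre (u + 1 + u⁻¹) b b' = 0 := by
    simp only [serre, pow_succ, pow_zero, one_mul, mul_assoc, add_mul, mul_add,
      mul_smul_comm, smul_mul_assoc, e1, e2, e3, h1, h2, h3, smul_add, smul_smul]
    match_scalars <;> field_simp <;> ring
  rw [ha, hb] at key
  simpa using key
end Serre

/-! ### The relations in terms of images of the generators -/

namespace Alg
variable {H X H' X' : Type}

variable (H X) in
/-- The image of `𝓔⁽ⁿ⁾`. -/
def homog (S : Rels H X) (n : ℕ) : Submodule ℂ (Alg S) :=
  (LinearMap.range (E.incl H X n)).map (ClosedQuot.mk (S (E H X) E.h E.x)).toLinearMap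

variable {S : Rels H X}

theorem x_mem_homog (j : X) : Alg.x S j ∈ homog H X S 1 :=
  ⟨_, ⟨_, (E.word_eq_incl (w := Word.x j) (n := 1) (Word.xdeg_x j)).symm⟩, rfl⟩

theorem texp_mem_homog {a : Alg S} (ha : a ∈ hspan S) : texp a ∈ homog H X S 0 := by
  rw [hspan_eq] at ha
  obtain ⟨a, ha, rfl⟩ := ha
  exact ⟨texp a, E.texp_mem ha, mk_texp ha⟩

theorem mul_mem_homog {m n : ℕ} {a b : Alg S} (ha : a ∈ homog H X S m) (hb : b ∈ homog H X S n) :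
    a * b ∈ homog H X S (m + n) := by
  obtain ⟨_, ⟨a, rfl⟩, rfl⟩ := ha
  obtain ⟨_, ⟨b, rfl⟩, rfl⟩ := hb
  exact ⟨_, ⟨_, (E.incl_mul a b).symm⟩, map_mul (ClosedQuot.mk (S (E H X) E.h E.x)) _ _⟩

/-- A continuous homomorphism between presented algebras is given by images of the generators in
degrees zero and one that satisfy the relations. -/
theorem exists_genHom [Finite H] [Finite X] {S' : Rels H' X'} (a : H → Alg S') (y : X → Alg S')
    (ha : ∀ i, a i ∈ hspan S') (hy : ∀ j, y j ∈ homog H' X' S' 1)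
    (hS : ∀ θ : E H X →ₐ[ℂ] Alg S', Continuous θ → (∀ i, θ (E.h i) = a i) →
      (∀ j, θ (E.x j) = y j) → ∀ r ∈ S (E H X) E.h E.x, θ r = 0) :
    ∃ φ : Alg S →ₐ[ℂ] Alg S', IsGenHom φ a y := by
  simp only [hspan_eq] at ha
  choose a' ha1 ha2 using ha
  choose y' hy1 hy2 using hy
  obtain rfl : _ = a := funext ha2
  obtain rfl : _ = y := funext hy2
  exact exists_hom a' (fun i j => E.hspan_commute (ha1 i) (ha1 j)) y' (fun i => E.hspan_le (ha1 i))
    hy1 hS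

end Alg

/-- The elements of two families of generators commute with each other. -/
structure CrossCommute {H X B : Type*} [Mul B] (h₁ : H → B) (x₁ : X → B) (h₂ : H → B) (x₂ : X → B) :
    Prop where
  hh : ∀ i j, Commute (h₁ i) (h₂ j)
  hx : ∀ i j, Commute (h₁ i) (x₂ j)
  xh : ∀ i j, Commute (x₁ i) (h₂ j)
  xx : ∀ i j, Commute (x₁ i) (x₂ j)

/-- The relations of the completed tensor product: those of the two factors and the commutation of
their generators. -/
theorem Rels.double_iff {H X C B : Type} [Ring C] [Algebra ℂ C] [TopologicalSpace C] [Ring B]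
    [Algebra ℂ B] (S : Rels H X) (θ : C →ₐ[ℂ] B) (a : H ⊕ H → C) (y : X ⊕ X → C) :
    (∀ r ∈ S.double C a y, θ r = 0) ↔
      (∀ r ∈ S C (a ∘ Sum.inl) (y ∘ Sum.inl), θ r = 0) ∧
      (∀ r ∈ S C (a ∘ Sum.inr) (y ∘ Sum.inr), θ r = 0) ∧
      CrossCommute (θ ∘ a ∘ Sum.inl) (θ ∘ y ∘ Sum.inl) (θ ∘ a ∘ Sum.inr) (θ ∘ y ∘ Sum.inr) := by
  have key : ∀ a b, θ (a * b - b * a) = 0 ↔ Commute (θ a) (θ b) := fun a b => by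
    rw [map_sub, map_mul, map_mul, sub_eq_zero]
    rfl
  constructor
  · intro h
    refine ⟨fun r hr => h r (.inl (.inl hr)), fun r hr => h r (.inl (.inr hr)),
      fun i j => ?_, fun i j => ?_, fun i j => ?_, fun i j => ?_⟩
    · exact (key _ _).1 (h _ (.inr ⟨_, _, .inl ⟨i, rfl⟩, .inl ⟨j, rfl⟩, rfl⟩))
    · exact (key _ _).1 (h _ (.inr ⟨_, _, .inl ⟨i, rfl⟩, .inr ⟨j, rfl⟩, rfl⟩))
    · exact (key _ _).1 (h _ (.inr ⟨_, _, .inr ⟨i, rfl⟩, .inl ⟨j, rfl⟩, rfl⟩))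
    · exact (key _ _).1 (h _ (.inr ⟨_, _, .inr ⟨i, rfl⟩, .inr ⟨j, rfl⟩, rfl⟩))
  · rintro ⟨h1, h2, h3⟩ r ((hr | hr) | ⟨a, b, ha, hb, rfl⟩)
    · exact h1 r hr
    · exact h2 r hr
    · rw [key]
      obtain ⟨i, rfl⟩ | ⟨i, rfl⟩ := ha <;> obtain ⟨j, rfl⟩ | ⟨j, rfl⟩ := hb
      exacts [h3.hh i j, h3.hx i j, h3.xh i j, h3.xx i j]

namespace AF

/-- The relations of `A_F`, for elements of an arbitrary algebra. -/
def Holds (ω : ℂ) {B : Type*} [Ring B] [Algebra ℂ B] (h : B) (x : Pm ⊕ Pm → B) : Prop :=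
  ∀ j, h * x j - x j * h = (Sum.elim Pm.val Pm.val j * ω) • x j

theorem rels_iff {C B : Type} [Ring C] [Algebra ℂ C] [TopologicalSpace C] [Ring B] [Algebra ℂ B]
    {ω : ℂ} (θ : C →ₐ[ℂ] B) (a : Unit → C) (y : Pm ⊕ Pm → C) :
    (∀ r ∈ rels ω C a y, θ r = 0) ↔ Holds ω (θ (a ())) (θ ∘ y) := by
  have key : ∀ (c : ℂ) (z : C), θ (a () * z - z * a () - c • z) = 0 ↔
      θ (a ()) * θ z - θ z * θ (a ()) = c • θ z := fun c z => by
    rw [map_sub, map_sub, map_mul, map_mul, map_smul, sub_eq_zero]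
  constructor
  · rintro h (s | s)
    · exact (key _ _).1 (h _ (.inl ⟨s, rfl⟩))
    · exact (key _ _).1 (h _ (.inr ⟨s, rfl⟩))
  · rintro h r (⟨s, rfl⟩ | ⟨s, rfl⟩)
    · exact (key _ _).2 (h (Sum.inl s))
    · exact (key _ _).2 (h (Sum.inr s))

end AF

namespace Uq

/-- The relations of `Ũ_ħ(Lsl₂)`, for elements of an arbitrary algebra, where `K i` and `K' i` stand
for `e^{ħ h_i}` and `e^{-ħ h_i}`. -/
structure Holds (ħ : ℂ) {B : Type*} [Ring B] [Algebra ℂ B] (h : Fin 2 → B) (x : Pm × Fin 2 → B)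
    (K K' : Fin 2 → B) : Prop where
  h_add : h 0 + h 1 = 0
  weight : ∀ s i, h i * x (s, i) - x (s, i) * h i = (2 * s.val) • x (s, i)
  comm_same : ∀ i, x (.pos, i) * x (.neg, i) - x (.neg, i) * x (.pos, i) =
    (Complex.exp ħ - Complex.exp (-ħ))⁻¹ • (K i - K' i)
  comm_ne : ∀ i j, i ≠ j → x (.pos, i) * x (.neg, j) = x (.neg, j) * x (.pos, i)
  serre : ∀ s i j, i ≠ j → serre (three ħ) (x (s, i)) (x (s, j)) = 0

theorem Holds.map {ħ : ℂ} {B C : Type*} [Ring B] [Algebra ℂ B] [Ring C] [Algebra ℂ C]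
    {h : Fin 2 → B} {x : Pm × Fin 2 → B} {K K' : Fin 2 → B} (H : Holds ħ h x K K') (f : B →ₐ[ℂ] C) :
    Holds ħ (f ∘ h) (f ∘ x) (f ∘ K) (f ∘ K') where
  h_add := by simpa using congrArg f H.h_add
  weight s i := by simpa using congrArg f (H.weight s i)
  comm_same i := by simpa using congrArg f (H.comm_same i)
  comm_ne i j hij := by simpa using congrArg f (H.comm_ne i j hij)
  serre s i j hij := by simpa [SinhGordon.serre] using congrArg f (H.serre s i j hij)

theorem rels_iff {C B : Type} [Ring C] [Algebra ℂ C] [TopologicalSpace C] [Ring B] [Algebra ℂ B]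
    {ħ : ℂ} (θ : C →ₐ[ℂ] B) (a : Fin 2 → C) (y : Pm × Fin 2 → C) :
    (∀ r ∈ rels ħ C a y, θ r = 0) ↔ Holds ħ (θ ∘ a) (θ ∘ y) (fun i => θ (texp (ħ • a i)))
      (fun i => θ (texp (-ħ • a i))) := by
  constructor
  · intro h
    refine ⟨?_, fun s i => ?_, fun i => ?_, fun i j hij => ?_, fun s i j _ => ?_⟩
    · simpa using h _ (.inl (.inl (.inl (.inl rfl))))
    · simpa [sub_eq_zero] using h _ (.inl (.inl (.inl (.inr ⟨s, i, rfl⟩))))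
    · simpa [sub_eq_zero] using h _ (.inl (.inl (.inr ⟨i, rfl⟩)))
    · simpa [sub_eq_zero] using h _ (.inl (.inr ⟨i, j, hij, rfl⟩))
    · simpa [SinhGordon.serre] using h _ (.inr ⟨s, i, j, rfl⟩)
  · rintro h r ((((hr | ⟨s, i, rfl⟩) | ⟨i, rfl⟩) | ⟨i, j, hij, rfl⟩) | ⟨s, i, j, rfl⟩)
    · rw [Set.mem_singleton_iff.1 hr, map_add]
      exact h.h_add
    · simpa [sub_eq_zero] using h.weight s i
    · simpa [sub_eq_zero] using h.comm_same i
    · simpa [sub_eq_zero] using h.comm_ne i j hij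
    · obtain rfl | hij := eq_or_ne i j
      · have h1 : y (s, i) * y (s, i) * y (s, i) ^ 2 = y (s, i) ^ 2 * y (s, i) * y (s, i) := by
          noncomm_ring
        rw [h1, ← pow_succ, ← pow_succ']
        simp
      · simpa [SinhGordon.serre] using h.serre s i j hij

end Uq

/-! ### Compatibility of the coproduct with the relations -/

namespace Uq

theorem Holds.h_one {ħ : ℂ} {B : Type*} [Ring B] [Algebra ℂ B] {h : Fin 2 → B} {x : Pm × Fin 2 → B}
    {K K' : Fin 2 → B} (H : Holds ħ h x K K') : h 1 = -h 0 := (neg_eq_of_add_eq_zero_right H.h_add).symm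

/-- The weight of `e_j^±` with respect to `h_i`. -/
def cartan (s : Pm) (i j : Fin 2) : ℂ := if i = j then 2 * s.val else -(2 * s.val)

theorem cartan_same (s : Pm) (i : Fin 2) : cartan s i i = 2 * s.val := if_pos rfl

theorem cartan_ne (s : Pm) {i j : Fin 2} (h : i ≠ j) : cartan s i j = -(2 * s.val) := if_neg h

/-- The relation `h₀ = -h₁` determines the weights of all generators. -/
theorem Holds.weight' {ħ : ℂ} {B : Type*} [Ring B] [Algebra ℂ B] {h : Fin 2 → B}
    {x : Pm × Fin 2 → B} {K K' : Fin 2 → B} (H : Holds ħ h x K K') (s : Pm) (i j : Fin 2) :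
    h i * x (s, j) - x (s, j) * h i = cartan s i j • x (s, j) := by
  have h0 := H.weight s 0
  have h1 := H.weight s 1
  rw [H.h_one] at h1
  have h1' : h 0 * x (s, 1) - x (s, 1) * h 0 = -((2 * s.val) • x (s, 1)) := by
    rw [← h1]; noncomm_ring
  have h0' : -h 0 * x (s, 0) - x (s, 0) * -h 0 = -((2 * s.val) • x (s, 0)) := by
    rw [← h0]; noncomm_ring
  rw [← neg_smul] at h0' h1'
  fin_cases i <;> fin_cases j <;> simp only [Fin.zero_eta, Fin.mk_one, H.h_one]
  · rw [h0, cartan_same]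
  · rw [h1', cartan_ne _ (by decide)]
  · rw [h0', cartan_ne _ (by decide)]
  · rw [h1, cartan_same]

/-- The relations of `Ũ_ħ(Lsl₂)` with the commutation relations of `K i = e^{ħ h_i}` and
`K' i = e^{-ħ h_i}`. -/
structure KHolds (ħ : ℂ) {B : Type*} [Ring B] [Algebra ℂ B] (h : Fin 2 → B) (x : Pm × Fin 2 → B)
    (K K' : Fin 2 → B) : Prop extends Holds ħ h x K K' where
  K_x : ∀ s i j, K i * x (s, j) = Complex.exp (ħ * cartan s i j) • (x (s, j) * K i)
  K'_x : ∀ s i j, K' i * x (s, j) = Complex.exp (-ħ * cartan s i j) • (x (s, j) * K' i)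
  h_K : ∀ i j, Commute (h i) (K j)
  h_K' : ∀ i j, Commute (h i) (K' j)
  K_K : ∀ i j, Commute (K i) (K j)
  K'_K' : ∀ i j, Commute (K' i) (K' j)

/-- The values of the coproduct on the generators `e_i^±`. -/
def comulX {B : Type*} [Ring B] (x₁ x₂ : Pm × Fin 2 → B) (K K' : Fin 2 → B) : Pm × Fin 2 → B
  | (.pos, i) => x₁ (.pos, i) * K i + x₂ (.pos, i)
  | (.neg, i) => x₁ (.neg, i) + K' i * x₂ (.neg, i)

section comul
variable {ħ : ℂ} {B : Type*} [Ring B] [Algebra ℂ B] {h₁ h₂ : Fin 2 → B} {x₁ x₂ : Pm × Fin 2 → B}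
  {K₁ K₁' K₂ K₂' : Fin 2 → B}

/-- The number `[3]_q` is `u + 1 + u⁻¹` for `u = q²`. -/
theorem three_eq (hħ : Complex.exp ħ - Complex.exp (-ħ) ≠ 0) :
    three ħ = Complex.exp (2 * ħ) + 1 + (Complex.exp (2 * ħ))⁻¹ := by
  rw [three, div_eq_iff hħ, ← Complex.exp_neg, add_mul, add_mul]
  simp only [mul_sub, ← Complex.exp_add, one_mul]
  ring_nf

/-- The coproduct is compatible with the relations of `Ũ_ħ(Lsl₂)`. -/
theorem Holds.comul (hħ : Complex.exp ħ - Complex.exp (-ħ) ≠ 0)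
    (H₁ : KHolds ħ h₁ x₁ K₁ K₁') (H₂ : KHolds ħ h₂ x₂ K₂ K₂')
    (hc : CrossCommute (Sum.elim h₁ (Sum.elim K₁ K₁')) x₁ (Sum.elim h₂ (Sum.elim K₂ K₂')) x₂) :
    Holds ħ (fun i => h₁ i + h₂ i) (comulX x₁ x₂ K₂ K₁') (fun i => K₁ i * K₂ i)
      (fun i => K₁' i * K₂' i) := by
  have hxx : ∀ p q, x₁ p * x₂ q = x₂ q * x₁ p := fun p q => hc.xx p q
  have hhx : ∀ p q, h₁ p * x₂ q = x₂ q * h₁ p := fun p q => hc.hx (.inl p) q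
  have hKx : ∀ p q, K₁' p * x₂ q = x₂ q * K₁' p := fun p q => hc.hx (.inr (.inr p)) q
  have hxh : ∀ p q, x₁ p * h₂ q = h₂ q * x₁ p := fun p q => hc.xh p (.inl q)
  have hxK : ∀ p q, x₁ p * K₂ q = K₂ q * x₁ p := fun p q => hc.xh p (.inr (.inl q))
  have hhK : ∀ p q, h₁ p * K₂ q = K₂ q * h₁ p := fun p q => hc.hh (.inl p) (.inr (.inl q))
  have hKh : ∀ p q, K₁' p * h₂ q = h₂ q * K₁' p := fun p q => hc.hh (.inr (.inr p)) (.inl q)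
  have hKK : ∀ p q, K₁' p * K₂ q = K₂ q * K₁' p := fun p q => hc.hh (.inr (.inr p)) (.inr (.inl q))
  -- the mixed terms in the commutator of positive and negative generators cancel
  have key : ∀ i j, (x₁ (.pos, i) * K₂ i + x₂ (.pos, i)) * (x₁ (.neg, j) + K₁' j * x₂ (.neg, j)) -
      (x₁ (.neg, j) + K₁' j * x₂ (.neg, j)) * (x₁ (.pos, i) * K₂ i + x₂ (.pos, i)) =
      (x₁ (.pos, i) * x₁ (.neg, j) - x₁ (.neg, j) * x₁ (.pos, i)) * K₂ i +
      K₁' j * (x₂ (.pos, i) * x₂ (.neg, j) - x₂ (.neg, j) * x₂ (.pos, i)) := fun i j => by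
    have hcar : -ħ * cartan .pos j i = ħ * cartan .neg i j := by
      by_cases hij : i = j
      · subst hij; simp [cartan, Pm.val]
      · rw [cartan_ne _ hij, cartan_ne _ (Ne.symm hij)]; simp [Pm.val]
    have h1 : x₁ (.pos, i) * K₂ i * (K₁' j * x₂ (.neg, j)) =
        K₁' j * x₂ (.neg, j) * (x₁ (.pos, i) * K₂ i) := by
      calc x₁ (.pos, i) * K₂ i * (K₁' j * x₂ (.neg, j))
          = x₁ (.pos, i) * (K₂ i * K₁' j) * x₂ (.neg, j) := by noncomm_ring
        _ = x₁ (.pos, i) * K₁' j * (K₂ i * x₂ (.neg, j)) := by rw [← hKK]; noncomm_ring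
        _ = (K₁' j * x₁ (.pos, i)) * (x₂ (.neg, j) * K₂ i) := by
          rw [H₂.K_x, H₁.K'_x, hcar, mul_smul_comm, smul_mul_assoc]
        _ = K₁' j * (x₁ (.pos, i) * x₂ (.neg, j)) * K₂ i := by noncomm_ring
        _ = _ := by rw [hxx]; noncomm_ring
    calc _ = x₁ (.pos, i) * (K₂ i * x₁ (.neg, j)) - x₁ (.neg, j) * x₁ (.pos, i) * K₂ i +
          (x₁ (.pos, i) * K₂ i * (K₁' j * x₂ (.neg, j)) -
            K₁' j * x₂ (.neg, j) * (x₁ (.pos, i) * K₂ i)) +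
          (x₂ (.pos, i) * x₁ (.neg, j) - x₁ (.neg, j) * x₂ (.pos, i)) +
          ((x₂ (.pos, i) * K₁' j) * x₂ (.neg, j) - K₁' j * (x₂ (.neg, j) * x₂ (.pos, i))) := by
            noncomm_ring
      _ = _ := by rw [h1, ← hxK, hxx, ← hKx]; noncomm_ring
  constructor
  · have := congrArg₂ (· + ·) H₁.h_add H₂.h_add
    rw [add_zero] at this
    rw [← this]
    abel
  · rintro (_ | _) i
    · have e1 := H₁.weight .pos i
      have e2 := H₂.weight .pos i
      calc (h₁ i + h₂ i) * (x₁ (.pos, i) * K₂ i + x₂ (.pos, i)) -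
            (x₁ (.pos, i) * K₂ i + x₂ (.pos, i)) * (h₁ i + h₂ i)
          = (h₁ i * x₁ (.pos, i) * K₂ i - x₁ (.pos, i) * (K₂ i * h₁ i)) +
            ((h₂ i * x₁ (.pos, i)) * K₂ i - x₁ (.pos, i) * (K₂ i * h₂ i)) +
            (h₁ i * x₂ (.pos, i) - x₂ (.pos, i) * h₁ i) +
            (h₂ i * x₂ (.pos, i) - x₂ (.pos, i) * h₂ i) := by noncomm_ring
        _ = (h₁ i * x₁ (.pos, i) - x₁ (.pos, i) * h₁ i) * K₂ i +
            (h₂ i * x₂ (.pos, i) - x₂ (.pos, i) * h₂ i) := by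
          rw [← hhK, ← hxh, hhx, ← (H₂.h_K i i).eq]; noncomm_ring
        _ = _ := by rw [e1, e2, comulX, smul_mul_assoc, smul_add]
    · have e1 := H₁.weight .neg i
      have e2 := H₂.weight .neg i
      calc (h₁ i + h₂ i) * (x₁ (.neg, i) + K₁' i * x₂ (.neg, i)) -
            (x₁ (.neg, i) + K₁' i * x₂ (.neg, i)) * (h₁ i + h₂ i)
          = (h₁ i * x₁ (.neg, i) - x₁ (.neg, i) * h₁ i) +
            (h₂ i * x₁ (.neg, i) - x₁ (.neg, i) * h₂ i) +
            ((h₁ i * K₁' i) * x₂ (.neg, i) - K₁' i * (x₂ (.neg, i) * h₁ i)) +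
            ((h₂ i * K₁' i) * x₂ (.neg, i) - K₁' i * (x₂ (.neg, i) * h₂ i)) := by noncomm_ring
        _ = (h₁ i * x₁ (.neg, i) - x₁ (.neg, i) * h₁ i) +
            K₁' i * (h₂ i * x₂ (.neg, i) - x₂ (.neg, i) * h₂ i) := by
          rw [← hKh, ← hxh, ← hhx, (H₁.h_K' i i).eq]; noncomm_ring
        _ = _ := by rw [e1, e2, comulX, mul_smul_comm, smul_add]
  · intro i
    refine (key i i).trans ?_
    rw [H₁.comm_same, H₂.comm_same, smul_mul_assoc, mul_smul_comm, ← smul_add]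
    congr 1
    noncomm_ring
  · intro i j hij
    refine sub_eq_zero.1 ((key i j).trans ?_)
    rw [H₁.comm_ne i j hij, H₂.comm_ne i j hij]
    simp
  · have hu := Complex.exp_ne_zero (2 * ħ)
    have S₁ := H₁.serre
    have S₂ := H₂.serre
    rw [three_eq hħ] at S₁ S₂ ⊢
    have hs : ∀ s i, Complex.exp (ħ * cartan s i i) = Complex.exp (2 * ħ * s.val) := fun s i => by
      rw [cartan_same]; ring_nf
    have hn : ∀ s i j, i ≠ j → Complex.exp (ħ * cartan s i j) = (Complex.exp (2 * ħ * s.val))⁻¹ :=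
      fun s i j hij => by rw [cartan_ne _ hij, ← Complex.exp_neg]; ring_nf
    have hs' : ∀ s i, Complex.exp (-ħ * cartan s i i) = (Complex.exp (2 * ħ * s.val))⁻¹ :=
      fun s i => by rw [cartan_same, ← Complex.exp_neg]; ring_nf
    have hn' : ∀ s i j, i ≠ j → Complex.exp (-ħ * cartan s i j) = Complex.exp (2 * ħ * s.val) :=
      fun s i j hij => by rw [cartan_ne _ hij]; ring_nf
    rintro (_ | _) i j hij
    · have e1 : ∀ i j, x₁ (.pos, i) * K₂ i * x₂ (.pos, j) =
          Complex.exp (ħ * cartan .pos i j) • (x₂ (.pos, j) * (x₁ (.pos, i) * K₂ i)) := fun i j => by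
        rw [mul_assoc, H₂.K_x, mul_smul_comm, ← mul_assoc, hxx, mul_assoc]
      refine serre_add hu ?_ ?_ ?_ ?_ (S₂ _ i j hij)
      · rw [e1, hs, Pm.val, mul_one]
      · rw [e1, hn _ _ _ hij, Pm.val, mul_one]
      · rw [e1, hn _ _ _ hij.symm, Pm.val, mul_one]
      · rw [serre_mul (hxK _ _).symm (hxK _ _).symm (hxK _ _).symm (H₂.K_K i j), S₁ _ i j hij,
          zero_mul]
    · have e1 : ∀ i j, K₁' i * x₂ (.neg, i) * x₁ (.neg, j) =
          Complex.exp (-ħ * cartan .neg i j) • (x₁ (.neg, j) * (K₁' i * x₂ (.neg, i))) := fun i j => by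
        rw [mul_assoc, ← hxx, ← mul_assoc, H₁.K'_x, smul_mul_assoc, mul_assoc]
      have hv : (Complex.exp (2 * ħ * Pm.neg.val))⁻¹ = Complex.exp (2 * ħ) := by
        rw [← Complex.exp_neg, Pm.val]; ring_nf
      have hv' : Complex.exp (2 * ħ * Pm.neg.val) = (Complex.exp (2 * ħ))⁻¹ := by
        rw [← hv, inv_inv]
      change SinhGordon.serre _ (x₁ (.neg, i) + K₁' i * x₂ (.neg, i))
        (x₁ (.neg, j) + K₁' j * x₂ (.neg, j)) = 0
      rw [add_comm (x₁ (.neg, i)), add_comm (x₁ (.neg, j))]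
      refine serre_add hu ?_ ?_ ?_ ?_ (S₁ _ i j hij)
      · rw [e1, hs', hv]
      · rw [e1, hn' _ _ _ hij, hv']
      · rw [e1, hn' _ _ _ hij.symm, hv']
      · rw [hKx, hKx, serre_mul (hKx _ _) (hKx _ _) (hKx _ _) (H₁.K'_K' i j), S₂ _ i j hij,
          zero_mul]

end comul
end Uq

/-! ### Counits and coproducts -/

instance : Finite Pm := Finite.of_injective (fun s : Pm => match s with | .pos => true | .neg => false)
  (by rintro (_ | _) (_ | _) h <;> simp_all)

/-- The counit of a presented algebra exists if the zero operators satisfy the relations. -/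
theorem Alg.exists_counit {H X : Type} [Finite H] [Finite X] {S : Rels H X}
    (hS : ∀ θ : E H X →ₐ[ℂ] Module.End ℂ ℂ, WeaklyContinuous θ → (∀ i, θ (E.h i) = 0) →
      (∀ j, θ (E.x j) = 0) → ∀ r ∈ S (E H X) E.h E.x, θ r = 0) :
    ∃ ε : Alg S →ₐ[ℂ] ℂ, IsGenHom ε 0 0 := by
  have hw : IsWeightData (V := ℂ) (0 : H → Module.End ℂ ℂ) (0 : X → Module.End ℂ ℂ) 0 :=
    ⟨fun i j => rfl, fun i j v => by simp, Submodule.eq_top_iff'.2 fun v =>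
      Submodule.subset_span fun i => ⟨0, by simp⟩⟩
  obtain ⟨θ, h1, h2, h3⟩ := hw.exists_rep
  obtain ⟨ρ, h4, h5, h6⟩ := Alg.exists_rep (S := S) θ h1 (hS θ h1 h2 h3)
  refine ⟨AlgHom.ofLinearMap (LinearMap.applyₗ (1 : ℂ) ∘ₗ ρ.toLinearMap) (by simp) fun a b => ?_,
    h4 1 LinearMap.id, fun i => ?_, fun j => ?_⟩
  · change ρ (a * b) 1 = ρ a 1 * ρ b 1
    rw [map_mul, Module.End.mul_apply, mul_comm, ← smul_eq_mul, ← map_smul, smul_eq_mul, mul_one]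
  · change ρ (Alg.h S i) 1 = 0
    rw [h5, h2]
    rfl
  · change ρ (Alg.x S j) 1 = 0
    rw [h6, h3]
    rfl

theorem E.texp_eigen {H X V : Type} [AddCommGroup V] [Module ℂ V] {θ : E H X →ₐ[ℂ] Module.End ℂ V}
    (hθ : WeaklyContinuous θ) (i : H) (t : ℂ) {c : ℂ} {v : V} (hv : θ (E.h i) v = c • v) :
    θ (texp (t • E.h i)) v = Complex.exp (t * c) • v :=
  SinhGordon.texp_eigen hθ (E.hasSum_texp (Submodule.smul_mem _ _ (E.h_mem_hspan i)))
    (by rw [map_smul, LinearMap.smul_apply, hv, smul_smul])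

namespace AF
variable (ω κ : ℂ)

theorem exists_counit : ∃ ε, IsCounit ω ε :=
  Alg.exists_counit fun θ _ hh hx => (rels_iff θ _ _).2 fun j => by simp [hh, hx]

theorem holds_left : Holds ω (h₁ ω) (fun j => Alg.x (rels ω).double (Sum.inl j)) :=
  (rels_iff (ClosedQuot.mk _) _ _).1 ((Rels.double_iff _ _ _ _).1
    fun _ hr => Alg.rel_eq_zero (rels ω).double hr).1

theorem holds_right : Holds ω (h₂ ω) (fun j => Alg.x (rels ω).double (Sum.inr j)) :=
  (rels_iff (ClosedQuot.mk _) _ _).1 ((Rels.double_iff _ _ _ _).1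
    fun _ hr => Alg.rel_eq_zero (rels ω).double hr).2.1

end AF

theorem Alg.crossCommute {H X : Type} (S : Rels H X) :
    CrossCommute (fun i => Alg.h S.double (Sum.inl i)) (fun i => Alg.x S.double (Sum.inl i))
      (fun i => Alg.h S.double (Sum.inr i)) (fun i => Alg.x S.double (Sum.inr i)) :=
  ((Rels.double_iff S (ClosedQuot.mk _) _ _).1 fun _ hr => Alg.rel_eq_zero S.double hr).2.2

theorem Alg.smul_h_mem {H X : Type} {S : Rels H X} (t : ℂ) (i : H) : t • Alg.h S i ∈ hspan S :=
  Submodule.smul_mem _ t (h_mem_hspan i)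

theorem Alg.texp_mul_mem_homog {H X : Type} {S : Rels H X} {a x : Alg S} (ha : a ∈ hspan S)
    {n : ℕ} (hx : x ∈ homog H X S n) : texp a * x ∈ homog H X S n := by
  have h := mul_mem_homog (texp_mem_homog ha) hx
  rwa [zero_add] at h

theorem Alg.mul_texp_mem_homog {H X : Type} {S : Rels H X} {a x : Alg S} (ha : a ∈ hspan S)
    {n : ℕ} (hx : x ∈ homog H X S n) : x * texp a ∈ homog H X S n := by
  have h := mul_mem_homog hx (texp_mem_homog ha)
  rwa [add_zero] at h

namespace AF
variable (ω κ : ℂ)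

/-- A twisted sum of two elements of the same weight has that weight. -/
theorem weight_comul {B : Type*} [Ring B] [Algebra ℂ B] {h₁ h₂ a b T : B} {c : ℂ}
    (e1 : h₁ * a - a * h₁ = c • a) (e2 : h₂ * b - b * h₂ = c • b) (c1 : Commute h₁ b)
    (c2 : Commute a h₂) (c3 : Commute T h₁) (c4 : Commute T h₂) :
    (h₁ + h₂) * (a + T * b) - (a + T * b) * (h₁ + h₂) = c • (a + T * b) := by
  rw [smul_add, ← mul_smul_comm, ← e1, ← e2]
  calc _ = (h₁ * a - a * h₁) + (h₂ * a - a * h₂) + ((h₁ * T) * b - T * (b * h₁)) +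
        ((h₂ * T) * b - T * b * h₂) := by noncomm_ring
    _ = _ := by rw [← c1.eq, c2.eq, ← c3.eq, ← c4.eq]; noncomm_ring

theorem exists_comul : ∃ Δ, IsComul ω κ Δ := by
  have hc := Alg.crossCommute (rels ω)
  refine Alg.exists_genHom _ _ (fun i => add_mem (Alg.h_mem_hspan _) (Alg.h_mem_hspan _)) ?_ ?_
  · rintro (s | s)
    · exact add_mem (Alg.x_mem_homog _) (Alg.texp_mul_mem_homog (Alg.smul_h_mem _ _) (Alg.x_mem_homog _))
    · exact add_mem (Alg.x_mem_homog _) (Alg.texp_mul_mem_homog (Alg.smul_h_mem _ _) (Alg.x_mem_homog _))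
  · intro θ _ hh hx
    refine (rels_iff θ _ _).2 fun j => ?_
    have key : ∀ t : ℂ, (h₁ ω + h₂ ω) * (Alg.x (rels ω).double (Sum.inl j) +
        texp (t • h₁ ω) * Alg.x (rels ω).double (Sum.inr j)) - (Alg.x (rels ω).double (Sum.inl j) +
        texp (t • h₁ ω) * Alg.x (rels ω).double (Sum.inr j)) * (h₁ ω + h₂ ω) =
        (Sum.elim Pm.val Pm.val j * ω) • (Alg.x (rels ω).double (Sum.inl j) +
        texp (t • h₁ ω) * Alg.x (rels ω).double (Sum.inr j)) := fun t =>
      weight_comul (holds_left ω j) (holds_right ω j) (hc.hx () j) (hc.xh j ())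
        (Alg.texp_commute (Alg.smul_h_mem _ _) ((Commute.refl (h₁ ω)).smul_left t))
        (Alg.texp_commute (Alg.smul_h_mem _ _) (Commute.smul_left (hc.hh () ()) t))
    rw [hh]
    rcases j with s | s
    · simp only [Function.comp_apply, hx]
      exact key _
    · simp only [Function.comp_apply, hx]
      exact key _

theorem exists_left : ∃ i₁ : Alg (rels ω) →ₐ[ℂ] Alg₂ (rels ω),
    IsGenHom i₁ (fun i => Alg.h (rels ω).double (Sum.inl i))
      (fun i => Alg.x (rels ω).double (Sum.inl i)) := by
  refine Alg.exists_genHom _ _ (fun i => Alg.h_mem_hspan _) (fun j => Alg.x_mem_homog _)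
    fun θ _ hh hx => (rels_iff θ _ _).2 fun j => ?_
  simp only [hh, hx, Function.comp_apply]
  exact holds_left ω j

theorem exists_right : ∃ i₁ : Alg (rels ω) →ₐ[ℂ] Alg₂ (rels ω),
    IsGenHom i₁ (fun i => Alg.h (rels ω).double (Sum.inr i))
      (fun i => Alg.x (rels ω).double (Sum.inr i)) := by
  refine Alg.exists_genHom _ _ (fun i => Alg.h_mem_hspan _) (fun j => Alg.x_mem_homog _)
    fun θ _ hh hx => (rels_iff θ _ _).2 fun j => ?_
  simp only [hh, hx, Function.comp_apply]
  exact holds_right ω j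

end AF

namespace Uq

section KHolds
variable {ħ : ℂ} {H X : Type} {S : Rels H X}

/-- The commutation relations of `e^{± ħ h_i}` follow from those of `h_i`. -/
theorem Holds.kHolds {h : Fin 2 → Alg S} {x : Pm × Fin 2 → Alg S} (hh : ∀ i, h i ∈ Alg.hspan S)
    (H : Holds ħ h x (fun i => texp (ħ • h i)) (fun i => texp (-ħ • h i))) :
    KHolds ħ h x (fun i => texp (ħ • h i)) (fun i => texp (-ħ • h i)) := by
  have hcomm : ∀ i j, Commute (h i) (h j) := fun i j => Alg.hspan_commute (hh i) (hh j)
  have hs : ∀ (t : ℂ) i, t • h i ∈ Alg.hspan S := fun t i => Submodule.smul_mem _ _ (hh i)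
  have hK : ∀ (t : ℂ) i j, Commute (h i) (texp (t • h j)) := fun t i j =>
    (Alg.texp_commute (hs t j) ((hcomm j i).smul_left t)).symm
  exact { toHolds := H
          K_x := fun s i j => Alg.texp_mul_smul (hh i) (H.weight' s i j) ħ
          K'_x := fun s i j => Alg.texp_mul_smul (hh i) (H.weight' s i j) (-ħ)
          h_K := hK ħ
          h_K' := hK (-ħ)
          K_K := fun i j => Alg.texp_commute (hs _ _) ((hK ħ i j).smul_left ħ)
          K'_K' := fun i j => Alg.texp_commute (hs _ _) ((hK (-ħ) i j).smul_left (-ħ)) }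

theorem mk_texp_h (i : H) (t : ℂ) : ClosedQuot.mk (S (E H X) E.h E.x) (texp (t • E.h i)) =
    texp (t • Alg.h S i) := by
  rw [Alg.mk_texp (Submodule.smul_mem _ _ (E.h_mem_hspan i)), map_smul]
  rfl

end KHolds

variable (ħ : ℂ)

theorem kHolds : KHolds ħ (h ħ) (fun p => e ħ p.1 p.2) (fun i => texp (ħ • h ħ i))
    (fun i => texp (-ħ • h ħ i)) := by
  refine Holds.kHolds (fun i => Alg.h_mem_hspan i) ?_
  have h1 := (rels_iff (ClosedQuot.mk _) _ _).1 fun _ hr => Alg.rel_eq_zero (rels ħ) hr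
  simp only [mk_texp_h] at h1
  exact h1

theorem kHolds_left : KHolds ħ (h₁ ħ) (fun p => e₁ ħ p.1 p.2) (fun i => texp (ħ • h₁ ħ i))
    (fun i => texp (-ħ • h₁ ħ i)) := by
  refine Holds.kHolds (fun i => Alg.h_mem_hspan _) ?_
  have h1 := (rels_iff (ClosedQuot.mk _) _ _).1 ((Rels.double_iff _ _ _ _).1
    fun _ hr => Alg.rel_eq_zero (rels ħ).double hr).1
  simp only [Function.comp_apply, mk_texp_h] at h1
  exact h1

theorem kHolds_right : KHolds ħ (h₂ ħ) (fun p => e₂ ħ p.1 p.2) (fun i => texp (ħ • h₂ ħ i))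
    (fun i => texp (-ħ • h₂ ħ i)) := by
  refine Holds.kHolds (fun i => Alg.h_mem_hspan _) ?_
  have h1 := (rels_iff (ClosedQuot.mk _) _ _).1 ((Rels.double_iff _ _ _ _).1
    fun _ hr => Alg.rel_eq_zero (rels ħ).double hr).2.1
  simp only [Function.comp_apply, mk_texp_h] at h1
  exact h1

end Uq

/-! ### The coproduct of `Ũ_ħ(Lsl₂)` and the homomorphism `ψ` -/

theorem weight_smul {B : Type*} [Ring B] [Algebra ℂ B] {h a : B} {c : ℂ}
    (e : h * a - a * h = c • a) (t : ℂ) : h * (t • a) - (t • a) * h = c • (t • a) := by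
  rw [mul_smul_comm, smul_mul_assoc, ← smul_sub, e, smul_comm]

namespace Uq
variable (ħ : ℂ)

theorem exists_left : ∃ i₁ : Alg (rels ħ) →ₐ[ℂ] Alg₂ (rels ħ),
    IsGenHom i₁ (fun i => Alg.h (rels ħ).double (Sum.inl i))
      (fun i => Alg.x (rels ħ).double (Sum.inl i)) := by
  refine Alg.exists_genHom _ _ (fun i => Alg.h_mem_hspan _) (fun j => Alg.x_mem_homog _)
    fun θ hθ hh hx => (rels_iff θ _ _).2 ?_
  simp only [E.map_texp hθ (Submodule.smul_mem _ _ (E.h_mem_hspan _)), map_smul, hh]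
  rw [show θ ∘ E.h = _ from funext hh, show θ ∘ E.x = _ from funext hx]
  exact (kHolds_left ħ).toHolds

theorem exists_right : ∃ i₂ : Alg (rels ħ) →ₐ[ℂ] Alg₂ (rels ħ),
    IsGenHom i₂ (fun i => Alg.h (rels ħ).double (Sum.inr i))
      (fun i => Alg.x (rels ħ).double (Sum.inr i)) := by
  refine Alg.exists_genHom _ _ (fun i => Alg.h_mem_hspan _) (fun j => Alg.x_mem_homog _)
    fun θ hθ hh hx => (rels_iff θ _ _).2 ?_
  simp only [E.map_texp hθ (Submodule.smul_mem _ _ (E.h_mem_hspan _)), map_smul, hh]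
  rw [show θ ∘ E.h = _ from funext hh, show θ ∘ E.x = _ from funext hx]
  exact (kHolds_right ħ).toHolds

/-- The two factors of the completed tensor product commute, also after exponentials of the `h_i`
are added to the generators. -/
theorem crossCommute : CrossCommute
    (Sum.elim (h₁ ħ) (Sum.elim (fun i => texp (ħ • h₁ ħ i)) (fun i => texp (-ħ • h₁ ħ i))))
    (fun p : Pm × Fin 2 => e₁ ħ p.1 p.2)
    (Sum.elim (h₂ ħ) (Sum.elim (fun i => texp (ħ • h₂ ħ i)) (fun i => texp (-ħ • h₂ ħ i))))
    (fun p : Pm × Fin 2 => e₂ ħ p.1 p.2) := by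
  have hc := Alg.crossCommute (rels ħ)
  have h1 : ∀ (t : ℂ) i {z}, Commute (h₁ ħ i) z → Commute (texp (t • h₁ ħ i)) z := fun t i z hz =>
    Alg.texp_commute (Alg.smul_h_mem _ _) (hz.smul_left t)
  have h2 : ∀ (t : ℂ) i {z}, Commute z (h₂ ħ i) → Commute z (texp (t • h₂ ħ i)) := fun t i z hz =>
    (Alg.texp_commute (Alg.smul_h_mem _ _) (hz.symm.smul_left t)).symm
  constructor
  · rintro (i | i | i) (j | j | j)
    · exact hc.hh i j
    · exact h2 _ _ (hc.hh i j)
    · exact h2 _ _ (hc.hh i j)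
    · exact h1 _ _ (hc.hh i j)
    · exact h1 _ _ (h2 _ _ (hc.hh i j))
    · exact h1 _ _ (h2 _ _ (hc.hh i j))
    · exact h1 _ _ (hc.hh i j)
    · exact h1 _ _ (h2 _ _ (hc.hh i j))
    · exact h1 _ _ (h2 _ _ (hc.hh i j))
  · rintro (i | i | i) j
    exacts [hc.hx i j, h1 _ _ (hc.hx i j), h1 _ _ (hc.hx i j)]
  · rintro j (i | i | i)
    exacts [hc.xh j i, h2 _ _ (hc.xh j i), h2 _ _ (hc.xh j i)]
  · exact fun i j => hc.xx i j

variable {ħ}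

theorem exists_comul (hħ : Complex.exp ħ - Complex.exp (-ħ) ≠ 0) : ∃ Δ, IsComul ħ Δ := by
  refine Alg.exists_genHom _ _ (fun i => add_mem (Alg.h_mem_hspan _) (Alg.h_mem_hspan _)) ?_ ?_
  · rintro ⟨s | s, i⟩
    · exact add_mem (Alg.mul_texp_mem_homog (Alg.smul_h_mem _ _) (Alg.x_mem_homog _))
        (Alg.x_mem_homog _)
    · exact add_mem (Alg.x_mem_homog _)
        (Alg.texp_mul_mem_homog (Alg.smul_h_mem _ _) (Alg.x_mem_homog _))
  · intro θ hθ hh hx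
    have h1 := Holds.comul hħ (kHolds_left ħ) (kHolds_right ħ) (crossCommute ħ)
    have h2 : comulX (fun p => e₁ ħ p.1 p.2) (fun p => e₂ ħ p.1 p.2) (fun i => texp (ħ • h₂ ħ i))
        (fun i => texp (-ħ • h₁ ħ i)) = comulE ħ := by
      ext ⟨s | s, i⟩ <;> rfl
    rw [h2] at h1
    refine (rels_iff θ _ _).2 ?_
    simp only [E.map_texp hθ (Submodule.smul_mem _ _ (E.h_mem_hspan _)), map_smul, hh, smul_add]
    rw [show θ ∘ E.h = _ from funext hh, show θ ∘ E.x = _ from funext hx]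
    have h3 : ∀ (t : ℂ) i, texp (t • h₁ ħ i + t • h₂ ħ i) = texp (t • h₁ ħ i) * texp (t • h₂ ħ i) :=
      fun t i => Alg.texp_add (Alg.smul_h_mem _ _) (Alg.smul_h_mem _ _)
    simp only [h3]
    exact h1

variable (ħ)

theorem exists_counit : ∃ ε, IsCounit ħ ε := by
  refine Alg.exists_counit fun θ hθ hh hx => (rels_iff θ _ _).2 ?_
  have h1 : ∀ (t : ℂ) i, θ (texp (t • E.h i)) = 1 := fun t i => LinearMap.ext fun v => by
    rw [E.texp_eigen (c := 0) hθ i t (by simp [hh])]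
    simp
  simp only [h1]
  rw [show θ ∘ E.h = 0 from funext hh, show θ ∘ E.x = 0 from funext hx]
  constructor <;> simp [serre]

/-- The values of `ψ` on the generators `f^±` and `f̄^±`, for elements of an arbitrary algebra. -/
def psiOf {B : Type} [Ring B] [Algebra ℂ B] [TopologicalSpace B] (ζ ξ : ℂ) (h : Fin 2 → B)
    (x : Pm × Fin 2 → B) : Pm ⊕ Pm → B
  | .inl .pos => x (.pos, 0) * texp (-ħ • h 0)
  | .inl .neg => (ξ * c ħ) • (x (.pos, 1) * texp (-ħ • h 1))
  | .inr .pos => x (.neg, 1)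
  | .inr .neg => (ζ * c ħ) • x (.neg, 0)

variable {ħ}
variable {H X : Type} {S : Rels H X} {h : Fin 2 → Alg S} {x : Pm × Fin 2 → Alg S}
  (ω ζ ξ : ℂ)

theorem psiOf_mem_homog (hh : ∀ i, h i ∈ Alg.hspan S) (hx : ∀ j, x j ∈ Alg.homog H X S 1) (j) :
    psiOf ħ ζ ξ h x j ∈ Alg.homog H X S 1 := by
  rcases j with (_ | _) | (_ | _)
  · exact Alg.mul_texp_mem_homog (Submodule.smul_mem _ _ (hh _)) (hx _)
  · exact Submodule.smul_mem _ _ (Alg.mul_texp_mem_homog (Submodule.smul_mem _ _ (hh _)) (hx _))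
  · exact hx _
  · exact Submodule.smul_mem _ _ (hx _)

/-- The images of the generators of `A_F` under `ψ` have the right weights for `(ω / 2) h₀`. -/
theorem KHolds.psi (H : KHolds ħ h x (fun i => texp (ħ • h i)) (fun i => texp (-ħ • h i))) :
    AF.Holds ω ((ω / 2) • h 0) (psiOf ħ ζ ξ h x) := by
  have h1 : ∀ (s t : Pm) (i j : Fin 2) (z : Alg S), z * h 0 = h 0 * z → cartan s 0 i = 2 * t.val →
      ((ω / 2) • h 0) * (x (s, i) * z) - (x (s, i) * z) * ((ω / 2) • h 0) =
        (t.val * ω) • (x (s, i) * z) := fun s t i j z hz ht => by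
    rw [smul_mul_assoc, mul_smul_comm, ← smul_sub, mul_assoc, hz, ← mul_assoc, ← mul_assoc,
      ← sub_mul, H.weight' s 0 i, ht, smul_mul_assoc, smul_smul]
    congr 1
    ring
  rintro ((_ | _) | (_ | _))
  · exact h1 .pos .pos 0 0 _ (H.h_K' 0 0).symm.eq (cartan_same _ _)
  · have := h1 .pos .neg 1 0 _ (H.h_K' 0 1).symm.eq (by rw [cartan_ne _ (by decide)]; simp [Pm.val])
    exact weight_smul this _
  · have := h1 .neg .pos 1 0 1 (by simp) (by rw [cartan_ne _ (by decide)]; simp [Pm.val])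
    rwa [mul_one] at this
  · have := h1 .neg .neg 0 0 1 (by simp) (by rw [cartan_same])
    rw [mul_one] at this
    exact weight_smul this _

theorem psiX_eq : psiX ħ ζ ξ = psiOf ħ ζ ξ (Uq.h ħ) (fun p => e ħ p.1 p.2) := by
  ext ((_ | _) | (_ | _)) <;> rfl

theorem exists_psi : ∃ ψ, IsPsi ħ ω ζ ξ ψ := by
  refine Alg.exists_genHom _ _ (fun i => Alg.smul_h_mem _ _) ?_ ?_
  · rw [psiX_eq]
    exact psiOf_mem_homog ζ ξ (fun _ => Alg.h_mem_hspan _) fun _ => Alg.x_mem_homog _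
  · intro θ hθ hh hx
    refine (AF.rels_iff θ _ _).2 ?_
    rw [show θ ∘ E.x = _ from funext hx, hh, psiX_eq]
    exact (kHolds ħ).psi ω ζ ξ

/-- The values of `ψ ⊗̄ ψ` on the generators. -/
theorem exists_psi₂ : ∃ ψ₂ : Alg₂ (AF.rels ω) →ₐ[ℂ] Alg₂ (rels ħ), IsGenHom ψ₂
    (Sum.elim (fun _ => (ω / 2) • h₁ ħ 0) (fun _ => (ω / 2) • h₂ ħ 0))
    (Sum.elim (psiOf ħ ζ ξ (h₁ ħ) (fun p => e₁ ħ p.1 p.2))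
      (psiOf ħ ζ ξ (h₂ ħ) (fun p => e₂ ħ p.1 p.2))) := by
  refine Alg.exists_genHom _ _ ?_ ?_ ?_
  · rintro (_ | _)
    exacts [Alg.smul_h_mem _ _, Alg.smul_h_mem _ _]
  · rintro (j | j)
    exacts [psiOf_mem_homog ζ ξ (fun _ => Alg.h_mem_hspan _) (fun _ => Alg.x_mem_homog _) j,
      psiOf_mem_homog ζ ξ (fun _ => Alg.h_mem_hspan _) (fun _ => Alg.x_mem_homog _) j]
  · intro θ hθ hh hx
    have hc := crossCommute ħ
    -- commutants are subalgebras, so it is enough to consider the factors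
    have hl : ∀ z, (∀ i, Commute (h₁ ħ i) z) → (∀ p : Pm × Fin 2, Commute (e₁ ħ p.1 p.2) z) →
        ∀ j, Commute (psiOf ħ ζ ξ (h₁ ħ) (fun p => e₁ ħ p.1 p.2) j) z := fun z h1 h2 j => by
      have h3 : ∀ i, Commute (texp (-ħ • h₁ ħ i)) z := fun i =>
        Alg.texp_commute (Alg.smul_h_mem _ _) ((h1 i).smul_left _)
      rcases j with (_ | _) | (_ | _)
      exacts [(h2 _).mul_left (h3 _), ((h2 _).mul_left (h3 _)).smul_left _, h2 _,
        (h2 _).smul_left _]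
    have hr : ∀ z, (∀ i, Commute z (h₂ ħ i)) → (∀ p : Pm × Fin 2, Commute z (e₂ ħ p.1 p.2)) →
        ∀ j, Commute z (psiOf ħ ζ ξ (h₂ ħ) (fun p => e₂ ħ p.1 p.2) j) := fun z h1 h2 j => by
      have h3 : ∀ i, Commute z (texp (-ħ • h₂ ħ i)) := fun i =>
        (Alg.texp_commute (Alg.smul_h_mem _ _) ((h1 i).symm.smul_left _)).symm
      rcases j with (_ | _) | (_ | _)
      exacts [(h2 _).mul_right (h3 _), ((h2 _).mul_right (h3 _)).smul_right _, h2 _,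
        (h2 _).smul_right _]
    refine (Rels.double_iff _ _ _ _).2 ⟨(AF.rels_iff θ _ _).2 ?_, (AF.rels_iff θ _ _).2 ?_, ?_⟩
    · rw [← Function.comp_assoc, funext (f := θ ∘ E.x) hx, Function.comp_apply, hh]
      exact (kHolds_left ħ).psi ω ζ ξ
    · rw [← Function.comp_assoc, funext (f := θ ∘ E.x) hx, Function.comp_apply, hh]
      exact (kHolds_right ħ).psi ω ζ ξ
    · rw [← Function.comp_assoc, ← Function.comp_assoc, ← Function.comp_assoc, ← Function.comp_assoc,
        funext (f := θ ∘ E.x) hx, funext (f := θ ∘ E.h) hh]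
      refine ⟨fun i j => ?_, fun i j => ?_, fun i j => ?_, fun i j => ?_⟩
      · exact ((hc.hh (.inl 0) (.inl 0)).smul_left _).smul_right _
      · exact hr _ (fun i => (hc.hh (.inl 0) (.inl i)).smul_left _)
          (fun p => (hc.hx (.inl 0) p).smul_left _) j
      · exact hl _ (fun i => (hc.hh (.inl i) (.inl 0)).smul_right _)
          (fun p => (hc.xh p (.inl 0)).smul_right _) i
      · exact hl _ (fun i => hr _ (fun k => hc.hh (.inl i) (.inl k)) (fun p => hc.hx (.inl i) p) j)
          (fun p => hr _ (fun k => hc.xh p (.inl k)) (fun q => hc.xx p q) j) i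

end Uq

/-! ### Compatibility of `ψ` with coproducts and counits -/

namespace Uq
variable {ħ ω κ ζ ξ : ℂ}

theorem map_psiOf {H X H' X' : Type} {S : Rels H X} {S' : Rels H' X'} {φ : Alg S →ₐ[ℂ] Alg S'}
    (hφ : Continuous φ) {h : Fin 2 → Alg S} (hh : ∀ i, h i ∈ Alg.hspan S) (x : Pm × Fin 2 → Alg S)
    (j : Pm ⊕ Pm) : φ (psiOf ħ ζ ξ h x j) =
      psiOf ħ ζ ξ (fun i => φ (h i)) (fun p => φ (x p)) j := by
  have h1 : ∀ i, φ (texp (-ħ • h i)) = texp (-ħ • φ (h i)) := fun i => by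
    rw [Alg.map_texp hφ (Submodule.smul_mem _ _ (hh i)), map_smul]
  rcases j with (_ | _) | (_ | _) <;> simp only [psiOf, map_mul, map_smul, h1]

/-- On generators, `ψ ⊗̄ ψ` is compatible with the two embeddings of the factors. -/
theorem isDoubleOf {ψ : Alg (AF.rels ω) →ₐ[ℂ] Alg (rels ħ)} (hψ : IsPsi ħ ω ζ ξ ψ)
    {ψ₂ : Alg₂ (AF.rels ω) →ₐ[ℂ] Alg₂ (rels ħ)} (hψ₂ : IsGenHom ψ₂
      (Sum.elim (fun _ => (ω / 2) • h₁ ħ 0) (fun _ => (ω / 2) • h₂ ħ 0))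
      (Sum.elim (psiOf ħ ζ ξ (h₁ ħ) (fun p => e₁ ħ p.1 p.2))
        (psiOf ħ ζ ξ (h₂ ħ) (fun p => e₂ ħ p.1 p.2)))) : IsDoubleOf ψ₂ ψ := by
  obtain ⟨i₁, hi₁⟩ := AF.exists_left ω
  obtain ⟨i₂, hi₂⟩ := AF.exists_right ω
  obtain ⟨j₁, hj₁⟩ := exists_left ħ
  obtain ⟨j₂, hj₂⟩ := exists_right ħ
  refine ⟨i₁, i₂, j₁, j₂, hi₁, hi₂, hj₁, hj₂, hψ₂.cont, fun a => ?_, fun a => ?_⟩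
  · refine DFunLike.congr_fun (Alg.hom_ext (φ := ψ₂.comp i₁) (χ := j₁.comp ψ)
      (hψ₂.cont.comp hi₁.cont) (hj₁.cont.comp hψ.cont) (fun i => ?_) fun j => ?_) a
    · rw [AlgHom.comp_apply, AlgHom.comp_apply, hi₁.map_h, hψ₂.map_h, hψ.map_h, map_smul, h, hj₁.map_h]
      rfl
    · rw [AlgHom.comp_apply, AlgHom.comp_apply, hi₁.map_x, hψ₂.map_x, hψ.map_x, psiX_eq,
        map_psiOf (h := h ħ) hj₁.cont fun _ => Alg.h_mem_hspan _]
      simp only [h, e, hj₁.map_h, hj₁.map_x]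
      rfl
  · refine DFunLike.congr_fun (Alg.hom_ext (φ := ψ₂.comp i₂) (χ := j₂.comp ψ)
      (hψ₂.cont.comp hi₂.cont) (hj₂.cont.comp hψ.cont) (fun i => ?_) fun j => ?_) a
    · rw [AlgHom.comp_apply, AlgHom.comp_apply, hi₂.map_h, hψ₂.map_h, hψ.map_h, map_smul, h, hj₂.map_h]
      rfl
    · rw [AlgHom.comp_apply, AlgHom.comp_apply, hi₂.map_x, hψ₂.map_x, hψ.map_x, psiX_eq,
        map_psiOf (h := h ħ) hj₂.cont fun _ => Alg.h_mem_hspan _]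
      simp only [h, e, hj₂.map_h, hj₂.map_x]
      rfl

theorem counit_psi {ψ : Alg (AF.rels ω) →ₐ[ℂ] Alg (rels ħ)} (hψ : IsPsi ħ ω ζ ξ ψ)
    {εA : Alg (AF.rels ω) →ₐ[ℂ] ℂ} (hA : AF.IsCounit ω εA) {εU : Alg (rels ħ) →ₐ[ℂ] ℂ}
    (hU : IsCounit ħ εU) (a : Alg (AF.rels ω)) : εU (ψ a) = εA a := by
  have hx : ∀ s i, εU (e ħ s i) = 0 := fun s i => hU.map_x (s, i)
  have hh : εU (h ħ 0) = 0 := hU.map_h 0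
  refine DFunLike.congr_fun (Alg.hom_ext (φ := εU.comp ψ) (hU.cont.comp hψ.cont) hA.cont
    (fun i => ?_) fun j => ?_) a
  · rw [AlgHom.comp_apply, hψ.map_h, hA.map_h, map_smul, hh, smul_zero]
    rfl
  · rw [AlgHom.comp_apply, hψ.map_x, hA.map_x]
    rcases j with (_ | _) | (_ | _) <;> simp [psiX, hx]

/-- The coproducts are compatible with `ψ` since `ψ(e^{κ ω h}) = e^{-ħ h₀} = e^{ħ h₁}`, which is
where `ħ = -κ ω² / 2` enters. -/
theorem comul_psi (hħ : ħ = -(κ * ω ^ 2) / 2) {ψ : Alg (AF.rels ω) →ₐ[ℂ] Alg (rels ħ)}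
    (hψ : IsPsi ħ ω ζ ξ ψ)
    {ψ₂ : Alg₂ (AF.rels ω) →ₐ[ℂ] Alg₂ (rels ħ)} (hψ₂ : IsGenHom ψ₂
      (Sum.elim (fun _ => (ω / 2) • h₁ ħ 0) (fun _ => (ω / 2) • h₂ ħ 0))
      (Sum.elim (psiOf ħ ζ ξ (h₁ ħ) (fun p => e₁ ħ p.1 p.2))
        (psiOf ħ ζ ξ (h₂ ħ) (fun p => e₂ ħ p.1 p.2))))
    {ΔA : Alg (AF.rels ω) →ₐ[ℂ] Alg₂ (AF.rels ω)} (hA : AF.IsComul ω κ ΔA)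
    {ΔU : Alg (rels ħ) →ₐ[ℂ] Alg₂ (rels ħ)} (hU : IsComul ħ ΔU) (a : Alg (AF.rels ω)) :
    ψ₂ (ΔA a) = ΔU (ψ a) := by
  refine DFunLike.congr_fun (Alg.hom_ext (φ := ψ₂.comp ΔA) (χ := ΔU.comp ψ)
    (hψ₂.cont.comp hA.cont) (hU.cont.comp hψ.cont) (fun i => ?_) fun j => ?_) a
  · rw [AlgHom.comp_apply, AlgHom.comp_apply, hA.map_h, hψ.map_h, map_add, map_smul, h, hU.map_h,
      AF.h₁, AF.h₂, hψ₂.map_h, hψ₂.map_h, smul_add]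
    rfl
  · have H₁ := kHolds_left ħ
    have hm₁ : ∀ t i, t • h₁ ħ i ∈ Alg.hspan (rels ħ).double := fun t i => Alg.smul_h_mem _ _
    have hm₂ : ∀ t i, t • h₂ ħ i ∈ Alg.hspan (rels ħ).double := fun t i => Alg.smul_h_mem _ _
    have hc := crossCommute ħ
    -- `e^{± κ ω h}` is mapped to `e^{∓ ħ h₀}`
    have hK : ∀ t : ℂ, ψ₂ (texp (t • AF.h₁ ω)) = texp ((t * (ω / 2)) • h₁ ħ 0) := fun t => by
      rw [AF.h₁, Alg.map_texp hψ₂.cont (Alg.smul_h_mem _ _), map_smul, hψ₂.map_h, Sum.elim_inl,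
        smul_smul]
    have h10 : h₁ ħ 1 = -h₁ ħ 0 := H₁.h_one
    have hp : (1 * κ * ω) * (ω / 2) = -ħ := by rw [hħ]; ring
    have hn : (-1 * κ * ω) * (ω / 2) = ħ := by rw [hħ]; ring
    have hnn : (- -1 * κ * ω) * (ω / 2) = -ħ := by rw [hħ]; ring
    have h01 : ħ • h₁ ħ 0 = -ħ • h₁ ħ 1 := by rw [h10, smul_neg, neg_smul, neg_neg]
    have hΔh : ∀ i, ΔU (texp (-ħ • h ħ i)) = texp (-ħ • h₁ ħ i) * texp (-ħ • h₂ ħ i) := fun i => by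
      rw [h, Alg.map_texp hU.cont (Alg.smul_h_mem _ _), map_smul, hU.map_h, smul_add,
        Alg.texp_add (hm₁ _ _) (hm₂ _ _)]
    have hΔp : ∀ i, ΔU (e ħ .pos i) = e₁ ħ .pos i * texp (ħ • h₂ ħ i) + e₂ ħ .pos i := fun i =>
      hU.map_x _
    have hΔn : ∀ i, ΔU (e ħ .neg i) = e₁ ħ .neg i + texp (-ħ • h₁ ħ i) * e₂ ħ .neg i := fun i =>
      hU.map_x _
    have hinv : ∀ i, texp (ħ • h₂ ħ i) * texp (-ħ • h₂ ħ i) = 1 := fun i => by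
      rw [← Alg.texp_add (hm₂ _ _) (hm₂ _ _), neg_smul, add_neg_cancel, texp_zero]
    have hcc : ∀ i, texp (-ħ • h₁ ħ i) * texp (ħ • h₂ ħ i) = texp (ħ • h₂ ħ i) * texp (-ħ • h₁ ħ i) :=
      fun i => (hc.hh (.inr (.inr i)) (.inr (.inl i))).eq
    have hcx : ∀ i, texp (-ħ • h₁ ħ i) * e₂ ħ .pos i = e₂ ħ .pos i * texp (-ħ • h₁ ħ i) :=
      fun i => (hc.hx (.inr (.inr i)) (.pos, i)).eq
    have hpos : ∀ i, ΔU (e ħ .pos i * texp (-ħ • h ħ i)) =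
        e₁ ħ .pos i * texp (-ħ • h₁ ħ i) +
          texp (-ħ • h₁ ħ i) * (e₂ ħ .pos i * texp (-ħ • h₂ ħ i)) := fun i => by
      rw [map_mul, hΔp, hΔh, add_mul, ← mul_assoc, ← mul_assoc (e₂ ħ .pos i), ← hcx,
        mul_assoc (e₁ ħ .pos i), ← hcc, mul_assoc (e₁ ħ .pos i), mul_assoc (texp (-ħ • h₁ ħ i)),
        hinv, mul_one, mul_assoc]
    rw [AlgHom.comp_apply, AlgHom.comp_apply, hA.map_x, hψ.map_x]
    rcases j with (_ | _) | (_ | _)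
    · simp only [Sum.elim_inl, map_add, map_mul, hψ₂.map_x, hK, Pm.val, hp, Sum.elim_inr, psiX,
        psiOf]
      exact (hpos 0).symm.trans (map_mul _ _ _)
    · simp only [Sum.elim_inl, map_add, map_mul, hψ₂.map_x, hK, Pm.val, hn, Sum.elim_inr, psiX,
        psiOf, h01]
      rw [map_smul, hpos, smul_add, mul_smul_comm]
    · simp only [Sum.elim_inl, map_add, map_mul, hψ₂.map_x, hK, Pm.val, hn, Sum.elim_inr, psiX,
        psiOf, h01]
      exact (hΔn 1).symm
    · simp only [Sum.elim_inl, map_add, map_mul, hψ₂.map_x, hK, Pm.val, hnn, Sum.elim_inr, psiX,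
        psiOf]
      rw [map_smul, hΔn, smul_add, mul_smul_comm]

end Uq

/-! ### Elements of objects of `𝒞` -/

namespace DiagRep
variable {κ : ℂ}

/-- Linear maps on an object of `𝒞` are determined by their values on eigenvectors of `h`. -/
theorem lin_ext {X : DiagRep κ} {M : Type*} [AddCommGroup M] [Module ℂ M] {f g : X.V →ₗ[ℂ] M}
    (h : ∀ (a : ℂ) (v : X.V), X.h v = a • v → f v = g v) : f = g :=
  LinearMap.eqLocus_eq_top.1 (X.diag.eq_top h)

/-- The operator `e^{c h}`. -/
def kop (X : DiagRep κ) (c : ℂ) : Module.End ℂ X.V := X.diag.fc fun a => Complex.exp (c * a)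

theorem kop_eigen {X : DiagRep κ} (c : ℂ) {a : ℂ} {v : X.V} (hv : X.h v = a • v) :
    X.kop c v = Complex.exp (c * a) • v := IsDiag.fc_apply _ _ hv

theorem lin_kop {X Y : DiagRep κ} (f : X ⟶ Y) (c : ℂ) (v : X.V) :
    lin f (X.kop c v) = Y.kop c (lin f v) := by
  refine LinearMap.congr_fun (f := lin f ∘ₗ X.kop c) (g := Y.kop c ∘ₗ lin f)
    (lin_ext fun a v hv => ?_) v
  simp [kop_eigen c hv, kop_eigen c (eigen_lin f hv)]

theorem kop_tmul (X Y : DiagRep κ) (c : ℂ) (v : X.V) (w : Y.V) :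
    (X ⊗ Y).kop c (v ⊗ₜ[ℂ] w : X.V ⊗[ℂ] Y.V) = X.kop c v ⊗ₜ[ℂ] Y.kop c w := by
  refine LinearMap.congr_fun (f := ((X ⊗ Y).kop c : X.V ⊗[ℂ] Y.V →ₗ[ℂ] X.V ⊗[ℂ] Y.V))
    (g := TensorProduct.map (X.kop c) (Y.kop c)) (tensor_ext fun a b v w hv hw => ?_) (v ⊗ₜ w)
  refine (kop_eigen (X := X ⊗ Y) c (addEnd_eigen hv hw)).trans ?_
  rw [TensorProduct.map_tmul, kop_eigen c hv, kop_eigen c hw, ← TensorProduct.smul_tmul',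
    TensorProduct.tmul_smul, smul_smul, ← Complex.exp_add, mul_add]

theorem kop_kop (X : DiagRep κ) (c d : ℂ) (v : X.V) : X.kop c (X.kop d v) = X.kop (c + d) v := by
  refine LinearMap.congr_fun (f := X.kop c ∘ₗ X.kop d) (g := X.kop (c + d))
    (lin_ext fun a v hv => ?_) v
  rw [LinearMap.comp_apply, kop_eigen d hv, map_smul, kop_eigen c hv, kop_eigen _ hv, smul_smul,
    ← Complex.exp_add]
  ring_nf

theorem kop_zero (X : DiagRep κ) (v : X.V) : X.kop 0 v = v := by
  refine LinearMap.congr_fun (f := X.kop 0) (g := LinearMap.id) (lin_ext fun a v hv => ?_) v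
  rw [kop_eigen 0 hv, zero_mul, Complex.exp_zero, one_smul, LinearMap.id_apply]

theorem h_kop (X : DiagRep κ) (c : ℂ) (v : X.V) : X.h (X.kop c v) = X.kop c (X.h v) := by
  refine LinearMap.congr_fun (f := X.h ∘ₗ X.kop c) (g := X.kop c ∘ₗ X.h)
    (lin_ext fun a v hv => ?_) v
  simp [kop_eigen c hv, hv, smul_smul, mul_comm]

theorem lin_braiding {X Y : DiagRep κ} {a b : ℂ} {v : X.V} {w : Y.V} (hv : X.h v = a • v)
    (hw : Y.h w = b • w) : lin (β_ X Y).hom (v ⊗ₜ[ℂ] w : X.V ⊗[ℂ] Y.V) =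
      Complex.exp (κ * (a * b)) • (w ⊗ₜ[ℂ] v) :=
  braidEquiv_tmul hv hw

/-- The interchange of the inner factors is the braiding, hence the scalar `e^{κ a b}` on weight
vectors. -/
theorem lin_tensorμ {X₁ X₂ Y₁ Y₂ : DiagRep κ} {a b : ℂ} (v₁ : X₁.V) {v₂ : X₂.V} {w₁ : Y₁.V} (w₂ : Y₂.V)
    (hv : X₂.h v₂ = a • v₂) (hw : Y₁.h w₁ = b • w₁) :
    lin (tensorμ X₁ X₂ Y₁ Y₂) ((v₁ ⊗ₜ[ℂ] v₂) ⊗ₜ[ℂ] (w₁ ⊗ₜ[ℂ] w₂) :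
      (X₁.V ⊗[ℂ] X₂.V) ⊗[ℂ] (Y₁.V ⊗[ℂ] Y₂.V)) =
      Complex.exp (κ * (a * b)) • ((v₁ ⊗ₜ[ℂ] w₁) ⊗ₜ[ℂ] (v₂ ⊗ₜ[ℂ] w₂)) := by
  have h1 := braidEquiv_tmul hv hw
  simp only [tensorμ, lin_comp, LinearMap.comp_apply, lin_assoc_hom, lin_whiskerLeft,
    lin_assoc_inv, lin_whiskerRight]
  change (TensorProduct.assoc ℂ X₁.V Y₁.V (X₂.V ⊗[ℂ] Y₂.V)).symm (v₁ ⊗ₜ[ℂ]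
    (TensorProduct.assoc ℂ Y₁.V X₂.V Y₂.V ((braidEquiv X₂ Y₁ (v₂ ⊗ₜ[ℂ] w₁)) ⊗ₜ[ℂ] w₂))) = _
  rw [h1, ← TensorProduct.smul_tmul', map_smul, TensorProduct.tmul_smul, map_smul]
  rfl

section MonObj
open MonObj ComonObj

/-- The multiplication of an algebra in `𝒞`. -/
def mul (M : DiagRep κ) [MonObj M] : M.V →ₗ[ℂ] M.V →ₗ[ℂ] M.V :=
  TensorProduct.curry (lin μ[M] : M.V ⊗[ℂ] M.V →ₗ[ℂ] M.V)

/-- The unit of an algebra in `𝒞`. -/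
def one (M : DiagRep κ) [MonObj M] : M.V := lin η[M] (1 : ℂ)

/-- The coproduct of a coalgebra in `𝒞`. -/
def comul (M : DiagRep κ) [ComonObj M] : M.V →ₗ[ℂ] M.V ⊗[ℂ] M.V := lin Δ[M]

/-- The counit of a coalgebra in `𝒞`. -/
def counit (M : DiagRep κ) [ComonObj M] : M.V →ₗ[ℂ] ℂ := lin ε[M]

variable {M N : DiagRep κ}

theorem lin_mul [MonObj M] (v w : M.V) : lin μ[M] (v ⊗ₜ[ℂ] w : M.V ⊗[ℂ] M.V) = mul M v w := rfl

theorem lin_one [MonObj M] (c : ℂ) : lin η[M] c = c • one M := by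
  have h := map_smul (lin η[M] : ℂ →ₗ[ℂ] M.V) c (1 : ℂ)
  exact (congrArg (lin η[M]) (_root_.mul_one c).symm).trans h

theorem one_mul [MonObj M] (v : M.V) : mul M (one M) v = v :=
  (LinearMap.congr_fun (congrArg lin (MonObj.one_mul M)) ((1 : ℂ) ⊗ₜ[ℂ] v)).trans (one_smul ℂ v)

theorem mul_one [MonObj M] (v : M.V) : mul M v (one M) = v :=
  (LinearMap.congr_fun (congrArg lin (MonObj.mul_one M)) (v ⊗ₜ[ℂ] (1 : ℂ))).trans (one_smul ℂ v)

theorem mul_assoc [MonObj M] (u v w : M.V) : mul M (mul M u v) w = mul M u (mul M v w) :=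
  LinearMap.congr_fun (congrArg lin (MonObj.mul_assoc M)) ((u ⊗ₜ[ℂ] v) ⊗ₜ[ℂ] w)

theorem h_one [MonObj M] : M.h (one M) = (0 : ℂ) • one M := by
  have h := comm (η[M]) (1 : ℂ)
  rw [zero_smul]
  exact h.symm.trans (map_zero _)

theorem h_mul [MonObj M] (v w : M.V) : M.h (mul M v w) = mul M (M.h v) w + mul M v (M.h w) := by
  have h := comm (μ[M]) (v ⊗ₜ[ℂ] w : M.V ⊗[ℂ] M.V)
  refine h.symm.trans ?_
  change lin μ[M] (addEnd M.h M.h (v ⊗ₜ[ℂ] w)) = _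
  rw [addEnd_tmul]
  exact map_add (lin μ[M]) _ _

theorem kop_mul [MonObj M] (c : ℂ) (v w : M.V) :
    M.kop c (mul M v w) = mul M (M.kop c v) (M.kop c w) := by
  rw [← lin_mul, ← lin_kop, kop_tmul]
  rfl

theorem kop_one [MonObj M] (c : ℂ) : M.kop c (one M) = one M := by
  rw [kop_eigen c h_one, mul_zero, Complex.exp_zero, one_smul]

theorem isMonHom_iff [MonObj M] [MonObj N] (f : M ⟶ N) : IsMonHom f ↔
    lin f (one M) = one N ∧ ∀ v w, lin f (mul M v w) = mul N (lin f v) (lin f w) := by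
  constructor
  · intro hf
    exact ⟨LinearMap.congr_fun (congrArg lin (IsMonHom.one_hom f)) (1 : ℂ), fun v w =>
      LinearMap.congr_fun (congrArg lin (IsMonHom.mul_hom f)) (v ⊗ₜ[ℂ] w)⟩
  · rintro ⟨h1, h2⟩
    exact ⟨hom_ext (LinearMap.ext_ring h1), hom_ext (TensorProduct.ext' h2)⟩

/-- The multiplication of a tensor product of algebras involves the braiding. -/
theorem tensor_mul [MonObj M] [MonObj N] {a b : ℂ} (v₁ : M.V) {v₂ : N.V} {w₁ : M.V} (w₂ : N.V)
    (hv : N.h v₂ = a • v₂) (hw : M.h w₁ = b • w₁) :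
    mul (M ⊗ N) (v₁ ⊗ₜ[ℂ] v₂ : M.V ⊗[ℂ] N.V) (w₁ ⊗ₜ[ℂ] w₂ : M.V ⊗[ℂ] N.V) =
      Complex.exp (κ * (a * b)) • (mul M v₁ w₁ ⊗ₜ[ℂ] mul N v₂ w₂ : M.V ⊗[ℂ] N.V) := by
  have h := congrArg (lin (μ[M] ⊗ₘ μ[N])) (lin_tensorμ v₁ w₂ hv hw)
  exact h.trans (map_smul (lin (μ[M] ⊗ₘ μ[N])) _ _)

end MonObj
end DiagRep

/-! ### The tensor algebra -/

namespace Tens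
open DiagRep
variable (κ ω : ℂ)

/-- The basis vectors of weights `± ω` of `F^±`. -/
def gen : Pm → (Fω κ ω).V
  | .pos => ((1, 0) : ℂ × ℂ)
  | .neg => ((0, 1) : ℂ × ℂ)

theorem h_gen (s : Pm) : (Fω κ ω).h (gen κ ω s) = (s.val * ω) • gen κ ω s := by
  have h : ∀ p : ℂ × ℂ, LinearMap.prodMap (ω • (LinearMap.id : ℂ →ₗ[ℂ] ℂ))
    (-ω • (LinearMap.id : ℂ →ₗ[ℂ] ℂ)) p = (ω * p.1, -ω * p.2) := fun p => rfl
  cases s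
  · refine (h (1, 0)).trans (Prod.ext ?_ ?_)
    · change ω * 1 = (1 * ω) * 1
      ring
    · change -ω * 0 = (1 * ω) * 0
      ring
  · refine (h (0, 1)).trans (Prod.ext ?_ ?_)
    · change ω * 0 = (-1 * ω) * 0
      ring
    · change -ω * 1 = (-1 * ω) * 1
      ring

theorem eq_gen (p : ℂ × ℂ) : (p : (Fω κ ω).V) = p.1 • gen κ ω .pos + p.2 • gen κ ω .neg := by
  refine Prod.ext ?_ ?_
  · change p.1 = p.1 * 1 + p.2 * 0
    ring
  · change p.2 = p.1 * 0 + p.2 * 1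
    ring

variable {κ ω} in
theorem fω_ext {M : Type*} [AddCommGroup M] [Module ℂ M] {f g : (Fω κ ω).V →ₗ[ℂ] M}
    (h : ∀ s, f (gen κ ω s) = g (gen κ ω s)) : f = g := by
  refine LinearMap.ext fun (p : ℂ × ℂ) => ?_
  have h1 : ∀ f : (Fω κ ω).V →ₗ[ℂ] M, f p = p.1 • f (gen κ ω .pos) + p.2 • f (gen κ ω .neg) :=
    fun f => by
      rw [← map_smul, ← map_smul, ← map_add]
      exact congrArg f (eq_gen κ ω p)
  rw [h1, h1, h, h]

/-- The weight of a list of signs. -/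
def wtL (l : List Pm) : ℂ := (l.map fun s => s.val * ω).sum

/-- The tensor algebra with the words as a basis. -/
def T₀ : DiagRep κ where
  V := List Pm →₀ ℂ
  h := Finsupp.linearCombination ℂ fun l => wtL ω l • Finsupp.single l 1
  diag := isDiag_of_forall fun P hP => top_le_iff.1 fun v _ => by
    induction v using Finsupp.induction_linear with
    | zero => exact P.zero_mem
    | add v w hv hw => exact P.add_mem (hv trivial) (hw trivial)
    | single l c =>
      exact hP (wtL ω l) _ (by simp [mul_comm])

/-- A word as an element of the tensor algebra. -/
def wd (l : List Pm) : (T₀ κ ω).V := (Finsupp.single l 1 : List Pm →₀ ℂ)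

theorem h_wd (l : List Pm) : (T₀ κ ω).h (wd κ ω l) = wtL ω l • wd κ ω l := by
  have h := Finsupp.linearCombination_single (R := ℂ)
    (v := fun l => wtL ω l • (Finsupp.single l 1 : List Pm →₀ ℂ)) 1 l
  exact h.trans (one_smul ℂ _)

variable {κ ω}

theorem T₀_ext {M : Type*} [AddCommGroup M] [Module ℂ M] {f g : (T₀ κ ω).V →ₗ[ℂ] M}
    (h : ∀ l, f (wd κ ω l) = g (wd κ ω l)) : f = g :=
  Finsupp.lhom_ext' fun l => LinearMap.ext_ring (h l)

/-- The linear map with given values on words. -/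
def lift₀ {M : Type*} [AddCommGroup M] [Module ℂ M] (f : List Pm → M) : (T₀ κ ω).V →ₗ[ℂ] M :=
  Finsupp.linearCombination ℂ f

theorem lift₀_wd {M : Type*} [AddCommGroup M] [Module ℂ M] (f : List Pm → M) (l : List Pm) :
    lift₀ f (wd κ ω l) = f l := by
  change Finsupp.linearCombination ℂ f (Finsupp.single l 1) = _
  simp

theorem wtL_append (l l' : List Pm) : wtL ω (l ++ l') = wtL ω l + wtL ω l' := by simp [wtL]

theorem wtL_cons (s : Pm) (l : List Pm) : wtL ω (s :: l) = s.val * ω + wtL ω l := by simp [wtL]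

/-- Concatenation of words. -/
def mul₀ : (T₀ κ ω).V →ₗ[ℂ] (T₀ κ ω).V →ₗ[ℂ] (T₀ κ ω).V :=
  lift₀ fun l => lift₀ fun l' => wd κ ω (l ++ l')

theorem mul₀_wd (l l' : List Pm) : mul₀ (wd κ ω l) (wd κ ω l') = wd κ ω (l ++ l') := by
  rw [mul₀, lift₀_wd, lift₀_wd]

open MonObj in
instance : MonObj (T₀ κ ω) where
  one := mk' (X := 𝟙_ (DiagRep κ)) (LinearMap.toSpanSingleton ℂ _ (wd κ ω [])) fun (c : ℂ) => by
    have h1 : (T₀ κ ω).h (c • wd κ ω []) = 0 := by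
      rw [map_smul, h_wd]
      simp [wtL]
    exact (zero_smul ℂ _).trans h1.symm
  mul := mk' (X := T₀ κ ω ⊗ T₀ κ ω) (TensorProduct.lift mul₀) <| addEnd_comm fun v w => by
    refine LinearMap.congr_fun (LinearMap.congr_fun (f := mul₀ ∘ₗ (T₀ κ ω).h + mul₀.compl₂ (T₀ κ ω).h)
      (g := mul₀.compr₂ (T₀ κ ω).h) (T₀_ext fun l => T₀_ext fun l' => ?_) v) w
    simp only [LinearMap.add_apply, LinearMap.comp_apply, LinearMap.compl₂_apply,
      LinearMap.compr₂_apply, h_wd, map_smul, LinearMap.smul_apply, mul₀_wd, wtL_append, add_smul]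
  one_mul := hom_ext (TensorProduct.ext' fun (c : ℂ) v => by
    refine LinearMap.congr_fun (f := mul₀ (c • wd κ ω [])) (g := c • LinearMap.id)
      (T₀_ext fun l => ?_) v
    rw [map_smul, LinearMap.smul_apply, mul₀_wd]
    rfl)
  mul_one := hom_ext (TensorProduct.ext' fun v (c : ℂ) => by
    refine LinearMap.congr_fun (f := mul₀.flip (c • wd κ ω [])) (g := c • LinearMap.id)
      (T₀_ext fun l => ?_) v
    rw [map_smul, LinearMap.smul_apply, LinearMap.flip_apply, mul₀_wd, List.append_nil]
    rfl)
  mul_assoc := hom_ext (TensorProduct.ext_threefold fun u v w => by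
    refine LinearMap.congr_fun (LinearMap.congr_fun (LinearMap.congr_fun
      (f := mul₀.compr₂ mul₀) (g := (LinearMap.llcomp ℂ _ _ _ ∘ₗ mul₀).flip ∘ₗ mul₀ |>.flip)
      (T₀_ext fun l => T₀_ext fun l' => T₀_ext fun l'' => ?_) u) v) w
    simp [mul₀_wd])

theorem mul_wd (l l' : List Pm) : mul (T₀ κ ω) (wd κ ω l) (wd κ ω l') = wd κ ω (l ++ l') :=
  mul₀_wd l l'

theorem one_eq : one (T₀ κ ω) = wd κ ω [] := one_smul ℂ _

/-- The linear map on `F^±` with given values on the basis vectors. -/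
def genLift {M : Type*} [AddCommGroup M] [Module ℂ M] (f : Pm → M) : (Fω κ ω).V →ₗ[ℂ] M :=
  (LinearMap.coprod (LinearMap.toSpanSingleton ℂ _ (f .pos))
    (LinearMap.toSpanSingleton ℂ _ (f .neg)) : ℂ × ℂ →ₗ[ℂ] M)

theorem genLift_gen {M : Type*} [AddCommGroup M] [Module ℂ M] (f : Pm → M) (s : Pm) :
    (genLift f : (Fω κ ω).V →ₗ[ℂ] M) (gen κ ω s) = f s := by
  have h : ∀ p : ℂ × ℂ, (LinearMap.coprod (LinearMap.toSpanSingleton ℂ _ (f .pos))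
    (LinearMap.toSpanSingleton ℂ _ (f .neg)) : ℂ × ℂ →ₗ[ℂ] M) p = p.1 • f .pos + p.2 • f .neg :=
    fun p => rfl
  cases s
  · exact (h (1, 0)).trans (by simp)
  · exact (h (0, 1)).trans (by simp)

theorem genLift_comm {X : DiagRep κ} {f : Pm → X.V} (hf : ∀ s, X.h (f s) = (s.val * ω) • f s)
    (v : (Fω κ ω).V) : genLift f ((Fω κ ω).h v) = X.h (genLift f v) := by
  refine LinearMap.congr_fun (f := genLift f ∘ₗ (Fω κ ω).h) (g := X.h ∘ₗ genLift f)
    (fω_ext fun s => ?_) v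
  rw [LinearMap.comp_apply, LinearMap.comp_apply, h_gen, map_smul, genLift_gen, hf]

/-- The inclusion of the generators. -/
def incl₀ : Fω κ ω ⟶ T₀ κ ω :=
  mk' (genLift fun s => wd κ ω [s]) (genLift_comm fun s => by rw [h_wd]; simp [wtL])

theorem incl₀_gen (s : Pm) : lin (incl₀ : Fω κ ω ⟶ T₀ κ ω) (gen κ ω s) = wd κ ω [s] :=
  genLift_gen (fun s => wd κ ω [s]) s

/-- The universal property of the tensor algebra. -/
theorem exists_lift₀ (A : DiagRep κ) [MonObj A] (f : Fω κ ω ⟶ A) :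
    ∃! g : T₀ κ ω ⟶ A, IsMonHom g ∧ incl₀ ≫ g = f := by
  let F : List Pm → A.V := fun l => l.foldr (fun s a => mul A (lin f (gen κ ω s)) a) (one A)
  have hFc : ∀ s l, F (s :: l) = mul A (lin f (gen κ ω s)) (F l) := fun _ _ => rfl
  have hF : ∀ l l', F (l ++ l') = mul A (F l) (F l') := fun l l' => by
    induction l with
    | nil => exact (DiagRep.one_mul (F l')).symm
    | cons s l ih => rw [List.cons_append, hFc, hFc, ih, DiagRep.mul_assoc]
  have hw : ∀ l, A.h (F l) = wtL ω l • F l := fun l => by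
    induction l with
    | nil => exact DiagRep.h_one
    | cons s l ih =>
      rw [hFc, h_mul, ih, ← comm, h_gen, wtL_cons, add_smul, map_smul, map_smul, map_smul,
        LinearMap.smul_apply]
  let g : T₀ κ ω ⟶ A := mk' (lift₀ F) fun v => by
    refine LinearMap.congr_fun (f := lift₀ F ∘ₗ (T₀ κ ω).h) (g := A.h ∘ₗ lift₀ F)
      (T₀_ext fun l => ?_) v
    rw [LinearMap.comp_apply, LinearMap.comp_apply, h_wd, map_smul, lift₀_wd, hw]
  have hg : ∀ l, lin g (wd κ ω l) = F l := fun l => lift₀_wd F l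
  refine ⟨g, ⟨(isMonHom_iff g).2 ⟨by rw [one_eq, hg]; rfl, fun v w => ?_⟩,
    hom_ext (fω_ext fun s => ?_)⟩, fun g' ⟨h1, h2⟩ => hom_ext (T₀_ext fun l => ?_)⟩
  · refine LinearMap.congr_fun (LinearMap.congr_fun (f := (mul (T₀ κ ω)).compr₂ (lin g))
      (g := (mul A).compl₁₂ (lin g) (lin g)) (T₀_ext fun l => T₀_ext fun l' => ?_) v) w
    rw [LinearMap.compr₂_apply, LinearMap.compl₁₂_apply, mul_wd, hg, hg, hg, hF]
  · refine (congrArg (lin g) (incl₀_gen s)).trans ((hg _).trans ?_)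
    exact DiagRep.mul_one _
  · obtain ⟨h3, h4⟩ := (isMonHom_iff g').1 h1
    rw [hg]
    induction l with
    | nil => rw [← one_eq, h3]; rfl
    | cons s l ih =>
      rw [← List.singleton_append, ← mul_wd, h4, ih, ← incl₀_gen, List.singleton_append, hFc, ← h2]
      rfl

end Tens

/-! ### The bialgebra structure of the tensor algebra -/

namespace Tens
open DiagRep MonObj ComonObj
variable {κ ω : ℂ}

/-- The morphism for which the elements of `F^±` are primitive. -/
def prim : Fω κ ω ⟶ T₀ κ ω ⊗ T₀ κ ω :=
  (ρ_ (Fω κ ω)).inv ≫ (incl₀ ⊗ₘ η[T₀ κ ω]) + (λ_ (Fω κ ω)).inv ≫ (η[T₀ κ ω] ⊗ₘ incl₀)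

theorem prim_apply (v : (Fω κ ω).V) : lin prim v = (lin incl₀ v ⊗ₜ[ℂ] one (T₀ κ ω) +
    one (T₀ κ ω) ⊗ₜ[ℂ] lin incl₀ v : (T₀ κ ω).V ⊗[ℂ] (T₀ κ ω).V) := rfl

/-- The coproduct and counit are the algebra homomorphisms for which the generators are primitive.
The axioms are equalities of algebra homomorphisms, so they can be checked on generators. -/
theorem exists_bimonObj : ∃ (_ : ComonObj (T₀ κ ω)), IsMonHom Δ[T₀ κ ω] ∧ IsMonHom ε[T₀ κ ω] ∧
    incl₀ ≫ Δ[T₀ κ ω] = prim ∧ incl₀ ≫ ε[T₀ κ ω] = 0 := by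
  obtain ⟨d, ⟨hd, hd'⟩, -⟩ := exists_lift₀ (T₀ κ ω ⊗ T₀ κ ω) prim
  obtain ⟨e, ⟨he, he'⟩, -⟩ := exists_lift₀ (𝟙_ (DiagRep κ)) 0
  have key : ∀ (A : DiagRep κ) [MonObj A] (f g : T₀ κ ω ⟶ A) [IsMonHom f] [IsMonHom g],
      incl₀ ≫ f = incl₀ ≫ g → f = g := fun A _ f g hf hg h =>
    (exists_lift₀ A (incl₀ ≫ f)).unique ⟨hf, rfl⟩ ⟨hg, h.symm⟩
  have hd1 : lin d (one (T₀ κ ω)) = (one (T₀ κ ω) ⊗ₜ[ℂ] one (T₀ κ ω) : _ ⊗[ℂ] _) :=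
    ((isMonHom_iff d).1 hd).1
  have he1 : lin e (one (T₀ κ ω)) = (1 : ℂ) := ((isMonHom_iff e).1 he).1
  have hdv : ∀ v, lin d (lin incl₀ v) = lin prim v := fun v =>
    LinearMap.congr_fun (congrArg lin hd') v
  have hev : ∀ v, lin e (lin incl₀ v) = (0 : ℂ) := fun v =>
    LinearMap.congr_fun (congrArg lin he') v
  have h1 : d ≫ e ▷ T₀ κ ω ≫ (λ_ _).hom = 𝟙 _ := by
    refine key _ _ _ (hom_ext (LinearMap.ext fun v => ?_))
    change TensorProduct.lid ℂ _ (TensorProduct.map (lin e) LinearMap.id (lin d (lin incl₀ v))) =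
      lin incl₀ v
    rw [hdv, prim_apply, map_add, map_add, TensorProduct.map_tmul, TensorProduct.map_tmul, hev, he1]
    simp
  have h2 : d ≫ T₀ κ ω ◁ e ≫ (ρ_ _).hom = 𝟙 _ := by
    refine key _ _ _ (hom_ext (LinearMap.ext fun v => ?_))
    change TensorProduct.rid ℂ _ (TensorProduct.map LinearMap.id (lin e) (lin d (lin incl₀ v))) =
      lin incl₀ v
    rw [hdv, prim_apply, map_add, map_add, TensorProduct.map_tmul, TensorProduct.map_tmul, hev, he1]
    simp
  refine ⟨{ counit := e, comul := d, counit_comul := ?_, comul_counit := ?_, comul_assoc := ?_ },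
    hd, he, hd', he'⟩
  · rw [← cancel_mono (λ_ (T₀ κ ω)).hom, Iso.inv_hom_id, Category.assoc, h1]
  · rw [← cancel_mono (ρ_ (T₀ κ ω)).hom, Iso.inv_hom_id, Category.assoc, h2]
  · refine key _ _ _ (hom_ext (LinearMap.ext fun v => ?_))
    change TensorProduct.map LinearMap.id (lin d) (lin d (lin incl₀ v)) =
      TensorProduct.assoc ℂ _ _ _ (TensorProduct.map (lin d) LinearMap.id (lin d (lin incl₀ v)))
    rw [hdv, prim_apply, map_add, map_add, TensorProduct.map_tmul, TensorProduct.map_tmul,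
      TensorProduct.map_tmul, TensorProduct.map_tmul, hdv, prim_apply, hd1]
    simp only [TensorProduct.tmul_add, TensorProduct.add_tmul, map_add, add_assoc]
    rfl

theorem nonempty_tensorBialgebra : Nonempty (TensorBialgebra (Fω κ ω)) := by
  obtain ⟨_, hΔ, hε, h1, h2⟩ := exists_bimonObj (κ := κ) (ω := ω)
  let _ : BimonObj (T₀ κ ω) :=
    { mul_comul := hΔ.mul_hom
      one_comul := hΔ.one_hom
      mul_counit := hε.mul_hom
      one_counit := hε.one_hom }
  exact ⟨⟨T₀ κ ω, incl₀, fun A _ f => exists_lift₀ A f, h1, h2⟩⟩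

end Tens

/-! ### Recursion on tensor algebras -/

namespace DiagRep
open MonObj ComonObj
variable {κ : ℂ} {T : DiagRep κ}

theorem comul_one [BimonObj T] : comul T (one T) = one T ⊗ₜ[ℂ] one T :=
  LinearMap.congr_fun (congrArg lin (BimonObj.one_comul T)) (1 : ℂ)

theorem counit_one [BimonObj T] : counit T (one T) = 1 :=
  LinearMap.congr_fun (congrArg lin (BimonObj.one_counit T)) (1 : ℂ)

theorem comul_mul [BimonObj T] (p q : T.V) :
    comul T (mul T p q) = mul (T ⊗ T) (comul T p) (comul T q) :=
  LinearMap.congr_fun (congrArg lin (BimonObj.mul_comul T)) (p ⊗ₜ[ℂ] q)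

theorem counit_mul [BimonObj T] (p q : T.V) :
    counit T (mul T p q) = counit T p * counit T q :=
  LinearMap.congr_fun (congrArg lin (BimonObj.mul_counit T)) (p ⊗ₜ[ℂ] q)

theorem counit_comul [ComonObj T] (p : T.V) :
    TensorProduct.lid ℂ T.V (TensorProduct.map (counit T) LinearMap.id (comul T p)) = p := by
  have h : TensorProduct.map (counit T) LinearMap.id (comul T p) =
    ((TensorProduct.lid ℂ T.V).symm p) :=
    LinearMap.congr_fun (congrArg lin (ComonObj.counit_comul T)) p
  rw [h, LinearEquiv.apply_symm_apply]

theorem comul_counit [ComonObj T] (p : T.V) :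
    TensorProduct.rid ℂ T.V (TensorProduct.map LinearMap.id (counit T) (comul T p)) = p := by
  have h : TensorProduct.map LinearMap.id (counit T) (comul T p) =
    ((TensorProduct.rid ℂ T.V).symm p) :=
    LinearMap.congr_fun (congrArg lin (ComonObj.comul_counit T)) p
  rw [h, LinearEquiv.apply_symm_apply]

theorem counit_h [ComonObj T] (p : T.V) : counit T (T.h p) = 0 :=
  comm (ε[T]) p

theorem comul_kop [ComonObj T] (c : ℂ) (p : T.V) :
    comul T (T.kop c p) = TensorProduct.map (T.kop c) (T.kop c) (comul T p) := by
  refine (lin_kop (Δ[T]) c p).trans ?_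
  refine LinearMap.congr_fun (f := ((T ⊗ T).kop c : T.V ⊗[ℂ] T.V →ₗ[ℂ] T.V ⊗[ℂ] T.V))
    (TensorProduct.ext' fun v w => ?_) (comul T p)
  rw [kop_tmul, TensorProduct.map_tmul]

end DiagRep

namespace TensorBialgebra
open DiagRep Tens
variable {κ ω : ℂ} (B : TensorBialgebra (Fω κ ω))

/-- The generators of the tensor algebra. -/
def g (s : Pm) : B.T.V := lin B.incl (gen κ ω s)

theorem h_g (s : Pm) : B.T.h (B.g s) = (s.val * ω) • B.g s := by
  rw [g, ← comm, h_gen, map_smul]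

/-- Any tensor algebra is a retract, in fact an isomorphic copy, of the one with the words as a
basis. This is the form in which the universal property is used for recursion. -/
theorem exists_iso : ∃ (f : B.T.V →ₗ[ℂ] (T₀ κ ω).V) (f' : (T₀ κ ω).V →ₗ[ℂ] B.T.V),
    (∀ p, f' (f p) = p) ∧ f (one B.T) = wd κ ω [] ∧
    (∀ s p, f (mul B.T (B.g s) p) = mul (T₀ κ ω) (wd κ ω [s]) (f p)) ∧
    f' (wd κ ω []) = one B.T ∧ ∀ s l, f' (wd κ ω (s :: l)) = mul B.T (B.g s) (f' (wd κ ω l)) := by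
  obtain ⟨f, ⟨hf, hf'⟩, -⟩ := B.lift (T₀ κ ω) incl₀
  obtain ⟨f', ⟨hg, hg'⟩, -⟩ := exists_lift₀ B.T B.incl
  have h1 : f ≫ f' = 𝟙 _ := (B.lift B.T B.incl).unique
    ⟨inferInstance, by rw [← Category.assoc, hf', hg']⟩ ⟨inferInstance, Category.comp_id _⟩
  obtain ⟨h2, h3⟩ := (isMonHom_iff f).1 hf
  obtain ⟨h4, h5⟩ := (isMonHom_iff f').1 hg
  have h6 : ∀ s, lin f (B.g s) = wd κ ω [s] := fun s => by
    rw [← incl₀_gen, ← hf']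
    rfl
  have h7 : ∀ s, lin f' (wd κ ω [s]) = B.g s := fun s => by
    rw [← incl₀_gen, g, ← hg']
    rfl
  refine ⟨lin f, lin f', fun p => LinearMap.congr_fun (congrArg lin h1) p, by rw [h2, one_eq],
    fun s p => by rw [h3, h6], by rw [← one_eq, h4], fun s l => ?_⟩
  rw [← List.singleton_append, ← mul_wd, h5, h7]

/-- Induction on words: a subspace that contains `1` and is stable under left multiplication by
generators is everything. -/
theorem ind {N : Submodule ℂ B.T.V} (h1 : one B.T ∈ N) (hg : ∀ s, ∀ p ∈ N, mul B.T (B.g s) p ∈ N)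
    (p : B.T.V) : p ∈ N := by
  obtain ⟨f, f', h2, -, -, h3, h4⟩ := B.exists_iso
  have h5 : ∀ l, f' (wd κ ω l) ∈ N := fun l => by
    induction l with
    | nil => rwa [h3]
    | cons s l ih => rw [h4]; exact hg s _ ih
  have h6 : N.mkQ ∘ₗ f' = 0 := T₀_ext fun l => (Submodule.Quotient.mk_eq_zero N).2 (h5 l)
  rw [← h2 p]
  exact (Submodule.Quotient.mk_eq_zero N).1 (LinearMap.congr_fun h6 (f p))

/-- Equality of two families of linear maps by induction on words, where the induction hypothesis is
for all indices at once. -/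
theorem ext_ind {ι M : Type*} [AddCommGroup M] [Module ℂ M] {f f' : ι → B.T.V →ₗ[ℂ] M}
    (h1 : ∀ i, f i (one B.T) = f' i (one B.T))
    (h : ∀ s p, (∀ i, f i p = f' i p) → ∀ i,
      f i (mul B.T (B.g s) p) = f' i (mul B.T (B.g s) p)) (i : ι) (p : B.T.V) :
    f i p = f' i p := by
  have h2 := B.ind (N := ⨅ i, LinearMap.eqLocus (f i) (f' i))
    ((Submodule.mem_iInf _).2 h1) (fun s p hp => (Submodule.mem_iInf _).2
      (h s p fun i => (Submodule.mem_iInf _).1 hp i)) p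
  exact (Submodule.mem_iInf _).1 h2 i

theorem ext_ind₁ {M : Type*} [AddCommGroup M] [Module ℂ M] {f f' : B.T.V →ₗ[ℂ] M}
    (h1 : f (one B.T) = f' (one B.T))
    (h : ∀ s p, f p = f' p → f (mul B.T (B.g s) p) = f' (mul B.T (B.g s) p)) (p : B.T.V) :
    f p = f' p :=
  B.ext_ind (f := fun _ : Unit => f) (f' := fun _ => f') (fun _ => h1)
    (fun s p hp _ => h s p (hp ())) () p

/-- Linear maps on the tensor algebra are defined by recursion on words. -/
theorem exists_rec {M : Type*} [AddCommGroup M] [Module ℂ M] (z : M) (a : Pm → M →ₗ[ℂ] M) :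
    ∃ f : B.T.V →ₗ[ℂ] M, f (one B.T) = z ∧ ∀ s p, f (mul B.T (B.g s) p) = a s (f p) := by
  obtain ⟨f, f', -, h1, h2, -⟩ := B.exists_iso
  let F : List Pm → M := fun l => l.foldr (fun s => a s) z
  refine ⟨lift₀ F ∘ₗ f, ?_, fun s p => ?_⟩
  · rw [LinearMap.comp_apply, h1, lift₀_wd]
    rfl
  · rw [LinearMap.comp_apply, h2, LinearMap.comp_apply]
    refine LinearMap.congr_fun (f := lift₀ F ∘ₗ mul (T₀ κ ω) (wd κ ω [s])) (g := a s ∘ₗ lift₀ F)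
      (T₀_ext fun l => ?_) (f p)
    rw [LinearMap.comp_apply, LinearMap.comp_apply, mul_wd, lift₀_wd, lift₀_wd]
    rfl

/-- A recursion that also uses the word itself. -/
theorem exists_affine_rec {M : Type*} [AddCommGroup M] [Module ℂ M] (z : M) (a : Pm → M →ₗ[ℂ] M)
    (c : Pm → B.T.V →ₗ[ℂ] M) : ∃ f : B.T.V →ₗ[ℂ] M, f (one B.T) = z ∧
      ∀ s p, f (mul B.T (B.g s) p) = a s (f p) + c s p := by
  obtain ⟨f, h1, h2⟩ := B.exists_rec (M := M × B.T.V) (z, one B.T) fun s =>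
    (a s ∘ₗ LinearMap.fst ℂ _ _ + c s ∘ₗ LinearMap.snd ℂ _ _).prod
      (mul B.T (B.g s) ∘ₗ LinearMap.snd ℂ _ _)
  have h3 : ∀ p, (f p).2 = p := B.ext_ind₁ (f := LinearMap.snd ℂ _ _ ∘ₗ f) (f' := LinearMap.id)
    (congrArg Prod.snd h1) fun s p hp => by
      refine (congrArg Prod.snd (h2 s p)).trans ?_
      change mul B.T (B.g s) (f p).2 = _
      rw [show (f p).2 = p from hp]
      rfl
  refine ⟨LinearMap.fst ℂ _ _ ∘ₗ f, congrArg Prod.fst h1, fun s p => ?_⟩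
  refine (congrArg Prod.fst (h2 s p)).trans ?_
  change a s (f p).1 + c s (f p).2 = _
  rw [h3]
  rfl

theorem comul_g (s : Pm) : comul B.T (B.g s) = B.g s ⊗ₜ[ℂ] one B.T + one B.T ⊗ₜ[ℂ] B.g s :=
  LinearMap.congr_fun (congrArg lin B.comul_incl) (gen κ ω s)

theorem counit_g (s : Pm) : counit B.T (B.g s) = 0 :=
  LinearMap.congr_fun (congrArg lin B.counit_incl) (gen κ ω s)

variable (κ ω) in
/-- The number `c` for which the braiding with a generator of weight `± ω` is given by `e^{c h}`. -/
def kw (s : Pm) : ℂ := κ * (s.val * ω)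

/-- The braided coproduct of `g p`: moving the generator past the first factor of `Δ p` produces
`e^{κ h ⊗ h}`, which on `p_{(1)} ⊗ g` is the operator `K_s = e^{κ s ω h}` on `p_{(1)}`. -/
theorem comul_g_mul (s : Pm) (p : B.T.V) : comul B.T (mul B.T (B.g s) p) =
    TensorProduct.map (mul B.T (B.g s)) LinearMap.id (comul B.T p) +
      TensorProduct.map (B.T.kop (kw κ ω s)) (mul B.T (B.g s)) (comul B.T p) := by
  have h1 : ∀ t : B.T.V ⊗[ℂ] B.T.V,
      mul (B.T ⊗ B.T) (B.g s ⊗ₜ[ℂ] one B.T + one B.T ⊗ₜ[ℂ] B.g s : B.T.V ⊗[ℂ] B.T.V) t =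
      TensorProduct.map (mul B.T (B.g s)) LinearMap.id t +
      TensorProduct.map (B.T.kop (kw κ ω s)) (mul B.T (B.g s)) t := fun t => by
    refine LinearMap.congr_fun (f := (mul (B.T ⊗ B.T)
      (B.g s ⊗ₜ[ℂ] one B.T + one B.T ⊗ₜ[ℂ] B.g s : B.T.V ⊗[ℂ] B.T.V) :
        B.T.V ⊗[ℂ] B.T.V →ₗ[ℂ] B.T.V ⊗[ℂ] B.T.V)) (g := TensorProduct.map (mul B.T (B.g s)) LinearMap.id +
      TensorProduct.map (B.T.kop (kw κ ω s)) (mul B.T (B.g s))) (tensor_ext fun a b v w hv hw => ?_) t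
    refine (LinearMap.congr_fun (map_add (mul (B.T ⊗ B.T)) _ _) _).trans ?_
    refine (congrArg₂ (· + ·) (tensor_mul _ w h_one hv) (tensor_mul _ w (B.h_g s) hv)).trans ?_
    rw [LinearMap.add_apply, TensorProduct.map_tmul, TensorProduct.map_tmul, kop_eigen _ hv,
      DiagRep.one_mul, DiagRep.one_mul, zero_mul, mul_zero, Complex.exp_zero, one_smul,
      ← TensorProduct.smul_tmul', kw,
      show κ * (s.val * ω * a) = κ * (s.val * ω) * a from by ring]
    rfl
  rw [comul_mul, comul_g, h1]

theorem counit_g_mul (s : Pm) (p : B.T.V) : counit B.T (mul B.T (B.g s) p) = 0 := by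
  rw [counit_mul, counit_g, zero_mul]

end TensorBialgebra

/-! ### The Hopf pairing -/

/-- `v ⊗ w ↦ φ(v) χ(w)`. -/
def pr {V W : Type*} [AddCommGroup V] [Module ℂ V] [AddCommGroup W] [Module ℂ W]
    (φ : V →ₗ[ℂ] ℂ) (χ : W →ₗ[ℂ] ℂ) : V ⊗[ℂ] W →ₗ[ℂ] ℂ :=
  LinearMap.mul' ℂ ℂ ∘ₗ TensorProduct.map φ χ

section pr
variable {V W V' W' : Type*} [AddCommGroup V] [Module ℂ V] [AddCommGroup W] [Module ℂ W]
  [AddCommGroup V'] [Module ℂ V'] [AddCommGroup W'] [Module ℂ W']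

theorem pr_tmul (φ : V →ₗ[ℂ] ℂ) (χ : W →ₗ[ℂ] ℂ) (v : V) (w : W) :
    pr φ χ (v ⊗ₜ w) = φ v * χ w := rfl

theorem pr_map (φ : V' →ₗ[ℂ] ℂ) (χ : W' →ₗ[ℂ] ℂ) (f : V →ₗ[ℂ] V') (g : W →ₗ[ℂ] W')
    (t : V ⊗[ℂ] W) : pr φ χ (TensorProduct.map f g t) = pr (φ ∘ₗ f) (χ ∘ₗ g) t :=
  LinearMap.congr_fun (f := pr φ χ ∘ₗ TensorProduct.map f g) (g := pr (φ ∘ₗ f) (χ ∘ₗ g))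
    (TensorProduct.ext' fun _ _ => rfl) t

end pr

namespace DiagRep
open MonObj ComonObj
variable {κ : ℂ} {P Q : DiagRep κ}

theorem pr_counit_right [ComonObj P] (χ : P.V →ₗ[ℂ] ℂ) (p : P.V) :
    pr χ (counit P) (comul P p) = χ p := by
  have h : pr χ (counit P) = χ ∘ₗ (TensorProduct.rid ℂ P.V).toLinearMap ∘ₗ
      TensorProduct.map LinearMap.id (counit P) := TensorProduct.ext' fun v w => by
    simp [pr_tmul, mul_comm]
  rw [h]
  exact congrArg χ (comul_counit p)

/-- The bilinear map of a morphism `P ⊗ Q ⟶ 𝟙`. -/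
def bil (r : P ⊗ Q ⟶ 𝟙_ (DiagRep κ)) : P.V →ₗ[ℂ] Q.V →ₗ[ℂ] ℂ :=
  TensorProduct.curry (lin r : P.V ⊗[ℂ] Q.V →ₗ[ℂ] ℂ)

/-- A pairing in `𝒞` preserves weights, so `e^{c h}` has the adjoint `e^{-c h}`. -/
theorem bil_kop (r : P ⊗ Q ⟶ 𝟙_ (DiagRep κ)) (c : ℂ) (p : P.V) (q : Q.V) :
    bil r (P.kop c p) q = bil r p (Q.kop (-c) q) := by
  have h : ∀ q, bil r (P.kop c p) (Q.kop c q) = bil r p q := fun q => by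
    have h1 := lin_kop r c (p ⊗ₜ[ℂ] q : P.V ⊗[ℂ] Q.V)
    rw [kop_tmul] at h1
    refine h1.trans ?_
    refine (kop_eigen (X := 𝟙_ (DiagRep κ)) c (a := 0) (zero_smul ℂ _).symm).trans ?_
    rw [mul_zero, Complex.exp_zero, one_smul]
    rfl
  rw [← h, kop_kop, add_neg_cancel, kop_zero]

/-- The axioms of a Hopf pairing in terms of elements. -/
theorem isHopfPairing_iff [BimonObj P] [BimonObj Q] (r : P ⊗ Q ⟶ 𝟙_ (DiagRep κ)) :
    IsHopfPairing r ↔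
      (∀ p p' q, bil r (mul P p p') q = pr (bil r p') (bil r p) (comul Q q)) ∧
      (∀ p q q', bil r p (mul Q q q') = pr ((bil r).flip q') ((bil r).flip q) (comul P p)) ∧
      (∀ q, bil r (one P) q = counit Q q) ∧ ∀ p, bil r p (one Q) = counit P p := by
  have h1 : ∀ p p' (t : Q.V ⊗[ℂ] Q.V), lin (nested r)
      ((p ⊗ₜ p') ⊗ₜ t : (P.V ⊗[ℂ] P.V) ⊗[ℂ] (Q.V ⊗[ℂ] Q.V)) = pr (bil r p') (bil r p) t :=
    fun p p' t => LinearMap.congr_fun (f := TensorProduct.curry (lin (nested r) :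
      (P.V ⊗[ℂ] P.V) ⊗[ℂ] (Q.V ⊗[ℂ] Q.V) →ₗ[ℂ] ℂ) (p ⊗ₜ p')) (TensorProduct.ext' fun q q' => by
        refine (map_smul (bil r p) (bil r p' q) q')) t
  have h2 : ∀ q q' (t : P.V ⊗[ℂ] P.V), lin (nested r)
      (t ⊗ₜ (q ⊗ₜ q') : (P.V ⊗[ℂ] P.V) ⊗[ℂ] (Q.V ⊗[ℂ] Q.V)) =
        pr ((bil r).flip q') ((bil r).flip q) t :=
    fun q q' t => LinearMap.congr_fun (f := (TensorProduct.curry (lin (nested r) :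
      (P.V ⊗[ℂ] P.V) ⊗[ℂ] (Q.V ⊗[ℂ] Q.V) →ₗ[ℂ] ℂ)).flip (q ⊗ₜ q'))
        (TensorProduct.ext' fun p p' => by
          refine (map_smul (bil r p) (bil r p' q) q').trans ?_
          exact mul_comm _ _) t
  constructor
  · intro hr
    refine ⟨fun p p' q => ?_, fun p q q' => ?_, fun q => ?_, fun p => ?_⟩
    · exact (LinearMap.congr_fun (congrArg lin hr.mul_left) ((p ⊗ₜ[ℂ] p') ⊗ₜ[ℂ] q)).trans
        (h1 p p' _)
    · exact (LinearMap.congr_fun (congrArg lin hr.mul_right) (p ⊗ₜ[ℂ] (q ⊗ₜ[ℂ] q'))).trans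
        (h2 q q' _)
    · refine (LinearMap.congr_fun (congrArg lin hr.one_left) ((1 : ℂ) ⊗ₜ[ℂ] q)).trans ?_
      exact congrArg (counit Q) (one_smul ℂ q)
    · refine (LinearMap.congr_fun (congrArg lin hr.one_right) (p ⊗ₜ[ℂ] (1 : ℂ))).trans ?_
      exact congrArg (counit P) (one_smul ℂ p)
  · rintro ⟨h3, h4, h5, h6⟩
    refine ⟨hom_ext (TensorProduct.ext_threefold fun p p' q => ?_),
      hom_ext (TensorProduct.ext (LinearMap.ext fun p => TensorProduct.ext' fun q q' => ?_)),
      hom_ext (TensorProduct.ext' fun (c : ℂ) q => ?_),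
      hom_ext (TensorProduct.ext' fun p (c : ℂ) => ?_)⟩
    · exact (h3 p p' q).trans (h1 p p' _).symm
    · exact (h4 p q q').trans (h2 q q' _).symm
    · have h7 : bil r (c • one P) q = counit Q (c • q) := by
        rw [map_smul, map_smul, LinearMap.smul_apply, h5]
      rw [← lin_one] at h7
      exact h7
    · have h7 : bil r p (c • one Q) = counit P (c • p) := by
        rw [map_smul, map_smul, h6]
      rw [← lin_one] at h7
      exact h7

end DiagRep

/-- The values of the pairing `b` on generators. -/
def bval (ζ ξ : ℂ) : Pm → Pm → ℂ
  | .pos, .neg => ζ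
  | .neg, .pos => ξ
  | _, _ => 0

/-- Since `b(s, t) = 0` unless `s = -t`, the weights `s` and `-t` can be exchanged next to `b(s,
t)`. -/
theorem bval_smul (ζ ξ : ℂ) {V : Type*} [AddCommGroup V] [Module ℂ V] (s t : Pm)
    {f : ℂ → V} {a b : ℂ} (h : s.val = -t.val → a = b) :
    bval ζ ξ s t • f a = bval ζ ξ s t • f b := by
  cases s <;> cases t
  · simp [bval]
  · rw [h (by simp [Pm.val])]
  · rw [h (by simp [Pm.val])]
  · simp [bval]

namespace TensorBialgebra
open DiagRep Tens MonObj ComonObj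
variable {κ ω : ℂ} (B : TensorBialgebra (Fω κ ω)) (ζ ξ : ℂ)

/-- The skew derivations of the tensor algebra that are dual to multiplication by generators. -/
structure IsDer (d : Pm → B.T.V →ₗ[ℂ] B.T.V) : Prop where
  one : ∀ s, d s (one B.T) = 0
  mul : ∀ s t q, d s (mul B.T (B.g t) q) =
    mul B.T (B.g t) (d s q) + bval ζ ξ s t • B.T.kop (kw κ ω t) q

theorem exists_isDer : ∃ d, B.IsDer ζ ξ d := by
  choose d h1 h2 using fun s => B.exists_affine_rec 0 (fun t => DiagRep.mul B.T (B.g t))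
    (fun t => bval ζ ξ s t • B.T.kop (kw κ ω t))
  exact ⟨d, h1, h2⟩

namespace IsDer
variable {B ζ ξ} {d : Pm → B.T.V →ₗ[ℂ] B.T.V} (hd : B.IsDer ζ ξ d)
include hd

/-- The skew derivation `d` is left colinear: `Δ ∘ d = (id ⊗ d) ∘ Δ`. -/
theorem comul_d (s : Pm) (q : B.T.V) :
    comul B.T (d s q) = TensorProduct.map LinearMap.id (d s) (comul B.T q) := by
  refine B.ext_ind₁ (f := comul B.T ∘ₗ d s)
    (f' := TensorProduct.map LinearMap.id (d s) ∘ₗ comul B.T) ?_ (fun t q hq => ?_) q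
  · rw [LinearMap.comp_apply, LinearMap.comp_apply, hd.one, comul_one, TensorProduct.map_tmul,
      hd.one, map_zero, TensorProduct.tmul_zero]
  · rw [LinearMap.comp_apply, LinearMap.comp_apply] at hq ⊢
    rw [hd.mul, map_add, map_smul, comul_kop, comul_g_mul, comul_g_mul, hq]
    generalize comul B.T q = z
    induction z with
    | zero => simp
    | add x y hx hy =>
      simp only [map_add, smul_add] at hx hy ⊢
      refine Eq.trans ?_ ((congrArg₂ (· + ·) hx hy).trans ?_) <;> abel
    | tmul x y =>
      simp only [TensorProduct.map_tmul, LinearMap.id_apply, map_add, hd.mul,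
        TensorProduct.tmul_add, TensorProduct.tmul_smul, add_assoc]

/-- The twisted Leibniz rule of `d` on arbitrary products. -/
theorem d_mul (s : Pm) (q q' : B.T.V) : d s (DiagRep.mul B.T q q') =
    DiagRep.mul B.T q (d s q') + DiagRep.mul B.T (d s q) (B.T.kop (-kw κ ω s) q') := by
  refine B.ext_ind₁ (f := d s ∘ₗ (DiagRep.mul B.T).flip q')
    (f' := (DiagRep.mul B.T).flip (d s q') +
      (DiagRep.mul B.T).flip (B.T.kop (-kw κ ω s) q') ∘ₗ d s) ?_ (fun t q hq => ?_) q
  · simp only [LinearMap.comp_apply, LinearMap.flip_apply, LinearMap.add_apply, DiagRep.one_mul,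
      hd.one, map_zero, add_zero]
  · simp only [LinearMap.comp_apply, LinearMap.flip_apply, LinearMap.add_apply] at hq ⊢
    rw [DiagRep.mul_assoc, hd.mul, hq, hd.mul, DiagRep.mul_assoc, kop_mul, map_add, map_add,
      LinearMap.add_apply, DiagRep.mul_assoc, map_smul, LinearMap.smul_apply, add_assoc]
    congr 2
    refine bval_smul ζ ξ s t (f := fun a => DiagRep.mul B.T (B.T.kop (kw κ ω t) q)
      (B.T.kop a q')) fun h => ?_
    rw [kw, kw, h]
    ring

/-- The skew derivation `d_s` has the weight `s ω`. -/
theorem h_d (s : Pm) (q : B.T.V) : B.T.h (d s q) = d s (B.T.h q) + (s.val * ω) • d s q := by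
  refine B.ext_ind₁ (f := B.T.h ∘ₗ d s) (f' := d s ∘ₗ B.T.h + (s.val * ω) • d s) ?_
    (fun t q hq => ?_) q
  · simp only [LinearMap.comp_apply, LinearMap.add_apply, LinearMap.smul_apply, hd.one, map_zero,
      h_one, zero_smul, smul_zero, add_zero]
  · simp only [LinearMap.comp_apply, LinearMap.add_apply, LinearMap.smul_apply] at hq ⊢
    have h1 : (s.val * ω) • (bval ζ ξ s t • B.T.kop (kw κ ω t) q) =
        - ((t.val * ω) • bval ζ ξ s t • B.T.kop (kw κ ω t) q) := by
      have := bval_smul ζ ξ s t (f := fun a => (a * ω) • B.T.kop (kw κ ω t) q)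
        (a := s.val) (b := -t.val) id
      rw [smul_comm, this, smul_comm, neg_mul, neg_smul]
    rw [h_mul, hd.mul, map_add, map_add, h_mul, h_g, hq, map_smul, LinearMap.smul_apply,
      LinearMap.smul_apply, map_smul, map_add, map_smul (d s), hd.mul, hd.mul, h_kop, smul_add, smul_add,
      h1, map_smul]
    abel

end IsDer

variable {ζ ξ}

/-- The pairing is defined by recursion on words of the first factor, where left multiplication by a
generator is dual to its skew derivation. -/
theorem exists_pairing {P Q : TensorBialgebra (Fω κ ω)} {d : Pm → Q.T.V →ₗ[ℂ] Q.T.V}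
    (hd : Q.IsDer ζ ξ d) : ∃ r : P.T ⊗ Q.T ⟶ 𝟙_ (DiagRep κ),
      (∀ q, bil r (DiagRep.one P.T) q = counit Q.T q) ∧
      ∀ s p q, bil r (DiagRep.mul P.T (P.g s) p) q = bil r p (d s q) := by
  obtain ⟨R, h1, h2⟩ := P.exists_rec (counit Q.T) fun s => (d s).lcomp ℂ ℂ
  have h3 : ∀ s p q, R (DiagRep.mul P.T (P.g s) p) q = R p (d s q) := fun s p q => by
    rw [h2]
    rfl
  have h4 : ∀ (p : P.T.V) (q : Q.T.V), R (P.T.h p) q + R p (Q.T.h q) = 0 := fun p q => by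
    refine P.ext_ind (f := fun q => LinearMap.applyₗ q ∘ₗ R ∘ₗ P.T.h +
      LinearMap.applyₗ (Q.T.h q) ∘ₗ R) (f' := fun _ => 0) (fun q => ?_) (fun s p hp q => ?_) q p
    · simp only [LinearMap.add_apply, LinearMap.comp_apply, LinearMap.applyₗ_apply_apply, h_one,
        map_zero, zero_smul, LinearMap.zero_apply, h1, counit_h, add_zero]
    · simp only [LinearMap.add_apply, LinearMap.comp_apply, LinearMap.applyₗ_apply_apply,
        LinearMap.zero_apply] at hp ⊢
      have h5 := hp (d s q)
      rw [hd.h_d, map_add, map_smul] at h5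
      rw [h_mul, h_g, map_add, LinearMap.add_apply, map_smul, LinearMap.smul_apply, map_smul,
        LinearMap.smul_apply, h3, h3, h3, ← h5]
      ring
  refine ⟨mk' (X := P.T ⊗ Q.T) (Y := 𝟙_ (DiagRep κ)) (TensorProduct.lift R : P.T.V ⊗[ℂ] Q.T.V →ₗ[ℂ] ℂ) <| addEnd_comm fun p q => ?_,
    fun q => ?_, fun s p q => h3 s p q⟩
  · exact h4 p q
  · exact LinearMap.congr_fun h1 q

section pairing
variable {P Q : TensorBialgebra (Fω κ ω)} {d : Pm → Q.T.V →ₗ[ℂ] Q.T.V} (hd : Q.IsDer ζ ξ d)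
  {r : P.T ⊗ Q.T ⟶ 𝟙_ (DiagRep κ)}
include hd

/-- A pairing given by skew derivations is a Hopf pairing: duality of the product on the left with
the coproduct on the right is the colinearity of `d`, and the other duality is its Leibniz rule. -/
theorem isHopfPairing (h1 : ∀ q, bil r (DiagRep.one P.T) q = counit Q.T q)
    (h2 : ∀ s p q, bil r (DiagRep.mul P.T (P.g s) p) q = bil r p (d s q)) : IsHopfPairing r := by
  have h1' : bil r (DiagRep.one P.T) = counit Q.T := LinearMap.ext h1
  have h2' : ∀ s p, bil r (DiagRep.mul P.T (P.g s) p) = bil r p ∘ₗ d s := fun s p =>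
    LinearMap.ext (h2 s p)
  refine (isHopfPairing_iff r).2 ⟨fun p p' q => ?_, fun p q q' => ?_, h1, fun p => ?_⟩
  · refine P.ext_ind (f := fun q => LinearMap.applyₗ q ∘ₗ bil r ∘ₗ (DiagRep.mul P.T).flip p')
      (f' := fun q => LinearMap.applyₗ (comul Q.T q) ∘ₗ (LinearMap.compRight ℂ (LinearMap.mul' ℂ ℂ)) ∘ₗ
        TensorProduct.mapBilinear (.id ℂ) Q.T.V Q.T.V ℂ ℂ (bil r p') ∘ₗ bil r) (fun q => ?_)
        (fun s p hp q => ?_) q p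
    · change bil r (DiagRep.mul P.T (DiagRep.one P.T) p') q =
        pr (bil r p') (bil r (DiagRep.one P.T)) (comul Q.T q)
      rw [DiagRep.one_mul, h1', pr_counit_right]
    · change ∀ q, bil r (DiagRep.mul P.T p p') q = pr (bil r p') (bil r p) (comul Q.T q) at hp
      change bil r (DiagRep.mul P.T (DiagRep.mul P.T (P.g s) p) p') q =
        pr (bil r p') (bil r (DiagRep.mul P.T (P.g s) p)) (comul Q.T q)
      rw [DiagRep.mul_assoc, h2, hp, hd.comul_d, pr_map, h2']
      rfl
  · refine P.ext_ind (f := fun i : Q.T.V × Q.T.V => (bil r).flip (DiagRep.mul Q.T i.1 i.2))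
      (f' := fun i => pr ((bil r).flip i.2) ((bil r).flip i.1) ∘ₗ comul P.T) (fun i => ?_)
        (fun s p hp i => ?_) (q, q') p
    · simp only [LinearMap.comp_apply, LinearMap.flip_apply, comul_one, pr_tmul, h1, counit_mul]
      exact mul_comm _ _
    · simp only [LinearMap.comp_apply, LinearMap.flip_apply, Prod.forall] at hp ⊢
      have h3 : ∀ q, (bil r).flip q ∘ₗ DiagRep.mul P.T (P.g s) = (bil r).flip (d s q) := fun q =>
        LinearMap.ext fun p => h2 s p q
      have h4 : ∀ c q, (bil r).flip q ∘ₗ P.T.kop c = (bil r).flip (Q.T.kop (-c) q) := fun c q =>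
        LinearMap.ext fun p => bil_kop r c p q
      rw [h2, hd.d_mul, map_add, hp, hp, comul_g_mul, map_add, pr_map, pr_map, h3, h3, h4]
      rfl
  · refine P.ext_ind₁ (f := (bil r).flip (DiagRep.one Q.T)) (f' := counit P.T) ?_
      (fun s p _ => ?_) p
    · rw [LinearMap.flip_apply, h1, counit_one, counit_one]
    · rw [LinearMap.flip_apply, h2, hd.one, map_zero, counit_g_mul]

/-- Every Hopf pairing that extends `b` satisfies the recursion of `exists_pairing`, since
`(id ⊗ r(g, ·)) ∘ Δ` satisfies the recursion that defines `d`. -/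
theorem pairing_g_mul (hr : IsHopfPairing r)
    (hb : ∀ s t, bil r (P.g s) (Q.g t) = bval ζ ξ s t) (s : Pm) (p : P.T.V) (q : Q.T.V) :
    bil r (DiagRep.mul P.T (P.g s) p) q = bil r p (d s q) := by
  obtain ⟨h1, h2, h3, h4⟩ := (isHopfPairing_iff r).1 hr
  have h5 : bil r (P.g s) (DiagRep.one Q.T) = 0 := by rw [h4, counit_g]
  have h6 : ∀ t, bil r (P.g s) ∘ₗ DiagRep.mul Q.T (Q.g t) = bval ζ ξ s t • counit Q.T := fun t =>
    LinearMap.ext fun q => by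
      rw [LinearMap.comp_apply, h2, comul_g, map_add, pr_tmul, pr_tmul, LinearMap.smul_apply]
      simp only [LinearMap.flip_apply, h3, counit_g, hb, mul_zero, zero_add, smul_eq_mul]
      exact mul_comm _ _
  have h7 : ∀ q, TensorProduct.rid ℂ Q.T.V (TensorProduct.map LinearMap.id (bil r (P.g s))
      (comul Q.T q)) = d s q := by
    refine Q.ext_ind₁ (f := (TensorProduct.rid ℂ Q.T.V).toLinearMap ∘ₗ
      TensorProduct.map LinearMap.id (bil r (P.g s)) ∘ₗ comul Q.T) ?_ fun t q hq => ?_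
    · simp only [LinearMap.comp_apply, comul_one, TensorProduct.map_tmul, h5, hd.one,
        TensorProduct.tmul_zero, map_zero]
    · simp only [LinearMap.comp_apply, LinearEquiv.coe_coe] at hq ⊢
      have h8 : Q.T.kop (kw κ ω t) q = Q.T.kop (kw κ ω t) (TensorProduct.rid ℂ Q.T.V
        (TensorProduct.map LinearMap.id (counit Q.T) (comul Q.T q))) := by rw [DiagRep.comul_counit]
      rw [comul_g_mul, hd.mul, ← hq, h8]
      generalize comul Q.T q = z
      induction z with
      | zero => simp
      | add x y hx hy =>
        simp only [map_add, smul_add] at hx hy ⊢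
        refine Eq.trans ?_ ((congrArg₂ (· + ·) hx hy).trans ?_) <;> abel
      | tmul x y =>
        have h9 := LinearMap.congr_fun (h6 t) y
        rw [LinearMap.comp_apply, LinearMap.smul_apply] at h9
        simp only [TensorProduct.map_tmul, LinearMap.id_apply, map_add, h9,
          TensorProduct.rid_tmul, map_smul, smul_smul, smul_eq_mul]
  rw [h1, ← h7]
  generalize comul Q.T q = z
  induction z with
  | zero => simp
  | add x y hx hy => simp only [map_add, hx, hy]
  | tmul x y =>
    simp only [TensorProduct.map_tmul, LinearMap.id_apply, TensorProduct.rid_tmul, map_smul,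
      pr_tmul, smul_eq_mul]
    exact mul_comm _ _

end pairing

/-- A pairing restricts to `b` if it does so on basis vectors. -/
theorem incl_comp_eq_bMor_iff {P Q : TensorBialgebra (Fω κ ω)} (r : P.T ⊗ Q.T ⟶ 𝟙_ (DiagRep κ)) :
    (P.incl ⊗ₘ Q.incl) ≫ r = bMor κ ω ζ ξ ↔ ∀ s t, bil r (P.g s) (Q.g t) = bval ζ ξ s t := by
  have h1 : ∀ s t, bLin ζ ξ (gen κ ω s ⊗ₜ[ℂ] gen κ ω t : (ℂ × ℂ) ⊗[ℂ] (ℂ × ℂ)) = bval ζ ξ s t := by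
    intro s t
    cases s <;> cases t <;> simp [bLin, gen, bval]
  constructor
  · intro h s t
    exact (LinearMap.congr_fun (congrArg lin h) (gen κ ω s ⊗ₜ[ℂ] gen κ ω t)).trans (h1 s t)
  · intro h
    refine hom_ext (TensorProduct.ext (fω_ext fun s => fω_ext fun t => ?_))
    exact (h s t).trans (h1 s t).symm

/-- Existence is `exists_pairing`, and uniqueness holds because the recursion of `pairing_g_mul`
determines the pairing. -/
theorem existsUnique_pairing (ζ ξ : ℂ) (P Q : TensorBialgebra (Fω κ ω)) :
    ∃! r : P.T ⊗ Q.T ⟶ 𝟙_ (DiagRep κ), IsHopfPairing r ∧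
      (P.incl ⊗ₘ Q.incl) ≫ r = bMor κ ω ζ ξ := by
  obtain ⟨d, hd⟩ := Q.exists_isDer ζ ξ
  obtain ⟨r, h1, h2⟩ := exists_pairing (P := P) hd
  have h3 : IsHopfPairing r := isHopfPairing hd h1 h2
  refine ⟨r, ⟨h3, (incl_comp_eq_bMor_iff r).2 fun s t => ?_⟩, fun r' ⟨h4, h5⟩ => ?_⟩
  · rw [← DiagRep.mul_one (P.g s), h2, h1, ← DiagRep.mul_one (Q.g t), hd.mul, hd.one, map_zero,
      zero_add, map_smul, kop_one, counit_one, smul_eq_mul, _root_.mul_one]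
  · have h6 := pairing_g_mul hd h4 ((incl_comp_eq_bMor_iff r').1 h5)
    have h7 := ((isHopfPairing_iff r').1 h4).2.2.1
    refine hom_ext (TensorProduct.ext' fun p q => ?_)
    refine P.ext_ind (f := fun q => (bil r').flip q) (f' := fun q => (bil r).flip q) (fun q => ?_)
      (fun s p hp q => ?_) q p
    · simp only [LinearMap.flip_apply, h1, h7]
    · simp only [LinearMap.flip_apply] at hp ⊢
      rw [h2, h6, hp]

end TensorBialgebra

/-! ### Yetter-Drinfeld modules in terms of generators -/

namespace DiagRep
open MonObj ComonObj
variable {κ : ℂ}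

theorem tensor_ext₄ {X Y Z W : DiagRep κ} {T : Type} [AddCommGroup T] [Module ℂ T]
    {f g : (X.V ⊗[ℂ] Y.V) ⊗[ℂ] (Z.V ⊗[ℂ] W.V) →ₗ[ℂ] T}
    (H : ∀ (a b c d : ℂ) (x : X.V) (y : Y.V) (z : Z.V) (w : W.V), X.h x = a • x → Y.h y = b • y →
      Z.h z = c • z → W.h w = d • w →
        f ((x ⊗ₜ y) ⊗ₜ (z ⊗ₜ w)) = g ((x ⊗ₜ y) ⊗ₜ (z ⊗ₜ w))) : f = g :=
  TensorProduct.ext <| tensor_ext fun a b x y hx hy => tensor_ext fun c d z w hz hw =>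
    H a b c d x y z w hx hy hz hw

/-- An operator of weight `w` commutes with `e^{c h}` up to `e^{c w}`. -/
theorem kop_shift {X : DiagRep κ} {f : Module.End ℂ X.V} {w : ℂ}
    (hf : ∀ v, X.h (f v) = f (X.h v) + w • f v) (c : ℂ) (v : X.V) :
    X.kop c (f v) = Complex.exp (c * w) • f (X.kop c v) := by
  refine LinearMap.congr_fun (f := X.kop c ∘ₗ f) (g := Complex.exp (c * w) • f ∘ₗ X.kop c)
    (lin_ext fun a v hv => ?_) v
  have h : X.h (f v) = (a + w) • f v := by rw [hf, hv, map_smul, add_smul]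
  rw [LinearMap.comp_apply, LinearMap.smul_apply, LinearMap.comp_apply, kop_eigen c h,
    kop_eigen c hv, map_smul, smul_smul, ← Complex.exp_add]
  ring_nf

/-- The bilinear map of a morphism `X ⊗ Y ⟶ Z`. -/
def cur {X Y Z : DiagRep κ} (f : X ⊗ Y ⟶ Z) : X.V →ₗ[ℂ] Y.V →ₗ[ℂ] Z.V :=
  TensorProduct.curry (lin f : X.V ⊗[ℂ] Y.V →ₗ[ℂ] Z.V)

theorem h_cur {X Y Z : DiagRep κ} (f : X ⊗ Y ⟶ Z) (x : X.V) (y : Y.V) :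
    Z.h (cur f x y) = cur f (X.h x) y + cur f x (Y.h y) := by
  refine (comm f (x ⊗ₜ[ℂ] y : X.V ⊗[ℂ] Y.V)).symm.trans ?_
  refine (congrArg (lin f) (addEnd_tmul X.h Y.h x y)).trans ?_
  exact map_add (lin f) _ _

theorem kop_cur {X Y Z : DiagRep κ} (f : X ⊗ Y ⟶ Z) (c : ℂ) (x : X.V) (y : Y.V) :
    Z.kop c (cur f x y) = cur f (X.kop c x) (Y.kop c y) := by
  refine (lin_kop f c (x ⊗ₜ[ℂ] y : X.V ⊗[ℂ] Y.V)).symm.trans ?_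
  exact congrArg (lin f) (kop_tmul X Y c x y)

/-- A pairing in `𝒞` vanishes on weight vectors whose weights do not cancel. -/
theorem bil_eq_zero {P Q : DiagRep κ} (r : P ⊗ Q ⟶ 𝟙_ (DiagRep κ)) {a b : ℂ} {p : P.V} {q : Q.V}
    (hp : P.h p = a • p) (hq : Q.h q = b • q) : a + b = 0 ∨ bil r p q = 0 := by
  have h := comm r (p ⊗ₜ[ℂ] q : P.V ⊗[ℂ] Q.V)
  have h1 : (a + b) • bil r p q = 0 := by
    refine Eq.trans ?_ h
    refine Eq.trans ?_ (congrArg (lin r) (addEnd_eigen hp hq)).symm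
    exact (map_smul (lin r : P.V ⊗[ℂ] Q.V →ₗ[ℂ] ℂ) (a + b) (p ⊗ₜ q)).symm
  exact smul_eq_zero.1 h1

section
variable {P Q : DiagRep κ} (r : P ⊗ Q ⟶ 𝟙_ (DiagRep κ)) (X : DiagRep κ)

/-- `(p ⊗ x) ⊗ (q ⊗ q') ↦ r(p, q) x ⊗ q'` with the braiding of `x` and `q`. -/
def ydR : (P ⊗ X) ⊗ (Q ⊗ Q) ⟶ X ⊗ Q := tensorμ P X Q Q ≫ r ▷ (X ⊗ Q) ≫ (λ_ (X ⊗ Q)).hom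

/-- `(p ⊗ p') ⊗ (x ⊗ q) ↦ r(p', q) p ⊗ x` with the braiding of `p'` and `x`. -/
def ydL : (P ⊗ P) ⊗ (X ⊗ Q) ⟶ P ⊗ X := tensorμ P P X Q ≫ (P ⊗ X) ◁ r ≫ (ρ_ (P ⊗ X)).hom

/-- The linear map of `ydR`. -/
def linR : (P.V ⊗[ℂ] X.V) ⊗[ℂ] (Q.V ⊗[ℂ] Q.V) →ₗ[ℂ] X.V ⊗[ℂ] Q.V := lin (ydR r X)

/-- The linear map of `ydL`. -/
def linL : (P.V ⊗[ℂ] P.V) ⊗[ℂ] (X.V ⊗[ℂ] Q.V) →ₗ[ℂ] P.V ⊗[ℂ] X.V := lin (ydL r X)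

variable {X}

theorem linR_tmul {a b : ℂ} (p : P.V) {x : X.V} {q : Q.V} (q' : Q.V) (hx : X.h x = a • x)
    (hq : Q.h q = b • q) : linR r X ((p ⊗ₜ x) ⊗ₜ (q ⊗ₜ q')) =
      (Complex.exp (κ * (a * b)) * bil r p q) • x ⊗ₜ[ℂ] q' := by
  refine (congrArg (lin (r ▷ (X ⊗ Q) ≫ (λ_ (X ⊗ Q)).hom)) (lin_tensorμ p q' hx hq)).trans ?_
  refine (map_smul (lin (r ▷ (X ⊗ Q) ≫ (λ_ (X ⊗ Q)).hom)) _ _).trans ?_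
  rw [mul_smul]
  rfl

theorem linL_tmul {a b : ℂ} (p : P.V) {p' : P.V} {x : X.V} (q : Q.V) (hp : P.h p' = a • p')
    (hx : X.h x = b • x) : linL r X ((p ⊗ₜ p') ⊗ₜ (x ⊗ₜ q)) =
      (Complex.exp (κ * (a * b)) * bil r p' q) • p ⊗ₜ[ℂ] x := by
  refine (congrArg (lin ((P ⊗ X) ◁ r ≫ (ρ_ (P ⊗ X)).hom)) (lin_tensorμ p q hp hx)).trans ?_
  refine (map_smul (lin ((P ⊗ X) ◁ r ≫ (ρ_ (P ⊗ X)).hom)) _ _).trans ?_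
  rw [mul_smul]
  rfl

/-- The Yetter-Drinfeld condition in terms of elements: each side first applies the pairing, with
the braiding it requires, and then the remaining action. -/
theorem yd_iff [BimonObj P] [BimonObj Q] (l : P ⊗ X ⟶ X) (m : X ⊗ Q ⟶ X) :
    (Δ[P] ⊗ₘ (X ◁ Δ[Q] ≫ (α_ X Q Q).inv ≫ m ▷ Q)) ≫ tensorμ P P X Q ≫ (l ⊗ₘ r) ≫ (ρ_ X).hom =
    (α_ P X Q).inv ≫ ((Δ[P] ▷ X ≫ (α_ P P X).hom ≫ P ◁ l) ⊗ₘ Δ[Q]) ≫ tensorμ P X Q Q ≫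
      (r ⊗ₘ m) ≫ (λ_ X).hom ↔
    ∀ p x q, TensorProduct.lift (cur l) (linL r X
        (comul P p ⊗ₜ TensorProduct.map (cur m x) LinearMap.id (comul Q q))) =
      TensorProduct.lift (cur m) (linR r X
        (TensorProduct.map LinearMap.id ((cur l).flip x) (comul P p) ⊗ₜ comul Q q)) := by
  have e1 : tensorμ P P X Q ≫ (l ⊗ₘ r) ≫ (ρ_ X).hom = ydL r X ≫ l := by
    simp only [ydL, Category.assoc, ← rightUnitor_naturality]
    rw [tensorHom_def', Category.assoc]
  have e2 : tensorμ P X Q Q ≫ (r ⊗ₘ m) ≫ (λ_ X).hom = ydR r X ≫ m := by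
    simp only [ydR, Category.assoc, ← leftUnitor_naturality]
    rw [MonoidalCategory.tensorHom_def, Category.assoc]
  rw [e1, e2]
  have e3 : ∀ x (t : Q.V ⊗[ℂ] Q.V), lin ((α_ X Q Q).inv ≫ m ▷ Q) (x ⊗ₜ t : X.V ⊗[ℂ] (Q.V ⊗[ℂ] Q.V)) =
      TensorProduct.map (cur m x) LinearMap.id t := fun x t =>
    LinearMap.congr_fun (f := TensorProduct.curry (lin ((α_ X Q Q).inv ≫ m ▷ Q) :
      X.V ⊗[ℂ] (Q.V ⊗[ℂ] Q.V) →ₗ[ℂ] X.V ⊗[ℂ] Q.V) x)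
        (g := TensorProduct.map (cur m x) LinearMap.id) (TensorProduct.ext' fun _ _ => rfl) t
  have e4 : ∀ x (t : P.V ⊗[ℂ] P.V), lin ((α_ P P X).hom ≫ P ◁ l) (t ⊗ₜ x : (P.V ⊗[ℂ] P.V) ⊗[ℂ] X.V) =
      TensorProduct.map LinearMap.id ((cur l).flip x) t := fun x t =>
    LinearMap.congr_fun (f := (TensorProduct.curry (lin ((α_ P P X).hom ≫ P ◁ l) :
      (P.V ⊗[ℂ] P.V) ⊗[ℂ] X.V →ₗ[ℂ] P.V ⊗[ℂ] X.V)).flip x)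
        (g := TensorProduct.map LinearMap.id ((cur l).flip x)) (TensorProduct.ext' fun _ _ => rfl) t
  have e5 : ∀ t, lin l t = TensorProduct.lift (cur l) t := fun t =>
    LinearMap.congr_fun (TensorProduct.lift_mk_compr₂ (lin l : P.V ⊗[ℂ] X.V →ₗ[ℂ] X.V)).symm t
  have e6 : ∀ t, lin m t = TensorProduct.lift (cur m) t := fun t =>
    LinearMap.congr_fun (TensorProduct.lift_mk_compr₂ (lin m : X.V ⊗[ℂ] Q.V →ₗ[ℂ] X.V)).symm t
  have e7 : ∀ p x q, lin ((Δ[P] ⊗ₘ (X ◁ Δ[Q] ≫ (α_ X Q Q).inv ≫ m ▷ Q)) ≫ ydL r X ≫ l)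
      (p ⊗ₜ (x ⊗ₜ q) : P.V ⊗[ℂ] (X.V ⊗[ℂ] Q.V)) = TensorProduct.lift (cur l) (linL r X
        (comul P p ⊗ₜ TensorProduct.map (cur m x) LinearMap.id (comul Q q))) := fun p x q => by
    rw [← e5, ← e3]
    rfl
  have e8 : ∀ p x q, lin ((α_ P X Q).inv ≫ ((Δ[P] ▷ X ≫ (α_ P P X).hom ≫ P ◁ l) ⊗ₘ Δ[Q]) ≫
      ydR r X ≫ m) (p ⊗ₜ (x ⊗ₜ q) : P.V ⊗[ℂ] (X.V ⊗[ℂ] Q.V)) =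
      TensorProduct.lift (cur m) (linR r X
        (TensorProduct.map LinearMap.id ((cur l).flip x) (comul P p) ⊗ₜ comul Q q)) :=
    fun p x q => by
    rw [← e6, ← e4]
    rfl
  constructor
  · intro h p x q
    rw [← e7, ← e8, h]
  · intro h
    refine hom_ext (TensorProduct.ext (LinearMap.ext fun p => TensorProduct.ext' fun x q => ?_))
    exact (e7 p x q).trans ((h p x q).trans (e8 p x q).symm)

end
end DiagRep

namespace TensorBialgebra
open DiagRep Tens MonObj ComonObj
variable {κ ω ζ ξ : ℂ}

/-- A pairing together with two families of skew derivations of `Q`: under the pairing `d s` is dual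
to the left multiplication by the generator `s` of `P`, and `d' s` is its mirror image, with
`(d s ⊗ id) ∘ Δ = (id ⊗ d' s) ∘ Δ` (`SkewDual.comul_d'`). -/
structure SkewDual (ζ ξ : ℂ) {P Q : TensorBialgebra (Fω κ ω)} (r : P.T ⊗ Q.T ⟶ 𝟙_ (DiagRep κ))
    (d d' : Pm → Q.T.V →ₗ[ℂ] Q.T.V) : Prop where
  isDer : Q.IsDer ζ ξ d
  one : ∀ q, bil r (DiagRep.one P.T) q = counit Q.T q
  g_mul : ∀ s p q, bil r (DiagRep.mul P.T (P.g s) p) q = bil r p (d s q)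
  one' : ∀ s, d' s (DiagRep.one Q.T) = 0
  mul' : ∀ s t q, d' s (DiagRep.mul Q.T (Q.g t) q) =
    Complex.exp (-kw κ ω s * (t.val * ω)) • DiagRep.mul Q.T (Q.g t) (d' s q) + bval ζ ξ s t • q

variable {P Q : TensorBialgebra (Fω κ ω)} {r : P.T ⊗ Q.T ⟶ 𝟙_ (DiagRep κ)}

/-- The pairing provides `d`, and `d'` is defined by recursion. -/
theorem exists_skewDual (hr : IsHopfPairing r) (hb : (P.incl ⊗ₘ Q.incl) ≫ r = bMor κ ω ζ ξ) :
    ∃ d d', SkewDual ζ ξ r d d' := by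
  obtain ⟨d, hd⟩ := Q.exists_isDer ζ ξ
  choose d' h1 h2 using fun s => Q.exists_affine_rec 0
    (fun t => Complex.exp (-kw κ ω s * (t.val * ω)) • DiagRep.mul Q.T (Q.g t))
    (fun t => bval ζ ξ s t • LinearMap.id)
  exact ⟨d, d', hd, ((isHopfPairing_iff r).1 hr).2.2.1,
    pairing_g_mul hd hr ((incl_comp_eq_bMor_iff r).1 hb), h1, h2⟩

namespace SkewDual
variable {d d' : Pm → Q.T.V →ₗ[ℂ] Q.T.V} (hd : SkewDual ζ ξ r d d')
include hd

theorem kop_d (c : ℂ) (s : Pm) (q : Q.T.V) :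
    Q.T.kop c (d s q) = Complex.exp (c * (s.val * ω)) • d s (Q.T.kop c q) :=
  kop_shift (hd.isDer.h_d s) c q

/-- The derivation `d'` is the mirror image of `d`: `(d ⊗ id) ∘ Δ = (id ⊗ d') ∘ Δ`. -/
theorem comul_d' (s : Pm) (q : Q.T.V) : TensorProduct.map (d s) LinearMap.id (comul Q.T q) =
    TensorProduct.map LinearMap.id (d' s) (comul Q.T q) := by
  refine Q.ext_ind₁ (f := TensorProduct.map (d s) LinearMap.id ∘ₗ comul Q.T)
    (f' := TensorProduct.map LinearMap.id (d' s) ∘ₗ comul Q.T) ?_ (fun t q hq => ?_) q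
  · rw [LinearMap.comp_apply, LinearMap.comp_apply, comul_one, TensorProduct.map_tmul,
      TensorProduct.map_tmul, hd.isDer.one, hd.one', TensorProduct.tmul_zero,
      TensorProduct.zero_tmul]
  · rw [LinearMap.comp_apply, LinearMap.comp_apply] at hq ⊢
    have h1 : ∀ z : Q.T.V ⊗[ℂ] Q.T.V, TensorProduct.map (d s) LinearMap.id
        (TensorProduct.map (DiagRep.mul Q.T (Q.g t)) LinearMap.id z +
          TensorProduct.map (Q.T.kop (kw κ ω t)) (DiagRep.mul Q.T (Q.g t)) z) =
        TensorProduct.map (DiagRep.mul Q.T (Q.g t)) LinearMap.id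
          (TensorProduct.map (d s) LinearMap.id z) +
        Complex.exp (-kw κ ω s * (t.val * ω)) • TensorProduct.map (Q.T.kop (kw κ ω t))
          (DiagRep.mul Q.T (Q.g t)) (TensorProduct.map (d s) LinearMap.id z) +
        bval ζ ξ s t • TensorProduct.map (Q.T.kop (kw κ ω t)) LinearMap.id z := fun z => by
      have h2 : ∀ x, d s (Q.T.kop (kw κ ω t) x) =
          Complex.exp (-kw κ ω s * (t.val * ω)) • Q.T.kop (kw κ ω t) (d s x) := fun x => by
        rw [hd.kop_d, smul_smul, ← Complex.exp_add, kw, kw]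
        ring_nf
        rw [Complex.exp_zero, one_smul]
      induction z with
      | zero => simp
      | add x y hx hy =>
        simp only [map_add, smul_add] at hx hy ⊢
        refine Eq.trans ?_ ((congrArg₂ (· + ·) hx hy).trans ?_) <;> abel
      | tmul x y =>
        simp only [TensorProduct.map_tmul, LinearMap.id_apply, map_add, hd.isDer.mul, h2,
          TensorProduct.add_tmul, ← TensorProduct.smul_tmul']
        abel
    rw [comul_g_mul, h1, hq]
    generalize comul Q.T q = z
    induction z with
    | zero => simp
    | add x y hx hy =>
      simp only [map_add, smul_add] at hx hy ⊢
      refine Eq.trans ?_ ((congrArg₂ (· + ·) hx hy).trans ?_) <;> abel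
    | tmul x y =>
      simp only [TensorProduct.map_tmul, LinearMap.id_apply, map_add, hd.mul',
        TensorProduct.tmul_add, TensorProduct.tmul_smul]
      abel

variable {X : DiagRep κ}

omit hd in
/-- A generator in front of the first tensor factor is not affected by the pairing. -/
theorem linL_mul (s : Pm) (t : P.T.V ⊗[ℂ] P.T.V) (u : X.V ⊗[ℂ] Q.T.V) :
    linL r X (TensorProduct.map (DiagRep.mul P.T (P.g s)) LinearMap.id t ⊗ₜ u) =
      TensorProduct.map (DiagRep.mul P.T (P.g s)) LinearMap.id (linL r X (t ⊗ₜ u)) := by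
  refine LinearMap.congr_fun (f := linL r X ∘ₗ TensorProduct.map
    (TensorProduct.map (DiagRep.mul P.T (P.g s)) LinearMap.id) LinearMap.id)
    (g := TensorProduct.map (DiagRep.mul P.T (P.g s)) LinearMap.id ∘ₗ linL r X)
    (tensor_ext₄ fun a b c e p p' x q hp hp' hx hq => ?_) (t ⊗ₜ u)
  simp only [LinearMap.comp_apply, TensorProduct.map_tmul, LinearMap.id_apply]
  rw [linL_tmul r _ _ hp' hx, linL_tmul r _ _ hp' hx, map_smul, TensorProduct.map_tmul,
    LinearMap.id_apply]

/-- A generator in front of the paired factor is moved to the other side of the pairing, where it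
becomes `d_s`. -/
theorem linL_kop (s : Pm) (t : P.T.V ⊗[ℂ] P.T.V) (u : X.V ⊗[ℂ] Q.T.V) :
    linL r X (TensorProduct.map (P.T.kop (kw κ ω s)) (DiagRep.mul P.T (P.g s)) t ⊗ₜ u) =
      TensorProduct.map (P.T.kop (kw κ ω s)) (X.kop (kw κ ω s)) (linL r X
        (t ⊗ₜ TensorProduct.map LinearMap.id (d s) u)) := by
  refine LinearMap.congr_fun (f := linL r X ∘ₗ TensorProduct.map
    (TensorProduct.map (P.T.kop (kw κ ω s)) (DiagRep.mul P.T (P.g s))) LinearMap.id)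
    (g := TensorProduct.map (P.T.kop (kw κ ω s)) (X.kop (kw κ ω s)) ∘ₗ linL r X ∘ₗ
      TensorProduct.map LinearMap.id (TensorProduct.map LinearMap.id (d s)))
    (tensor_ext₄ fun a b c e p p' x q hp hp' hx hq => ?_) (t ⊗ₜ u)
  have h1 : P.T.h (DiagRep.mul P.T (P.g s) p') = (s.val * ω + b) • DiagRep.mul P.T (P.g s) p' := by
    rw [h_mul, h_g, hp', map_smul, map_smul, LinearMap.smul_apply, add_smul]
  simp only [LinearMap.comp_apply, TensorProduct.map_tmul, LinearMap.id_apply]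
  rw [linL_tmul r _ _ h1 hx, linL_tmul r _ _ hp' hx, map_smul, TensorProduct.map_tmul,
    kop_eigen _ hx, hd.g_mul, TensorProduct.tmul_smul, smul_smul]
  congr 1
  rw [kw, mul_right_comm, ← Complex.exp_add]
  ring_nf

/-- A generator in front of the paired factor is moved to the other side of the pairing, where it
becomes `d_s`. The braiding with the shifted weight accounts for `K_s⁻¹`. -/
theorem linR_mul (s : Pm) (t : P.T.V ⊗[ℂ] X.V) (u : Q.T.V ⊗[ℂ] Q.T.V) :
    linR r X (TensorProduct.map (DiagRep.mul P.T (P.g s)) LinearMap.id t ⊗ₜ u) =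
      TensorProduct.map (X.kop (-kw κ ω s)) LinearMap.id
        (linR r X (t ⊗ₜ TensorProduct.map (d s) LinearMap.id u)) := by
  refine LinearMap.congr_fun (f := linR r X ∘ₗ TensorProduct.map
    (TensorProduct.map (DiagRep.mul P.T (P.g s)) LinearMap.id) LinearMap.id)
    (g := TensorProduct.map (X.kop (-kw κ ω s)) LinearMap.id ∘ₗ linR r X ∘ₗ
      TensorProduct.map LinearMap.id (TensorProduct.map (d s) LinearMap.id))
    (tensor_ext₄ fun a b c e p x q q' hp hx hq hq' => ?_) (t ⊗ₜ u)
  have h1 : Q.T.h (d s q) = (c + s.val * ω) • d s q := by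
    rw [hd.isDer.h_d, hq, map_smul, add_smul]
  simp only [LinearMap.comp_apply, TensorProduct.map_tmul, LinearMap.id_apply]
  rw [linR_tmul r _ _ hx hq, linR_tmul r _ _ hx h1, map_smul, TensorProduct.map_tmul,
    kop_eigen _ hx, hd.g_mul, ← TensorProduct.smul_tmul', smul_smul, LinearMap.id_apply]
  congr 1
  rw [kw, mul_right_comm, ← Complex.exp_add]
  ring_nf

omit hd in
/-- An operator of weight `s ω` on the module, together with `K_s` on the paired factor, commutes
with the pairing: the pairing vanishes unless the weights cancel, and then the scalars agree. -/
theorem linR_kop {A : Module.End ℂ X.V} {s : Pm}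
    (hA : ∀ v, X.h (A v) = A (X.h v) + (s.val * ω) • A v)
    (t : P.T.V ⊗[ℂ] X.V) (u : Q.T.V ⊗[ℂ] Q.T.V) :
    linR r X (TensorProduct.map (P.T.kop (kw κ ω s)) A t ⊗ₜ u) =
      TensorProduct.map A LinearMap.id (linR r X (t ⊗ₜ u)) := by
  refine LinearMap.congr_fun (f := linR r X ∘ₗ TensorProduct.map
    (TensorProduct.map (P.T.kop (kw κ ω s)) A) LinearMap.id)
    (g := TensorProduct.map A LinearMap.id ∘ₗ linR r X)
    (tensor_ext₄ fun a b c e p x q q' hp hx hq hq' => ?_) (t ⊗ₜ u)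
  have h1 : X.h (A x) = (b + s.val * ω) • A x := by rw [hA, hx, map_smul, add_smul]
  simp only [LinearMap.comp_apply, TensorProduct.map_tmul, LinearMap.id_apply]
  rw [linR_tmul r _ _ h1 hq, linR_tmul r _ _ hx hq, map_smul, TensorProduct.map_tmul,
    LinearMap.id_apply]
  congr 1
  rcases bil_eq_zero r hp hq with h | h
  · rw [kop_eigen _ hp, map_smul, LinearMap.smul_apply, smul_eq_mul, ← _root_.mul_assoc,
      ← Complex.exp_add, kw, eq_neg_of_add_eq_zero_left h]
    ring_nf
  · rw [kop_eigen _ hp, map_smul, LinearMap.smul_apply, h]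
    simp

omit hd in
theorem linR_right (f : Module.End ℂ Q.T.V) (t : P.T.V ⊗[ℂ] X.V) (u : Q.T.V ⊗[ℂ] Q.T.V) :
    linR r X (t ⊗ₜ TensorProduct.map LinearMap.id f u) =
      TensorProduct.map LinearMap.id f (linR r X (t ⊗ₜ u)) := by
  refine LinearMap.congr_fun (f := linR r X ∘ₗ TensorProduct.map LinearMap.id
    (TensorProduct.map LinearMap.id f)) (g := TensorProduct.map LinearMap.id f ∘ₗ linR r X)
    (tensor_ext₄ fun a b c e p x q q' hp hx hq hq' => ?_) (t ⊗ₜ u)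
  simp only [LinearMap.comp_apply, TensorProduct.map_tmul, LinearMap.id_apply]
  rw [linR_tmul r _ _ hx hq, linR_tmul r _ _ hx hq, map_smul, TensorProduct.map_tmul,
    LinearMap.id_apply]

theorem linL_one (u : X.V ⊗[ℂ] Q.T.V) :
    linL r X ((DiagRep.one P.T ⊗ₜ DiagRep.one P.T) ⊗ₜ u) =
      DiagRep.one P.T ⊗ₜ TensorProduct.rid ℂ X.V (TensorProduct.map LinearMap.id (counit Q.T) u) := by
  refine LinearMap.congr_fun (f := linL r X ∘ₗ
    TensorProduct.mk ℂ _ _ (DiagRep.one P.T ⊗ₜ DiagRep.one P.T))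
    (g := TensorProduct.mk ℂ _ _ (DiagRep.one P.T) ∘ₗ (TensorProduct.rid ℂ X.V).toLinearMap ∘ₗ
      TensorProduct.map LinearMap.id (counit Q.T)) (tensor_ext fun a b x q hx hq => ?_) u
  simp only [LinearMap.comp_apply, TensorProduct.mk_apply]
  rw [linL_tmul r _ _ h_one hx, hd.one, TensorProduct.map_tmul]
  simp

theorem linR_one (x : X.V) (u : Q.T.V ⊗[ℂ] Q.T.V) : linR r X ((DiagRep.one P.T ⊗ₜ x) ⊗ₜ u) =
    x ⊗ₜ TensorProduct.lid ℂ Q.T.V (TensorProduct.map (counit Q.T) LinearMap.id u) := by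
  refine LinearMap.congr_fun (f := TensorProduct.curry (linR r X) ∘ₗ
    TensorProduct.mk ℂ _ _ (DiagRep.one P.T)) (g := (TensorProduct.mk ℂ _ _).compl₂
      ((TensorProduct.lid ℂ Q.T.V).toLinearMap ∘ₗ TensorProduct.map (counit Q.T) LinearMap.id))
    (lin_ext fun a x hx => tensor_ext fun b c q q' hq hq' => ?_) x |>.trans rfl
    |> fun h => LinearMap.congr_fun h u
  simp only [LinearMap.comp_apply, TensorProduct.mk_apply, TensorProduct.curry_apply,
    LinearMap.compl₂_apply]
  rw [linR_tmul r _ _ hx hq, hd.one, TensorProduct.map_tmul]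
  rcases eq_or_ne (counit Q.T q) 0 with h | h
  · simp [h]
  · have h1 : b = 0 := by
      have h2 := counit_h q
      rw [hq, map_smul, smul_eq_mul] at h2
      exact (mul_eq_zero.1 h2).resolve_right h
    simp [h1]

end SkewDual
end TensorBialgebra

/-! ### The Yetter-Drinfeld condition on generators -/

theorem map_comp_apply {U U' U'' W W' W'' : Type*} [AddCommGroup U] [Module ℂ U]
    [AddCommGroup U'] [Module ℂ U'] [AddCommGroup U''] [Module ℂ U''] [AddCommGroup W]
    [Module ℂ W] [AddCommGroup W'] [Module ℂ W'] [AddCommGroup W''] [Module ℂ W'']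
    (f' : U' →ₗ[ℂ] U'') (g' : W' →ₗ[ℂ] W'') (f : U →ₗ[ℂ] U') (g : W →ₗ[ℂ] W') (t : U ⊗[ℂ] W) :
    TensorProduct.map f' g' (TensorProduct.map f g t) = TensorProduct.map (f' ∘ₗ f) (g' ∘ₗ g) t := by
  rw [TensorProduct.map_comp]
  rfl

namespace TensorBialgebra
open DiagRep Tens MonObj ComonObj
variable {κ ω ζ ξ : ℂ} {P Q : TensorBialgebra (Fω κ ω)} {r : P.T ⊗ Q.T ⟶ 𝟙_ (DiagRep κ)}
  {X Y : DiagRep κ}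

variable (ω ζ ξ) in
/-- The operators by which the generators act on a Yetter-Drinfeld module: `A` from the left and
`B` from the right. On generators the Yetter-Drinfeld condition becomes the commutation relation
`comm`. -/
structure GenData (X : DiagRep κ) where
  A : Pm → Module.End ℂ X.V
  B : Pm → Module.End ℂ X.V
  hA : ∀ s v, X.h (A s v) = A s (X.h v) + (s.val * ω) • A s v
  hB : ∀ s v, X.h (B s v) = B s (X.h v) + (s.val * ω) • B s v
  comm : ∀ s t v, A s (B t v) - B t (A s v) =
    bval ζ ξ s t • (X.kop (-kw κ ω s) v - X.kop (kw κ ω s) v)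

section sides
variable {l : P.T ⊗ X ⟶ X} {m : X ⊗ Q.T ⟶ X} {A B : Pm → Module.End ℂ X.V}

/-- The left-hand side of the Yetter-Drinfeld condition. -/
def lhs (r : P.T ⊗ Q.T ⟶ 𝟙_ (DiagRep κ)) (l : P.T ⊗ X ⟶ X) (m : X ⊗ Q.T ⟶ X) (x : X.V)
    (q : Q.T.V) : P.T.V →ₗ[ℂ] X.V :=
  TensorProduct.lift (cur l) ∘ₗ linL r X ∘ₗ (TensorProduct.mk ℂ _ _).flip
    (TensorProduct.map (cur m x) LinearMap.id (comul Q.T q)) ∘ₗ comul P.T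

/-- The right-hand side of the Yetter-Drinfeld condition. -/
def rhs (r : P.T ⊗ Q.T ⟶ 𝟙_ (DiagRep κ)) (l : P.T ⊗ X ⟶ X) (m : X ⊗ Q.T ⟶ X) (x : X.V)
    (q : Q.T.V) : P.T.V →ₗ[ℂ] X.V :=
  TensorProduct.lift (cur m) ∘ₗ linR r X ∘ₗ (TensorProduct.mk ℂ _ _).flip (comul Q.T q) ∘ₗ
    TensorProduct.map LinearMap.id ((cur l).flip x) ∘ₗ comul P.T

theorem lhs_apply (x : X.V) (q : Q.T.V) (p : P.T.V) : lhs r l m x q p =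
    TensorProduct.lift (cur l) (linL r X
      (comul P.T p ⊗ₜ TensorProduct.map (cur m x) LinearMap.id (comul Q.T q))) := rfl

theorem rhs_apply (x : X.V) (q : Q.T.V) (p : P.T.V) : rhs r l m x q p =
    TensorProduct.lift (cur m) (linR r X
      (TensorProduct.map LinearMap.id ((cur l).flip x) (comul P.T p) ⊗ₜ comul Q.T q)) := rfl

variable {d d' : Pm → Q.T.V →ₗ[ℂ] Q.T.V} (hd : SkewDual ζ ξ r d d')
  (hl : ∀ x, cur l (DiagRep.one P.T) x = x)
  (hA : ∀ s p x, cur l (DiagRep.mul P.T (P.g s) p) x = A s (cur l p x))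
include hd hl

/-- For the unit of `P`, the left side of the Yetter-Drinfeld condition is the right action. -/
theorem lhs_one (x : X.V) (q : Q.T.V) : lhs r l m x q (DiagRep.one P.T) = cur m x q := by
  have h1 : TensorProduct.rid ℂ X.V (TensorProduct.map LinearMap.id (counit Q.T)
      (TensorProduct.map (cur m x) LinearMap.id (comul Q.T q))) =
      cur m x (TensorProduct.rid ℂ Q.T.V (TensorProduct.map LinearMap.id (counit Q.T)
        (comul Q.T q))) := by
    generalize comul Q.T q = z
    induction z with
    | zero => simp
    | add x y hx hy => simp only [map_add, hx, hy]
    | tmul x y => simp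
  rw [lhs_apply, comul_one, hd.linL_one, h1, DiagRep.comul_counit, TensorProduct.lift.tmul, hl]

/-- For the unit of `P`, the right side of the Yetter-Drinfeld condition is the right action. -/
theorem rhs_one (x : X.V) (q : Q.T.V) : rhs r l m x q (DiagRep.one P.T) = cur m x q := by
  rw [rhs_apply, comul_one, TensorProduct.map_tmul, LinearMap.flip_apply, hl, LinearMap.id_apply,
    hd.linR_one, DiagRep.counit_comul, TensorProduct.lift.tmul]

omit hl
include hA

/-- The left side of the Yetter-Drinfeld condition satisfies a recursion on words in `P`. -/
theorem lhs_g_mul (s : Pm) (x : X.V) (q : Q.T.V) (p : P.T.V) :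
    lhs r l m x q (DiagRep.mul P.T (P.g s) p) =
      A s (lhs r l m x q p) + X.kop (kw κ ω s) (lhs r l m x (d s q) p) := by
  have h1 : ∀ z : P.T.V ⊗[ℂ] X.V, TensorProduct.lift (cur l)
      (TensorProduct.map (DiagRep.mul P.T (P.g s)) LinearMap.id z) =
      A s (TensorProduct.lift (cur l) z) := fun z =>
    LinearMap.congr_fun (f := TensorProduct.lift (cur l) ∘ₗ
      TensorProduct.map (DiagRep.mul P.T (P.g s)) LinearMap.id)
      (g := A s ∘ₗ TensorProduct.lift (cur l)) (TensorProduct.ext' fun p x => hA s p x) z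
  have h2 : ∀ z : P.T.V ⊗[ℂ] X.V, TensorProduct.lift (cur l)
      (TensorProduct.map (P.T.kop (kw κ ω s)) (X.kop (kw κ ω s)) z) =
      X.kop (kw κ ω s) (TensorProduct.lift (cur l) z) := fun z =>
    LinearMap.congr_fun (f := TensorProduct.lift (cur l) ∘ₗ
      TensorProduct.map (P.T.kop (kw κ ω s)) (X.kop (kw κ ω s)))
      (g := X.kop (kw κ ω s) ∘ₗ TensorProduct.lift (cur l))
      (TensorProduct.ext' fun p x => (kop_cur l _ p x).symm) z
  have h3 : TensorProduct.map LinearMap.id (d s)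
      (TensorProduct.map (cur m x) LinearMap.id (comul Q.T q)) =
      TensorProduct.map (cur m x) LinearMap.id (comul Q.T (d s q)) := by
    rw [hd.isDer.comul_d, map_comp_apply, map_comp_apply]
    rfl
  rw [lhs_apply, comul_g_mul, TensorProduct.add_tmul, map_add, map_add, SkewDual.linL_mul,
    hd.linL_kop, h1, h2, h3]
  rfl

/-- The right side of the Yetter-Drinfeld condition for `g p`, in terms of that for `p` before the
right action is applied. Together with `gen_comm` it gives the recursion of `lhs_g_mul`. -/
theorem rhs_g_mul (hA' : ∀ s v, X.h (A s v) = A s (X.h v) + (s.val * ω) • A s v) (s : Pm)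
    (x : X.V) (q : Q.T.V) (p : P.T.V) : rhs r l m x q (DiagRep.mul P.T (P.g s) p) =
      TensorProduct.lift (cur m) ((TensorProduct.map (A s) LinearMap.id +
        TensorProduct.map (X.kop (-kw κ ω s)) (d' s) : X.V ⊗[ℂ] Q.T.V →ₗ[ℂ] X.V ⊗[ℂ] Q.T.V) (linR r X
          (TensorProduct.map LinearMap.id ((cur l).flip x) (comul P.T p) ⊗ₜ comul Q.T q))) := by
  have h1 : TensorProduct.map LinearMap.id ((cur l).flip x)
      (TensorProduct.map (DiagRep.mul P.T (P.g s)) LinearMap.id (comul P.T p)) =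
      TensorProduct.map (DiagRep.mul P.T (P.g s)) LinearMap.id
        (TensorProduct.map LinearMap.id ((cur l).flip x) (comul P.T p)) := by
    rw [map_comp_apply, map_comp_apply]
    rfl
  have h2 : TensorProduct.map LinearMap.id ((cur l).flip x)
      (TensorProduct.map (P.T.kop (kw κ ω s)) (DiagRep.mul P.T (P.g s)) (comul P.T p)) =
      TensorProduct.map (P.T.kop (kw κ ω s)) (A s)
        (TensorProduct.map LinearMap.id ((cur l).flip x) (comul P.T p)) := by
    rw [map_comp_apply, map_comp_apply,
      show (cur l).flip x ∘ₗ DiagRep.mul P.T (P.g s) = A s ∘ₗ (cur l).flip x from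
        LinearMap.ext fun p => hA s p x]
    rfl
  have h3 : ∀ z : X.V ⊗[ℂ] Q.T.V, TensorProduct.map (X.kop (-kw κ ω s)) LinearMap.id
      (TensorProduct.map LinearMap.id (d' s) z) =
      TensorProduct.map (X.kop (-kw κ ω s)) (d' s) z := fun z => by
    rw [map_comp_apply]
    rfl
  rw [rhs_apply, comul_g_mul, map_add, TensorProduct.add_tmul, map_add, map_add, h1, h2,
    hd.linR_mul, SkewDual.linR_kop (hA' s), hd.comul_d', SkewDual.linR_right, h3, add_comm,
    LinearMap.add_apply, map_add]

end sides

namespace GenData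
variable (D : GenData ω ζ ξ X) {d d' : Pm → Q.T.V →ₗ[ℂ] Q.T.V} (hd : SkewDual ζ ξ r d d')

theorem kop_B (c : ℂ) (s : Pm) (v : X.V) :
    X.kop c (D.B s v) = Complex.exp (c * (s.val * ω)) • D.B s (X.kop c v) :=
  kop_shift (D.hB s) c v

theorem kop_A (c : ℂ) (s : Pm) (v : X.V) :
    X.kop c (D.A s v) = Complex.exp (c * (s.val * ω)) • D.A s (X.kop c v) :=
  kop_shift (D.hA s) c v

/-- Since `T(F⁺)` is free, any operators of the right weights define a left action. -/
theorem exists_left (P : TensorBialgebra (Fω κ ω)) : ∃ l : P.T ⊗ X ⟶ X,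
    (∀ x, cur l (DiagRep.one P.T) x = x) ∧
    ∀ s p x, cur l (DiagRep.mul P.T (P.g s) p) x = D.A s (cur l p x) := by
  obtain ⟨L, h1, h2⟩ := P.exists_rec (M := Module.End ℂ X.V) LinearMap.id fun s =>
    LinearMap.llcomp ℂ X.V X.V X.V (D.A s)
  have h2' : ∀ s p x, L (DiagRep.mul P.T (P.g s) p) x = D.A s (L p x) := fun s p x => by
    rw [h2]
    rfl
  refine ⟨mk' (X := P.T ⊗ X) (TensorProduct.lift L : P.T.V ⊗[ℂ] X.V →ₗ[ℂ] X.V) <| addEnd_comm fun p x => ?_,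
    fun x => LinearMap.congr_fun h1 x, h2'⟩
  change L (P.T.h p) x + L p (X.h x) = X.h (L p x)
  refine P.ext_ind₁ (f := LinearMap.applyₗ x ∘ₗ L ∘ₗ P.T.h + LinearMap.applyₗ (X.h x) ∘ₗ L)
    (f' := X.h ∘ₗ LinearMap.applyₗ x ∘ₗ L) ?_ (fun s p hp => ?_) p
  · simp [h1, h_one]
  · simp only [LinearMap.add_apply, LinearMap.comp_apply, LinearMap.applyₗ_apply_apply] at hp ⊢
    rw [h_mul, h_g, map_add, map_smul, LinearMap.add_apply, h2', h2', h2', D.hA, ← hp,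
      LinearMap.smul_apply, map_smul, LinearMap.smul_apply, h2', map_add]
    abel

/-- Since `T(F⁻)` is free, any operators of the right weights define a right action. -/
theorem exists_right (Q : TensorBialgebra (Fω κ ω)) : ∃ m : X ⊗ Q.T ⟶ X,
    (∀ x, cur m x (DiagRep.one Q.T) = x) ∧
    ∀ s q x, cur m x (DiagRep.mul Q.T (Q.g s) q) = cur m (D.B s x) q := by
  obtain ⟨L, h1, h2⟩ := Q.exists_rec (M := Module.End ℂ X.V) LinearMap.id fun s =>
    LinearMap.lcomp ℂ X.V (D.B s)
  have h2' : ∀ s p x, L (DiagRep.mul Q.T (Q.g s) p) x = L p (D.B s x) := fun s p x => by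
    rw [h2]
    rfl
  refine ⟨mk' (X := X ⊗ Q.T) (TensorProduct.lift L.flip : X.V ⊗[ℂ] Q.T.V →ₗ[ℂ] X.V) <| addEnd_comm fun x p => ?_,
    fun x => LinearMap.congr_fun h1 x, h2'⟩
  change L p (X.h x) + L (Q.T.h p) x = X.h (L p x)
  refine Q.ext_ind (f := fun x => LinearMap.applyₗ (X.h x) ∘ₗ L + LinearMap.applyₗ x ∘ₗ L ∘ₗ Q.T.h)
    (f' := fun x => X.h ∘ₗ LinearMap.applyₗ x ∘ₗ L) (fun x => ?_) (fun s p hp x => ?_) x p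
  · simp [h1, h_one]
  · simp only [LinearMap.add_apply, LinearMap.comp_apply, LinearMap.applyₗ_apply_apply] at hp ⊢
    rw [h_mul, h_g, map_add, map_smul, LinearMap.add_apply, h2', h2', h2', ← hp,
      LinearMap.smul_apply, map_smul, LinearMap.smul_apply, h2', D.hB, map_add, map_smul]
    abel

include hd in
/-- The Yetter-Drinfeld condition for a generator of `P` and an arbitrary element of `Q`. -/
theorem gen_comm {m : X ⊗ Q.T ⟶ X} (hm : ∀ x, cur m x (DiagRep.one Q.T) = x)
    (hB : ∀ s q x, cur m x (DiagRep.mul Q.T (Q.g s) q) = cur m (D.B s x) q) (s : Pm) (z : X.V)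
    (q : Q.T.V) : D.A s (cur m z q) + X.kop (kw κ ω s) (cur m z (d s q)) =
      cur m (D.A s z) q + cur m (X.kop (-kw κ ω s) z) (d' s q) := by
  refine Q.ext_ind (f := fun z => D.A s ∘ₗ cur m z + X.kop (kw κ ω s) ∘ₗ cur m z ∘ₗ d s)
    (f' := fun z => cur m (D.A s z) + cur m (X.kop (-kw κ ω s) z) ∘ₗ d' s) (fun z => ?_)
    (fun t q hq z => ?_) z q
  · simp [hm, hd.isDer.one, hd.one']
  · simp only [LinearMap.add_apply, LinearMap.comp_apply] at hq ⊢
    have h1 : bval ζ ξ s t • X.kop (kw κ ω s) (cur m z (Q.T.kop (kw κ ω t) q)) =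
        bval ζ ξ s t • cur m (X.kop (kw κ ω s) z) q := by
      rw [kop_cur, kop_kop]
      refine (bval_smul ζ ξ s t (f := fun a => cur m (X.kop (kw κ ω s) z) (Q.T.kop a q))
        (b := 0) fun h => ?_).trans ?_
      · rw [kw, kw, h]
        ring
      · simp only [kop_zero]
    have h2 : cur m (D.A s (D.B t z)) q = cur m (D.B t (D.A s z)) q +
        bval ζ ξ s t • (cur m (X.kop (-kw κ ω s) z) q - cur m (X.kop (kw κ ω s) z) q) := by
      rw [← LinearMap.sub_apply, ← map_sub, ← LinearMap.smul_apply, ← map_smul, ← D.comm, map_sub,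
        LinearMap.sub_apply]
      abel
    have h3 : cur m (X.kop (-kw κ ω s) (D.B t z)) (d' s q) =
        Complex.exp (-kw κ ω s * (t.val * ω)) • cur m (D.B t (X.kop (-kw κ ω s) z)) (d' s q) := by
      rw [D.kop_B, map_smul, LinearMap.smul_apply]
    rw [hB, hB, hd.isDer.mul, hd.mul', map_add, map_add, map_add, hB, map_smul, map_smul, map_smul,
      map_smul, h1, hB, ← h3, ← add_assoc, hq, h2, smul_sub]
    abel

include hd in
/-- Operators on the generators that satisfy the commutation relation extend to a Yetter-Drinfeld
structure. -/
theorem exists_str : ∃ s : YDStructure r X, (∀ t x, cur s.l (P.g t) x = D.A t x) ∧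
    ∀ t x, cur s.m x (Q.g t) = D.B t x := by
  obtain ⟨l, hl, hA⟩ := D.exists_left P
  obtain ⟨m, hm, hB⟩ := D.exists_right Q
  refine ⟨⟨l, m, ?_, ?_, ?_, ?_, (yd_iff r l m).2 fun p x q => ?_⟩, fun t x => ?_, fun t x => ?_⟩
  · refine hom_ext (TensorProduct.ext (LinearMap.ext_ring (LinearMap.ext fun x => ?_)))
    exact (hl x).trans (one_smul ℂ x).symm
  · refine hom_ext (TensorProduct.ext_threefold fun p p' x => ?_)
    change cur l (DiagRep.mul P.T p p') x = cur l p (cur l p' x)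
    refine P.ext_ind₁ (f := (cur l).flip x ∘ₗ (DiagRep.mul P.T).flip p')
      (f' := (cur l).flip (cur l p' x)) ?_ (fun s p hp => ?_) p
    · simp only [LinearMap.comp_apply, LinearMap.flip_apply, DiagRep.one_mul, hl]
    · simp only [LinearMap.comp_apply, LinearMap.flip_apply] at hp ⊢
      rw [DiagRep.mul_assoc, hA, hA, hp]
  · refine hom_ext (TensorProduct.ext (LinearMap.ext fun x => LinearMap.ext_ring ?_))
    exact (hm x).trans (one_smul ℂ x).symm
  · refine hom_ext (TensorProduct.ext (LinearMap.ext fun x => TensorProduct.ext' fun q q' => ?_))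
    change cur m x (DiagRep.mul Q.T q q') = cur m (cur m x q) q'
    refine Q.ext_ind (f := fun x => cur m x ∘ₗ (DiagRep.mul Q.T).flip q')
      (f' := fun x => (cur m).flip q' ∘ₗ cur m x) (fun x => ?_) (fun s p hp x => ?_) x q
    · simp only [LinearMap.comp_apply, LinearMap.flip_apply, DiagRep.one_mul, hm]
    · simp only [LinearMap.comp_apply, LinearMap.flip_apply] at hp ⊢
      rw [DiagRep.mul_assoc, hB, hB, hp]
  -- induction over products of generators of `P`, with `q` arbitrary
  · refine P.ext_ind (f := fun q => lhs r l m x q) (f' := fun q => rhs r l m x q) (fun q => ?_)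
      (fun s p hp q => ?_) q p
    · rw [lhs_one hd hl, rhs_one hd hl]
    · have h1 : ∀ z : X.V ⊗[ℂ] Q.T.V, TensorProduct.lift (cur m)
          ((TensorProduct.map (D.A s) LinearMap.id +
            TensorProduct.map (X.kop (-kw κ ω s)) (d' s) : X.V ⊗[ℂ] Q.T.V →ₗ[ℂ] X.V ⊗[ℂ] Q.T.V) z) =
          D.A s (TensorProduct.lift (cur m) z) + X.kop (kw κ ω s)
            (TensorProduct.lift (cur m) (TensorProduct.map LinearMap.id (d s) z)) := fun z =>
        LinearMap.congr_fun (f := TensorProduct.lift (cur m) ∘ₗ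
          (TensorProduct.map (D.A s) LinearMap.id + TensorProduct.map (X.kop (-kw κ ω s)) (d' s)))
          (g := D.A s ∘ₗ TensorProduct.lift (cur m) + X.kop (kw κ ω s) ∘ₗ
            TensorProduct.lift (cur m) ∘ₗ TensorProduct.map LinearMap.id (d s))
          (TensorProduct.ext' fun z q => (D.gen_comm hd hm hB s z q).symm) z
      rw [lhs_g_mul hd hA, rhs_g_mul hd hA D.hA, h1, hp, hp, rhs_apply, rhs_apply, hd.isDer.comul_d,
        SkewDual.linR_right]
  · have h := hA t (DiagRep.one P.T) x
    rwa [DiagRep.mul_one, hl] at h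
  · have h := hB t (DiagRep.one Q.T) x
    rwa [DiagRep.mul_one, hm] at h

end GenData

section str
variable (s : YDStructure r X)

theorem str_one_l (x : X.V) : cur s.l (DiagRep.one P.T) x = x :=
  (LinearMap.congr_fun (congrArg lin s.one_l) ((1 : ℂ) ⊗ₜ[ℂ] x)).trans (one_smul ℂ x)

theorem str_mul_l (p p' : P.T.V) (x : X.V) :
    cur s.l (DiagRep.mul P.T p p') x = cur s.l p (cur s.l p' x) :=
  LinearMap.congr_fun (congrArg lin s.mul_l) ((p ⊗ₜ[ℂ] p') ⊗ₜ[ℂ] x)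

theorem str_one_m (x : X.V) : cur s.m x (DiagRep.one Q.T) = x :=
  (LinearMap.congr_fun (congrArg lin s.one_m) (x ⊗ₜ[ℂ] (1 : ℂ))).trans (one_smul ℂ x)

theorem str_mul_m (x : X.V) (q q' : Q.T.V) :
    cur s.m x (DiagRep.mul Q.T q q') = cur s.m (cur s.m x q) q' :=
  LinearMap.congr_fun (congrArg lin s.mul_m) (x ⊗ₜ[ℂ] (q ⊗ₜ[ℂ] q'))

/-- Compatibility of a morphism with the left actions can be checked on generators. -/
theorem l_comm_of {s : YDStructure r X} {s' : YDStructure r Y} {f : X ⟶ Y}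
    (h : ∀ t x, lin f (cur s.l (P.g t) x) = cur s'.l (P.g t) (lin f x)) :
    s.l ≫ f = P.T ◁ f ≫ s'.l := by
  refine hom_ext (TensorProduct.ext' fun p x => ?_)
  change lin f (cur s.l p x) = cur s'.l p (lin f x)
  refine P.ext_ind₁ (f := lin f ∘ₗ (cur s.l).flip x) (f' := (cur s'.l).flip (lin f x)) ?_
    (fun t p hp => ?_) p
  · simp only [LinearMap.comp_apply, LinearMap.flip_apply, str_one_l]
  · simp only [LinearMap.comp_apply, LinearMap.flip_apply] at hp ⊢
    rw [str_mul_l, h, hp, str_mul_l]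

/-- Compatibility of a morphism with the right actions can be checked on generators. -/
theorem m_comm_of {s : YDStructure r X} {s' : YDStructure r Y} {f : X ⟶ Y}
    (h : ∀ t x, lin f (cur s.m x (Q.g t)) = cur s'.m (lin f x) (Q.g t)) :
    s.m ≫ f = f ▷ Q.T ≫ s'.m := by
  refine hom_ext (TensorProduct.ext' fun x q => ?_)
  change lin f (cur s.m x q) = cur s'.m (lin f x) q
  refine Q.ext_ind (f := fun x => lin f ∘ₗ cur s.m x) (f' := fun x => cur s'.m (lin f x))
    (fun x => ?_) (fun t p hp x => ?_) x q
  · simp only [LinearMap.comp_apply, str_one_m]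
  · simp only [LinearMap.comp_apply] at hp ⊢
    rw [str_mul_m, hp, h, str_mul_m]

variable {d d' : Pm → Q.T.V →ₗ[ℂ] Q.T.V} (hd : SkewDual ζ ξ r d d')
include hd

/-- The operators by which the generators act on a Yetter-Drinfeld module. -/
def genData : GenData ω ζ ξ X where
  A t := cur s.l (P.g t)
  B t := (cur s.m).flip (Q.g t)
  hA t v := by rw [h_cur, h_g, map_smul, LinearMap.smul_apply, add_comm]
  hB t v := by
    simp only [LinearMap.flip_apply]
    rw [h_cur, h_g, map_smul]
  comm t u v := by
    have h1 : lhs r s.l s.m v (Q.g u) (P.g t) = rhs r s.l s.m v (Q.g u) (P.g t) :=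
      (yd_iff r s.l s.m).1 s.yd (P.g t) v (Q.g u)
    have h2 : ∀ s, d s (Q.g u) = bval ζ ξ s u • DiagRep.one Q.T := fun s => by
      have h := hd.isDer.mul s u (DiagRep.one Q.T)
      rwa [DiagRep.mul_one, hd.isDer.one, map_zero, zero_add, kop_one] at h
    have h3 : ∀ s, d' s (Q.g u) = bval ζ ξ s u • DiagRep.one Q.T := fun s => by
      have h := hd.mul' s u (DiagRep.one Q.T)
      rwa [DiagRep.mul_one, hd.one', map_zero, smul_zero, zero_add] at h
    have hA' : ∀ t v, X.h (cur s.l (P.g t) v) = cur s.l (P.g t) (X.h v) +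
        (t.val * ω) • cur s.l (P.g t) v := fun t v => by
      rw [h_cur, h_g, map_smul, LinearMap.smul_apply, add_comm]
    rw [← DiagRep.mul_one (P.g t), lhs_g_mul (A := fun t => cur s.l (P.g t)) hd
      (fun t p x => str_mul_l s _ _ _), rhs_g_mul (A := fun t => cur s.l (P.g t)) hd
      (fun t p x => str_mul_l s _ _ _) hA', lhs_one hd (str_one_l s), lhs_one hd (str_one_l s),
      comul_one, TensorProduct.map_tmul, LinearMap.flip_apply, str_one_l, LinearMap.id_apply,
      hd.linR_one, DiagRep.counit_comul, LinearMap.add_apply, TensorProduct.map_tmul,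
      TensorProduct.map_tmul, map_add, TensorProduct.lift.tmul, TensorProduct.lift.tmul, h2, h3,
      map_smul, str_one_m, map_smul, map_smul, str_one_m, LinearMap.id_apply] at h1
    simp only [LinearMap.flip_apply]
    rw [smul_sub, sub_eq_sub_iff_add_eq_add, h1]
    abel

end str
end TensorBialgebra

/-! ### The monoidal category of Yetter-Drinfeld modules -/

namespace DiagRep
variable {κ : ℂ}

theorem kop_unit (c : ℂ) (z : ℂ) : (𝟙_ (DiagRep κ)).kop c z = z := by
  refine (kop_eigen (X := 𝟙_ (DiagRep κ)) c (a := 0) (zero_smul ℂ _).symm).trans ?_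
  rw [mul_zero, Complex.exp_zero]
  exact one_smul ℂ z

end DiagRep

namespace TensorBialgebra
open DiagRep Tens MonObj ComonObj
variable {κ ω ζ ξ : ℂ} {P Q : TensorBialgebra (Fω κ ω)} {r : P.T ⊗ Q.T ⟶ 𝟙_ (DiagRep κ)}
  {X Y : DiagRep κ}

theorem assoc_add {U V W : Type*} [AddCommGroup U] [Module ℂ U] [AddCommGroup V] [Module ℂ V]
    [AddCommGroup W] [Module ℂ W] (x₁ x₂ : U) (y₁ y₂ y₃ : V) (z₁ z₂ : W) :
    TensorProduct.assoc ℂ U V W ((x₁ ⊗ₜ y₁ + x₂ ⊗ₜ y₂) ⊗ₜ z₁ + (x₂ ⊗ₜ y₃) ⊗ₜ z₂) =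
      x₁ ⊗ₜ (y₁ ⊗ₜ z₁) + x₂ ⊗ₜ (y₂ ⊗ₜ z₁ + y₃ ⊗ₜ z₂) := by
  rw [TensorProduct.add_tmul, map_add, map_add, TensorProduct.tmul_add, add_assoc]
  rfl

namespace GenData

theorem tensor_shift {a : Module.End ℂ X.V} {b : Module.End ℂ Y.V} {w w' w'' : ℂ}
    (ha : ∀ v, X.h (a v) = a (X.h v) + w • a v) (hb : ∀ v, Y.h (b v) = b (Y.h v) + w' • b v)
    (h : w + w' = w'') (v : X.V ⊗[ℂ] Y.V) : addEnd X.h Y.h (TensorProduct.map a b v) =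
      TensorProduct.map a b (addEnd X.h Y.h v) + w'' • TensorProduct.map a b v := by
  induction v with
  | zero => simp
  | add x y hx hy =>
    simp only [map_add, smul_add] at hx hy ⊢
    rw [hx, hy]
    abel
  | tmul x y =>
    simp only [TensorProduct.map_tmul, addEnd_tmul, map_add, ha, hb, TensorProduct.add_tmul,
      TensorProduct.tmul_add, ← TensorProduct.smul_tmul', TensorProduct.tmul_smul, ← h, add_smul]
    abel

/-- The commutation relation of `GenData` passes to tensor products: `[ΔA, ΔB]` telescopes to
`k'⊗k' - k⊗k`, since the mixed terms cancel by `h3` and `h4`. -/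
theorem tensor_comm {V W : Type*} [AddCommGroup V] [Module ℂ V] [AddCommGroup W] [Module ℂ W]
    {a b k k' : Module.End ℂ V} {a' b' k₁ k₁' d : Module.End ℂ W} {β e : ℂ}
    (h1 : ∀ v, a (b v) - b (a v) = β • (k' v - k v))
    (h2 : ∀ v, a' (b' v) - b' (a' v) = β • (k₁' v - k₁ v))
    (h3 : ∀ v, k (b v) = e • b (k v)) (h4 : ∀ v, d (a' v) = e • a' (d v))
    (h5 : ∀ v, β • d v = β • k₁' v) (v : V) (w : W) :
    (TensorProduct.map a LinearMap.id + TensorProduct.map k a' : Module.End ℂ (V ⊗[ℂ] W))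
        ((TensorProduct.map b d + TensorProduct.map LinearMap.id b' : Module.End ℂ (V ⊗[ℂ] W))
          (v ⊗ₜ[ℂ] w)) -
      (TensorProduct.map b d + TensorProduct.map LinearMap.id b' : Module.End ℂ (V ⊗[ℂ] W))
        ((TensorProduct.map a LinearMap.id + TensorProduct.map k a' : Module.End ℂ (V ⊗[ℂ] W))
          (v ⊗ₜ[ℂ] w)) =
      β • (k' v ⊗ₜ[ℂ] k₁' w - k v ⊗ₜ[ℂ] k₁ w) := by
  simp only [LinearMap.add_apply, TensorProduct.map_tmul, map_add, LinearMap.id_apply, h3, h4]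
  have e1 : a (b v) ⊗ₜ[ℂ] d w = b (a v) ⊗ₜ[ℂ] d w + (β • (k' v - k v)) ⊗ₜ[ℂ] d w := by
    rw [← h1, TensorProduct.sub_tmul]
    abel
  have e2 : k v ⊗ₜ[ℂ] a' (b' w) = k v ⊗ₜ[ℂ] b' (a' w) + k v ⊗ₜ[ℂ] (β • (k₁' w - k₁ w)) := by
    rw [← h2, TensorProduct.tmul_sub]
    abel
  have e3 : (β • (k' v - k v)) ⊗ₜ[ℂ] d w = β • ((k' v - k v) ⊗ₜ[ℂ] k₁' w) := by
    rw [TensorProduct.smul_tmul, h5, TensorProduct.tmul_smul]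
  rw [e1, e2, e3]
  simp only [← TensorProduct.smul_tmul', TensorProduct.tmul_smul, TensorProduct.sub_tmul,
    TensorProduct.tmul_sub, smul_sub]
  abel

/-- The action of the generators on a tensor product. -/
def tensor (D : GenData ω ζ ξ X) (E : GenData ω ζ ξ Y) : GenData ω ζ ξ (X ⊗ Y) where
  A s := (TensorProduct.map (D.A s) LinearMap.id + TensorProduct.map (X.kop (kw κ ω s)) (E.A s) :
    X.V ⊗[ℂ] Y.V →ₗ[ℂ] X.V ⊗[ℂ] Y.V)
  B s := (TensorProduct.map (D.B s) (Y.kop (kw κ ω s)) + TensorProduct.map LinearMap.id (E.B s) :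
    X.V ⊗[ℂ] Y.V →ₗ[ℂ] X.V ⊗[ℂ] Y.V)
  hA s v := by
    have h1 := tensor_shift (D.hA s) (b := LinearMap.id) (w' := 0) (fun v => by simp)
      (add_zero _) v
    have h2 := tensor_shift (a := X.kop (kw κ ω s)) (w := 0) (fun v => by simp [h_kop])
      (E.hA s) (zero_add _) v
    refine (map_add (addEnd X.h Y.h) _ _).trans ?_
    rw [h1, h2, LinearMap.add_apply, LinearMap.add_apply, smul_add]
    exact add_add_add_comm _ _ _ _
  hB s v := by
    have h1 := tensor_shift (D.hB s) (b := Y.kop (kw κ ω s)) (w' := 0) (fun v => by simp [h_kop])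
      (add_zero _) v
    have h2 := tensor_shift (a := LinearMap.id) (w := 0) (fun v => by simp)
      (E.hB s) (zero_add _) v
    refine (map_add (addEnd X.h Y.h) _ _).trans ?_
    rw [h1, h2, LinearMap.add_apply, LinearMap.add_apply, smul_add]
    exact add_add_add_comm _ _ _ _
  comm s t v := by
    refine LinearMap.congr_fun (f := (TensorProduct.map (D.A s) LinearMap.id +
      TensorProduct.map (X.kop (kw κ ω s)) (E.A s)) ∘ₗ (TensorProduct.map (D.B t)
        (Y.kop (kw κ ω t)) + TensorProduct.map LinearMap.id (E.B t)) -
      (TensorProduct.map (D.B t) (Y.kop (kw κ ω t)) + TensorProduct.map LinearMap.id (E.B t)) ∘ₗ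
      (TensorProduct.map (D.A s) LinearMap.id + TensorProduct.map (X.kop (kw κ ω s)) (E.A s)))
      (g := bval ζ ξ s t • ((X ⊗ Y).kop (-kw κ ω s) - (X ⊗ Y).kop (kw κ ω s) :
        X.V ⊗[ℂ] Y.V →ₗ[ℂ] X.V ⊗[ℂ] Y.V)) (TensorProduct.ext' fun x y => ?_) v
    rw [LinearMap.smul_apply, LinearMap.sub_apply, LinearMap.sub_apply, kop_tmul, kop_tmul]
    refine tensor_comm (D.comm s t) (E.comm s t) (fun v => D.kop_B _ t v) (fun v => ?_)
      (fun v => ?_) x y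
    · rw [E.kop_A, kw, kw]
      ring_nf
    · refine bval_smul ζ ξ s t (f := fun a => Y.kop a v) fun h => ?_
      rw [kw, kw, h]
      ring

variable (ω ζ ξ) in
/-- The generators act on the unit object by zero. -/
def unit : GenData ω ζ ξ (𝟙_ (DiagRep κ)) where
  A _ := 0
  B _ := 0
  hA _ v := by simp
  hB _ v := by simp
  comm s t (v : ℂ) := by
    rw [kop_unit, kop_unit]
    simp

end GenData

variable {d d' : Pm → Q.T.V →ₗ[ℂ] Q.T.V} (hd : SkewDual ζ ξ r d d')

/-- The Yetter-Drinfeld structure with given action of the generators. -/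
def toStr (D : GenData ω ζ ξ X) : YDStructure r X := (D.exists_str hd).choose

theorem toStr_l (D : GenData ω ζ ξ X) (t : Pm) (x : X.V) :
    cur (toStr hd D).l (P.g t) x = D.A t x := (D.exists_str hd).choose_spec.1 t x

theorem toStr_m (D : GenData ω ζ ξ X) (t : Pm) (x : X.V) :
    cur (toStr hd D).m x (Q.g t) = D.B t x := (D.exists_str hd).choose_spec.2 t x

/-- The tensor product of Yetter-Drinfeld modules. -/
def tens (M N : YDMod r) : YDMod r :=
  ⟨M.X ⊗ N.X, toStr hd ((genData M.str hd).tensor (genData N.str hd))⟩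

/-- The unit Yetter-Drinfeld module. -/
def unitYD : YDMod r := ⟨𝟙_ (DiagRep κ), toStr hd (GenData.unit ω ζ ξ)⟩

theorem tens_l (M N : YDMod r) (t : Pm) (x : M.X.V) (y : N.X.V) :
    cur (tens hd M N).str.l (P.g t) (x ⊗ₜ[ℂ] y : M.X.V ⊗[ℂ] N.X.V) =
      (cur M.str.l (P.g t) x ⊗ₜ y + M.X.kop (kw κ ω t) x ⊗ₜ cur N.str.l (P.g t) y :
        M.X.V ⊗[ℂ] N.X.V) :=
  toStr_l hd ((genData M.str hd).tensor (genData N.str hd)) t (x ⊗ₜ[ℂ] y : M.X.V ⊗[ℂ] N.X.V)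

theorem tens_m (M N : YDMod r) (t : Pm) (x : M.X.V) (y : N.X.V) :
    cur (tens hd M N).str.m (x ⊗ₜ[ℂ] y : M.X.V ⊗[ℂ] N.X.V) (Q.g t) =
      (cur M.str.m x (Q.g t) ⊗ₜ N.X.kop (kw κ ω t) y + x ⊗ₜ cur N.str.m y (Q.g t) :
        M.X.V ⊗[ℂ] N.X.V) :=
  toStr_m hd ((genData M.str hd).tensor (genData N.str hd)) t (x ⊗ₜ[ℂ] y : M.X.V ⊗[ℂ] N.X.V)

theorem unitYD_l (t : Pm) (x : ℂ) : cur (unitYD hd).str.l (P.g t) x = (0 : ℂ) :=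
  toStr_l hd (GenData.unit ω ζ ξ) t x

theorem unitYD_m (t : Pm) (x : ℂ) : cur (unitYD hd).str.m x (Q.g t) = (0 : ℂ) :=
  toStr_m hd (GenData.unit ω ζ ξ) t x

/-- A morphism of `𝒞` that commutes with the generators is a morphism of Yetter-Drinfeld
modules. -/
def ydHom {M N : YDMod r} (f : M.X ⟶ N.X)
    (h1 : ∀ t x, lin f (cur M.str.l (P.g t) x) = cur N.str.l (P.g t) (lin f x))
    (h2 : ∀ t x, lin f (cur M.str.m x (Q.g t)) = cur N.str.m (lin f x) (Q.g t)) : M ⟶ N :=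
  (⟨f, l_comm_of h1, m_comm_of h2⟩ : YDMod.Hom M N)

/-- The underlying morphism of `𝒞`. -/
def ydMor {M N : YDMod r} (f : M ⟶ N) : M.X ⟶ N.X := YDMod.Hom.hom f

theorem ydMor_ext {M N : YDMod r} {f g : M ⟶ N} (h : ydMor f = ydMor g) : f = g := YDMod.Hom.ext h

theorem ydMor_l {M N : YDMod r} (f : M ⟶ N) (p : P.T.V) (x : M.X.V) :
    lin (ydMor f) (cur M.str.l p x) = cur N.str.l p (lin (ydMor f) x) :=
  LinearMap.congr_fun (congrArg lin (YDMod.Hom.l_comm f)) (p ⊗ₜ[ℂ] x)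

theorem ydMor_m {M N : YDMod r} (f : M ⟶ N) (q : Q.T.V) (x : M.X.V) :
    lin (ydMor f) (cur M.str.m x q) = cur N.str.m (lin (ydMor f) x) q :=
  LinearMap.congr_fun (congrArg lin (YDMod.Hom.m_comm f)) (x ⊗ₜ[ℂ] q)

/-- An isomorphism of `𝒞` that commutes with the generators is an isomorphism of Yetter-Drinfeld
modules. -/
def ydIso {M N : YDMod r} (e : M.X ≅ N.X)
    (h1 : ∀ t x, lin e.hom (cur M.str.l (P.g t) x) = cur N.str.l (P.g t) (lin e.hom x))
    (h2 : ∀ t x, lin e.hom (cur M.str.m x (Q.g t)) = cur N.str.m (lin e.hom x) (Q.g t)) :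
    M ≅ N where
  hom := ydHom e.hom h1 h2
  inv := ydHom e.inv (fun t x => by
      have e1 : ∀ x, lin e.hom (lin e.inv x) = x := LinearMap.congr_fun (congrArg lin e.inv_hom_id)
      have e2 : ∀ x, lin e.inv (lin e.hom x) = x := LinearMap.congr_fun (congrArg lin e.hom_inv_id)
      rw [← e2 (cur M.str.l (P.g t) (lin e.inv x)), h1, e1]) (fun t x => by
      have e1 : ∀ x, lin e.hom (lin e.inv x) = x := LinearMap.congr_fun (congrArg lin e.inv_hom_id)
      have e2 : ∀ x, lin e.inv (lin e.hom x) = x := LinearMap.congr_fun (congrArg lin e.hom_inv_id)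
      rw [← e2 (cur M.str.m (lin e.inv x) (Q.g t)), h2, e1])
  hom_inv_id := ydMor_ext e.hom_inv_id
  inv_hom_id := ydMor_ext e.inv_hom_id

theorem tensHom_l {M N M' N' : YDMod r} (f : M ⟶ M') (g : N ⟶ N') (t : Pm) (z : M.X.V ⊗[ℂ] N.X.V) :
    lin (ydMor f ⊗ₘ ydMor g) (cur (tens hd M N).str.l (P.g t) z) =
      cur (tens hd M' N').str.l (P.g t) (lin (ydMor f ⊗ₘ ydMor g) z) := by
  refine LinearMap.congr_fun (f := (lin (ydMor f ⊗ₘ ydMor g) ∘ₗ cur (tens hd M N).str.l (P.g t) :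
    M.X.V ⊗[ℂ] N.X.V →ₗ[ℂ] M'.X.V ⊗[ℂ] N'.X.V)) (g := (cur (tens hd M' N').str.l (P.g t) ∘ₗ
      lin (ydMor f ⊗ₘ ydMor g) : M.X.V ⊗[ℂ] N.X.V →ₗ[ℂ] M'.X.V ⊗[ℂ] N'.X.V))
    (TensorProduct.ext' fun x y => ?_) z
  refine (congrArg (lin (ydMor f ⊗ₘ ydMor g)) (tens_l hd M N t x y)).trans ?_
  refine Eq.trans ?_ (tens_l hd M' N' t (lin (ydMor f) x) (lin (ydMor g) y)).symm
  refine (map_add (TensorProduct.map (lin (ydMor f)) (lin (ydMor g))) _ _).trans ?_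
  rw [TensorProduct.map_tmul, TensorProduct.map_tmul, ydMor_l, ydMor_l, lin_kop]

theorem tensHom_m {M N M' N' : YDMod r} (f : M ⟶ M') (g : N ⟶ N') (t : Pm) (z : M.X.V ⊗[ℂ] N.X.V) :
    lin (ydMor f ⊗ₘ ydMor g) (cur (tens hd M N).str.m z (Q.g t)) =
      cur (tens hd M' N').str.m (lin (ydMor f ⊗ₘ ydMor g) z) (Q.g t) := by
  refine LinearMap.congr_fun (f := (lin (ydMor f ⊗ₘ ydMor g) ∘ₗ (cur (tens hd M N).str.m).flip (Q.g t) :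
    M.X.V ⊗[ℂ] N.X.V →ₗ[ℂ] M'.X.V ⊗[ℂ] N'.X.V)) (g := ((cur (tens hd M' N').str.m).flip (Q.g t) ∘ₗ
      lin (ydMor f ⊗ₘ ydMor g) : M.X.V ⊗[ℂ] N.X.V →ₗ[ℂ] M'.X.V ⊗[ℂ] N'.X.V))
    (TensorProduct.ext' fun x y => ?_) z
  refine (congrArg (lin (ydMor f ⊗ₘ ydMor g)) (tens_m hd M N t x y)).trans ?_
  refine Eq.trans ?_ (tens_m hd M' N' t (lin (ydMor f) x) (lin (ydMor g) y)).symm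
  refine (map_add (TensorProduct.map (lin (ydMor f)) (lin (ydMor g))) _ _).trans ?_
  rw [TensorProduct.map_tmul, TensorProduct.map_tmul, ydMor_m, ydMor_m, lin_kop]

/-- The tensor product of morphisms of Yetter-Drinfeld modules. -/
def tensHom {M N M' N' : YDMod r} (f : M ⟶ M') (g : N ⟶ N') : tens hd M N ⟶ tens hd M' N' :=
  ydHom (ydMor f ⊗ₘ ydMor g) (tensHom_l hd f g) (tensHom_m hd f g)

/-- The associator of Yetter-Drinfeld modules. -/
def assocYD (M N L : YDMod r) : tens hd (tens hd M N) L ≅ tens hd M (tens hd N L) :=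
  ydIso (α_ M.X N.X L.X) (fun t z => by
    refine LinearMap.congr_fun (f := (lin (α_ M.X N.X L.X).hom ∘ₗ
      cur (tens hd (tens hd M N) L).str.l (P.g t) :
      (M.X.V ⊗[ℂ] N.X.V) ⊗[ℂ] L.X.V →ₗ[ℂ] M.X.V ⊗[ℂ] (N.X.V ⊗[ℂ] L.X.V)))
      (g := (cur (tens hd M (tens hd N L)).str.l (P.g t) ∘ₗ lin (α_ M.X N.X L.X).hom :
        (M.X.V ⊗[ℂ] N.X.V) ⊗[ℂ] L.X.V →ₗ[ℂ] M.X.V ⊗[ℂ] (N.X.V ⊗[ℂ] L.X.V)))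
      (TensorProduct.ext_threefold fun x y z => ?_) z
    refine (congrArg (TensorProduct.assoc ℂ _ _ _) ((tens_l hd (tens hd M N) L t
      (x ⊗ₜ[ℂ] y : M.X.V ⊗[ℂ] N.X.V) z).trans (congrArg₂ (· + ·) (congrArg (· ⊗ₜ[ℂ] z)
        (tens_l hd M N t x y)) (congrArg (· ⊗ₜ[ℂ] cur L.str.l (P.g t) z)
          (kop_tmul M.X N.X (kw κ ω t) x y))))).trans ?_
    refine Eq.trans ?_ ((tens_l hd M (tens hd N L) t x (y ⊗ₜ[ℂ] z : N.X.V ⊗[ℂ] L.X.V)).trans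
      (congrArg₂ (· + ·) rfl (congrArg (M.X.kop (kw κ ω t) x ⊗ₜ[ℂ] ·) (tens_l hd N L t y z)))).symm
    exact assoc_add _ _ _ _ _ _ _) (fun t z => by
    refine LinearMap.congr_fun (f := (lin (α_ M.X N.X L.X).hom ∘ₗ
      (cur (tens hd (tens hd M N) L).str.m).flip (Q.g t) :
      (M.X.V ⊗[ℂ] N.X.V) ⊗[ℂ] L.X.V →ₗ[ℂ] M.X.V ⊗[ℂ] (N.X.V ⊗[ℂ] L.X.V)))
      (g := ((cur (tens hd M (tens hd N L)).str.m).flip (Q.g t) ∘ₗ lin (α_ M.X N.X L.X).hom :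
        (M.X.V ⊗[ℂ] N.X.V) ⊗[ℂ] L.X.V →ₗ[ℂ] M.X.V ⊗[ℂ] (N.X.V ⊗[ℂ] L.X.V)))
      (TensorProduct.ext_threefold fun x y z => ?_) z
    refine (congrArg (TensorProduct.assoc ℂ _ _ _) ((tens_m hd (tens hd M N) L t
      (x ⊗ₜ[ℂ] y : M.X.V ⊗[ℂ] N.X.V) z).trans (congrArg₂ (· + ·)
        (congrArg (· ⊗ₜ[ℂ] L.X.kop (kw κ ω t) z) (tens_m hd M N t x y)) rfl))).trans ?_
    refine Eq.trans ?_ ((tens_m hd M (tens hd N L) t x (y ⊗ₜ[ℂ] z : N.X.V ⊗[ℂ] L.X.V)).trans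
      (congrArg₂ (· + ·) (congrArg (cur M.str.m x (Q.g t) ⊗ₜ[ℂ] ·) (kop_tmul N.X L.X _ y z))
        (congrArg (x ⊗ₜ[ℂ] ·) (tens_m hd N L t y z)))).symm
    exact assoc_add _ _ _ _ _ _ _)

/-- The left unitor of Yetter-Drinfeld modules. -/
def lidYD (M : YDMod r) : tens hd (unitYD hd) M ≅ M :=
  ydIso (λ_ M.X) (fun t z => by
    refine LinearMap.congr_fun (f := (lin (λ_ M.X).hom ∘ₗ
      cur (tens hd (unitYD hd) M).str.l (P.g t) : ℂ ⊗[ℂ] M.X.V →ₗ[ℂ] M.X.V))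
      (g := (cur M.str.l (P.g t) ∘ₗ lin (λ_ M.X).hom : ℂ ⊗[ℂ] M.X.V →ₗ[ℂ] M.X.V))
      (TensorProduct.ext' fun c x => ?_) z
    refine (congrArg (TensorProduct.lid ℂ _) ((tens_l hd (unitYD hd) M t (c : ℂ) x).trans
      (congrArg₂ (· + ·) (congrArg (· ⊗ₜ[ℂ] x) (unitYD_l hd t c))
        (congrArg (· ⊗ₜ[ℂ] cur M.str.l (P.g t) x) (kop_unit _ c))))).trans ?_
    refine Eq.trans (b := (0 : ℂ) • x + c • cur M.str.l (P.g t) x) rfl ?_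
    rw [zero_smul, zero_add, ← map_smul]
    rfl) (fun t z => by
    refine LinearMap.congr_fun (f := (lin (λ_ M.X).hom ∘ₗ
      (cur (tens hd (unitYD hd) M).str.m).flip (Q.g t) : ℂ ⊗[ℂ] M.X.V →ₗ[ℂ] M.X.V))
      (g := ((cur M.str.m).flip (Q.g t) ∘ₗ lin (λ_ M.X).hom : ℂ ⊗[ℂ] M.X.V →ₗ[ℂ] M.X.V))
      (TensorProduct.ext' fun c x => ?_) z
    refine (congrArg (TensorProduct.lid ℂ _) ((tens_m hd (unitYD hd) M t (c : ℂ) x).trans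
      (congrArg₂ (· + ·) (congrArg (· ⊗ₜ[ℂ] M.X.kop (kw κ ω t) x) (unitYD_m hd t c)) rfl))).trans ?_
    refine Eq.trans (b := (0 : ℂ) • M.X.kop (kw κ ω t) x + c • (cur M.str.m).flip (Q.g t) x) rfl ?_
    rw [zero_smul, zero_add, ← map_smul]
    rfl)

/-- The right unitor of Yetter-Drinfeld modules. -/
def ridYD (M : YDMod r) : tens hd M (unitYD hd) ≅ M :=
  ydIso (ρ_ M.X) (fun t z => by
    refine LinearMap.congr_fun (f := (lin (ρ_ M.X).hom ∘ₗ
      cur (tens hd M (unitYD hd)).str.l (P.g t) : M.X.V ⊗[ℂ] ℂ →ₗ[ℂ] M.X.V))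
      (g := (cur M.str.l (P.g t) ∘ₗ lin (ρ_ M.X).hom : M.X.V ⊗[ℂ] ℂ →ₗ[ℂ] M.X.V))
      (TensorProduct.ext' fun x c => ?_) z
    refine (congrArg (TensorProduct.rid ℂ _) ((tens_l hd M (unitYD hd) t x (c : ℂ)).trans
      (congrArg₂ (· + ·) rfl (congrArg (M.X.kop (kw κ ω t) x ⊗ₜ[ℂ] ·)
        (unitYD_l hd t c))))).trans ?_
    refine Eq.trans (b := c • cur M.str.l (P.g t) x + (0 : ℂ) • M.X.kop (kw κ ω t) x) rfl ?_
    rw [zero_smul, add_zero, ← map_smul]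
    rfl) (fun t z => by
    refine LinearMap.congr_fun (f := (lin (ρ_ M.X).hom ∘ₗ
      (cur (tens hd M (unitYD hd)).str.m).flip (Q.g t) : M.X.V ⊗[ℂ] ℂ →ₗ[ℂ] M.X.V))
      (g := ((cur M.str.m).flip (Q.g t) ∘ₗ lin (ρ_ M.X).hom : M.X.V ⊗[ℂ] ℂ →ₗ[ℂ] M.X.V))
      (TensorProduct.ext' fun x c => ?_) z
    refine (congrArg (TensorProduct.rid ℂ _) ((tens_m hd M (unitYD hd) t x (c : ℂ)).trans
      (congrArg₂ (· + ·) (congrArg (cur M.str.m x (Q.g t) ⊗ₜ[ℂ] ·) (kop_unit _ c))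
        (congrArg (x ⊗ₜ[ℂ] ·) (unitYD_m hd t c))))).trans ?_
    refine Eq.trans (b := c • (cur M.str.m).flip (Q.g t) x + (0 : ℂ) • x) rfl ?_
    rw [zero_smul, add_zero, ← map_smul]
    rfl)

/-- The monoidal category of Yetter-Drinfeld modules. -/
abbrev ydMonoidal : MonoidalCategory (YDMod r) where
  tensorObj := tens hd
  tensorUnit := unitYD hd
  tensorHom := tensHom hd
  whiskerLeft M _ _ g := tensHom hd (𝟙 M) g
  whiskerRight f N := tensHom hd f (𝟙 N)
  associator := assocYD hd
  leftUnitor := lidYD hd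
  rightUnitor := ridYD hd
  tensorHom_def f g := ydMor_ext ((MonoidalCategory.tensorHom_def (ydMor f) (ydMor g)).trans
    (congrArg₂ (· ≫ ·) (tensorHom_id _ _).symm (id_tensorHom _ _).symm))
  id_tensorHom_id M N := ydMor_ext (id_tensorHom_id M.X N.X)
  tensorHom_comp_tensorHom f g f' g' :=
    ydMor_ext (tensorHom_comp_tensorHom (ydMor f) (ydMor g) (ydMor f') (ydMor g'))
  whiskerLeft_id M N := ydMor_ext (id_tensorHom_id M.X N.X)
  id_whiskerRight M N := ydMor_ext (id_tensorHom_id M.X N.X)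
  associator_naturality f g h := ydMor_ext (associator_naturality (ydMor f) (ydMor g) (ydMor h))
  leftUnitor_naturality f := ydMor_ext <|
    (congrArg (· ≫ _) (id_tensorHom _ _)).trans (leftUnitor_naturality (ydMor f))
  rightUnitor_naturality f := ydMor_ext <|
    (congrArg (· ≫ _) (tensorHom_id _ _)).trans (rightUnitor_naturality (ydMor f))
  pentagon M N L K := ydMor_ext <|
    (congrArg₂ (fun f g => f ≫ _ ≫ g) (tensorHom_id _ _) (id_tensorHom _ _)).trans
      (MonoidalCategory.pentagon M.X N.X L.X K.X)
  triangle M N := ydMor_ext <|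
    (congrArg (_ ≫ ·) (id_tensorHom _ _)).trans ((MonoidalCategory.triangle M.X N.X).trans
      (tensorHom_id _ _).symm)

/-- The forgetful functor is monoidal, with identities as structure morphisms. -/
abbrev ydForgetMonoidal :
    letI := ydMonoidal hd
    (YDMod.forget r).Monoidal :=
  letI := ydMonoidal hd
  Functor.CoreMonoidal.toMonoidal
    { εIso := Iso.refl _
      μIso := fun _ _ => Iso.refl _
      μIso_hom_natural_left := fun f N => by
        refine (Category.comp_id _).trans (Eq.trans ?_ (Category.id_comp _).symm)
        exact (tensorHom_id (ydMor f) N.X).symm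
      μIso_hom_natural_right := fun M f => by
        refine (Category.comp_id _).trans (Eq.trans ?_ (Category.id_comp _).symm)
        exact (id_tensorHom M.X (ydMor f)).symm
      associativity := fun M N L => hom_ext (TensorProduct.ext_threefold fun _ _ _ => rfl)
      left_unitality := fun M => hom_ext (TensorProduct.ext' fun _ _ => rfl)
      right_unitality := fun M => hom_ext (TensorProduct.ext' fun _ _ => rfl) }

end TensorBialgebra

/-! ### Actions on tensor products through the coproducts -/

namespace TensorBialgebra
open DiagRep Tens MonObj ComonObj
variable {κ ω ζ ξ : ℂ} {P Q : TensorBialgebra (Fω κ ω)} {r : P.T ⊗ Q.T ⟶ 𝟙_ (DiagRep κ)}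
  {X Y : DiagRep κ} {d d' : Pm → Q.T.V →ₗ[ℂ] Q.T.V} (hd : SkewDual ζ ξ r d d')

/-- The diagonal left action before the coproduct is applied. -/
def diagL (M N : YDMod r) :
    (P.T.V ⊗[ℂ] P.T.V) ⊗[ℂ] (M.X.V ⊗[ℂ] N.X.V) →ₗ[ℂ] M.X.V ⊗[ℂ] N.X.V :=
  lin (tensorμ P.T P.T M.X N.X ≫ (M.str.l ⊗ₘ N.str.l))

/-- The diagonal right action before the coproduct is applied. -/
def diagM (M N : YDMod r) :
    (M.X.V ⊗[ℂ] N.X.V) ⊗[ℂ] (Q.T.V ⊗[ℂ] Q.T.V) →ₗ[ℂ] M.X.V ⊗[ℂ] N.X.V :=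
  lin (tensorμ M.X N.X Q.T Q.T ≫ (M.str.m ⊗ₘ N.str.m))

theorem diagL_tmul (M N : YDMod r) {a b : ℂ} (p : P.T.V) {p' : P.T.V} {x : M.X.V} (y : N.X.V)
    (hp : P.T.h p' = a • p') (hx : M.X.h x = b • x) : diagL M N ((p ⊗ₜ p') ⊗ₜ (x ⊗ₜ y)) =
      Complex.exp (κ * (a * b)) • (cur M.str.l p x ⊗ₜ[ℂ] cur N.str.l p' y) := by
  refine (congrArg (lin (M.str.l ⊗ₘ N.str.l)) (lin_tensorμ p y hp hx)).trans ?_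
  exact map_smul (lin (M.str.l ⊗ₘ N.str.l)) _ _

theorem diagM_tmul (M N : YDMod r) {a b : ℂ} (x : M.X.V) {y : N.X.V} {q : Q.T.V} (q' : Q.T.V)
    (hy : N.X.h y = a • y) (hq : Q.T.h q = b • q) : diagM M N ((x ⊗ₜ y) ⊗ₜ (q ⊗ₜ q')) =
      Complex.exp (κ * (a * b)) • (cur M.str.m x q ⊗ₜ[ℂ] cur N.str.m y q') := by
  refine (congrArg (lin (M.str.m ⊗ₘ N.str.m)) (lin_tensorμ x q' hy hq)).trans ?_
  exact map_smul (lin (M.str.m ⊗ₘ N.str.m)) _ _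

theorem h_g_mul (B : TensorBialgebra (Fω κ ω)) (s : Pm) {a : ℂ} {p : B.T.V} (hp : B.T.h p = a • p) :
    B.T.h (DiagRep.mul B.T (B.g s) p) = (s.val * ω + a) • DiagRep.mul B.T (B.g s) p := by
  rw [h_mul, h_g, hp, map_smul, map_smul, LinearMap.smul_apply, add_smul]

/-- The action of a generator from the left on a tensor product. -/
def tensA (M N : YDMod r) (s : Pm) : Module.End ℂ (M.X.V ⊗[ℂ] N.X.V) :=
  TensorProduct.map (cur M.str.l (P.g s)) LinearMap.id +
    TensorProduct.map (M.X.kop (kw κ ω s)) (cur N.str.l (P.g s))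

/-- The action of a generator from the right on a tensor product. -/
def tensB (M N : YDMod r) (s : Pm) : Module.End ℂ (M.X.V ⊗[ℂ] N.X.V) :=
  TensorProduct.map ((cur M.str.m).flip (Q.g s)) (N.X.kop (kw κ ω s)) +
    TensorProduct.map LinearMap.id ((cur N.str.m).flip (Q.g s))

/-- The coproduct of `g p` acts as the operator of the generator on the tensor product, after `p`.
-/
theorem diagL_mul (M N : YDMod r) (s : Pm) (t : P.T.V ⊗[ℂ] P.T.V) (z : M.X.V ⊗[ℂ] N.X.V) :
    diagL M N ((TensorProduct.map (DiagRep.mul P.T (P.g s)) LinearMap.id t +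
      TensorProduct.map (P.T.kop (kw κ ω s)) (DiagRep.mul P.T (P.g s)) t) ⊗ₜ z) =
    tensA M N s (diagL M N (t ⊗ₜ z)) := by
  suffices h : diagL M N ∘ₗ TensorProduct.map
      (TensorProduct.map (DiagRep.mul P.T (P.g s)) LinearMap.id +
        TensorProduct.map (P.T.kop (kw κ ω s)) (DiagRep.mul P.T (P.g s))) LinearMap.id =
      tensA M N s ∘ₗ diagL M N by
    have h1 := LinearMap.congr_fun h (t ⊗ₜ z)
    rwa [LinearMap.comp_apply, TensorProduct.map_tmul, LinearMap.id_apply,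
      LinearMap.add_apply] at h1
  refine tensor_ext₄ fun a b c e p p' x y hp hp' hx hy => ?_
  simp only [LinearMap.comp_apply, TensorProduct.map_tmul, LinearMap.id_apply,
    LinearMap.add_apply, TensorProduct.add_tmul]
  rw [map_add, diagL_tmul M N _ _ hp' hx, diagL_tmul M N _ _ hp' hx, diagL_tmul M N _ _
    (h_g_mul P s hp') hx, str_mul_l M.str, str_mul_l N.str, map_smul, tensA, LinearMap.add_apply,
    TensorProduct.map_tmul, TensorProduct.map_tmul, smul_add, LinearMap.id_apply,
    kop_cur, kop_eigen _ hx, map_smul, ← TensorProduct.smul_tmul', smul_smul,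
    ← Complex.exp_add, kw]
  ring_nf

/-- The coproduct of `g q` acts as the operator of the generator on the tensor product, before `q`.
-/
theorem diagM_mul (M N : YDMod r) (s : Pm) (t : Q.T.V ⊗[ℂ] Q.T.V) (z : M.X.V ⊗[ℂ] N.X.V) :
    diagM M N (z ⊗ₜ (TensorProduct.map (DiagRep.mul Q.T (Q.g s)) LinearMap.id t +
      TensorProduct.map (Q.T.kop (kw κ ω s)) (DiagRep.mul Q.T (Q.g s)) t)) =
    diagM M N (tensB M N s z ⊗ₜ t) := by
  suffices h : diagM M N ∘ₗ TensorProduct.map LinearMap.id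
      (TensorProduct.map (DiagRep.mul Q.T (Q.g s)) LinearMap.id +
        TensorProduct.map (Q.T.kop (kw κ ω s)) (DiagRep.mul Q.T (Q.g s))) =
      diagM M N ∘ₗ TensorProduct.map (tensB M N s) LinearMap.id by
    have h1 := LinearMap.congr_fun h (z ⊗ₜ t)
    rwa [LinearMap.comp_apply, LinearMap.comp_apply, TensorProduct.map_tmul,
      TensorProduct.map_tmul, LinearMap.id_apply, LinearMap.id_apply, LinearMap.add_apply] at h1
  refine tensor_ext₄ fun a b c e x y q q' hx hy hq hq' => ?_
  have h2 : N.X.h (cur N.str.m y (Q.g s)) = (b + s.val * ω) • cur N.str.m y (Q.g s) := by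
    rw [h_cur, h_g, hy, map_smul, map_smul, LinearMap.smul_apply, add_smul]
  simp only [LinearMap.comp_apply, TensorProduct.map_tmul, LinearMap.id_apply, tensB,
    LinearMap.add_apply, TensorProduct.tmul_add, LinearMap.flip_apply, TensorProduct.add_tmul]
  rw [map_add, map_add, kop_eigen _ hy, kop_eigen _ hq,
    TensorProduct.tmul_smul, ← TensorProduct.smul_tmul', ← TensorProduct.smul_tmul',
    TensorProduct.tmul_smul, map_smul, map_smul,
    diagM_tmul M N _ _ hy hq, diagM_tmul M N _ _ hy hq, diagM_tmul M N _ _ h2 hq,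
    diagM_tmul M N _ _ hy (h_g_mul Q s hq), str_mul_m M.str, str_mul_m N.str, smul_smul, smul_smul,
    ← Complex.exp_add, ← Complex.exp_add, kw]
  ring_nf

theorem diagL_one (M N : YDMod r) (z : M.X.V ⊗[ℂ] N.X.V) :
    diagL M N ((DiagRep.one P.T ⊗ₜ DiagRep.one P.T) ⊗ₜ z) = z := by
  refine LinearMap.congr_fun (f := diagL M N ∘ₗ TensorProduct.mk ℂ _ _
    (DiagRep.one P.T ⊗ₜ DiagRep.one P.T)) (g := LinearMap.id)
    (tensor_ext fun a b x y hx hy => ?_) z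
  refine (diagL_tmul M N _ _ h_one hx).trans ?_
  rw [str_one_l, str_one_l, zero_mul, mul_zero, Complex.exp_zero, one_smul, LinearMap.id_apply]

theorem diagM_one (M N : YDMod r) (z : M.X.V ⊗[ℂ] N.X.V) :
    diagM M N (z ⊗ₜ (DiagRep.one Q.T ⊗ₜ DiagRep.one Q.T)) = z := by
  refine LinearMap.congr_fun (f := diagM M N ∘ₗ (TensorProduct.mk ℂ _ _).flip
    (DiagRep.one Q.T ⊗ₜ DiagRep.one Q.T)) (g := LinearMap.id)
    (tensor_ext fun a b x y hx hy => ?_) z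
  refine (diagM_tmul M N _ _ hy h_one).trans ?_
  rw [str_one_m, str_one_m, mul_zero, mul_zero, Complex.exp_zero, one_smul, LinearMap.id_apply]

/-- The left action on a tensor product is the diagonal action through the coproduct. -/
theorem diagL_comul (M N : YDMod r) (p : P.T.V) (z : M.X.V ⊗[ℂ] N.X.V) :
    diagL M N (comul P.T p ⊗ₜ z) = cur (tens hd M N).str.l p z := by
  obtain ⟨L, hL, hL1, hL2⟩ : ∃ L : P.T.V →ₗ[ℂ] M.X.V ⊗[ℂ] N.X.V →ₗ[ℂ] M.X.V ⊗[ℂ] N.X.V,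
      (∀ p z, L p z = cur (tens hd M N).str.l p z) ∧ (∀ z, L (DiagRep.one P.T) z = z) ∧
      ∀ s p z, L (DiagRep.mul P.T (P.g s) p) z = tensA M N s (L p z) :=
    ⟨cur (tens hd M N).str.l, fun _ _ => rfl, str_one_l (tens hd M N).str, fun s p z =>
      (str_mul_l (tens hd M N).str _ _ _).trans (toStr_l hd ((genData M.str hd).tensor (genData N.str hd)) s _)⟩
  rw [← hL]
  refine P.ext_ind₁ (f := diagL M N ∘ₗ (TensorProduct.mk ℂ _ _).flip z ∘ₗ comul P.T)
    (f' := L.flip z) ?_ (fun s p hp => ?_) p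
  · simp only [LinearMap.comp_apply, LinearMap.flip_apply, TensorProduct.mk_apply, comul_one,
      diagL_one, hL1]
  · simp only [LinearMap.comp_apply, LinearMap.flip_apply, TensorProduct.mk_apply] at hp ⊢
    rw [comul_g_mul, diagL_mul, hp, hL2]

/-- The right action on a tensor product is the diagonal action through the coproduct. -/
theorem diagM_comul (M N : YDMod r) (q : Q.T.V) (z : M.X.V ⊗[ℂ] N.X.V) :
    diagM M N (z ⊗ₜ comul Q.T q) = cur (tens hd M N).str.m z q := by
  obtain ⟨L, hL, hL1, hL2⟩ : ∃ L : M.X.V ⊗[ℂ] N.X.V →ₗ[ℂ] Q.T.V →ₗ[ℂ] M.X.V ⊗[ℂ] N.X.V,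
      (∀ z q, L z q = cur (tens hd M N).str.m z q) ∧ (∀ z, L z (DiagRep.one Q.T) = z) ∧
      ∀ s q z, L z (DiagRep.mul Q.T (Q.g s) q) = L (tensB M N s z) q :=
    ⟨cur (tens hd M N).str.m, fun _ _ => rfl, str_one_m (tens hd M N).str, fun s q z =>
      (str_mul_m (tens hd M N).str _ _ _).trans (congrArg (fun w => cur (tens hd M N).str.m w q)
        (toStr_m hd ((genData M.str hd).tensor (genData N.str hd)) s z))⟩
  rw [← hL]
  refine Q.ext_ind (f := fun z => diagM M N ∘ₗ TensorProduct.mk ℂ _ _ z ∘ₗ comul Q.T)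
    (f' := fun z => L z) (fun z => ?_) (fun s p hp z => ?_) z q
  · simp only [LinearMap.comp_apply, TensorProduct.mk_apply, comul_one, diagM_one, hL1]
  · simp only [LinearMap.comp_apply, TensorProduct.mk_apply] at hp ⊢
    rw [comul_g_mul, diagM_mul, hp, hL2]

theorem unitYD_l_eq (p : P.T.V) (z : ℂ) : cur (unitYD hd).str.l p z = z * counit P.T p := by
  obtain ⟨L, hL, hL1, hL2⟩ : ∃ L : P.T.V →ₗ[ℂ] ℂ →ₗ[ℂ] ℂ,
      (∀ p z, L p z = cur (unitYD hd).str.l p z) ∧ (∀ z, L (DiagRep.one P.T) z = z) ∧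
      ∀ s p z, L (DiagRep.mul P.T (P.g s) p) z = 0 :=
    ⟨cur (unitYD hd).str.l, fun _ _ => rfl, str_one_l (unitYD hd).str, fun s p z =>
      (str_mul_l (unitYD hd).str _ _ _).trans (unitYD_l hd s _)⟩
  refine (hL p z).symm.trans (P.ext_ind₁ (f := L.flip z) (f' := z • counit P.T) ?_
    (fun s p _ => ?_) p)
  · rw [LinearMap.flip_apply, hL1, LinearMap.smul_apply, counit_one, smul_eq_mul, _root_.mul_one]
  · rw [LinearMap.flip_apply, hL2, LinearMap.smul_apply, counit_g_mul, smul_zero]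

theorem unitYD_m_eq (q : Q.T.V) (z : ℂ) : cur (unitYD hd).str.m z q = z * counit Q.T q := by
  obtain ⟨L, hL, hL1, hL2⟩ : ∃ L : ℂ →ₗ[ℂ] Q.T.V →ₗ[ℂ] ℂ,
      (∀ z q, L z q = cur (unitYD hd).str.m z q) ∧ (∀ z, L z (DiagRep.one Q.T) = z) ∧
      ∀ s q z, L z (DiagRep.mul Q.T (Q.g s) q) = L 0 q :=
    ⟨cur (unitYD hd).str.m, fun _ _ => rfl, str_one_m (unitYD hd).str, fun s q z =>
      (str_mul_m (unitYD hd).str _ _ _).trans (congrArg (fun w => cur (unitYD hd).str.m w q)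
        (unitYD_m hd s z))⟩
  refine (hL z q).symm.trans (Q.ext_ind₁ (f := L z) (f' := z • counit Q.T) ?_
    (fun s p _ => ?_) q)
  · rw [hL1, LinearMap.smul_apply, counit_one, smul_eq_mul, _root_.mul_one]
  · rw [hL2, LinearMap.smul_apply, counit_g_mul, smul_zero, map_zero, LinearMap.zero_apply]

/-- The monoidal structure defined on generators is the one given by coproducts and counits. -/
theorem isTensor :
    letI := ydMonoidal hd
    letI := ydForgetMonoidal hd
    YDMod.IsTensor (r := r) := by
  let := ydMonoidal hd
  let := ydForgetMonoidal hd
  refine ⟨fun M N => ?_, fun M N => ?_, ?_, ?_⟩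
  · refine hom_ext (TensorProduct.ext' fun p (z : M.X.V ⊗[ℂ] N.X.V) => ?_)
    exact (diagL_comul hd M N p z).symm
  · refine hom_ext (TensorProduct.ext' fun (z : M.X.V ⊗[ℂ] N.X.V) q => ?_)
    exact (diagM_comul hd M N q z).symm
  · refine hom_ext (TensorProduct.ext' fun p (z : ℂ) => ?_)
    exact (unitYD_l_eq hd p z).trans (map_smul (counit P.T) z p).symm
  · refine hom_ext (TensorProduct.ext' fun (z : ℂ) q => ?_)
    exact (unitYD_m_eq hd q z).trans (map_smul (counit Q.T) z q).symm

end TensorBialgebra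

/-! ### Tensor products of representations -/

namespace RepU
variable {ħ : ℂ}

/-- The representation is spanned by simultaneous eigenvectors of `h₀` and `h₁`. -/
theorem eq_top (V : RepU ħ) {P : Submodule ℂ V.V}
    (hP : ∀ (c : Fin 2 → ℂ) (v : V.V), (∀ i, V.act (Uq.h ħ i) v = c i • v) → v ∈ P) : P = ⊤ := by
  refine V.diag.eq_top fun a v hv => hP ![a, -a] v fun i => ?_
  fin_cases i
  · exact hv
  · change V.act (Uq.h ħ 1) v = (-a) • v
    rw [(Uq.kHolds ħ).h_one, map_neg, LinearMap.neg_apply, hv, neg_smul]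

theorem tensor_eq_top (V W : RepU ħ) {P : Submodule ℂ (V.V ⊗[ℂ] W.V)}
    (hP : ∀ (c d : Fin 2 → ℂ) (v : V.V) (w : W.V), (∀ i, V.act (Uq.h ħ i) v = c i • v) →
      (∀ i, W.act (Uq.h ħ i) w = d i • w) → v ⊗ₜ[ℂ] w ∈ P) : P = ⊤ := by
  refine top_le_iff.1 ?_
  rw [← TensorProduct.span_tmul_eq_top, Submodule.span_le]
  rintro _ ⟨v, w, rfl⟩
  have h1 : P.comap (TensorProduct.mk ℂ V.V W.V v) = ⊤ := W.eq_top fun d w hw => by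
    have h2 : P.comap ((TensorProduct.mk ℂ V.V W.V).flip w) = ⊤ := V.eq_top fun c v hv =>
      hP c d v w hv hw
    exact (h2 ▸ Submodule.mem_top : v ∈ P.comap ((TensorProduct.mk ℂ V.V W.V).flip w))
  exact (h1 ▸ Submodule.mem_top : w ∈ P.comap (TensorProduct.mk ℂ V.V W.V v))

/-- On weight vectors the exponentials act by exponentials. -/
theorem act_texp (V : RepU ħ) (t : ℂ) {i : Fin 2} {c : ℂ} {v : V.V}
    (hv : V.act (Uq.h ħ i) v = c • v) :
    V.act (texp (t • Uq.h ħ i)) v = Complex.exp (t * c) • v :=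
  texp_eigen V.cont (Alg.hasSum_texp (Alg.smul_h_mem t i))
    (by rw [map_smul, LinearMap.smul_apply]; exact (congrArg (t • ·) hv).trans (smul_smul t c v))

theorem holds (V : RepU ħ) : Uq.Holds ħ (fun i => V.act (Uq.h ħ i))
    (fun p => V.act (Uq.e ħ p.1 p.2)) (fun i => V.act (texp (ħ • Uq.h ħ i)))
    (fun i => V.act (texp (-ħ • Uq.h ħ i))) :=
  (Uq.kHolds ħ).toHolds.map V.act

theorem act_h_e (V : RepU ħ) (s : Pm) (i j : Fin 2) (v : V.V) :
    V.act (Uq.h ħ i) (V.act (Uq.e ħ s j) v) =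
      V.act (Uq.e ħ s j) (V.act (Uq.h ħ i) v) + Uq.cartan s i j • V.act (Uq.e ħ s j) v := by
  have h := LinearMap.congr_fun (V.holds.weight' s i j) v
  exact sub_eq_iff_eq_add'.1 h

theorem act_h_h (V : RepU ħ) (i j : Fin 2) : V.act (Uq.h ħ i) * V.act (Uq.h ħ j) =
    V.act (Uq.h ħ j) * V.act (Uq.h ħ i) := by
  rw [← map_mul, ← map_mul]
  exact congrArg V.act (Alg.hspan_commute (Alg.h_mem_hspan i) (Alg.h_mem_hspan j)).eq

/-- The tensor product of representations as a representation of the completed tensor product. -/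
theorem exists_tensorRep (V W : RepU ħ) :
    ∃ ρ₂ : Alg₂ (Uq.rels ħ) →ₐ[ℂ] Module.End ℂ (V.V ⊗[ℂ] W.V), IsTensorRep V.act W.act ρ₂ := by
  obtain ⟨a, ha⟩ : ∃ a : Fin 2 ⊕ Fin 2 → Module.End ℂ (V.V ⊗[ℂ] W.V), a =
    Sum.elim (fun i => TensorProduct.map (V.act (Uq.h ħ i)) LinearMap.id)
      (fun i => TensorProduct.map LinearMap.id (W.act (Uq.h ħ i))) := ⟨_, rfl⟩
  obtain ⟨y, hy⟩ : ∃ y : (Pm × Fin 2) ⊕ (Pm × Fin 2) → Module.End ℂ (V.V ⊗[ℂ] W.V), y =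
    Sum.elim (fun p => TensorProduct.map (V.act (Uq.e ħ p.1 p.2)) LinearMap.id)
      (fun p => TensorProduct.map LinearMap.id (W.act (Uq.e ħ p.1 p.2))) := ⟨_, rfl⟩
  have hw : IsWeightData a y (fun i p => match i, p with
      | .inl i, .inl p => Uq.cartan p.1 i p.2
      | .inr i, .inr p => Uq.cartan p.1 i p.2
      | _, _ => 0) := by
    subst ha hy
    refine ⟨?_, ?_, ?_⟩
    · rintro (i | i) (j | j) <;> refine TensorProduct.ext' fun v w => ?_ <;>
        simp only [Sum.elim_inl, Sum.elim_inr, Module.End.mul_apply, TensorProduct.map_tmul,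
          LinearMap.id_apply]
      · exact congrArg (· ⊗ₜ[ℂ] w) (LinearMap.congr_fun (V.act_h_h i j) v)
      · exact congrArg (v ⊗ₜ[ℂ] ·) (LinearMap.congr_fun (W.act_h_h i j) w)
    · rintro (i | i) (j | j) z <;> induction z with
        | zero => simp
        | add z z' h1 h2 =>
          simp only [map_add, smul_add] at h1 h2 ⊢
          rw [h1, h2]
          abel
        | tmul v w =>
          simp only [Sum.elim_inl, Sum.elim_inr, TensorProduct.map_tmul, LinearMap.id_apply,
            act_h_e, TensorProduct.add_tmul, TensorProduct.tmul_add, zero_smul, add_zero,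
            TensorProduct.tmul_smul, ← TensorProduct.smul_tmul']
    · refine V.tensor_eq_top W fun c d v w hv hw => Submodule.subset_span ?_
      rintro (i | i)
      · exact ⟨c i, by rw [Sum.elim_inl, TensorProduct.map_tmul, hv, ← TensorProduct.smul_tmul']; rfl⟩
      · exact ⟨d i, by rw [Sum.elim_inr, TensorProduct.map_tmul, hw, TensorProduct.tmul_smul]; rfl⟩
  obtain ⟨θ, hθ, hθh, hθx⟩ := hw.exists_rep
  have hl : ∀ t i, θ (texp (t • E.h (Sum.inl i : Fin 2 ⊕ Fin 2))) =
      Module.End.rTensorAlgHom ℂ V.V W.V (V.act (texp (t • Uq.h ħ i))) := fun t i => by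
    refine LinearMap.eqLocus_eq_top.1 (V.tensor_eq_top W fun c d v w hv hw => ?_)
    refine (E.texp_eigen (c := c i) hθ _ t ?_).trans ?_
    · rw [hθh, ha, Sum.elim_inl, TensorProduct.map_tmul, hv, ← TensorProduct.smul_tmul']
      rfl
    · exact (congrArg (· ⊗ₜ[ℂ] w) (V.act_texp t (hv i))).symm
  have hr : ∀ t i, θ (texp (t • E.h (Sum.inr i : Fin 2 ⊕ Fin 2))) =
      Module.End.lTensorAlgHom ℂ W.V V.V (W.act (texp (t • Uq.h ħ i))) := fun t i => by
    refine LinearMap.eqLocus_eq_top.1 (V.tensor_eq_top W fun c d v w hv hw => ?_)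
    refine (E.texp_eigen (c := d i) hθ _ t ?_).trans ?_
    · rw [hθh, ha, Sum.elim_inr, TensorProduct.map_tmul, hw, TensorProduct.tmul_smul]
      rfl
    · exact ((congrArg (v ⊗ₜ[ℂ] ·) (W.act_texp t (hw i))).trans
        (TensorProduct.tmul_smul _ _ _)).symm
  have hrel : ∀ r ∈ (Uq.rels ħ).double (E (Fin 2 ⊕ Fin 2) _) E.h E.x, θ r = 0 := by
    refine (Rels.double_iff _ _ _ _).2 ⟨(Uq.rels_iff θ _ _).2 ?_, (Uq.rels_iff θ _ _).2 ?_, ?_⟩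
    · have h1 := V.holds.map (Module.End.rTensorAlgHom ℂ V.V W.V)
      rw [← Function.comp_assoc, ← Function.comp_assoc, funext (f := θ ∘ E.h) hθh,
        funext (f := θ ∘ E.x) hθx, ha, hy]
      exact Eq.mpr (congrArg₂ (Uq.Holds ħ _ _) (funext (hl ħ)) (funext (hl (-ħ)))) h1
    · have h1 := W.holds.map (Module.End.lTensorAlgHom ℂ W.V V.V)
      rw [← Function.comp_assoc, ← Function.comp_assoc, funext (f := θ ∘ E.h) hθh,
        funext (f := θ ∘ E.x) hθx, ha, hy]
      exact Eq.mpr (congrArg₂ (Uq.Holds ħ _ _) (funext (hr ħ)) (funext (hr (-ħ)))) h1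
    · rw [← Function.comp_assoc, ← Function.comp_assoc, ← Function.comp_assoc, ← Function.comp_assoc,
        funext (f := θ ∘ E.h) hθh, funext (f := θ ∘ E.x) hθx, ha, hy]
      have h1 : ∀ (f : Module.End ℂ V.V) (g : Module.End ℂ W.V),
          Commute (TensorProduct.map f LinearMap.id : Module.End ℂ (V.V ⊗[ℂ] W.V))
            (TensorProduct.map LinearMap.id g) := fun f g =>
        TensorProduct.ext' fun v w => rfl
      exact ⟨fun i j => h1 _ _, fun i j => h1 _ _, fun i j => h1 _ _, fun i j => h1 _ _⟩
  obtain ⟨ρ, hρ, hρh, hρx⟩ := Alg.exists_rep θ hθ hrel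
  exact ⟨ρ, ⟨hρ, fun i => (hρh _).trans ((hθh _).trans (congrFun ha _)),
    fun i => (hρh _).trans ((hθh _).trans (congrFun ha _)),
    fun i => (hρx _).trans ((hθx _).trans (congrFun hy _)),
    fun i => (hρx _).trans ((hθx _).trans (congrFun hy _))⟩⟩

/-- The representation of the completed tensor product on the tensor product. -/
def tensorRep (V W : RepU ħ) : Alg₂ (Uq.rels ħ) →ₐ[ℂ] Module.End ℂ (V.V ⊗[ℂ] W.V) :=
  (exists_tensorRep V W).choose

theorem isTensorRep (V W : RepU ħ) : IsTensorRep V.act W.act (tensorRep V W) :=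
  (exists_tensorRep V W).choose_spec

theorem tensorRep_h₁ (V W : RepU ħ) (i : Fin 2) : tensorRep V W (Uq.h₁ ħ i) =
    TensorProduct.map (V.act (Uq.h ħ i)) LinearMap.id := (isTensorRep V W).h_left i

theorem tensorRep_h₂ (V W : RepU ħ) (i : Fin 2) : tensorRep V W (Uq.h₂ ħ i) =
    TensorProduct.map LinearMap.id (W.act (Uq.h ħ i)) := (isTensorRep V W).h_right i

theorem tensorRep_e₁ (V W : RepU ħ) (s : Pm) (i : Fin 2) : tensorRep V W (Uq.e₁ ħ s i) =
    TensorProduct.map (V.act (Uq.e ħ s i)) LinearMap.id := (isTensorRep V W).x_left (s, i)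

theorem tensorRep_e₂ (V W : RepU ħ) (s : Pm) (i : Fin 2) : tensorRep V W (Uq.e₂ ħ s i) =
    TensorProduct.map LinearMap.id (W.act (Uq.e ħ s i)) := (isTensorRep V W).x_right (s, i)

theorem tensorRep_texp₁ (V W : RepU ħ) (t : ℂ) (i : Fin 2) :
    tensorRep V W (texp (t • Uq.h₁ ħ i)) =
      TensorProduct.map (V.act (texp (t • Uq.h ħ i))) LinearMap.id := by
  refine LinearMap.eqLocus_eq_top.1 (V.tensor_eq_top W fun c d v w hv hw => ?_)
  refine (texp_eigen (c := t * c i) (isTensorRep V W).cont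
    (Alg.hasSum_texp (Alg.smul_h_mem t _)) ?_).trans ?_
  · rw [map_smul, LinearMap.smul_apply, (isTensorRep V W).h_left, TensorProduct.map_tmul]
    exact (congrArg (fun z => t • (z ⊗ₜ[ℂ] w)) (hv i)).trans (smul_smul t (c i) (v ⊗ₜ[ℂ] w))
  · exact (congrArg (· ⊗ₜ[ℂ] w) (V.act_texp t (hv i))).symm

theorem tensorRep_texp₂ (V W : RepU ħ) (t : ℂ) (i : Fin 2) :
    tensorRep V W (texp (t • Uq.h₂ ħ i)) =
      TensorProduct.map LinearMap.id (W.act (texp (t • Uq.h ħ i))) := by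
  refine LinearMap.eqLocus_eq_top.1 (V.tensor_eq_top W fun c d v w hv hw => ?_)
  refine (texp_eigen (c := t * d i) (isTensorRep V W).cont
    (Alg.hasSum_texp (Alg.smul_h_mem t _)) ?_).trans ?_
  · rw [map_smul, LinearMap.smul_apply, (isTensorRep V W).h_right, TensorProduct.map_tmul]
    exact (congrArg (t • ·) ((congrArg (v ⊗ₜ[ℂ] ·) (hw i)).trans (TensorProduct.tmul_smul _ _ _))).trans
      (smul_smul t (d i) (v ⊗ₜ[ℂ] w))
  · exact ((congrArg (v ⊗ₜ[ℂ] ·) (W.act_texp t (hw i))).trans (TensorProduct.tmul_smul _ _ _)).symm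

/-- The underlying linear map of an intertwiner. -/
def lin {V W : RepU ħ} (f : V ⟶ W) : V.V →ₗ[ℂ] W.V := RepSS.Hom.lin f

theorem lin_act {V W : RepU ħ} (f : V ⟶ W) (u : Alg (Uq.rels ħ)) (v : V.V) :
    lin f (V.act u v) = W.act u (lin f v) := RepSS.Hom.comm f u v

theorem hom_ext {V W : RepU ħ} {f g : V ⟶ W} (h : lin f = lin g) : f = g := RepSS.Hom.ext h

/-- Two actions agree along a linear map if they do so on generators. -/
theorem comm_of {V W : Type} [AddCommGroup V] [Module ℂ V] [AddCommGroup W] [Module ℂ W]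
    {ρ : Alg (Uq.rels ħ) →ₐ[ℂ] Module.End ℂ V} {σ : Alg (Uq.rels ħ) →ₐ[ℂ] Module.End ℂ W}
    (hρ : WeaklyContinuous ρ) (hσ : WeaklyContinuous σ) {f : V →ₗ[ℂ] W}
    (hh : ∀ v, f (ρ (Uq.h ħ 0) v) = σ (Uq.h ħ 0) (f v))
    (he : ∀ s i v, f (ρ (Uq.e ħ s i) v) = σ (Uq.e ħ s i) (f v)) (u : Alg (Uq.rels ħ)) (v : V) :
    f (ρ u v) = σ u (f v) := by
  have h1 : intertwined ρ σ f = ⊤ := by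
    refine Alg.subalgebra_eq_top _ (isClosed_intertwined hρ hσ f) (fun i => ?_) fun p v => he p.1 p.2 v
    fin_cases i
    · exact hh
    · intro v
      change f (ρ (Uq.h ħ 1) v) = σ (Uq.h ħ 1) (f v)
      rw [(Uq.kHolds ħ).h_one, map_neg, map_neg, LinearMap.neg_apply, LinearMap.neg_apply, map_neg, hh]
  exact (h1 ▸ Algebra.mem_top : u ∈ intertwined ρ σ f) v

/-- An intertwiner from a linear map that commutes with the generators. -/
def homOf {V W : RepU ħ} (f : V.V →ₗ[ℂ] W.V)
    (hh : ∀ v, f (V.act (Uq.h ħ 0) v) = W.act (Uq.h ħ 0) (f v))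
    (he : ∀ s i v, f (V.act (Uq.e ħ s i) v) = W.act (Uq.e ħ s i) (f v)) : V ⟶ W :=
  (⟨f, comm_of V.cont W.cont hh he⟩ : RepSS.Hom V W)

/-- An isomorphism from a linear equivalence that commutes with the generators. -/
def isoOf {V W : RepU ħ} (e : V.V ≃ₗ[ℂ] W.V)
    (hh : ∀ v, e (V.act (Uq.h ħ 0) v) = W.act (Uq.h ħ 0) (e v))
    (he : ∀ s i v, e (V.act (Uq.e ħ s i) v) = W.act (Uq.e ħ s i) (e v)) : V ≅ W where
  hom := homOf e.toLinearMap hh he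
  inv := homOf e.symm.toLinearMap (fun v => e.injective <| by simp [hh])
    (fun s i v => e.injective <| by simp [he])
  hom_inv_id := hom_ext (LinearMap.ext e.symm_apply_apply)
  inv_hom_id := hom_ext (LinearMap.ext e.apply_symm_apply)

section tensor
variable {ΔU : Alg (Uq.rels ħ) →ₐ[ℂ] Alg₂ (Uq.rels ħ)} (hΔ : Uq.IsComul ħ ΔU)
  {εU : Alg (Uq.rels ħ) →ₐ[ℂ] ℂ} (hε : Uq.IsCounit ħ εU)

/-- The tensor product of representations. -/
def tens (V W : RepU ħ) : RepU ħ where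
  V := V.V ⊗[ℂ] W.V
  act := (tensorRep V W).comp ΔU
  cont v φ := ((isTensorRep V W).cont v φ).comp hΔ.cont
  diag := by
    have h1 : (tensorRep V W).comp ΔU (Uq.h ħ 0) =
        addEnd (V.act (Uq.h ħ 0)) (W.act (Uq.h ħ 0)) := by
      rw [AlgHom.comp_apply, show ΔU (Uq.h ħ 0) = _ from hΔ.map_h 0, map_add, tensorRep_h₁,
        tensorRep_h₂]
      rfl
    rw [h1]
    exact V.diag.addEnd W.diag

/-- The unit representation. -/
def unit : RepU ħ where
  V := ℂ
  act := (Algebra.lmul ℂ ℂ).comp εU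
  cont v φ := by
    have h1 : (fun b => φ ((Algebra.lmul ℂ ℂ).comp εU b v)) = fun b => εU b * φ v :=
      funext fun b => map_smul φ (εU b) v
    rw [h1]
    exact hε.cont.mul continuous_const
  diag := isDiag_of_forall fun P hP => Submodule.eq_top_iff'.2 fun v => hP 0 v <| by
    change εU (Uq.h ħ 0) * v = 0 • v
    rw [show εU (Uq.h ħ 0) = 0 from hε.map_h 0, zero_smul, zero_mul]

theorem tens_h (V W : RepU ħ) (i : Fin 2) (v : V.V) (w : W.V) :
    (tens hΔ V W).act (Uq.h ħ i) (v ⊗ₜ[ℂ] w : V.V ⊗[ℂ] W.V) =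
      (V.act (Uq.h ħ i) v ⊗ₜ w + v ⊗ₜ W.act (Uq.h ħ i) w : V.V ⊗[ℂ] W.V) := by
  change tensorRep V W (ΔU (Alg.h _ i)) (v ⊗ₜ[ℂ] w) = _
  rw [hΔ.map_h, map_add, LinearMap.add_apply, tensorRep_h₁, tensorRep_h₂]
  rfl

theorem tens_pos (V W : RepU ħ) (i : Fin 2) (v : V.V) (w : W.V) :
    (tens hΔ V W).act (Uq.e ħ .pos i) (v ⊗ₜ[ℂ] w : V.V ⊗[ℂ] W.V) =
      (V.act (Uq.e ħ .pos i) v ⊗ₜ W.act (texp (ħ • Uq.h ħ i)) w + v ⊗ₜ W.act (Uq.e ħ .pos i) w :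
        V.V ⊗[ℂ] W.V) := by
  change tensorRep V W (ΔU (Alg.x _ (.pos, i))) (v ⊗ₜ[ℂ] w) = _
  rw [hΔ.map_x, Uq.comulE, map_add, map_mul, LinearMap.add_apply, Module.End.mul_apply,
    tensorRep_texp₂, tensorRep_e₁, tensorRep_e₂]
  rfl

theorem tens_neg (V W : RepU ħ) (i : Fin 2) (v : V.V) (w : W.V) :
    (tens hΔ V W).act (Uq.e ħ .neg i) (v ⊗ₜ[ℂ] w : V.V ⊗[ℂ] W.V) =
      (V.act (Uq.e ħ .neg i) v ⊗ₜ w + V.act (texp (-ħ • Uq.h ħ i)) v ⊗ₜ W.act (Uq.e ħ .neg i) w :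
        V.V ⊗[ℂ] W.V) := by
  change tensorRep V W (ΔU (Alg.x _ (.neg, i))) (v ⊗ₜ[ℂ] w) = _
  rw [hΔ.map_x, Uq.comulE, map_add, map_mul, LinearMap.add_apply, Module.End.mul_apply,
    tensorRep_texp₁, tensorRep_e₁, tensorRep_e₂]
  rfl

theorem tens_texp (V W : RepU ħ) (t : ℂ) (i : Fin 2) (v : V.V) (w : W.V) :
    (tens hΔ V W).act (texp (t • Uq.h ħ i)) (v ⊗ₜ[ℂ] w : V.V ⊗[ℂ] W.V) =
      (V.act (texp (t • Uq.h ħ i)) v ⊗ₜ W.act (texp (t • Uq.h ħ i)) w : V.V ⊗[ℂ] W.V) := by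
  change tensorRep V W (ΔU (texp (t • Alg.h _ i))) (v ⊗ₜ[ℂ] w) = _
  rw [Alg.map_texp hΔ.cont (Alg.smul_h_mem t i), map_smul, hΔ.map_h, smul_add,
    show texp (t • Uq.h₁ ħ i + t • Uq.h₂ ħ i) = _ from
      Alg.texp_add (Alg.smul_h_mem t _) (Alg.smul_h_mem t _), map_mul, Module.End.mul_apply,
    tensorRep_texp₂, tensorRep_texp₁]
  rfl

theorem unit_h (i : Fin 2) (z : ℂ) : (unit hε).act (Uq.h ħ i) z = (0 : ℂ) := by
  change εU (Alg.h _ i) * z = 0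
  rw [hε.map_h]
  exact zero_mul z

theorem unit_e (s : Pm) (i : Fin 2) (z : ℂ) : (unit hε).act (Uq.e ħ s i) z = (0 : ℂ) := by
  change εU (Alg.x _ (s, i)) * z = 0
  rw [hε.map_x]
  exact zero_mul z

theorem unit_texp (t : ℂ) (i : Fin 2) (z : ℂ) :
    (unit hε).act (texp (t • Uq.h ħ i)) z = z := by
  refine ((unit hε).act_texp t (c := 0) ((unit_h hε i z).trans (zero_smul ℂ z).symm)).trans ?_
  rw [mul_zero, Complex.exp_zero]
  exact one_smul ℂ z

end tensor
end RepU

/-! ### The monoidal category of representations -/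

namespace RepU
variable {κ ω ħ ζ ξ : ℂ} {ΔU : Alg (Uq.rels ħ) →ₐ[ℂ] Alg₂ (Uq.rels ħ)} (hΔ : Uq.IsComul ħ ΔU)
  {εU : Alg (Uq.rels ħ) →ₐ[ℂ] ℂ} (hε : Uq.IsCounit ħ εU)

theorem comm_tmul {V W Z : Type} [AddCommGroup V] [Module ℂ V] [AddCommGroup W] [Module ℂ W]
    [AddCommGroup Z] [Module ℂ Z] {S : Module.End ℂ (V ⊗[ℂ] W)} {T : Module.End ℂ Z}
    {f : V ⊗[ℂ] W →ₗ[ℂ] Z} (h : ∀ v w, f (S (v ⊗ₜ w)) = T (f (v ⊗ₜ w))) (z : V ⊗[ℂ] W) :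
    f (S z) = T (f z) :=
  LinearMap.congr_fun (f := f ∘ₗ S) (g := T ∘ₗ f) (TensorProduct.ext' h) z

theorem comm_tmul₃ {U V W Z : Type} [AddCommGroup U] [Module ℂ U] [AddCommGroup V] [Module ℂ V]
    [AddCommGroup W] [Module ℂ W] [AddCommGroup Z] [Module ℂ Z]
    {S : Module.End ℂ ((U ⊗[ℂ] V) ⊗[ℂ] W)} {T : Module.End ℂ Z} {f : (U ⊗[ℂ] V) ⊗[ℂ] W →ₗ[ℂ] Z}
    (h : ∀ u v w, f (S ((u ⊗ₜ v) ⊗ₜ w)) = T (f ((u ⊗ₜ v) ⊗ₜ w))) (z : (U ⊗[ℂ] V) ⊗[ℂ] W) :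
    f (S z) = T (f z) :=
  LinearMap.congr_fun (f := f ∘ₗ S) (g := T ∘ₗ f) (TensorProduct.ext_threefold h) z

theorem map_add_tmul {V W V' W' : Type} [AddCommGroup V] [Module ℂ V] [AddCommGroup W] [Module ℂ W]
    [AddCommGroup V'] [Module ℂ V'] [AddCommGroup W'] [Module ℂ W'] (f : V →ₗ[ℂ] V')
    (g : W →ₗ[ℂ] W') (v v' : V) (w w' : W) : TensorProduct.map f g (v ⊗ₜ w + v' ⊗ₜ w') =
      f v ⊗ₜ g w + f v' ⊗ₜ g w' := by
  rw [map_add, TensorProduct.map_tmul, TensorProduct.map_tmul]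

theorem smul_tmul_add {V W : Type} [AddCommGroup V] [Module ℂ V] [AddCommGroup W] [Module ℂ W]
    (c : ℂ) (v v' : V) (w w' : W) :
    c • (v' ⊗ₜ[ℂ] w + v ⊗ₜ w') = (c • v') ⊗ₜ[ℂ] w + v ⊗ₜ (c • w') := by
  rw [smul_add, TensorProduct.smul_tmul', TensorProduct.tmul_smul]

/-- The tensor product of intertwiners. -/
def tensHom {V V' W W' : RepU ħ} (f : V ⟶ V') (g : W ⟶ W') : tens hΔ V W ⟶ tens hΔ V' W' :=
  homOf (V := tens hΔ V W) (W := tens hΔ V' W') (TensorProduct.map (lin f) (lin g))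
    (comm_tmul fun v w => by
      refine (congrArg (TensorProduct.map (lin f) (lin g)) (tens_h hΔ V W 0 v w)).trans
        (Eq.trans ?_ (tens_h hΔ V' W' 0 (lin f v) (lin g w)).symm)
      rw [map_add_tmul, lin_act, lin_act])
    (fun s i => comm_tmul fun v w => by
      cases s
      · refine (congrArg (TensorProduct.map (lin f) (lin g)) (tens_pos hΔ V W i v w)).trans
          (Eq.trans ?_ (tens_pos hΔ V' W' i (lin f v) (lin g w)).symm)
        rw [map_add_tmul, lin_act, lin_act, lin_act]
      · refine (congrArg (TensorProduct.map (lin f) (lin g)) (tens_neg hΔ V W i v w)).trans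
          (Eq.trans ?_ (tens_neg hΔ V' W' i (lin f v) (lin g w)).symm)
        rw [map_add_tmul, lin_act, lin_act, lin_act])

/-- The associator of representations. -/
def assoc (U V W : RepU ħ) : tens hΔ (tens hΔ U V) W ≅ tens hΔ U (tens hΔ V W) :=
  isoOf (V := tens hΔ (tens hΔ U V) W) (W := tens hΔ U (tens hΔ V W))
    (TensorProduct.assoc ℂ U.V V.V W.V)
    (comm_tmul₃ (f := (TensorProduct.assoc ℂ U.V V.V W.V).toLinearMap) fun u v w => by
      refine (congrArg (TensorProduct.assoc ℂ U.V V.V W.V) ((tens_h hΔ (tens hΔ U V) W 0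
        (u ⊗ₜ[ℂ] v : U.V ⊗[ℂ] V.V) w).trans (congrArg₂ (· + ·) (congrArg (· ⊗ₜ[ℂ] w)
          (tens_h hΔ U V 0 u v)) rfl))).trans (Eq.trans ?_ ((tens_h hΔ U (tens hΔ V W) 0 u
        (v ⊗ₜ[ℂ] w : V.V ⊗[ℂ] W.V)).trans (congrArg₂ (· + ·) rfl (congrArg (u ⊗ₜ[ℂ] ·)
          (tens_h hΔ V W 0 v w)))).symm)
      exact TensorBialgebra.assoc_add _ _ _ _ _ _ _)
    (fun s i => comm_tmul₃ (f := (TensorProduct.assoc ℂ U.V V.V W.V).toLinearMap) fun u v w => by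
      cases s
      · refine (congrArg (TensorProduct.assoc ℂ U.V V.V W.V) ((tens_pos hΔ (tens hΔ U V) W i
          (u ⊗ₜ[ℂ] v : U.V ⊗[ℂ] V.V) w).trans (congrArg₂ (· + ·) (congrArg (· ⊗ₜ[ℂ] _)
            (tens_pos hΔ U V i u v)) rfl))).trans (Eq.trans ?_ ((tens_pos hΔ U (tens hΔ V W) i u
          (v ⊗ₜ[ℂ] w : V.V ⊗[ℂ] W.V)).trans (congrArg₂ (· + ·)
            (congrArg (_ ⊗ₜ[ℂ] ·) (tens_texp hΔ V W ħ i v w)) (congrArg (u ⊗ₜ[ℂ] ·)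
            (tens_pos hΔ V W i v w)))).symm)
        exact TensorBialgebra.assoc_add _ _ _ _ _ _ _
      · refine (congrArg (TensorProduct.assoc ℂ U.V V.V W.V) ((tens_neg hΔ (tens hΔ U V) W i
          (u ⊗ₜ[ℂ] v : U.V ⊗[ℂ] V.V) w).trans (congrArg₂ (· + ·) (congrArg (· ⊗ₜ[ℂ] w)
            (tens_neg hΔ U V i u v)) (congrArg (· ⊗ₜ[ℂ] _) (tens_texp hΔ U V (-ħ) i u v))))).trans
          (Eq.trans ?_ ((tens_neg hΔ U (tens hΔ V W) i u
          (v ⊗ₜ[ℂ] w : V.V ⊗[ℂ] W.V)).trans (congrArg₂ (· + ·) rfl (congrArg (_ ⊗ₜ[ℂ] ·)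
            (tens_neg hΔ V W i v w)))).symm)
        exact TensorBialgebra.assoc_add _ _ _ _ _ _ _)

/-- The left unitor of representations. -/
def lid (V : RepU ħ) : tens hΔ (unit hε) V ≅ V :=
  isoOf (V := tens hΔ (unit hε) V) (TensorProduct.lid ℂ V.V)
    (comm_tmul (f := (TensorProduct.lid ℂ V.V).toLinearMap) fun c v => by
      refine (congrArg (TensorProduct.lid ℂ V.V) ((tens_h hΔ (unit hε) V 0 c v).trans
        (congrArg₂ (· + ·) (congrArg (· ⊗ₜ[ℂ] v) (unit_h hε 0 c)) rfl))).trans ?_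
      refine Eq.trans (b := (0 : ℂ) • v + c • V.act (Uq.h ħ 0) v) rfl ?_
      rw [zero_smul, zero_add, ← map_smul]
      rfl)
    (fun s i => comm_tmul (f := (TensorProduct.lid ℂ V.V).toLinearMap) fun c v => by
      cases s
      · refine (congrArg (TensorProduct.lid ℂ V.V) ((tens_pos hΔ (unit hε) V i c v).trans
          (congrArg₂ (· + ·) (congrArg (· ⊗ₜ[ℂ] _) (unit_e hε .pos i c)) rfl))).trans ?_
        refine Eq.trans (b := (0 : ℂ) • V.act (texp (ħ • Uq.h ħ i)) v +
          c • V.act (Uq.e ħ .pos i) v) rfl ?_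
        rw [zero_smul, zero_add, ← map_smul]
        rfl
      · refine (congrArg (TensorProduct.lid ℂ V.V) ((tens_neg hΔ (unit hε) V i c v).trans
          (congrArg₂ (· + ·) (congrArg (· ⊗ₜ[ℂ] _) (unit_e hε .neg i c))
            (congrArg (· ⊗ₜ[ℂ] _) (unit_texp hε (-ħ) i c))))).trans ?_
        refine Eq.trans (b := (0 : ℂ) • v + c • V.act (Uq.e ħ .neg i) v) rfl ?_
        rw [zero_smul, zero_add, ← map_smul]
        rfl)

/-- The right unitor of representations. -/
def rid (V : RepU ħ) : tens hΔ V (unit hε) ≅ V :=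
  isoOf (V := tens hΔ V (unit hε)) (TensorProduct.rid ℂ V.V)
    (comm_tmul (f := (TensorProduct.rid ℂ V.V).toLinearMap) fun v c => by
      refine (congrArg (TensorProduct.rid ℂ V.V) ((tens_h hΔ V (unit hε) 0 v c).trans
        (congrArg₂ (· + ·) rfl (congrArg (v ⊗ₜ[ℂ] ·) (unit_h hε 0 c))))).trans ?_
      refine Eq.trans (b := c • V.act (Uq.h ħ 0) v + (0 : ℂ) • v) rfl ?_
      rw [zero_smul, add_zero, ← map_smul]
      rfl)
    (fun s i => comm_tmul (f := (TensorProduct.rid ℂ V.V).toLinearMap) fun v c => by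
      cases s
      · refine (congrArg (TensorProduct.rid ℂ V.V) ((tens_pos hΔ V (unit hε) i v c).trans
          (congrArg₂ (· + ·) (congrArg (_ ⊗ₜ[ℂ] ·) (unit_texp hε ħ i c))
            (congrArg (_ ⊗ₜ[ℂ] ·) (unit_e hε .pos i c))))).trans ?_
        refine Eq.trans (b := c • V.act (Uq.e ħ .pos i) v + (0 : ℂ) • v) rfl ?_
        rw [zero_smul, add_zero, ← map_smul]
        rfl
      · refine (congrArg (TensorProduct.rid ℂ V.V) ((tens_neg hΔ V (unit hε) i v c).trans
          (congrArg₂ (· + ·) rfl (congrArg (_ ⊗ₜ[ℂ] ·) (unit_e hε .neg i c))))).trans ?_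
        refine Eq.trans (b := c • V.act (Uq.e ħ .neg i) v +
          (0 : ℂ) • V.act (texp (-ħ • Uq.h ħ i)) v) rfl ?_
        rw [zero_smul, add_zero, ← map_smul]
        rfl)

/-- The monoidal category of representations. -/
abbrev repMonoidal : MonoidalCategory (RepU ħ) where
  tensorObj := tens hΔ
  tensorUnit := unit hε
  tensorHom := tensHom hΔ
  whiskerLeft V _ _ g := tensHom hΔ (𝟙 V) g
  whiskerRight f W := tensHom hΔ f (𝟙 W)
  associator := assoc hΔ
  leftUnitor := lid hΔ hε
  rightUnitor := rid hΔ hε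
  tensorHom_def _ _ := hom_ext (TensorProduct.ext' fun _ _ => rfl)
  id_tensorHom_id _ _ := hom_ext (TensorProduct.ext' fun _ _ => rfl)
  tensorHom_comp_tensorHom _ _ _ _ := hom_ext (TensorProduct.ext' fun _ _ => rfl)
  whiskerLeft_id _ _ := hom_ext (TensorProduct.ext' fun _ _ => rfl)
  id_whiskerRight _ _ := hom_ext (TensorProduct.ext' fun _ _ => rfl)
  associator_naturality _ _ _ := hom_ext (TensorProduct.ext_threefold fun _ _ _ => rfl)
  leftUnitor_naturality f := hom_ext (TensorProduct.ext' fun (a : ℂ) v => (map_smul (lin f) a v).symm)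
  rightUnitor_naturality f := hom_ext (TensorProduct.ext' fun v (a : ℂ) => (map_smul (lin f) a v).symm)
  pentagon _ _ _ _ := hom_ext (TensorProduct.ext_fourfold fun _ _ _ _ => rfl)
  triangle _ _ := hom_ext (TensorProduct.ext_threefold fun _ _ _ => TensorProduct.tmul_smul _ _ _)

variable {ψ : Alg (AF.rels ω) →ₐ[ℂ] Alg (Uq.rels ħ)} (hψ : Uq.IsPsi ħ ω ζ ξ ψ)

theorem under_h (V : RepU ħ) (v : V.V) :
    ((under κ hψ).obj V).h v = (ω / 2) • V.act (Uq.h ħ 0) v := by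
  change V.act (ψ (Alg.h _ ())) v = _
  rw [hψ.map_h, map_smul]
  rfl

theorem under_addEnd (V W : RepU ħ) (z : V.V ⊗[ℂ] W.V) :
    addEnd ((under κ hψ).obj V).h ((under κ hψ).obj W).h z =
      ((under κ hψ).obj (tens hΔ V W)).h z := by
  refine Eq.trans ?_ (under_h hψ (tens hΔ V W) z).symm
  refine comm_tmul (f := LinearMap.id) (S := addEnd ((under κ hψ).obj V).h ((under κ hψ).obj W).h)
    (T := (ω / 2) • (tens hΔ V W).act (Uq.h ħ 0)) (fun (v : V.V) (w : W.V) => ?_) z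
  refine (addEnd_tmul _ _ v w).trans ((congrArg₂ (fun (a : V.V) (b : W.V) => a ⊗ₜ[ℂ] w + v ⊗ₜ[ℂ] b)
    (under_h hψ V v) (under_h hψ W w)).trans ?_)
  refine Eq.trans ?_ (congrArg ((ω / 2) • ·) (tens_h hΔ V W 0 v w)).symm
  exact (smul_tmul_add _ v _ w _).symm

variable (κ)

/-- The functor to `𝒞` is monoidal, with identities as structure morphisms. -/
abbrev underMonoidal :
    letI := repMonoidal hΔ hε
    (under κ hψ).Monoidal :=
  letI := repMonoidal hΔ hε
  Functor.CoreMonoidal.toMonoidal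
    { εIso := DiagRep.mkIso (X := 𝟙_ (DiagRep κ)) (Y := (under κ hψ).obj (unit hε))
        (LinearEquiv.refl ℂ ℂ) fun v => by
          refine Eq.trans ?_ (under_h hψ (unit hε) v).symm
          exact ((congrArg ((ω / 2) • ·) (unit_h hε 0 v)).trans (smul_zero (A := ℂ) _)).symm
      μIso := fun V W => DiagRep.mkIso (X := (under κ hψ).obj V ⊗ (under κ hψ).obj W)
        (Y := (under κ hψ).obj (tens hΔ V W)) (LinearEquiv.refl ℂ (V.V ⊗[ℂ] W.V))
        (under_addEnd hΔ hψ V W)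
      μIso_hom_natural_left := fun _ _ => DiagRep.hom_ext (TensorProduct.ext' fun _ _ => rfl)
      μIso_hom_natural_right := fun _ _ => DiagRep.hom_ext (TensorProduct.ext' fun _ _ => rfl)
      associativity := fun _ _ _ => DiagRep.hom_ext (TensorProduct.ext_threefold fun _ _ _ => rfl)
      left_unitality := fun _ => DiagRep.hom_ext (TensorProduct.ext' fun _ _ => rfl)
      right_unitality := fun _ => DiagRep.hom_ext (TensorProduct.ext' fun _ _ => rfl) }

theorem isRepTensor :
    letI := repMonoidal hΔ hε
    letI := underMonoidal κ hΔ hε hψ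
    IsRepTensor (κ := κ) hψ ΔU εU := by
  let := repMonoidal hΔ hε
  let := underMonoidal κ hΔ hε hψ
  exact ⟨fun V W => ⟨tensorRep V W, isTensorRep V W, fun _ _ => rfl⟩, fun _ _ => rfl⟩

end RepU

/-! ### The action of the generators of `T(F^±)` on representations -/

/-- The index of the positive generator in `ψ(f^±)`. -/
def Pm.ix : Pm → Fin 2
  | .pos => 0
  | .neg => 1

/-- The index of the negative generator in `ψ(f̄^±)`. -/
def Pm.ix' : Pm → Fin 2
  | .pos => 1
  | .neg => 0

namespace Uq
open TensorBialgebra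
variable {ħ ζ ξ : ℂ}

variable (ħ ξ) in
/-- The coefficient of `e_i⁺ e^{-ħ h_i}` in `ψ(f^±)`. -/
def fCoef : Pm → ℂ
  | .pos => 1
  | .neg => ξ * c ħ

variable (ħ ζ) in
/-- The coefficient of `e_i⁻` in `ψ(f̄^±)`. -/
def fbarCoef : Pm → ℂ
  | .pos => 1
  | .neg => ζ * c ħ

theorem psiX_inl (s : Pm) : psiX ħ ζ ξ (.inl s) =
    fCoef ħ ξ s • (e ħ .pos s.ix * texp (-ħ • h ħ s.ix)) := by
  cases s
  · exact (one_smul ℂ _).symm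
  · rfl

theorem psiX_inr (s : Pm) : psiX ħ ζ ξ (.inr s) = fbarCoef ħ ζ s • e ħ .neg s.ix' := by
  cases s
  · exact (one_smul ℂ _).symm
  · rfl

theorem h_ix (s : Pm) : h ħ s.ix = s.val • h ħ 0 := by
  cases s
  · exact (one_smul ℂ _).symm
  · change h ħ 1 = (-1 : ℂ) • h ħ 0
    rw [(kHolds ħ).h_one, neg_one_smul]

theorem h_ix' (s : Pm) : h ħ s.ix' = -h ħ s.ix := by
  cases s
  · exact (kHolds ħ).h_one
  · change h ħ 0 = -h ħ 1
    rw [(kHolds ħ).h_one, neg_neg]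

theorem texp_ix' (t : ℂ) (s : Pm) : texp (t • h ħ s.ix') = texp (-t • h ħ s.ix) := by
  rw [h_ix', smul_neg, neg_smul]

theorem texp_mul_texp (t : ℂ) (i : Fin 2) : texp (t • h ħ i) * texp (-t • h ħ i) = 1 := by
  have h1 := Alg.texp_add (Alg.smul_h_mem (S := rels ħ) t i) (Alg.smul_h_mem (-t) i)
  rw [neg_smul, add_neg_cancel, texp_zero, ← neg_smul] at h1
  exact h1.symm

theorem c_ne_zero (hħ : Complex.exp ħ - Complex.exp (-ħ) ≠ 0) : c ħ ≠ 0 :=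
  div_ne_zero hħ (Complex.exp_ne_zero _)

theorem fCoef_ne_zero (hħ : Complex.exp ħ - Complex.exp (-ħ) ≠ 0) (hξ : ξ ≠ 0) (s : Pm) :
    fCoef ħ ξ s ≠ 0 := by
  cases s
  exacts [one_ne_zero, mul_ne_zero hξ (c_ne_zero hħ)]

theorem fbarCoef_ne_zero (hħ : Complex.exp ħ - Complex.exp (-ħ) ≠ 0) (hζ : ζ ≠ 0) (s : Pm) :
    fbarCoef ħ ζ s ≠ 0 := by
  cases s
  exacts [one_ne_zero, mul_ne_zero hζ (c_ne_zero hħ)]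

/-- If the factors `e^{-ħ h}` cross the generators with the same scalar `u`, they can be extracted
from the commutator. -/
theorem KHolds.comm_K' {B : Type*} [Ring B] [Algebra ℂ B] {h : Fin 2 → B} {x : Pm × Fin 2 → B}
    {K K' : Fin 2 → B} (H : KHolds ħ h x K K') {i j k : Fin 2} {u : ℂ}
    (h1 : Complex.exp (-ħ * cartan .neg i k) = u) (h2 : Complex.exp (-ħ * cartan .pos j i) = u) :
    x (.pos, i) * K' i * (x (.neg, k) * K' j) - x (.neg, k) * K' j * (x (.pos, i) * K' i) =
      u • ((x (.pos, i) * x (.neg, k) - x (.neg, k) * x (.pos, i)) * (K' i * K' j)) := by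
  have e1 : x (.pos, i) * K' i * (x (.neg, k) * K' j) =
      x (.pos, i) * (K' i * x (.neg, k)) * K' j := by noncomm_ring
  have e2 : x (.neg, k) * K' j * (x (.pos, i) * K' i) =
      x (.neg, k) * (K' j * x (.pos, i)) * K' i := by noncomm_ring
  rw [e1, e2, H.K'_x, H.K'_x, h1, h2, mul_smul_comm, mul_smul_comm, smul_mul_assoc, smul_mul_assoc,
    ← smul_sub]
  congr 1
  have e3 : x (.neg, k) * (x (.pos, i) * K' j) * K' i = x (.neg, k) * x (.pos, i) * (K' j * K' i) := by
    noncomm_ring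
  rw [e3, (H.K'_K' j i).eq]
  noncomm_ring

/-- The commutation relation that corresponds to the Yetter-Drinfeld condition. -/
theorem comm_psi (hħ : Complex.exp ħ - Complex.exp (-ħ) ≠ 0) (s t : Pm) :
    psiX ħ ζ ξ (.inl s) * (psiX ħ ζ ξ (.inr t) * texp (-ħ • h ħ t.ix)) -
      psiX ħ ζ ξ (.inr t) * texp (-ħ • h ħ t.ix) * psiX ħ ζ ξ (.inl s) =
      bval ζ ξ s t • (texp (ħ • h ħ s.ix) - texp (-ħ • h ħ s.ix)) := by
  have H := kHolds ħ
  have h01 : texp (-ħ • h ħ 0) * texp (-ħ • h ħ 1) = 1 := by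
    have h1 := texp_mul_texp (ħ := ħ) (-ħ) 0
    rwa [neg_neg, show texp (ħ • h ħ 0) = texp (-ħ • h ħ 1) by
      rw [H.h_one, smul_neg, neg_smul, neg_neg]] at h1
  have h10 : texp (-ħ • h ħ 1) * texp (-ħ • h ħ 0) = 1 := by rw [(H.K'_K' 1 0).eq, h01]
  have hl : ∀ (a b : ℂ) (x y : Alg (rels ħ)), (a • x) * (b • y) - (b • y) * (a • x) =
      (a * b) • (x * y - y * x) := fun a b x y => by
    rw [smul_mul_smul_comm, smul_mul_smul_comm, mul_comm b a, smul_sub]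
  have hc : c ħ * (Complex.exp (2 * ħ) * (Complex.exp ħ - Complex.exp (-ħ))⁻¹) = 1 := by
    rw [c]
    field_simp
  rw [psiX_inl, psiX_inr, smul_mul_assoc (fbarCoef ħ ζ t), hl]
  rcases s with _ | _ <;> rcases t with _ | _ <;> simp only [Pm.ix, Pm.ix', bval, zero_smul]
  · have h1 := H.comm_K' (i := 0) (j := 0) (k := 1) rfl
      (by rw [cartan_same, cartan_ne _ (by decide)]; simp [Pm.val])
    simp only at h1
    rw [h1, H.comm_ne 0 1 (by decide)]
    simp
  · have h1 := H.comm_K' (i := 0) (j := 1) (k := 0) rfl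
      (by rw [cartan_same, cartan_ne _ (by decide)]; simp [Pm.val])
    simp only at h1
    rw [h1, H.comm_same 0, h01, mul_one, smul_smul, smul_smul, cartan_same]
    congr 1
    rw [fCoef, fbarCoef, Pm.val, show -ħ * (2 * -1) = 2 * ħ by ring]
    linear_combination ζ * hc
  · have h1 := H.comm_K' (i := 1) (j := 0) (k := 1) rfl
      (by rw [cartan_same, cartan_ne _ (by decide)]; simp [Pm.val])
    simp only at h1
    rw [h1, H.comm_same 1, h10, mul_one, smul_smul, smul_smul, cartan_same]
    congr 1
    rw [fCoef, fbarCoef, Pm.val, show -ħ * (2 * -1) = 2 * ħ by ring]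
    linear_combination ξ * hc
  · have h1 := H.comm_K' (i := 1) (j := 1) (k := 0) rfl
      (by rw [cartan_same, cartan_ne _ (by decide)]; simp [Pm.val])
    simp only at h1
    rw [h1, H.comm_ne 1 0 (by decide)]
    simp

end Uq

namespace RepU
open TensorBialgebra
variable {κ ω ħ ζ ξ : ℂ} {ψ : Alg (AF.rels ω) →ₐ[ℂ] Alg (Uq.rels ħ)} (hψ : Uq.IsPsi ħ ω ζ ξ ψ)

/-- The operator `e^{c h}`, with `h = (ω / 2) h₀`, is the action of an exponential of `h_i`. -/
theorem under_kop (hω : ω ≠ 0) (V : RepU ħ) {c t : ℂ} (s : Pm) (hc : c * (ω / 2) = t * s.val)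
    (v : V.V) : ((under κ hψ).obj V).kop c v = V.act (texp (t • Uq.h ħ s.ix)) v := by
  refine LinearMap.congr_fun (f := (((under κ hψ).obj V).kop c : V.V →ₗ[ℂ] V.V))
    (DiagRep.lin_ext (X := (under κ hψ).obj V) fun a (v : V.V) hv => ?_) v
  have hv' : (ω / 2) • V.act (Uq.h ħ 0) v = a • v := (under_h (κ := κ) hψ V v).symm.trans hv
  have h0 : V.act (Uq.h ħ 0) v = (2 / ω * a) • v := by
    rw [mul_smul, ← hv', smul_smul, div_mul_div_cancel₀ hω, div_self two_ne_zero, one_smul]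
  have h1 : V.act (Uq.h ħ s.ix) v = (s.val * (2 / ω * a)) • v := by
    rw [Uq.h_ix, map_smul, LinearMap.smul_apply, h0, smul_smul]
  refine (DiagRep.kop_eigen c hv).trans ((V.act_texp t h1).trans ?_).symm
  congr 2
  rw [← mul_assoc, ← hc]
  field_simp

/-- The braiding operator `K_s` acts as `e^{-ħ h_i}`, because `κ ω · ω / 2 = -ħ`. -/
theorem kop_kw (hħ : ħ = -(κ * ω ^ 2) / 2) (hω : ω ≠ 0) (V : RepU ħ) (s : Pm) (v : V.V) :
    ((under κ hψ).obj V).kop (kw κ ω s) v = V.act (texp (-ħ • Uq.h ħ s.ix)) v :=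
  under_kop hψ hω V s (by rw [kw, hħ]; ring) v

theorem kop_neg_kw (hħ : ħ = -(κ * ω ^ 2) / 2) (hω : ω ≠ 0) (V : RepU ħ) (s : Pm) (v : V.V) :
    ((under κ hψ).obj V).kop (-kw κ ω s) v = V.act (texp (ħ • Uq.h ħ s.ix)) v :=
  under_kop hψ hω V s (by rw [kw, hħ]; ring) v

include hψ in
theorem act_f (V : RepU ħ) (t : Pm) (v : V.V) : V.act (ψ (AF.f ω t)) v = Uq.fCoef ħ ξ t •
    V.act (Uq.e ħ .pos t.ix) (V.act (texp (-ħ • Uq.h ħ t.ix)) v) := by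
  rw [show ψ (AF.f ω t) = _ from hψ.map_x _, Uq.psiX_inl, map_smul, map_mul]
  rfl

include hψ in
theorem act_fbar (V : RepU ħ) (t : Pm) (v : V.V) : V.act (ψ (AF.fbar ω t)) v =
    Uq.fbarCoef ħ ζ t • V.act (Uq.e ħ .neg t.ix') v := by
  rw [show ψ (AF.fbar ω t) = _ from hψ.map_x _, Uq.psiX_inr, map_smul]
  rfl

theorem act_texp_texp (V : RepU ħ) (t : ℂ) (i : Fin 2) (v : V.V) :
    V.act (texp (t • Uq.h ħ i)) (V.act (texp (-t • Uq.h ħ i)) v) = v := by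
  have h3 := LinearMap.congr_fun (congrArg V.act (Uq.texp_mul_texp (ħ := ħ) t i)) v
  rw [map_mul, map_one] at h3
  exact h3

variable (κ)

/-- The operators by which the generators of `T(F⁺)` and `T(F⁻)` act on a representation. -/
def genData (hħ : ħ = -(κ * ω ^ 2) / 2) (hω : ω ≠ 0) (hq : Complex.exp ħ - Complex.exp (-ħ) ≠ 0)
    (V : RepU ħ) : GenData ω ζ ξ ((under κ hψ).obj V) where
  A s := V.act (ψ (AF.f ω s))
  B t := V.act (ψ (AF.fbar ω t)) ∘ₗ (((under κ hψ).obj V).kop (kw κ ω t) : V.V →ₗ[ℂ] V.V)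
  hA s v := by
    have h1 := (AF.rels_iff (ClosedQuot.mk _) _ _).1 (fun r hr => Alg.rel_eq_zero (AF.rels ω) hr)
      (.inl s)
    have h2 := LinearMap.congr_fun (congrArg (V.act.comp ψ) h1) v
    simp only [map_sub, map_mul, map_smul] at h2
    exact sub_eq_iff_eq_add'.1 h2
  hB s v := by
    have h1 := (AF.rels_iff (ClosedQuot.mk _) _ _).1 (fun r hr => Alg.rel_eq_zero (AF.rels ω) hr)
      (.inr s)
    have h2 := LinearMap.congr_fun (congrArg (V.act.comp ψ) h1)
      (((under κ hψ).obj V).kop (kw κ ω s) v)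
    simp only [map_sub, map_mul, map_smul] at h2
    refine (sub_eq_iff_eq_add'.1 h2).trans (congrArg₂ (· + ·) ?_ rfl)
    exact congrArg (V.act (ψ (AF.fbar ω s))) (((under κ hψ).obj V).h_kop _ v)
  comm s t v := by
    have h1 := LinearMap.congr_fun (congrArg V.act (Uq.comm_psi (ζ := ζ) (ξ := ξ) hq s t)) v
    rw [← hψ.map_x, ← hψ.map_x] at h1
    simp only [map_sub, map_mul, map_smul] at h1
    refine Eq.trans ?_ (h1.trans (congrArg (bval ζ ξ s t • ·) (congrArg₂ (· - ·)
      (kop_neg_kw hψ hħ hω V s v).symm (kop_kw hψ hħ hω V s v).symm)))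
    refine congrArg₂ (· - ·) (congrArg (fun w => V.act (ψ (AF.f ω s)) (V.act (ψ (AF.fbar ω t)) w))
      (kop_kw hψ hħ hω V t v)) (congrArg (V.act (ψ (AF.fbar ω t))) (kop_kw hψ hħ hω V t _))

end RepU

/-! ### The functor to Yetter-Drinfeld modules -/

namespace RepU
open TensorBialgebra
variable {κ ω ħ ζ ξ : ℂ} {P Q : TensorBialgebra (Fω κ ω)} {r : P.T ⊗ Q.T ⟶ 𝟙_ (DiagRep κ)}
  {ψ : Alg (AF.rels ω) →ₐ[ℂ] Alg (Uq.rels ħ)} (hψ : Uq.IsPsi ħ ω ζ ξ ψ)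
  {d d' : Pm → Q.T.V →ₗ[ℂ] Q.T.V} (hd : SkewDual ζ ξ r d d')
  (hħ : ħ = -(κ * ω ^ 2) / 2) (hω : ω ≠ 0) (hq : Complex.exp ħ - Complex.exp (-ħ) ≠ 0)

/-- The Yetter-Drinfeld structures on the pullbacks of representations along `ψ`. -/
def ydLift : YDMod.Lift r (under κ hψ) where
  str V := toStr hd (genData κ hψ hħ hω hq V)
  l_map {V W} f := l_comm_of fun t x => by
    rw [toStr_l, toStr_l]
    exact lin_act f _ _
  m_map {V W} f := m_comm_of fun t x => by
    rw [toStr_m, toStr_m]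
    exact (lin_act f _ _).trans (congrArg (W.act (ψ (AF.fbar ω t)))
      (DiagRep.lin_kop ((under κ hψ).map f) _ _))

theorem ydLift_l (V : RepU ħ) (t : Pm) (v : V.V) :
    DiagRep.cur ((ydLift hψ hd hħ hω hq).str V).l (P.g t) v = V.act (ψ (AF.f ω t)) v :=
  toStr_l hd (genData κ hψ hħ hω hq V) t v

theorem ydLift_m (V : RepU ħ) (t : Pm) (v : V.V) :
    DiagRep.cur ((ydLift hψ hd hħ hω hq).str V).m v (Q.g t) =
      V.act (ψ (AF.fbar ω t)) (((under κ hψ).obj V).kop (kw κ ω t) v) :=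
  toStr_m hd (genData κ hψ hħ hω hq V) t v

theorem kop_kop_neg (X : DiagRep κ) (c : ℂ) (v : X.V) : X.kop c (X.kop (-c) v) = v := by
  rw [DiagRep.kop_kop, add_neg_cancel, DiagRep.kop_zero]

theorem ydLift_m_kop (V : RepU ħ) (t : Pm) (v : V.V) :
    DiagRep.cur ((ydLift hψ hd hħ hω hq).str V).m (((under κ hψ).obj V).kop (-kw κ ω t) v) (Q.g t) =
      V.act (ψ (AF.fbar ω t)) v :=
  (ydLift_m hψ hd hħ hω hq V t _).trans
    (congrArg (V.act (ψ (AF.fbar ω t))) (kop_kop_neg ((under κ hψ).obj V) (kw κ ω t) v))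

/-- The inverse braiding moves a generator to the right at the cost of `K_s⁻¹`. -/
theorem lin_braiding_inv_gen (X : DiagRep κ) (s : Pm) (v : X.V) :
    DiagRep.lin (β_ X (Fω κ ω)).inv (Tens.gen κ ω s ⊗ₜ[ℂ] v : (Fω κ ω).V ⊗[ℂ] X.V) =
      (X.kop (-kw κ ω s) v ⊗ₜ[ℂ] Tens.gen κ ω s : X.V ⊗[ℂ] (Fω κ ω).V) := by
  have h1 : ∀ z : X.V ⊗[ℂ] (Fω κ ω).V, DiagRep.lin (β_ X (Fω κ ω)).inv
      (DiagRep.lin (β_ X (Fω κ ω)).hom z) = z := fun z =>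
    LinearMap.congr_fun (congrArg DiagRep.lin (β_ X (Fω κ ω)).hom_inv_id) z
  refine Eq.trans ?_ (h1 _)
  refine congrArg (DiagRep.lin (β_ X (Fω κ ω)).inv) ?_
  refine LinearMap.congr_fun (f := (TensorProduct.mk ℂ _ _ (Tens.gen κ ω s) :
    X.V →ₗ[ℂ] (Fω κ ω).V ⊗[ℂ] X.V)) (g := (DiagRep.lin (β_ X (Fω κ ω)).hom :
      X.V ⊗[ℂ] (Fω κ ω).V →ₗ[ℂ] (Fω κ ω).V ⊗[ℂ] X.V) ∘ₗ
      (TensorProduct.mk ℂ X.V (Fω κ ω).V).flip (Tens.gen κ ω s) ∘ₗ X.kop (-kw κ ω s))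
    (DiagRep.lin_ext fun a v hv => ?_) v
  simp only [LinearMap.comp_apply, DiagRep.kop_eigen _ hv, map_smul]
  rw [LinearMap.flip_apply, TensorProduct.mk_apply, TensorProduct.mk_apply,
    DiagRep.lin_braiding hv (Tens.h_gen κ ω s), smul_smul, ← Complex.exp_add, kw]
  ring_nf
  rw [Complex.exp_zero, one_smul]

/-- The right action was defined with a factor `K_t`, which cancels the `K_t⁻¹` from the inverse
braiding. -/
theorem isActionOf (V : RepU ħ) : IsActionOf hψ V ((ydLift hψ hd hħ hω hq).str V) := by
  have key : ∀ (T : (ℂ × ℂ) →ₗ[ℂ] V.V) (a : Pm → Alg (AF.rels ω)) (v : V.V),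
      (∀ s, T (Tens.gen κ ω s) = V.act (ψ (a s)) v) → ∀ p : ℂ × ℂ,
      T p = V.act (ψ (p.1 • a .pos + p.2 • a .neg)) v := fun T a v hT p => by
    refine (congrArg T (Tens.eq_gen κ ω p)).trans ?_
    refine (map_add T _ _).trans ?_
    refine (congrArg₂ (· + ·) ((map_smul T _ _).trans (congrArg (p.1 • ·) (hT .pos)))
      ((map_smul T _ _).trans (congrArg (p.2 • ·) (hT .neg)))).trans ?_
    simp only [map_add, map_smul, LinearMap.add_apply, LinearMap.smul_apply]
  constructor
  · intro p v
    exact key ((DiagRep.lin (P.incl ▷ (under κ hψ).obj V ≫ ((ydLift hψ hd hħ hω hq).str V).l) :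
      (ℂ × ℂ) ⊗[ℂ] V.V →ₗ[ℂ] V.V) ∘ₗ (TensorProduct.mk ℂ (ℂ × ℂ) V.V).flip v) (AF.f ω) v
      (fun s => ydLift_l hψ hd hħ hω hq V s v) p
  · intro p v
    refine key ((DiagRep.lin ((β_ ((under κ hψ).obj V) (Fω κ ω)).inv ≫ (under κ hψ).obj V ◁ Q.incl ≫
      ((ydLift hψ hd hħ hω hq).str V).m) :
      (ℂ × ℂ) ⊗[ℂ] V.V →ₗ[ℂ] V.V) ∘ₗ (TensorProduct.mk ℂ (ℂ × ℂ) V.V).flip v) (AF.fbar ω) v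
      (fun s => ?_) p
    refine (congrArg (DiagRep.lin ((under κ hψ).obj V ◁ Q.incl ≫ ((ydLift hψ hd hħ hω hq).str V).m))
      (lin_braiding_inv_gen ((under κ hψ).obj V) s v)).trans ?_
    exact ydLift_m_kop hψ hd hħ hω hq V s v

/-! ### Full faithfulness and injectivity on objects -/

section recover
variable (hζ : ζ ≠ 0) (hξ : ξ ≠ 0)

/-- The sign of the generator `f^±` that involves `e_i⁺`. -/
def sgn : Fin 2 → Pm
  | 0 => .pos
  | 1 => .neg

/-- The sign of the generator `f̄^±` that involves `e_i⁻`. -/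
def sgn' : Fin 2 → Pm
  | 0 => .neg
  | 1 => .pos

theorem ix_sgn (i : Fin 2) : (sgn i).ix = i := by
  fin_cases i <;> rfl

theorem ix'_sgn' (i : Fin 2) : (sgn' i).ix' = i := by
  fin_cases i <;> rfl

variable (ħ ζ ξ) in
/-- The action of the generators `e_i^±`, in terms of a Yetter-Drinfeld structure. -/
def ydE (M : YDMod r) : Pm → Fin 2 → Module.End ℂ M.X.V
  | .pos, i => (Uq.fCoef ħ ξ (sgn i))⁻¹ • (DiagRep.cur M.str.l (P.g (sgn i)) ∘ₗ M.X.kop (-kw κ ω (sgn i)))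
  | .neg, i => (Uq.fbarCoef ħ ζ (sgn' i))⁻¹ •
      ((DiagRep.cur M.str.m).flip (Q.g (sgn' i)) ∘ₗ M.X.kop (-kw κ ω (sgn' i)))

theorem lin_ydE {M N : YDMod r} (f : M ⟶ N) (s : Pm) (i : Fin 2) (x : M.X.V) :
    DiagRep.lin (ydMor f) (ydE ħ ζ ξ M s i x) = ydE ħ ζ ξ N s i (DiagRep.lin (ydMor f) x) := by
  cases s <;> simp only [ydE, LinearMap.smul_apply, LinearMap.comp_apply, map_smul,
    LinearMap.flip_apply, ydMor_l, ydMor_m, DiagRep.lin_kop]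

include hζ hξ in
/-- The functor loses no information: the generators `e_i^±` are recovered from the Yetter-Drinfeld
structure, as the coefficients and the operators `K_s` are invertible. -/
theorem ydE_obj (V : RepU ħ) (s : Pm) (i : Fin 2) (v : V.V) :
    ydE ħ ζ ξ ((ydLift hψ hd hħ hω hq).functor.obj V) s i v = V.act (Uq.e ħ s i) v := by
  cases s
  · have h2 := V.act_texp_texp (-ħ) i v
    rw [neg_neg] at h2
    refine (congrArg ((Uq.fCoef ħ ξ (sgn i))⁻¹ • ·) ((ydLift_l hψ hd hħ hω hq V (sgn i) _).trans
      ((act_f hψ V _ _).trans (congrArg (fun w => Uq.fCoef ħ ξ (sgn i) • V.act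
        (Uq.e ħ .pos (sgn i).ix) (V.act (texp (-ħ • Uq.h ħ (sgn i).ix)) w))
        (kop_neg_kw hψ hħ hω V (sgn i) v))))).trans ?_
    rw [ix_sgn, h2]
    exact inv_smul_smul₀ (Uq.fCoef_ne_zero hq hξ _) _
  · refine (congrArg ((Uq.fbarCoef ħ ζ (sgn' i))⁻¹ • ·)
      ((ydLift_m_kop hψ hd hħ hω hq V (sgn' i) v).trans (act_fbar hψ V _ v))).trans ?_
    rw [ix'_sgn']
    exact inv_smul_smul₀ (Uq.fbarCoef_ne_zero hq hζ _) _

include hω in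
theorem act_h_eq (V : RepU ħ) (v : V.V) :
    V.act (Uq.h ħ 0) v = (2 / ω) • (((under κ hψ).obj V).h v : V.V) := by
  refine Eq.trans ?_ (congrArg ((2 / ω) • ·) (under_h hψ V v)).symm
  refine Eq.trans ?_ (smul_smul (2 / ω) (ω / 2) (V.act (Uq.h ħ 0) v)).symm
  rw [div_mul_div_cancel₀ hω, div_self two_ne_zero, one_smul]

include hζ hξ in
/-- A morphism of Yetter-Drinfeld modules commutes with the operators `ydE`, hence with `e_i^±`. -/
theorem full : (ydLift hψ hd hħ hω hq).functor.Full where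
  map_surjective {V W} f := by
    let φ : V.V →ₗ[ℂ] W.V := DiagRep.lin (ydMor f)
    refine ⟨homOf φ (fun v => ?_) fun s i v => ?_, ydMor_ext (DiagRep.hom_ext rfl)⟩
    · exact (congrArg φ (act_h_eq (κ := κ) hψ hω V v)).trans ((map_smul φ _ _).trans
        ((congrArg ((2 / ω) • ·) (DiagRep.comm (ydMor f) v)).trans
          (act_h_eq (κ := κ) hψ hω W (φ v)).symm))
    · rw [← ydE_obj hψ hd hħ hω hq hζ hξ V, ← ydE_obj hψ hd hħ hω hq hζ hξ W]
      exact lin_ydE f s i v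

theorem faithful : (ydLift hψ hd hħ hω hq).functor.Faithful where
  map_injective {V W} f g h := by
    have h1 : DiagRep.lin (ydMor ((ydLift hψ hd hħ hω hq).functor.map f)) =
        DiagRep.lin (ydMor ((ydLift hψ hd hħ hω hq).functor.map g)) := by rw [h]
    exact hom_ext h1

/-- A vector space with operators for the generators. -/
structure Ops where
  V : Type
  acg : AddCommGroup V
  mod : Module ℂ V
  h : Module.End ℂ V
  e : Pm → Fin 2 → Module.End ℂ V

/-- The operators that give a representation. -/
def ops (V : RepU ħ) : Ops := ⟨V.V, V.acg, V.mod, V.act (Uq.h ħ 0), fun s i => V.act (Uq.e ħ s i)⟩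

/-- A representation is determined by the operators of the generators, by weak continuity and
density. -/
theorem ops_injective : Function.Injective (ops (ħ := ħ)) := by
  rintro ⟨V, act, cont, diag⟩ ⟨V', act', cont', diag'⟩ h
  injection h with h1 h2 h3 h4 h5
  subst h1
  cases eq_of_heq h2
  cases eq_of_heq h3
  have h6 : act = act' := AlgHom.ext fun u => LinearMap.ext fun v =>
    comm_of (f := LinearMap.id) cont cont' (fun v => LinearMap.congr_fun (eq_of_heq h4) v)
      (fun s i v => LinearMap.congr_fun (congrFun (congrFun (eq_of_heq h5) s) i) v) u v
  subst h6
  rfl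

include hζ hξ in
/-- The operators of the generators are functions of the image of a representation. -/
theorem obj_injective : Function.Injective (ydLift hψ hd hħ hω hq).functor.obj := by
  let R : YDMod r → Ops := fun M => ⟨M.X.V, M.X.acg, M.X.mod, (2 / ω) • M.X.h, ydE ħ ζ ξ M⟩
  have hR : ∀ V : RepU ħ, R ((ydLift hψ hd hħ hω hq).functor.obj V) = ops V := fun V => by
    have h1 : ((2 / ω) • ((under κ hψ).obj V).h : V.V →ₗ[ℂ] V.V) = V.act (Uq.h ħ 0) :=
      LinearMap.ext fun v => (act_h_eq hψ hω V v).symm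
    have h2 : ydE ħ ζ ξ ((ydLift hψ hd hħ hω hq).functor.obj V) = fun s i => V.act (Uq.e ħ s i) :=
      funext fun s => funext fun i => LinearMap.ext fun v => ydE_obj hψ hd hħ hω hq hζ hξ V s i v
    exact congrArg₂ (Ops.mk V.V V.acg V.mod) h1 h2
  intro V W h
  refine ops_injective ?_
  rw [← hR, ← hR, h]

end recover
end RepU

/-! ### The monoidal structure of the functor -/

namespace RepU
open TensorBialgebra
variable {κ ω ħ ζ ξ : ℂ} {P Q : TensorBialgebra (Fω κ ω)} {r : P.T ⊗ Q.T ⟶ 𝟙_ (DiagRep κ)}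
  {ψ : Alg (AF.rels ω) →ₐ[ℂ] Alg (Uq.rels ħ)} (hψ : Uq.IsPsi ħ ω ζ ξ ψ)
  {d d' : Pm → Q.T.V →ₗ[ℂ] Q.T.V} (hd : SkewDual ζ ξ r d d')
  (hħ : ħ = -(κ * ω ^ 2) / 2) (hω : ω ≠ 0) (hq : Complex.exp ħ - Complex.exp (-ħ) ≠ 0)
  {ΔU : Alg (Uq.rels ħ) →ₐ[ℂ] Alg₂ (Uq.rels ħ)} (hΔ : Uq.IsComul ħ ΔU)
  {εU : Alg (Uq.rels ħ) →ₐ[ℂ] ℂ} (hε : Uq.IsCounit ħ εU)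

include hψ in
/-- The coproduct of `ψ(f^±)`. -/
theorem tens_f (V W : RepU ħ) (t : Pm) (v : V.V) (w : W.V) :
    (tens hΔ V W).act (ψ (AF.f ω t)) (v ⊗ₜ[ℂ] w : V.V ⊗[ℂ] W.V) =
      (V.act (ψ (AF.f ω t)) v ⊗ₜ w + V.act (texp (-ħ • Uq.h ħ t.ix)) v ⊗ₜ W.act (ψ (AF.f ω t)) w :
        V.V ⊗[ℂ] W.V) := by
  refine (act_f hψ (tens hΔ V W) t (v ⊗ₜ[ℂ] w : V.V ⊗[ℂ] W.V)).trans ?_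
  refine (congrArg (fun z => Uq.fCoef ħ ξ t • (tens hΔ V W).act (Uq.e ħ .pos t.ix) z)
    (tens_texp hΔ V W (-ħ) t.ix v w)).trans ?_
  refine (congrArg (Uq.fCoef ħ ξ t • ·) (tens_pos hΔ V W t.ix _ _)).trans ?_
  refine (smul_tmul_add _ _ _ _ _).trans ?_
  rw [act_f hψ, act_f hψ, act_texp_texp]

include hψ in
/-- The coproduct of `ψ(f̄^±)`. -/
theorem tens_fbar (V W : RepU ħ) (t : Pm) (v : V.V) (w : W.V) :
    (tens hΔ V W).act (ψ (AF.fbar ω t)) (v ⊗ₜ[ℂ] w : V.V ⊗[ℂ] W.V) =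
      (V.act (ψ (AF.fbar ω t)) v ⊗ₜ w +
        V.act (texp (-ħ • Uq.h ħ t.ix')) v ⊗ₜ W.act (ψ (AF.fbar ω t)) w : V.V ⊗[ℂ] W.V) := by
  refine (act_fbar hψ (tens hΔ V W) t (v ⊗ₜ[ℂ] w : V.V ⊗[ℂ] W.V)).trans ?_
  refine (congrArg (Uq.fbarCoef ħ ζ t • ·) (tens_neg hΔ V W t.ix' _ _)).trans ?_
  refine (smul_tmul_add _ _ _ _ _).trans ?_
  rw [act_fbar hψ, act_fbar hψ]

/-- The tensor product structure morphism of the functor. -/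
def mu (V W : RepU ħ) : TensorBialgebra.tens hd ((ydLift hψ hd hħ hω hq).functor.obj V)
    ((ydLift hψ hd hħ hω hq).functor.obj W) ≅ (ydLift hψ hd hħ hω hq).functor.obj (tens hΔ V W) :=
  ydIso (DiagRep.mkIso (X := (under κ hψ).obj V ⊗ (under κ hψ).obj W)
    (Y := (under κ hψ).obj (tens hΔ V W)) (LinearEquiv.refl ℂ (V.V ⊗[ℂ] W.V))
    (under_addEnd hΔ hψ V W))
    (fun t z => by
      refine (comm_tmul (f := LinearMap.id) (S := DiagRep.cur (TensorBialgebra.tens hd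
        ((ydLift hψ hd hħ hω hq).functor.obj V) ((ydLift hψ hd hħ hω hq).functor.obj W)).str.l (P.g t))
        (T := (tens hΔ V W).act (ψ (AF.f ω t))) (fun (v : V.V) (w : W.V) => ?_) z).trans
        (ydLift_l hψ hd hħ hω hq (tens hΔ V W) t z).symm
      refine Eq.trans ?_ (tens_f hψ hΔ V W t v w).symm
      refine (tens_l hd ((ydLift hψ hd hħ hω hq).functor.obj V)
        ((ydLift hψ hd hħ hω hq).functor.obj W) t v w).trans ?_
      exact congrArg₂ (· + ·) (congrArg (· ⊗ₜ[ℂ] w) (ydLift_l hψ hd hħ hω hq V t v))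
        (congrArg₂ (fun (a : V.V) (b : W.V) => a ⊗ₜ[ℂ] b) (kop_kw hψ hħ hω V t v)
          (ydLift_l hψ hd hħ hω hq W t w)))
    (fun t z => by
      refine (comm_tmul (f := LinearMap.id) (S := (DiagRep.cur (TensorBialgebra.tens hd
        ((ydLift hψ hd hħ hω hq).functor.obj V)
          ((ydLift hψ hd hħ hω hq).functor.obj W)).str.m).flip (Q.g t))
        (T := (tens hΔ V W).act (ψ (AF.fbar ω t)) ∘ₗ (((under κ hψ).obj (tens hΔ V W)).kop (kw κ ω t) :
          V.V ⊗[ℂ] W.V →ₗ[ℂ] V.V ⊗[ℂ] W.V)) (fun (v : V.V) (w : W.V) => ?_) z).trans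
        (ydLift_m hψ hd hħ hω hq (tens hΔ V W) t z).symm
      refine (tens_m hd ((ydLift hψ hd hħ hω hq).functor.obj V)
        ((ydLift hψ hd hħ hω hq).functor.obj W) t v w).trans ?_
      have h1 : V.act (texp (-ħ • Uq.h ħ t.ix')) (V.act (texp (-ħ • Uq.h ħ t.ix)) v) = v := by
        rw [Uq.texp_ix', neg_neg]
        exact V.act_texp_texp ħ t.ix v
      refine (congrArg₂ (fun (a b : V.V ⊗[ℂ] W.V) => a + b) (congrArg₂ (fun (a : V.V) (b : W.V) => a ⊗ₜ[ℂ] b)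
        ((ydLift_m hψ hd hħ hω hq V t v).trans (congrArg (V.act (ψ (AF.fbar ω t)))
          (kop_kw hψ hħ hω V t v))) (kop_kw hψ hħ hω W t w)) (congrArg (v ⊗ₜ[ℂ] ·)
          ((ydLift_m hψ hd hħ hω hq W t w).trans (congrArg (W.act (ψ (AF.fbar ω t)))
          (kop_kw hψ hħ hω W t w))))).trans ?_
      refine Eq.trans ?_ (congrArg ((tens hΔ V W).act (ψ (AF.fbar ω t)))
        ((kop_kw hψ hħ hω (tens hΔ V W) t (v ⊗ₜ[ℂ] w : V.V ⊗[ℂ] W.V)).trans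
          (tens_texp hΔ V W (-ħ) t.ix v w))).symm
      refine Eq.trans ?_ (tens_fbar hψ hΔ V W t _ _).symm
      rw [h1])

/-- The unit structure morphism of the functor. -/
def eps : unitYD hd ≅ (ydLift hψ hd hħ hω hq).functor.obj (unit hε) :=
  ydIso (DiagRep.mkIso (X := 𝟙_ (DiagRep κ)) (Y := (under κ hψ).obj (unit hε))
        (LinearEquiv.refl ℂ ℂ) fun v => by
          refine Eq.trans ?_ (under_h hψ (unit hε) v).symm
          exact ((congrArg ((ω / 2) • ·) (unit_h hε 0 v)).trans (smul_zero (A := ℂ) _)).symm)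
    (fun t z => by
      refine (unitYD_l hd t z).trans (Eq.trans ?_ (ydLift_l hψ hd hħ hω hq (unit hε) t z).symm)
      refine Eq.trans ?_ (act_f hψ (unit hε) t z).symm
      exact ((congrArg (Uq.fCoef ħ ξ t • ·) (unit_e hε .pos t.ix _)).trans
        (smul_zero (A := ℂ) _)).symm)
    (fun t z => by
      refine (unitYD_m hd t z).trans (Eq.trans ?_ (ydLift_m hψ hd hħ hω hq (unit hε) t z).symm)
      refine Eq.trans ?_ (act_fbar hψ (unit hε) t _).symm
      exact ((congrArg (Uq.fbarCoef ħ ζ t • ·) (unit_e hε .neg t.ix' _)).trans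
        (smul_zero (A := ℂ) _)).symm)

/-- The functor to Yetter-Drinfeld modules is monoidal. -/
abbrev functorMonoidal :
    letI := repMonoidal hΔ hε
    letI := ydMonoidal hd
    (ydLift hψ hd hħ hω hq).functor.Monoidal :=
  letI := repMonoidal hΔ hε
  letI := ydMonoidal hd
  Functor.CoreMonoidal.toMonoidal
    { εIso := eps hψ hd hħ hω hq hε
      μIso := mu hψ hd hħ hω hq hΔ
      μIso_hom_natural_left := fun _ _ =>
        ydMor_ext (DiagRep.hom_ext (TensorProduct.ext' fun _ _ => rfl))
      μIso_hom_natural_right := fun _ _ =>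
        ydMor_ext (DiagRep.hom_ext (TensorProduct.ext' fun _ _ => rfl))
      associativity := fun _ _ _ =>
        ydMor_ext (DiagRep.hom_ext (TensorProduct.ext_threefold fun _ _ _ => rfl))
      left_unitality := fun _ => ydMor_ext (DiagRep.hom_ext (TensorProduct.ext' fun _ _ => rfl))
      right_unitality := fun _ => ydMor_ext (DiagRep.hom_ext (TensorProduct.ext' fun _ _ => rfl)) }

theorem isMonoidalOver :
    letI := repMonoidal hΔ hε
    letI := ydMonoidal hd
    letI := ydForgetMonoidal hd
    letI := underMonoidal κ hΔ hε hψ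
    letI := functorMonoidal hψ hd hħ hω hq hΔ hε
    IsMonoidalOver (under κ hψ) (ydLift hψ hd hħ hω hq) := by
  let := repMonoidal hΔ hε
  let := ydMonoidal hd
  let := ydForgetMonoidal hd
  let := underMonoidal κ hΔ hε hψ
  let := functorMonoidal hψ hd hħ hω hq hΔ hε
  exact ⟨fun _ _ => DiagRep.hom_ext (TensorProduct.ext' fun _ _ => rfl),
    DiagRep.hom_ext (LinearMap.ext fun _ => rfl)⟩

end RepU

/-- The essential image of a monoidal functor contains the unit object and is closed under tensor
products. -/
theorem isMonoidal_essImage {C D : Type*} [Category C] [Category D] [MonoidalCategory C]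
    [MonoidalCategory D] (F : C ⥤ D) [F.Monoidal] : F.essImage.IsMonoidal where
  prop_unit := ⟨𝟙_ C, ⟨(Functor.Monoidal.εIso F).symm⟩⟩
  prop_tensor := by
    rintro X Y ⟨V, ⟨e⟩⟩ ⟨W, ⟨e'⟩⟩
    exact ⟨V ⊗ W, ⟨(Functor.Monoidal.μIso F V W).symm ≪≫ (e ⊗ᵢ e')⟩⟩

end SinhGordon

theorem mainTheorem6 (κ ω ħ ζ ξ : ℂ) (hω : ω ≠ 0) (hζ : ζ ≠ 0) (hξ : ξ ≠ 0)
    (hħ : ħ = -(κ * ω ^ 2) / 2) (hq : ∀ n : ℤ, ħ ≠ n * (Real.pi * Complex.I)) :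
    Nonempty (SinhGordon.TensorBialgebra (SinhGordon.Fω κ ω)) ∧
    ∀ Tp Tm : SinhGordon.TensorBialgebra (SinhGordon.Fω κ ω),
      (∃! r : Tp.T ⊗ Tm.T ⟶ 𝟙_ (SinhGordon.DiagRep κ),
        SinhGordon.IsHopfPairing r ∧
          (Tp.incl ⊗ₘ Tm.incl) ≫ r = SinhGordon.bMor κ ω ζ ξ) ∧
      ∀ r : Tp.T ⊗ Tm.T ⟶ 𝟙_ (SinhGordon.DiagRep κ), SinhGordon.IsHopfPairing r →
        (Tp.incl ⊗ₘ Tm.incl) ≫ r = SinhGordon.bMor κ ω ζ ξ →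
      ∃ (ΔA : SinhGordon.Alg (SinhGordon.AF.rels ω) →ₐ[ℂ]
            SinhGordon.Alg₂ (SinhGordon.AF.rels ω))
        (εA : SinhGordon.Alg (SinhGordon.AF.rels ω) →ₐ[ℂ] ℂ)
        (ΔU : SinhGordon.Alg (SinhGordon.Uq.rels ħ) →ₐ[ℂ]
            SinhGordon.Alg₂ (SinhGordon.Uq.rels ħ))
        (εU : SinhGordon.Alg (SinhGordon.Uq.rels ħ) →ₐ[ℂ] ℂ)
        (ψ : SinhGordon.Alg (SinhGordon.AF.rels ω) →ₐ[ℂ]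
            SinhGordon.Alg (SinhGordon.Uq.rels ħ))
        (ψ₂ : SinhGordon.Alg₂ (SinhGordon.AF.rels ω) →ₐ[ℂ]
            SinhGordon.Alg₂ (SinhGordon.Uq.rels ħ))
        (hψ : SinhGordon.Uq.IsPsi ħ ω ζ ξ ψ),
        SinhGordon.AF.IsComul ω κ ΔA ∧ SinhGordon.AF.IsCounit ω εA ∧
        SinhGordon.Uq.IsComul ħ ΔU ∧ SinhGordon.Uq.IsCounit ħ εU ∧
        SinhGordon.IsDoubleOf ψ₂ ψ ∧
        (∀ a, ψ₂ (ΔA a) = ΔU (ψ a)) ∧ (∀ a, εU (ψ a) = εA a) ∧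
        ∃ (_ : MonoidalCategory (SinhGordon.RepU ħ))
          (_ : (SinhGordon.under κ hψ).Monoidal)
          (_ : MonoidalCategory (SinhGordon.YDMod r))
          (_ : (SinhGordon.YDMod.forget r).Monoidal),
          SinhGordon.IsRepTensor (κ := κ) hψ ΔU εU ∧
          SinhGordon.YDMod.IsTensor (r := r) ∧
          ∃ F : SinhGordon.YDMod.Lift r (SinhGordon.under κ hψ),
            (∀ V, SinhGordon.IsActionOf hψ V (F.str V)) ∧
            F.functor.Full ∧ F.functor.Faithful ∧ Function.Injective F.functor.obj ∧
            ∃ _ : F.functor.Monoidal,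
              SinhGordon.IsMonoidalOver (SinhGordon.under κ hψ) F ∧
              F.functor.essImage.IsMonoidal := by
  -- otherwise `e^{2ħ} = 1`, and then `ħ ∈ iπℤ`
  have hq' : Complex.exp ħ - Complex.exp (-ħ) ≠ 0 := fun h => by
    have h1 : Complex.exp (2 * ħ) = 1 := by
      rw [two_mul, Complex.exp_add]
      nth_rw 1 [sub_eq_zero.1 h]
      rw [← Complex.exp_add, neg_add_cancel, Complex.exp_zero]
    obtain ⟨n, hn⟩ := Complex.exp_eq_one_iff.1 h1
    exact hq n (by linear_combination hn / 2)
  refine ⟨SinhGordon.Tens.nonempty_tensorBialgebra, fun P Q =>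
    ⟨SinhGordon.TensorBialgebra.existsUnique_pairing ζ ξ P Q, fun r hr hb => ?_⟩⟩
  obtain ⟨d, d', hd⟩ := SinhGordon.TensorBialgebra.exists_skewDual hr hb
  obtain ⟨ΔA, hΔA⟩ := SinhGordon.AF.exists_comul ω κ
  obtain ⟨εA, hεA⟩ := SinhGordon.AF.exists_counit ω
  obtain ⟨ΔU, hΔU⟩ := SinhGordon.Uq.exists_comul hq'
  obtain ⟨εU, hεU⟩ := SinhGordon.Uq.exists_counit ħ
  obtain ⟨ψ, hψ⟩ := SinhGordon.Uq.exists_psi (ħ := ħ) ω ζ ξ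
  obtain ⟨ψ₂, hψ₂⟩ := SinhGordon.Uq.exists_psi₂ (ħ := ħ) ω ζ ξ
  refine ⟨ΔA, εA, ΔU, εU, ψ, ψ₂, hψ, hΔA, hεA, hΔU, hεU, SinhGordon.Uq.isDoubleOf hψ hψ₂,
    SinhGordon.Uq.comul_psi hħ hψ hψ₂ hΔA hΔU, SinhGordon.Uq.counit_psi hψ hεA hεU,
    SinhGordon.RepU.repMonoidal hΔU hεU, SinhGordon.RepU.underMonoidal κ hΔU hεU hψ,
    SinhGordon.TensorBialgebra.ydMonoidal hd, SinhGordon.TensorBialgebra.ydForgetMonoidal hd,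
    SinhGordon.RepU.isRepTensor κ hΔU hεU hψ, SinhGordon.TensorBialgebra.isTensor hd,
    SinhGordon.RepU.ydLift hψ hd hħ hω hq', SinhGordon.RepU.isActionOf hψ hd hħ hω hq',
    SinhGordon.RepU.full hψ hd hħ hω hq' hζ hξ, SinhGordon.RepU.faithful hψ hd hħ hω hq',
    SinhGordon.RepU.obj_injective hψ hd hħ hω hq' hζ hξ,
    SinhGordon.RepU.functorMonoidal hψ hd hħ hω hq' hΔU hεU,
    SinhGordon.RepU.isMonoidalOver hψ hd hħ hω hq' hΔU hεU, ?_⟩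
  let := SinhGordon.RepU.repMonoidal hΔU hεU
  let := SinhGordon.TensorBialgebra.ydMonoidal hd
  let := SinhGordon.RepU.functorMonoidal hψ hd hħ hω hq' hΔU hεU
  exact SinhGordon.isMonoidal_essImage _
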